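/- For each $n$ let $\theta_n=(\rho,\gamma,\alpha_1,\beta_1,\dots,\alpha_n,\beta_n)$ be real parameters (all depending on $n$) with $\sum_i\alpha_i=\sum_i\beta_i=0$, and let $A$ be the adjacency matrix of a random directed graph on $n$ nodes from the $p_1$ model: $A_{ii}=0$, the pairs $(A_{ij},A_{ji})$, $i<j$, are independent, and for $i\ne j$, $a,b\in\{0,1\}$, $$\mathbb P(A_{ij}=a,A_{ji}=b)=K_{ij}\,e^{a(\gamma+\alpha_i+\beta_j)+b(\gamma+\alpha_j+\beta_i)+ab\rho}=:\Omega^{ab}_{ij},$$ where $K_{ij}=[1+e^{\gamma+\alpha_i+\beta_j}+e^{\gamma+\alpha_j+\beta_i}+e^{2\gamma+\alpha_i+\beta_j+\alpha_j+\beta_i+\rho}]^{-1}$. Put $\mu_i=e^{\gamma/2+\alpha_i}$, $\nu_i=e^{\gamma/2+\beta_i}$, $\eta_i=\mu_i\nu_i$; write $(\cdot,\cdot)$ for the Euclidean inner product, $\|\cdot\|_1$ for the $\ell^1$-norm, $x_{\max},x_{\min}$ for the largest and smallest entry of $x$, and $\tilde\rho=\log\big(\|\eta\|_1^2/[(\mu,\eta)(\nu,\eta)]\big)$.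 Let $A^{ab}_{ij}$ be the indicator that $i\neq j$, $A_{ij}=a$ and $A_{ji}=b$, and put $$Q_n(a)=\sum_{i,j,k,\ell\ \mathrm{dist.}}A^{11}_{ij}A^{00}_{jk}A^{01}_{k\ell}A^{00}_{\ell i},\qquad Q_n(b)=\sum_{i,j,k,\ell\ \mathrm{dist.}}A^{10}_{ij}A^{10}_{jk}A^{00}_{k\ell}A^{10}_{\ell i},$$ $U_n(\rho)=Q_n(a)-e^{\rho}Q_n(b)$ and $\mathrm{SNR}=\mathbb E[Q_n(a)]/\sqrt{\mathrm{Var}(U_n(\rho))}$. Let $\hat\rho=\log(Q_n(a)/Q_n(b))$ (with the conventional value $0$ if $Q_n(a)=0$ or $Q_n(b)=0$), and let $\hat\rho^*=\hat\rho$ if $|\hat\rho|\le2\log n$ and $\hat\rho^*=2\,\mathrm{sign}(\hat\rho)\log n$ otherwise. With all sums over ordered pairs $(k,\ell)$, $k\ne\ell$, $k,\ell\notin\{i,j\}$, let $r_{ij}=\sum\Omega^{00}_{jk}\Omega^{01}_{k\ell}\Omega^{00}_{\ell i}$, $s_{ij}=\sum\Omega^{00}_{jk}\Omega^{11}_{k\ell}\Omega^{00}_{\ell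 i}$, $t_{ij}=\sum(\Omega^{10}_{jk}\Omega^{10}_{k\ell}\Omega^{00}_{\ell i}+\Omega^{00}_{jk}\Omega^{10}_{k\ell}\Omega^{10}_{\ell i}+\Omega^{10}_{jk}\Omega^{00}_{k\ell}\Omega^{10}_{\ell i})$, and $\hat r_{ij}=\sum A^{01}_{k\ell}$, $\hat s_{ij}=\sum A^{11}_{k\ell}$, $\hat t_{ij}=\sum(A^{10}_{jk}A^{10}_{k\ell}+A^{10}_{k\ell}A^{10}_{\ell i}+A^{10}_{jk}A^{10}_{\ell i})$. Put $$V_n(\rho)=\sum_{i\ne j}\big[2r_{ij}^2\Omega^{11}_{ij}+(s_{ij}-e^{\rho}t_{ij})^2\Omega^{10}_{ij}\big],\qquad \widehat V_n(\hat\rho)=\sum_{i\ne j}\big[2\hat r_{ij}^2A^{11}_{ij}+(\hat s_{ij}-e^{\hat\rho}\hat t_{ij})^2A^{10}_{ij}\big],$$ $\widehat{\mathrm{SNR}}=Q_n(a)/\sqrt{\widehat V_n(\hat\rho)}$ (with value $0$ if $\widehat V_n(\hat\rho)=0$), and, for given $\rho_0=\rho_{0,n}$, $\psi_n^*=\widehat{\mathrm{SNR}}\cdot(\hat\rho^*-\rho_0)$.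 For fixed $\alpha\in(0,1)$ let $z_{\alpha/2}$ satisfy $\mathbb P(N(0,1)\ge z_{\alpha/2})=\alpha/2$; the two-sided LCR test rejects $H_0^{(n)}:\rho=\rho_0$ if and only if $|\psi_n^*|\ge z_{\alpha/2}$. Assume, as $n\to\infty$: * (G1) $\mu_{\max}\to0$, $\nu_{\max}\to0$ and $e^{\rho/2}\eta_{\max}\to0$; * $\|\eta\|_1\to\infty$ and $e^{\rho/2}\|\eta\|_1/\sqrt{\log n}\to\infty$; * for every $c>0$, along the indices $n$ with $e^{\rho}\ge c\,e^{\tilde\rho}$: $\|\mu\|_1\asymp\|\nu\|_1$ (with constants that may depend on $c$), and $\min\{\mu_{\min}/\mu_{\max},\ \nu_{\min}/\nu_{\max}\}\cdot\|\eta\|_1/\log n\to\infty$. (This is no condition if $e^{\rho}/e^{\tilde\rho}\to0$.) Then, as $n\to\infty$: * $\mathbb P(Q_n(a)>0,\ Q_n(b)>0)\to1$, so that $\hat\rho$ is well defined with probability tending to one; $\widehat V_n(\hat\rho)/V_n(\rho)\to1$ and $\widehat{\mathrm{SNR}}/\mathrm{SNR}\to1$ in probability; and $\widehat{\mathrm{SNR}}\cdot(\hat\rho^*-\rho)\to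 N(0,1)$ in law. * If $H_0^{(n)}$ holds for all $n$, then $\psi_n^*\to N(0,1)$ in law, and for each fixed $\alpha\in(0,1)$ the level of the LCR test is $\alpha+o(1)$. * If $\mathrm{SNR}\cdot|\rho-\rho_0|\to\infty$, then for each fixed $\alpha\in(0,1)$ the power of the LCR test tends to $1$. -/

import Mathlib

open Filter Topology MeasureTheory ProbabilityTheory

namespace P1

/-- Parameters `θ = (ρ, γ, α₁, β₁, …, αₙ, βₙ)` of the `p₁` model on `n` nodes, with the
identifiability constraints. -/
structure Param (n : ℕ) where
  ρ : ℝ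
  γ : ℝ
  α : Fin n → ℝ
  β : Fin n → ℝ
  sum_α : ∑ i, α i = 0
  sum_β : ∑ i, β i = 0

/-- A directed graph on `n` nodes given by its adjacency matrix: `G i j = true` iff there is an
edge from `i` to `j`. -/
abbrev Graph (n : ℕ) : Type := Fin n → Fin n → Bool

namespace Param

variable {n : ℕ} (θ : Param n)

noncomputable def μ (i : Fin n) : ℝ := Real.exp (θ.γ / 2 + θ.α i)

noncomputable def ν (i : Fin n) : ℝ := Real.exp (θ.γ / 2 + θ.β i)

noncomputable def η (i : Fin n) : ℝ := θ.μ i * θ.ν i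

/-- The normalizing factors `K i j` of the model. -/
noncomputable def K (i j : Fin n) : ℝ :=
  (1 + Real.exp (θ.γ + θ.α i + θ.β j) + Real.exp (θ.γ + θ.α j + θ.β i)
    + Real.exp (2 * θ.γ + θ.α i + θ.β j + θ.α j + θ.β i + θ.ρ))⁻¹

/-- `Ω^{ab}_{ij}`, the probability (for `i ≠ j`) of the event `A_{ij} = a, A_{ji} = b`. -/
noncomputable def dyadProb (a b : Bool) (i j : Fin n) : ℝ :=
  θ.K i j * Real.exp
    ((if a then θ.γ + θ.α i + θ.β j else 0) + (if b then θ.γ + θ.α j + θ.β i else 0)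
      + (if a && b then θ.ρ else 0))

/-- The `ℓ¹` norms of the (entrywise positive) vectors `μ`, `ν`, `η`. -/
noncomputable def normμ : ℝ := ∑ i, |θ.μ i|

noncomputable def normν : ℝ := ∑ i, |θ.ν i|

noncomputable def normη : ℝ := ∑ i, |θ.η i|

/-- The inner products `(μ, η)` and `(ν, η)`. -/
noncomputable def innerμη : ℝ := ∑ i, θ.μ i * θ.η i

noncomputable def innerνη : ℝ := ∑ i, θ.ν i * θ.η i

/-- Largest and smallest entries. -/
noncomputable def μmax : ℝ := ⨆ i, θ.μ i

noncomputable def μmin : ℝ := ⨅ i, θ.μ i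

noncomputable def νmax : ℝ := ⨆ i, θ.ν i

noncomputable def νmin : ℝ := ⨅ i, θ.ν i

noncomputable def ηmax : ℝ := ⨆ i, θ.η i

/-- The critical value `ρ̃ = log (‖η‖₁² / [(μ, η)(ν, η)])` that separates small `ρ` from
large `ρ`. -/
noncomputable def ρtilde : ℝ := Real.log (θ.normη ^ 2 / (θ.innerμη * θ.innerνη))

/-- `ρ` is in the large regime with constant `c`: `e^ρ ≥ c e^ρ̃`. -/
def LargeWith (c : ℝ) : Prop := c * Real.exp θ.ρtilde ≤ Real.exp θ.ρ

end Param

/-- The ordered pairs `(k, ℓ)` with `k ≠ ℓ` and `k, ℓ ∉ {i, j}`. -/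
def others {n : ℕ} (i j : Fin n) : Finset (Fin n × Fin n) :=
  Finset.univ.filter fun p =>
    p.1 ≠ i ∧ p.1 ≠ j ∧ p.2 ≠ i ∧ p.2 ≠ j ∧ p.1 ≠ p.2

namespace Param

variable {n : ℕ} (θ : Param n)

noncomputable def r (i j : Fin n) : ℝ :=
  ∑ p ∈ others i j, θ.dyadProb false false j p.1 * θ.dyadProb false true p.1 p.2
    * θ.dyadProb false false p.2 i

noncomputable def s (i j : Fin n) : ℝ :=
  ∑ p ∈ others i j, θ.dyadProb false false j p.1 * θ.dyadProb true true p.1 p.2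
    * θ.dyadProb false false p.2 i

noncomputable def t (i j : Fin n) : ℝ :=
  ∑ p ∈ others i j,
    (θ.dyadProb true false j p.1 * θ.dyadProb true false p.1 p.2 * θ.dyadProb false false p.2 i
    + θ.dyadProb false false j p.1 * θ.dyadProb true false p.1 p.2 * θ.dyadProb true false p.2 i
    + θ.dyadProb true false j p.1 * θ.dyadProb false false p.1 p.2 * θ.dyadProb true false p.2 i)

/-- The deterministic variance proxy `V_n(ρ)`. -/
noncomputable def V : ℝ :=
  ∑ i, ∑ j ∈ Finset.univ.erase i,
    (2 * θ.r i j ^ 2 * θ.dyadProb true true i j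
      + (θ.s i j - Real.exp θ.ρ * θ.t i j) ^ 2 * θ.dyadProb true false i j)

end Param

namespace Graph

variable {n : ℕ} (G : Graph n)

/-- The entry `A^{ab}_{ij}`: it is `1` if `i ≠ j`, `A_{ij} = a` and `A_{ji} = b`, and `0`
otherwise. -/
def dyad (a b : Bool) (i j : Fin n) : ℝ :=
  if i ≠ j ∧ G i j = a ∧ G j i = b then 1 else 0

/-- `Q_n(a)`: the sum over distinct `i, j, k, ℓ` of
`A^{11}_{ij} A^{00}_{jk} A^{01}_{kℓ} A^{00}_{ℓi}`. -/
noncomputable def Qa : ℝ :=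
  ∑ i, ∑ j ∈ Finset.univ.erase i, ∑ p ∈ others i j,
    dyad G true true i j * dyad G false false j p.1 * dyad G false true p.1 p.2
      * dyad G false false p.2 i

/-- `Q_n(b)`: the sum over distinct `i, j, k, ℓ` of
`A^{10}_{ij} A^{10}_{jk} A^{00}_{kℓ} A^{10}_{ℓi}`. -/
noncomputable def Qb : ℝ :=
  ∑ i, ∑ j ∈ Finset.univ.erase i, ∑ p ∈ others i j,
    dyad G true false i j * dyad G true false j p.1 * dyad G false false p.1 p.2
      * dyad G true false p.2 i

/-- `ρ̂ = log (Q_n(a) / Q_n(b))`. If `Q_n(a) = 0` or `Q_n(b) = 0` it takes the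
conventional value `0`. -/
noncomputable def ρhat : ℝ := Real.log (Qa G / Qb G)

end Graph

/-- The truncation `H(x; t)`: `x` if `|x| ≤ t` and `sign(x) t` otherwise. -/
noncomputable def truncate (x t : ℝ) : ℝ := if |x| ≤ t then x else Real.sign x * t

namespace Graph

variable {n : ℕ} (G : Graph n)

/-- The LCR estimator `ρ̂* = H(ρ̂; 2 log n)`. -/
noncomputable def ρstar : ℝ := truncate (ρhat G) (2 * Real.log n)

noncomputable def rhat (i j : Fin n) : ℝ := ∑ p ∈ others i j, dyad G false true p.1 p.2

noncomputable def shat (i j : Fin n) : ℝ := ∑ p ∈ others i j, dyad G true true p.1 p.2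

noncomputable def that (i j : Fin n) : ℝ :=
  ∑ p ∈ others i j,
    (dyad G true false j p.1 * dyad G true false p.1 p.2
    + dyad G true false p.1 p.2 * dyad G true false p.2 i
    + dyad G true false j p.1 * dyad G true false p.2 i)

/-- The variance estimator `V̂_n(ρ̂)`. -/
noncomputable def Vhat : ℝ :=
  ∑ i, ∑ j ∈ Finset.univ.erase i,
    (2 * rhat G i j ^ 2 * dyad G true true i j
      + (shat G i j - Real.exp (ρhat G) * that G i j) ^ 2 * dyad G true false i j)

/-- The estimated signal-to-noise ratio `Q_n(a) / √(V̂_n(ρ̂))`. -/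
noncomputable def SNRhat : ℝ := Qa G / Real.sqrt (Vhat G)

/-- The test statistic `ψ_n^*` for the null hypothesis `ρ = ρ₀`. -/
noncomputable def ψ (ρ₀ : ℝ) : ℝ := SNRhat G * (ρstar G - ρ₀)

end Graph

/-- The random directed graph `A` on the probability space `(Ω, P)` follows the `p₁` model with
parameter `θ`: no self-loops, independent dyads `(A_{ij}, A_{ji})`, `i < j`, and the prescribed law
of each dyad. -/
structure IsP1Model {n : ℕ} (θ : Param n) {Ω : Type*} [MeasurableSpace Ω] (P : Measure Ω)
    (A : Ω → Graph n) : Prop where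
  measurable : Measurable A
  loopless : ∀ ω i, A ω i i = false
  indep : iIndepFun
    (fun (e : {e : Fin n × Fin n // e.1 < e.2}) (ω : Ω) =>
      (A ω e.1.1 e.1.2, A ω e.1.2 e.1.1)) P
  law : ∀ i j : Fin n, i ≠ j → ∀ a b : Bool,
    P.real {ω | A ω i j = a ∧ A ω j i = b} = θ.dyadProb a b i j

/-- `SNR = E[Q_n(a)] / √(Var(U_n(ρ)))`, where `U_n(ρ) = Q_n(a) - e^ρ Q_n(b)`. -/
noncomputable def SNR {n : ℕ} (θ : Param n) {Ω : Type*} [MeasurableSpace Ω] (P : Measure Ω)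
    (A : Ω → Graph n) : ℝ :=
  (∫ ω, (A ω).Qa ∂P)
    / Real.sqrt (variance (fun ω => (A ω).Qa - Real.exp θ.ρ * (A ω).Qb) P)

/-- Convergence in probability to a constant, for random variables `X n` on probability spaces
`(Ω n, P n)` that may vary with `n`. -/
def TendstoInProb {Ω : ℕ → Type*} [∀ n, MeasurableSpace (Ω n)] (P : ∀ n, Measure (Ω n))
    (X : ∀ n, Ω n → ℝ) (c : ℝ) : Prop :=
  ∀ ε : ℝ, 0 < ε → Tendsto (fun n => (P n).real {ω | ε ≤ |X n ω - c|}) atTop (𝓝 0)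

end P1

/-! Write `R = e^ρ`. The mean of a dyad indicator `A^{ab}_{ij}` is `K i j` times a weight of `i`
times a weight of `j`, and sparsity puts `K` within `3ε` of one. Around a four-cycle the weights of
the patterns `a` and `b` agree up to the factor `R`, and the factors `K` are the same, so the two
mean cycle sums satisfy `mean a = R * mean b` exactly (`R_mul_cyc_eq_meanQ`). Hence `ρ̂ - ρ = log
(Qa / (R Qb))` is close to `U / (R Qb)` with `U = Qa - R Qb`, in which the means cancel.

Each indicator is split into its mean and a centred part, and the cycle sums are multiplied out.
Products of centred functions of distinct dyads are orthogonal unless they use the same set of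
dyads, and only boundedly many quadruples share such a set. The second moment of every term is
therefore at most a constant times a sum of squares (`ex_sq_sum_le`), which factorizes into power
sums of `μ`, `ν`, `η`. These are compared with `V0 = R ‖μ‖² ‖ν‖² (‖η‖² + R (μ,η)(ν,η))` through
Cauchy–Schwarz, `‖η‖² ≤ (μ,η)‖ν‖` and `‖η‖² ≤ (ν,η)‖μ‖`. The terms kept in `linA` and `linB` are
`O(V0)`, all others `O(ε V0)` (`ex_remA_sq_le`, `ex_remB_sq_le`).

So `U` is `linU` plus a negligible remainder, and `linU` is a sum of independent terms, one for each
unordered pair of nodes, with coefficients `rr` and `uu = ss - R tt`. Its variance is asymptotic to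
`V`, and `V ≥ (2/5) V0` (`le_V`): the difference in `uu` does not cancel on average, because the
cross terms in its second moment are nonnegative by Cauchy–Schwarz (`sum_sq_main`). The Lyapunov
condition holds by a dichotomy (`sum_truncMoment_le`). If `R (μ,η)(ν,η) ≥ c ‖η‖²`, the heterogeneity
condition makes every single term small against `√V`; otherwise the non-reciprocated dyads carry at
most a fraction of order `c` of the variance, and the coefficients of the reciprocated ones are
always small.

The estimator `V̂` is compared with `V` with observed dyads in place of their probabilities
(`semiV`). The errors of `r̂`, `ŝ`, `t̂` are `O(ε V0)` in mean, and replacing `R` by `e^ρ̂` costs a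
tight quantity times `(1 - e^(ρ̂-ρ))²` (`abs_Vhat_sub_le`, `tendsto_Vhat_div`). Finally `ŜNR (ρ̂ -
ρ) = (U / √V) Z` with `Z → 1` in probability; the truncation of `ρ̂` is inactive because `|ρ| ≤ 2
log n - 2` eventually; the level follows by portmanteau, and the power because `ψ` is `ŜNR (ρ - ρ₀)`
plus a tight term.

All moment bounds are explicit inequalities for a single `n` under `Sparse ε c`. The limits follow
because the hypotheses give `Sparse ε c` eventually for all small `ε` and `c`. -/

namespace P1

/-! ### Expectations of functions of the random graph -/

section Expectation

variable {n : ℕ} {Ω : Type*} [MeasurableSpace Ω]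

/-- The expectation of a function of the random graph. -/
noncomputable def ex (P : Measure Ω) (A : Ω → Graph n) (f : Graph n → ℝ) : ℝ := ∫ ω, f (A ω) ∂P

variable {P : Measure Ω} [IsProbabilityMeasure P] {A : Ω → Graph n}

theorem measurable_graph_comp (hm : Measurable A) {β : Type*} [MeasurableSpace β]
    (f : Graph n → β) : Measurable fun ω => f (A ω) :=
  (measurable_of_countable f).comp hm

/-- The graphs on `n` nodes form a finite type, so every function of the random graph is integrable
and expectations can be manipulated without side conditions. -/
theorem integrable_graph_comp (hm : Measurable A) (f : Graph n → ℝ) :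
    Integrable (fun ω => f (A ω)) P := by
  have : IsProbabilityMeasure (P.map A) := Measure.isProbabilityMeasure_map hm.aemeasurable
  exact (Integrable.of_finite (μ := P.map A) (f := f)).comp_measurable hm

theorem ex_add (hm : Measurable A) (f g : Graph n → ℝ) :
    ex P A (fun G => f G + g G) = ex P A f + ex P A g :=
  integral_add (integrable_graph_comp hm f) (integrable_graph_comp hm g)

theorem ex_sub (hm : Measurable A) (f g : Graph n → ℝ) :
    ex P A (fun G => f G - g G) = ex P A f - ex P A g :=
  integral_sub (integrable_graph_comp hm f) (integrable_graph_comp hm g)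

omit [IsProbabilityMeasure P] in
theorem ex_const_mul (c : ℝ) (f : Graph n → ℝ) :
    ex P A (fun G => c * f G) = c * ex P A f :=
  integral_const_mul c _

omit [IsProbabilityMeasure P] in
theorem ex_mul_const (c : ℝ) (f : Graph n → ℝ) :
    ex P A (fun G => f G * c) = ex P A f * c :=
  integral_mul_const c _

theorem ex_const (c : ℝ) : ex P A (fun _ => c) = c := by simp [ex]

theorem ex_sum (hm : Measurable A) {ι : Type*} (s : Finset ι) (f : ι → Graph n → ℝ) :
    ex P A (fun G => ∑ i ∈ s, f i G) = ∑ i ∈ s, ex P A (f i) :=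
  integral_finsetSum s fun i _ => integrable_graph_comp hm (f i)

theorem ex_mono (hm : Measurable A) {f g : Graph n → ℝ} (h : ∀ G, f G ≤ g G) :
    ex P A f ≤ ex P A g :=
  integral_mono (integrable_graph_comp hm f) (integrable_graph_comp hm g) fun ω => h (A ω)

omit [IsProbabilityMeasure P] in
theorem ex_nonneg {f : Graph n → ℝ} (h : ∀ G, 0 ≤ f G) : 0 ≤ ex P A f :=
  integral_nonneg fun ω => h (A ω)

theorem ex_add_sq_le (hm : Measurable A) (f g : Graph n → ℝ) :
    ex P A (fun G => (f G + g G) ^ 2)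
      ≤ 2 * ex P A (fun G => f G ^ 2) + 2 * ex P A (fun G => g G ^ 2) := by
  rw [← ex_const_mul, ← ex_const_mul, ← ex_add hm]
  exact ex_mono hm fun G => by nlinarith [sq_nonneg (f G - g G)]

theorem ex_sub_sq_le (hm : Measurable A) (f g : Graph n → ℝ) :
    ex P A (fun G => (f G - g G) ^ 2)
      ≤ 2 * ex P A (fun G => f G ^ 2) + 2 * ex P A (fun G => g G ^ 2) := by
  rw [← ex_const_mul, ← ex_const_mul, ← ex_add hm]
  exact ex_mono hm fun G => by nlinarith [sq_nonneg (f G + g G)]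

end Expectation

/-! ### Products of functions of dyads and their factorization -/

/-- A function of the dyad between two given nodes. -/
structure Item (n : ℕ) where
  fst : Fin n
  snd : Fin n
  g : Bool → Bool → ℝ

namespace Item

variable {n : ℕ}

def val (t : Item n) (G : Graph n) : ℝ := t.g (G t.fst t.snd) (G t.snd t.fst)

def edge (t : Item n) : Sym2 (Fin n) := s(t.fst, t.snd)

/-- The contribution of an item to the dyad `e`. -/
def factor (t : Item n) (e : {e : Fin n × Fin n // e.1 < e.2}) (z : Bool × Bool) : ℝ :=
  if e.1.1 = t.fst ∧ e.1.2 = t.snd then t.g z.1 z.2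
  else if e.1.1 = t.snd ∧ e.1.2 = t.fst then t.g z.2 z.1 else 1

/-- Exactly one ordered dyad carries the item, all other factors being one. In this form the
independence of the dyads `i < j` applies to items whose nodes come in either order. -/
theorem val_eq_prod (t : Item n) (ht : t.fst ≠ t.snd) (G : Graph n) :
    t.val G = ∏ e : {e : Fin n × Fin n // e.1 < e.2},
      t.factor e (G e.1.1 e.1.2, G e.1.2 e.1.1) := by
  rcases lt_or_gt_of_ne ht with h | h
  · rw [Finset.prod_eq_single ⟨(t.fst, t.snd), h⟩]
    · simp [factor, val]
    · rintro ⟨⟨x, y⟩, hxy⟩ - hne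
      simp only [factor]
      rw [if_neg, if_neg]
      · rintro ⟨rfl, rfl⟩
        exact absurd h (lt_asymm hxy)
      · rintro ⟨rfl, rfl⟩
        exact hne rfl
    · simp
  · rw [Finset.prod_eq_single ⟨(t.snd, t.fst), h⟩]
    · simp [factor, val, ht.symm]
    · rintro ⟨⟨x, y⟩, hxy⟩ - hne
      simp only [factor]
      rw [if_neg, if_neg]
      · rintro ⟨rfl, rfl⟩
        exact hne rfl
      · rintro ⟨rfl, rfl⟩
        exact absurd h (lt_asymm hxy)
    · simp

theorem factor_eq_one (t : Item n) (e : {e : Fin n × Fin n // e.1 < e.2})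
    (h : t.edge ≠ s(e.1.1, e.1.2)) (z : Bool × Bool) : t.factor e z = 1 := by
  rw [edge, Ne, Sym2.eq_iff, not_or] at h
  unfold factor
  rw [if_neg (fun h' => h.1 ⟨h'.1.symm, h'.2.symm⟩), if_neg (fun h' => h.2 ⟨h'.2.symm, h'.1.symm⟩)]

end Item

/-- The product of the values of a list of items. -/
def listVal {n : ℕ} (L : List (Item n)) (G : Graph n) : ℝ := (L.map fun t => t.val G).prod

section Factor

variable {n : ℕ}

@[simp] theorem listVal_nil (G : Graph n) : listVal [] G = 1 := by simp [listVal]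

theorem listVal_nil_eq : (listVal [] : Graph n → ℝ) = fun _ => 1 := by
  funext G; simp

@[simp] theorem listVal_cons (t : Item n) (L : List (Item n)) (G : Graph n) :
    listVal (t :: L) G = t.val G * listVal L G := by simp [listVal]

theorem listVal_append (L L' : List (Item n)) (G : Graph n) :
    listVal (L ++ L') G = listVal L G * listVal L' G := by simp [listVal]

theorem listVal_eq_prod (L : List (Item n)) (hL : ∀ t ∈ L, t.fst ≠ t.snd) (G : Graph n) :
    listVal L G = ∏ e : {e : Fin n × Fin n // e.1 < e.2},
      (L.map fun t => t.factor e (G e.1.1 e.1.2, G e.1.2 e.1.1)).prod := by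
  induction L with
  | nil => simp
  | cons t L ih =>
    rw [listVal_cons, t.val_eq_prod (hL t (by simp)), ih fun u hu => hL u (by simp [hu]),
      ← Finset.prod_mul_distrib]
    simp

variable {θ : Param n} {Ω : Type*} [MeasurableSpace Ω] {P : Measure Ω} [IsProbabilityMeasure P]
  {A : Ω → Graph n} (hA : IsP1Model θ P A)
include hA

omit [IsProbabilityMeasure P] in
-- Collecting the factors dyad by dyad leaves one function for each of the independent dyads, even
-- when several items share a dyad.
theorem ex_listVal_eq_prod (L : List (Item n)) (hL : ∀ t ∈ L, t.fst ≠ t.snd) :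
    ex P A (listVal L) = ∏ e : {e : Fin n × Fin n // e.1 < e.2},
      ex P A fun G => (L.map fun t => t.factor e (G e.1.1 e.1.2, G e.1.2 e.1.1)).prod := by
  unfold ex
  rw [← hA.indep.integral_fun_prod_comp
    (f := fun e z => (L.map fun t => t.factor e z).prod)]
  · exact integral_congr_ae (ae_of_all _ fun ω => listVal_eq_prod L hL (A ω))
  · intro e
    exact (measurable_graph_comp hA.measurable
      (fun G => (G e.1.1 e.1.2, G e.1.2 e.1.1))).aemeasurable
  · intro e
    exact (measurable_of_countable _).aestronglyMeasurable

/-- The product formulas for both sides are compared dyad by dyad: at the dyad of `t` all factors of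
`L` are one, and at every other dyad the factor of `t` is one. -/
theorem ex_val_mul_listVal (t : Item n) (L : List (Item n)) (ht : t.fst ≠ t.snd)
    (hL : ∀ u ∈ L, u.fst ≠ u.snd) (hd : ∀ u ∈ L, u.edge ≠ t.edge) :
    ex P A (fun G => t.val G * listVal L G) = ex P A t.val * ex P A (listVal L) := by
  have h1 := ex_listVal_eq_prod hA (t :: L) (by simpa using ⟨ht, hL⟩)
  have h2 := ex_listVal_eq_prod hA [t] (by simpa using ht)
  have h3 := ex_listVal_eq_prod hA L hL
  have e1 : (listVal (t :: L)) = fun G => t.val G * listVal L G := by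
    funext G; simp
  have e2 : (listVal [t]) = t.val := by
    funext G; simp
  rw [e1] at h1
  rw [e2] at h2
  rw [h1, h2, h3, ← Finset.prod_mul_distrib]
  refine Finset.prod_congr rfl fun e _ => ?_
  by_cases he : t.edge = s(e.1.1, e.1.2)
  · have : ∀ z, (L.map fun u => u.factor e z).prod = 1 := by
      intro z
      apply List.prod_eq_one
      simp only [List.mem_map, forall_exists_index, and_imp]
      rintro x u hu rfl
      exact u.factor_eq_one e (fun h => hd u hu (h.trans he.symm)) z
    simp [this, ex_const]
  · simp [t.factor_eq_one e he, ex_const]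

theorem ex_listVal (L : List (Item n)) (hL : ∀ u ∈ L, u.fst ≠ u.snd)
    (hd : (L.map Item.edge).Nodup) : ex P A (listVal L) = (L.map fun t => ex P A t.val).prod := by
  induction L with
  | nil => simp [listVal_nil_eq, ex_const]
  | cons t L ih =>
    simp only [List.map_cons, List.nodup_cons, List.mem_map, not_exists, not_and] at hd
    have : (listVal (t :: L)) = fun G => t.val G * listVal L G := by
      funext G; simp
    rw [this, ex_val_mul_listVal hA t L (hL t (by simp)) (fun u hu => hL u (by simp [hu])) hd.1,
      ih (fun u hu => hL u (by simp [hu])) hd.2]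
    simp

/-- Factorization over two families of items that touch different dyads. -/
theorem ex_listVal_mul (W L : List (Item n)) (hW : ∀ u ∈ W, u.fst ≠ u.snd)
    (hL : ∀ u ∈ L, u.fst ≠ u.snd) (hWn : (W.map Item.edge).Nodup)
    (hd : ∀ u ∈ W, ∀ v ∈ L, v.edge ≠ u.edge) :
    ex P A (fun G => listVal W G * listVal L G) = ex P A (listVal W) * ex P A (listVal L) := by
  induction W with
  | nil => simp [listVal_nil_eq, ex_const]
  | cons t W ih =>
    simp only [List.map_cons, List.nodup_cons, List.mem_map, not_exists, not_and] at hWn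
    have e1 : (fun G => listVal (t :: W) G * listVal L G)
        = fun G => t.val G * listVal (W ++ L) G := by
      funext G; simp [listVal_append, mul_assoc]
    have e2 : (listVal (W ++ L)) = fun G => listVal W G * listVal L G := by
      funext G; simp [listVal_append]
    have e3 : (listVal (t :: W)) = fun G => t.val G * listVal W G := by
      funext G; simp
    rw [e1, ex_val_mul_listVal hA t (W ++ L) (hW t (by simp)), e2,
      ih (fun u hu => hW u (by simp [hu])) hWn.2 (fun u hu => hd u (by simp [hu])), e3,
      ex_val_mul_listVal hA t W (hW t (by simp)) (fun u hu => hW u (by simp [hu])) hWn.1]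
    · ring
    · intro u hu
      rcases List.mem_append.1 hu with h | h
      · exact hW u (by simp [h])
      · exact hL u h
    · intro u hu
      rcases List.mem_append.1 hu with h | h
      · exact hWn.1 u h
      · exact hd t (by simp) u h

end Factor

/-! ### Orthogonality of centred products and second moments of their sums -/

section SumOfSquares

variable {n : ℕ}

/-- A product of centred functions of distinct dyads. -/
structure CenteredProd {Ω : Type*} [MeasurableSpace Ω] (P : Measure Ω) (A : Ω → Graph n)
    (L : List (Item n)) : Prop where
  ne : ∀ t ∈ L, t.fst ≠ t.snd
  nodup : (L.map Item.edge).Nodup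
  centered : ∀ t ∈ L, ex P A t.val = 0

variable {θ : Param n} {Ω : Type*} [MeasurableSpace Ω] {P : Measure Ω} [IsProbabilityMeasure P]
  {A : Ω → Graph n} (hA : IsP1Model θ P A)
include hA

/-- The dyad of `t` occurs in no other factor, so its vanishing mean splits off. The weight `W` is
allowed so that the indicator of a further dyad can multiply the squares. -/
theorem ex_mul_eq_zero_of_mem {L : List (Item n)} (W L' : List (Item n))
    (hL : CenteredProd P A L) (hL' : ∀ t ∈ L', t.fst ≠ t.snd) (hW : ∀ t ∈ W, t.fst ≠ t.snd)
    (hWL : ∀ u ∈ W, ∀ v ∈ L, v.edge ≠ u.edge)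
    (t : Item n) (ht : t ∈ L) (ht' : t.edge ∉ L'.map Item.edge) :
    ex P A (fun G => listVal W G * (listVal L G * listVal L' G)) = 0 := by
  obtain ⟨s₁, s₂, rfl⟩ := List.append_of_mem ht
  have e1 : (fun G => listVal W G * (listVal (s₁ ++ t :: s₂) G * listVal L' G))
      = fun G => t.val G * listVal (W ++ (s₁ ++ s₂) ++ L') G := by
    funext G
    simp only [listVal_append, listVal_cons]
    ring
  have hn := hL.nodup
  rw [List.map_append, List.map_cons, List.nodup_middle, List.nodup_cons, ← List.map_append] at hn
  rw [e1, ex_val_mul_listVal hA t _ (hL.ne t ht), hL.centered t ht, zero_mul]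
  · intro u hu
    simp only [List.mem_append] at hu
    rcases hu with (h | h) | h
    · exact hW u h
    · exact hL.ne u (by simp only [List.mem_append, List.mem_cons]; tauto)
    · exact hL' u h
  · intro u hu he
    simp only [List.mem_append] at hu
    rcases hu with (h | h) | h
    · exact hWL u h t ht he.symm
    · exact hn.1 (List.mem_map.2 ⟨u, List.mem_append.2 h, he⟩)
    · exact ht' (List.mem_map.2 ⟨u, h, he⟩)

/-- If the dyad sets differ, one of the two lists contains a dyad that is missing from the other,
and that factor makes the expectation vanish. -/
theorem ex_mul_eq_zero (W L L' : List (Item n)) (hL : CenteredProd P A L)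
    (hL' : CenteredProd P A L') (hW : ∀ t ∈ W, t.fst ≠ t.snd)
    (hWL : ∀ u ∈ W, ∀ v ∈ L, v.edge ≠ u.edge) (hWL' : ∀ u ∈ W, ∀ v ∈ L', v.edge ≠ u.edge)
    (h : (L.map Item.edge).toFinset ≠ (L'.map Item.edge).toFinset) :
    ex P A (fun G => listVal W G * (listVal L G * listVal L' G)) = 0 := by
  by_cases h1 : ∃ t ∈ L, t.edge ∉ L'.map Item.edge
  · obtain ⟨t, ht, ht'⟩ := h1
    exact ex_mul_eq_zero_of_mem hA W L' hL hL'.ne hW hWL t ht ht'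
  by_cases h2 : ∃ t ∈ L', t.edge ∉ L.map Item.edge
  · obtain ⟨t, ht, ht'⟩ := h2
    have := ex_mul_eq_zero_of_mem hA W L hL' hL.ne hW hWL' t ht ht'
    simpa only [mul_comm (listVal L' _)] using this
  push Not at h1 h2
  refine absurd ?_ h
  ext e
  simp only [List.mem_toFinset]
  constructor
  · intro he
    obtain ⟨t, ht, rfl⟩ := List.mem_map.1 he
    exact h1 t ht
  · intro he
    obtain ⟨t, ht, rfl⟩ := List.mem_map.1 he
    exact h2 t ht

/-- Squaring item by item gives a list on the same distinct dyads, to which the factorization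
applies. -/
theorem ex_mul_sq (W L : List (Item n)) (hL : CenteredProd P A L)
    (hW : ∀ t ∈ W, t.fst ≠ t.snd) (hWn : (W.map Item.edge).Nodup)
    (hWL : ∀ u ∈ W, ∀ v ∈ L, v.edge ≠ u.edge) :
    ex P A (fun G => listVal W G * listVal L G ^ 2)
      = ex P A (listVal W) * (L.map fun t => ex P A fun G => t.val G ^ 2).prod := by
  set L2 : List (Item n) := L.map fun t => ⟨t.fst, t.snd, fun a b => t.g a b ^ 2⟩ with hL2
  have hv : ∀ G, listVal L G ^ 2 = listVal L2 G := by
    intro G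
    rw [hL2, listVal, listVal, List.map_map, sq, ← List.prod_map_mul]
    congr 1
    refine List.map_congr_left fun t _ => ?_
    simp [Item.val, sq]
  have hne : ∀ u ∈ L2, u.fst ≠ u.snd := by
    intro u hu
    obtain ⟨t, ht, rfl⟩ := List.mem_map.1 hu
    exact hL.ne t ht
  have hnd : (L2.map Item.edge).Nodup := by
    rw [hL2, List.map_map]
    exact hL.nodup
  have hdj : ∀ u ∈ W, ∀ v ∈ L2, v.edge ≠ u.edge := by
    intro u hu v hv
    obtain ⟨t, ht, rfl⟩ := List.mem_map.1 hv
    exact hWL u hu t ht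
  simp_rw [hv]
  rw [ex_listVal_mul hA W L2 hW hne hWn hdj, ex_listVal hA L2 hne hnd, hL2, List.map_map]
  rfl

omit hA in
-- Four dyads meet at most eight nodes, and the dyads of an index cover its tuple. Every tuple with
-- the same dyads as `x` thus has its `m` entries among these eight nodes.
theorem card_filter_edges_le {ι : Type*} [DecidableEq ι] (s : Finset ι) {m : ℕ}
    (tup : ι → Fin m → Fin n)
    (hinj : Function.Injective tup) (L : ι → List (Item n)) (hlen : ∀ x ∈ s, (L x).length ≤ 4)
    (hcov : ∀ x ∈ s, ∀ a, ∃ t ∈ L x, tup x a ∈ t.edge) (x : ι) (hx : x ∈ s) :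
    (s.filter fun y => ((L y).map Item.edge).toFinset = ((L x).map Item.edge).toFinset).card
      ≤ 8 ^ m := by
  classical
  set T : Finset (Fin n) := ((L x).flatMap fun t => [t.fst, t.snd]).toFinset with hT
  have hTc : T.card ≤ 8 := by
    refine (List.toFinset_card_le _).trans ?_
    rw [List.length_flatMap]
    simp only [List.length_cons, List.length_nil, List.map_const', List.sum_replicate, smul_eq_mul]
    have := hlen x hx
    omega
  calc (s.filter fun y => ((L y).map Item.edge).toFinset = ((L x).map Item.edge).toFinset).card
      ≤ (Fintype.piFinset fun _ : Fin m => T).card := by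
        refine Finset.card_le_card_of_injOn tup ?_ hinj.injOn
        intro y hy
        simp only [Finset.coe_filter, Set.mem_ofPred_eq] at hy
        simp only [Finset.mem_coe, Fintype.mem_piFinset]
        intro a
        obtain ⟨t, ht, hta⟩ := hcov y hy.1 a
        have : t.edge ∈ ((L x).map Item.edge).toFinset := by
          rw [← hy.2]
          simpa using ⟨t, ht, rfl⟩
        obtain ⟨u, hu, hue⟩ := List.mem_map.1 (List.mem_toFinset.1 this)
        rw [← hue, Item.edge, Sym2.mem_iff] at hta
        rw [hT]
        simp only [List.mem_toFinset, List.mem_flatMap, List.mem_cons, List.not_mem_nil, or_false]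
        exact ⟨u, hu, hta⟩
    _ ≤ 8 ^ m := by
        rw [Fintype.card_piFinset]
        simp only [Finset.prod_const, Finset.card_univ, Fintype.card_fin]
        exact Nat.pow_le_pow_left hTc m

/-- The main second moment bound for sums of products of centred functions of dyads. -/
theorem ex_sq_sum_le {ι : Type*} [Fintype ι] [DecidableEq ι] {m : ℕ} (tup : ι → Fin m → Fin n)
    (hm : m ≤ 4) (hinj : Function.Injective tup) (L : ι → List (Item n)) (W : List (Item n))
    (c : ι → ℝ)
    (hlen : ∀ x, (L x).length ≤ 4)
    (hcov : ∀ x, ∀ a, ∃ t ∈ L x, tup x a ∈ t.edge)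
    (hL : ∀ x, c x ≠ 0 → CenteredProd P A (L x))
    (hW0 : ∀ G, 0 ≤ listVal W G)
    (hW : ∀ t ∈ W, t.fst ≠ t.snd) (hWn : (W.map Item.edge).Nodup)
    (hWL : ∀ x, c x ≠ 0 → ∀ u ∈ W, ∀ v ∈ L x, v.edge ≠ u.edge) :
    ex P A (fun G => listVal W G * (∑ x, c x * listVal (L x) G) ^ 2)
      ≤ 4096 * ∑ x, c x ^ 2 *
        (ex P A (listVal W) * ((L x).map fun t => ex P A fun G => t.val G ^ 2).prod) := by
  classical
  have hmeas := hA.measurable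
  -- Centredness is known only where the coefficient is nonzero, so the sum is restricted to such
  -- indices.
  set s : Finset ι := Finset.univ.filter fun x => c x ≠ 0 with hs
  have hsum : ∀ f : ι → ℝ, (∀ x, c x = 0 → f x = 0) → ∑ x, f x = ∑ x ∈ s, f x := by
    intro f hf
    rw [hs, Finset.sum_filter_of_ne]
    intro x _ hx h0
    exact hx (hf x h0)
  set K : ι → Finset (Sym2 (Fin n)) := fun x => ((L x).map Item.edge).toFinset with hK
  set v : ι → ℝ := fun x => c x ^ 2 *
        (ex P A (listVal W) * ((L x).map fun t => ex P A fun G => t.val G ^ 2).prod) with hv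
  have hv' : ∀ x ∈ s, ex P A (fun G => listVal W G * (c x * listVal (L x) G) ^ 2) = v x := by
    intro x hx
    have hcx : c x ≠ 0 := by simpa [hs] using hx
    rw [hv]
    simp only
    rw [← ex_mul_sq hA W (L x) (hL x hcx) hW hWn (hWL x hcx), ← ex_const_mul]
    congr 1
    funext G
    ring
  have hexp : (fun G => listVal W G * (∑ x, c x * listVal (L x) G) ^ 2)
      = fun G => ∑ x ∈ s, ∑ y ∈ s,
        (c x * c y) * (listVal W G * (listVal (L x) G * listVal (L y) G)) := by
    funext G
    rw [hsum (fun x => c x * listVal (L x) G) (fun x h => by simp [h]), sq, Finset.sum_mul_sum,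
      Finset.mul_sum]
    refine Finset.sum_congr rfl fun x _ => ?_
    rw [Finset.mul_sum]
    refine Finset.sum_congr rfl fun y _ => ?_
    ring
  -- Pairs with different dyad sets are orthogonal. For the others the mixed moment is at most the
  -- average of the two squares, and by the counting lemma each `x` has at most `8 ^ 4 = 4096`
  -- partners.
  have hpair : ∀ x ∈ s, ∀ y ∈ s,
      ex P A (fun G => (c x * c y) * (listVal W G * (listVal (L x) G * listVal (L y) G)))
        ≤ if K y = K x then (v x + v y) / 2 else 0 := by
    intro x hx y hy
    have hcx : c x ≠ 0 := by simpa [hs] using hx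
    have hcy : c y ≠ 0 := by simpa [hs] using hy
    split_ifs with h
    · rw [← hv' x hx, ← hv' y hy, ← ex_add hmeas, div_eq_mul_inv, ← ex_mul_const]
      refine ex_mono hmeas fun G => ?_
      nlinarith [mul_nonneg (hW0 G) (sq_nonneg (c x * listVal (L x) G - c y * listVal (L y) G))]
    · rw [ex_const_mul, ex_mul_eq_zero hA W (L x) (L y) (hL x hcx) (hL y hcy) hW (hWL x hcx)
        (hWL y hcy) (fun h' => h h'.symm), mul_zero]
  have hcard : ∀ x ∈ s, ((s.filter fun y => K y = K x).card : ℝ) ≤ 4096 := by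
    intro x hx
    have := card_filter_edges_le s tup hinj L (fun x _ => hlen x) (fun x _ => hcov x) x hx
    have h8 : 8 ^ m ≤ 8 ^ 4 := Nat.pow_le_pow_right (by norm_num) hm
    have : (s.filter fun y => K y = K x).card ≤ 4096 := by
      refine (this.trans h8).trans ?_
      norm_num
    exact_mod_cast this
  have hv0 : ∀ x ∈ s, 0 ≤ v x := by
    intro x hx
    rw [← hv' x hx]
    exact ex_nonneg fun G => mul_nonneg (hW0 G) (sq_nonneg _)
  have hhalf : ∀ f : ι → ι → ℝ, (∀ x ∈ s, ∀ y ∈ s, f x y = if K y = K x then v x else 0) →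
      ∑ x ∈ s, ∑ y ∈ s, f x y ≤ 4096 * ∑ x ∈ s, v x := by
    intro f hf
    rw [Finset.mul_sum]
    refine Finset.sum_le_sum fun x hx => ?_
    rw [Finset.sum_congr rfl (hf x hx), ← Finset.sum_filter, Finset.sum_const, nsmul_eq_mul]
    exact mul_le_mul_of_nonneg_right (hcard x hx) (hv0 x hx)
  rw [hexp, ex_sum hmeas, hsum v (fun x h => by simp [hv, h])]
  calc ∑ x ∈ s, ex P A (fun G => ∑ y ∈ s,
          (c x * c y) * (listVal W G * (listVal (L x) G * listVal (L y) G)))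
      ≤ ∑ x ∈ s, ∑ y ∈ s, (if K y = K x then (v x + v y) / 2 else 0) := by
        refine Finset.sum_le_sum fun x hx => ?_
        rw [ex_sum hmeas]
        exact Finset.sum_le_sum fun y hy => hpair x hx y hy
    _ = (∑ x ∈ s, ∑ y ∈ s, (if K y = K x then v x else 0)) / 2
        + (∑ x ∈ s, ∑ y ∈ s, (if K y = K x then v y else 0)) / 2 := by
        rw [← add_div, ← Finset.sum_add_distrib, Finset.sum_div]
        refine Finset.sum_congr rfl fun x _ => ?_
        rw [← Finset.sum_add_distrib, Finset.sum_div]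
        refine Finset.sum_congr rfl fun y _ => ?_
        split_ifs <;> simp
    _ ≤ 4096 * ∑ x ∈ s, v x := by
        have h1 := hhalf (fun x y => if K y = K x then v x else 0) (fun _ _ _ _ => rfl)
        have h2 := hhalf (fun y x => if K y = K x then v y else 0)
          (fun x _ y _ => by simp only [eq_comm (a := K x)])
        rw [Finset.sum_comm] at h2
        linarith

end SumOfSquares

end P1

namespace P1

/-! ### Characteristic functions of sums of independent variables -/

section CharFun

/-- Taylor's bound for `|x| ≤ 1`, the trivial bound beyond. Keeping the minimum means that third
moments are never needed where only second moments are controlled. -/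
theorem norm_cexp_mul_I_sub_le (x : ℝ) :
    ‖Complex.exp (x * Complex.I) - (1 + x * Complex.I - x ^ 2 / 2)‖ ≤ 4 * min (x ^ 2) (|x| ^ 3) := by
  have hI : ‖(x : ℂ) * Complex.I‖ = |x| := by simp
  rcases le_or_gt |x| 1 with h | h
  · have h2 : |x| ^ 3 ≤ x ^ 2 := by
      rw [← sq_abs]
      nlinarith [abs_nonneg x, sq_nonneg |x|]
    rw [min_eq_right h2]
    have := Complex.exp_bound (x := x * Complex.I) (by rw [hI]; exact h) (n := 3) (by norm_num)
    rw [hI] at this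
    simp only [Finset.sum_range_succ, Finset.sum_range_zero] at this
    have e : (0 : ℂ) + (↑x * Complex.I) ^ 0 / ((Nat.factorial 0 : ℕ) : ℂ)
        + (↑x * Complex.I) ^ 1 / ((Nat.factorial 1 : ℕ) : ℂ)
        + (↑x * Complex.I) ^ 2 / ((Nat.factorial 2 : ℕ) : ℂ)
        = 1 + x * Complex.I - x ^ 2 / 2 := by
      simp [mul_pow, Complex.I_sq, Nat.factorial]
      ring
    rw [e] at this
    refine this.trans ?_
    have h0 : 0 ≤ |x| ^ 3 := by positivity
    norm_num [Nat.factorial]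
    linarith
  · have h2 : x ^ 2 ≤ |x| ^ 3 := by
      rw [← sq_abs]
      nlinarith [abs_nonneg x, sq_nonneg |x|]
    rw [min_eq_left h2]
    calc ‖Complex.exp (x * Complex.I) - (1 + x * Complex.I - x ^ 2 / 2)‖
        ≤ ‖Complex.exp (x * Complex.I)‖ + ‖(1 + x * Complex.I - x ^ 2 / 2 : ℂ)‖ := norm_sub_le _ _
      _ ≤ 1 + (1 + |x| + x ^ 2 / 2) := by
          rw [Complex.norm_exp_ofReal_mul_I]
          gcongr
          refine (norm_sub_le _ _).trans ?_
          gcongr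
          · refine (norm_add_le _ _).trans ?_
            rw [hI]
            simp
          · simp
      _ ≤ 4 * x ^ 2 := by
          rw [← sq_abs]
          nlinarith

/-- Telescoping: the factors are exchanged one at a time, the remaining ones having modulus at most
one. -/
theorem norm_prod_sub_prod_le {ι : Type*} (s : Finset ι) (a b : ι → ℂ) (ha : ∀ i, ‖a i‖ ≤ 1)
    (hb : ∀ i, ‖b i‖ ≤ 1) : ‖∏ i ∈ s, a i - ∏ i ∈ s, b i‖ ≤ ∑ i ∈ s, ‖a i - b i‖ := by
  classical
  induction s using Finset.induction_on with
  | empty => simp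
  | insert i s hi ih =>
    rw [Finset.prod_insert hi, Finset.prod_insert hi, Finset.sum_insert hi]
    have e : a i * ∏ j ∈ s, a j - b i * ∏ j ∈ s, b j
        = (a i - b i) * ∏ j ∈ s, a j + b i * (∏ j ∈ s, a j - ∏ j ∈ s, b j) := by ring
    rw [e]
    refine (norm_add_le _ _).trans ?_
    rw [norm_mul, norm_mul]
    have h1 : ‖∏ j ∈ s, a j‖ ≤ 1 := by
      rw [norm_prod]
      exact Finset.prod_le_one (fun _ _ => norm_nonneg _) fun j _ => ha j
    have := hb i
    gcongr
    · exact mul_le_of_le_one_right (norm_nonneg _) h1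
    · exact (mul_le_of_le_one_left (norm_nonneg _) this).trans ih

theorem abs_exp_neg_sub_le {x : ℝ} (hx : 0 ≤ x) : |Real.exp (-x) - (1 - x)| ≤ x ^ 2 := by
  have h1 : 1 - x ≤ Real.exp (-x) := by
    have := Real.add_one_le_exp (-x)
    linarith
  rw [abs_of_nonneg (by linarith)]
  rcases le_or_gt x 1 with h | h
  · have := Real.norm_exp_sub_one_sub_id_le (x := -x) (by rw [norm_neg, Real.norm_of_nonneg hx]; exact h)
    rw [Real.norm_eq_abs, norm_neg, Real.norm_of_nonneg hx] at this
    have h3 := (abs_le.1 this).2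
    linarith
  · have : Real.exp (-x) ≤ 1 := Real.exp_le_one_iff.2 (by linarith)
    nlinarith

variable {Ω : Type*} [MeasurableSpace Ω] {P : Measure Ω} [IsProbabilityMeasure P]

/-- The truncated third absolute moment `E min (Y², |Y|³)`. -/
noncomputable def truncMoment (P : Measure Ω) (Y : Ω → ℝ) : ℝ := ∫ ω, min (Y ω ^ 2) (|Y ω| ^ 3) ∂P

omit [IsProbabilityMeasure P] in
theorem integrable_min_sq {Y : Ω → ℝ} (hY : MemLp Y 2 P) :
    Integrable (fun ω => min (Y ω ^ 2) (|Y ω| ^ 3)) P := by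
  have h := hY.aestronglyMeasurable
  refine hY.integrable_sq.mono' ?_ (ae_of_all _ fun ω => ?_)
  · have h' := h.aemeasurable
    exact (AEMeasurable.min (h'.pow_const 2) (h'.norm.pow_const 3)).aestronglyMeasurable
  · rw [Real.norm_of_nonneg (by positivity)]
    exact min_le_left _ _

omit [IsProbabilityMeasure P] in
theorem truncMoment_nonneg (Y : Ω → ℝ) : 0 ≤ truncMoment P Y :=
  integral_nonneg fun _ => by positivity

/-- For centred `Y` the integrated second order expansion leaves only the variance. The scale `t`
leaves the error through `min (t²y²) (|t|³|y|³) ≤ (t² + |t|³) min (y²) (|y|³)`. -/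
theorem norm_charFun_sub_le {Y : Ω → ℝ} (hY : MemLp Y 2 P) (h0 : ∫ ω, Y ω ∂P = 0) (t : ℝ) :
    ‖charFun (P.map Y) t - ((1 - t ^ 2 * (∫ ω, Y ω ^ 2 ∂P) / 2 : ℝ) : ℂ)‖
      ≤ 4 * (t ^ 2 + |t| ^ 3) * truncMoment P Y := by
  have hm := hY.aestronglyMeasurable.aemeasurable
  have hint := hY.integrable (by norm_num)
  have h2 := hY.integrable_sq
  rw [charFun_apply_real, integral_map hm (by fun_prop)]
  have i2 : Integrable (fun ω => ((t * Y ω : ℝ) : ℂ) ^ 2 / 2) P := by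
    have : Integrable (fun ω => ((t ^ 2 / 2 * Y ω ^ 2 : ℝ) : ℂ)) P :=
      (h2.const_mul (t ^ 2 / 2)).ofReal
    refine this.congr (ae_of_all _ fun ω => ?_)
    push_cast
    ring
  have e : ((1 - t ^ 2 * (∫ ω, Y ω ^ 2 ∂P) / 2 : ℝ) : ℂ)
      = ∫ ω, (1 + ((t * Y ω : ℝ) : ℂ) * Complex.I - ((t * Y ω : ℝ) : ℂ) ^ 2 / 2) ∂P := by
    have i1 : Integrable (fun ω => ((t * Y ω : ℝ) : ℂ)) P := (hint.const_mul t).ofReal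
    have i5 : Integrable (fun ω => (1 : ℂ) + ((t * Y ω : ℝ) : ℂ) * Complex.I) P :=
      (integrable_const 1).add (i1.mul_const _)
    rw [integral_sub i5 i2, integral_add (integrable_const 1) (i1.mul_const _), integral_mul_const]
    have e1 : ∫ ω, ((t * Y ω : ℝ) : ℂ) ∂P = 0 := by
      rw [integral_complex_ofReal, integral_const_mul, h0]
      simp
    have e2 : ∫ ω, ((t * Y ω : ℝ) : ℂ) ^ 2 / 2 ∂P = ((t ^ 2 * (∫ ω, Y ω ^ 2 ∂P) / 2 : ℝ) : ℂ) := by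
      have : ∀ ω, ((t * Y ω : ℝ) : ℂ) ^ 2 / 2 = ((t ^ 2 / 2 * Y ω ^ 2 : ℝ) : ℂ) := by
        intro ω
        push_cast
        ring
      simp_rw [this]
      rw [integral_complex_ofReal, integral_const_mul]
      congr 1
      ring
    rw [e1, e2]
    simp
  have i3 : Integrable (fun ω => Complex.exp (t * Y ω * Complex.I)) P := by
    refine Integrable.of_bound (C := 1) ?_ (ae_of_all _ fun ω => ?_)
    · exact (by fun_prop : AEMeasurable (fun ω => Complex.exp (t * Y ω * Complex.I)) P).aestronglyMeasurable
    · rw [← Complex.ofReal_mul, Complex.norm_exp_ofReal_mul_I]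
  have i4 : Integrable (fun ω => (1 + ((t * Y ω : ℝ) : ℂ) * Complex.I - ((t * Y ω : ℝ) : ℂ) ^ 2 / 2)) P := by
    exact ((integrable_const 1).add (((hint.const_mul t).ofReal).mul_const _)).sub i2
  rw [e, ← integral_sub i3 i4, truncMoment, ← integral_const_mul]
  refine norm_integral_le_of_norm_le ((integrable_min_sq hY).const_mul _) (ae_of_all _ fun ω => ?_)
  have := norm_cexp_mul_I_sub_le (t * Y ω)
  rw [Complex.ofReal_mul] at this ⊢
  refine this.trans ?_
  rw [mul_assoc]
  gcongr
  have hA : 0 ≤ Y ω ^ 2 := by positivity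
  have hB : 0 ≤ |Y ω| ^ 3 := by positivity
  have hc : 0 ≤ t ^ 2 := by positivity
  have hd : 0 ≤ |t| ^ 3 := by positivity
  rw [abs_mul, mul_pow, mul_pow]
  rcases le_total (Y ω ^ 2) (|Y ω| ^ 3) with h | h
  · rw [min_eq_left h]
    refine (min_le_left _ _).trans ?_
    nlinarith
  · rw [min_eq_right h]
    refine (min_le_right _ _).trans ?_
    nlinarith

/-- Below `|Y| = τ` one has `Y² ≤ τ²`; above it `τ Y² ≤ min (Y²) (|Y|³)`, as `τ ≤ 1`. A small
truncated moment therefore forces each individual variance to be small. -/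
theorem integral_sq_le_truncMoment {Y : Ω → ℝ} (hY : MemLp Y 2 P) {τ : ℝ} (h0 : 0 < τ) (h1 : τ ≤ 1) :
    ∫ ω, Y ω ^ 2 ∂P ≤ τ ^ 2 + truncMoment P Y / τ := by
  have : τ ^ 2 + truncMoment P Y / τ = ∫ ω, (τ ^ 2 + min (Y ω ^ 2) (|Y ω| ^ 3) / τ) ∂P := by
    rw [integral_add (integrable_const _) ((integrable_min_sq hY).div_const _), integral_div]
    simp [truncMoment]
  rw [this]
  refine integral_mono hY.integrable_sq
    ((integrable_const _).add ((integrable_min_sq hY).div_const _)) fun ω => ?_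
  simp only
  rw [← sq_abs (Y ω)]
  have hy := abs_nonneg (Y ω)
  rcases le_or_gt |Y ω| τ with h | h
  · have : |Y ω| ^ 2 ≤ τ ^ 2 := by gcongr
    have : 0 ≤ min (|Y ω| ^ 2) (|Y ω| ^ 3) / τ := by positivity
    linarith
  · have : |Y ω| ^ 2 ≤ min (|Y ω| ^ 2) (|Y ω| ^ 3) / τ := by
      rw [le_div_iff₀ h0]
      refine le_min ?_ ?_
      · nlinarith [sq_nonneg |Y ω|]
      · nlinarith [sq_nonneg |Y ω|]
    nlinarith [sq_nonneg τ]

/-- Each factor is compared with `1 - t²v/2` and that with `exp (-t²v/2)`. The second errors are of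
order `v²`, and their sum is at most the total variance times a common bound for the individual
variances. -/
theorem norm_charFun_sum_sub_le {ι : Type*} [Fintype ι] {Y : ι → Ω → ℝ}
    (hind : iIndepFun Y P) (hY : ∀ i, MemLp (Y i) 2 P) (h0 : ∀ i, ∫ ω, Y i ω ∂P = 0) (t : ℝ)
    {τ : ℝ} (hτ0 : 0 < τ) (hτ1 : τ ≤ 1) :
    ‖charFun (P.map fun ω => ∑ i, Y i ω) t
        - Complex.exp (-(t ^ 2 * (∑ i, ∫ ω, Y i ω ^ 2 ∂P) / 2 : ℝ))‖
      ≤ 4 * (t ^ 2 + |t| ^ 3) * (∑ i, truncMoment P (Y i))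
        + t ^ 4 * (∑ i, ∫ ω, Y i ω ^ 2 ∂P) * (τ ^ 2 + (∑ i, truncMoment P (Y i)) / τ) := by
  have hm : ∀ i, AEMeasurable (Y i) P := fun i => (hY i).aestronglyMeasurable.aemeasurable
  have hv : ∀ i, 0 ≤ ∫ ω, Y i ω ^ 2 ∂P := fun i => integral_nonneg fun _ => by positivity
  rw [hind.charFun_map_fun_sum_eq_prod hm]
  have e : Complex.exp (-(t ^ 2 * (∑ i, ∫ ω, Y i ω ^ 2 ∂P) / 2 : ℝ))
      = ∏ i, ((Real.exp (-(t ^ 2 * (∫ ω, Y i ω ^ 2 ∂P) / 2)) : ℝ) : ℂ) := by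
    rw [← Complex.ofReal_neg, ← Complex.ofReal_exp, Finset.mul_sum, Finset.sum_div,
      ← Finset.sum_neg_distrib, Real.exp_sum]
    push_cast
    rfl
  rw [e, Finset.prod_apply]
  refine (norm_prod_sub_prod_le _ _ _ (fun i => ?_) fun i => ?_).trans ?_
  · have := Measure.isProbabilityMeasure_map (hm i)
    exact norm_charFun_le_one _
  · rw [Complex.norm_real, Real.norm_of_nonneg (Real.exp_nonneg _), Real.exp_le_one_iff]
    have := hv i
    have : 0 ≤ t ^ 2 * (∫ ω, Y i ω ^ 2 ∂P) / 2 := by positivity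
    linarith
  have hT : ∀ i, truncMoment P (Y i) ≤ ∑ i, truncMoment P (Y i) := fun i =>
    Finset.single_le_sum (f := fun i => truncMoment P (Y i)) (fun j _ => truncMoment_nonneg _)
      (Finset.mem_univ i)
  calc _ ≤ ∑ i, (4 * (t ^ 2 + |t| ^ 3) * truncMoment P (Y i)
        + t ^ 4 * (∫ ω, Y i ω ^ 2 ∂P) * (τ ^ 2 + (∑ i, truncMoment P (Y i)) / τ)) := by
        refine Finset.sum_le_sum fun i _ => ?_
        set v := ∫ ω, Y i ω ^ 2 ∂P with hvdef
        have hvi : 0 ≤ v := hv i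
        have h1 := norm_charFun_sub_le (hY i) (h0 i) t
        have h2 := abs_exp_neg_sub_le (x := t ^ 2 * v / 2) (by positivity)
        have h3 : v ≤ τ ^ 2 + (∑ i, truncMoment P (Y i)) / τ := by
          refine (integral_sq_le_truncMoment (hY i) hτ0 hτ1).trans ?_
          gcongr
          exact hT i
        have h4 : (t ^ 2 * v / 2) ^ 2
            ≤ t ^ 4 * v * (τ ^ 2 + (∑ i, truncMoment P (Y i)) / τ) := by
          have : 0 ≤ t ^ 4 * v := by positivity
          nlinarith [mul_le_mul_of_nonneg_left h3 this, sq_nonneg (t ^ 2 * v)]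
        calc _ = ‖(charFun (P.map (Y i)) t - ((1 - t ^ 2 * v / 2 : ℝ) : ℂ))
              - ((Real.exp (-(t ^ 2 * v / 2)) - (1 - t ^ 2 * v / 2) : ℝ) : ℂ)‖ := by
                congr 1
                push_cast
                ring
          _ ≤ _ + _ := norm_sub_le _ _
          _ ≤ _ := by
                refine add_le_add h1 (le_trans ?_ h4)
                rw [Complex.norm_real]
                exact h2
    _ = _ := by
        rw [Finset.sum_add_distrib, ← Finset.mul_sum, ← Finset.sum_mul, ← Finset.mul_sum]

end CharFun

section Limits

variable {Ω : ℕ → Type*} [∀ n, MeasurableSpace (Ω n)] {P : ∀ n, Measure (Ω n)}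
  [∀ n, IsProbabilityMeasure (P n)]

/-- A central limit theorem for triangular arrays, row `n` living on its own probability space. -/
theorem tendsto_charFun_of_truncMoment {ι : ℕ → Type*} [∀ n, Fintype (ι n)]
    (Y : ∀ n, ι n → Ω n → ℝ) (hind : ∀ n, iIndepFun (Y n) (P n))
    (hY : ∀ n i, MemLp (Y n i) 2 (P n)) (h0 : ∀ n i, ∫ ω, Y n i ω ∂(P n) = 0)
    (hv : Tendsto (fun n => ∑ i, ∫ ω, Y n i ω ^ 2 ∂(P n)) atTop (𝓝 1))
    (hT : Tendsto (fun n => ∑ i, truncMoment (P n) (Y n i)) atTop (𝓝 0)) (t : ℝ) :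
    Tendsto (fun n => charFun ((P n).map fun ω => ∑ i, Y n i ω) t) atTop
      (𝓝 (charFun (gaussianReal 0 1) t)) := by
  set T : ℕ → ℝ := fun n => ∑ i, truncMoment (P n) (Y n i) with hTdef
  set v : ℕ → ℝ := fun n => ∑ i, ∫ ω, Y n i ω ^ 2 ∂(P n) with hvdef
  have hT0 : ∀ n, 0 ≤ T n := fun n => Finset.sum_nonneg fun i _ => truncMoment_nonneg _
  have hv0 : ∀ n, 0 ≤ v n := fun n => Finset.sum_nonneg fun i _ =>
    integral_nonneg fun _ => by positivity
  -- With this choice both `τ` and `T / τ ≤ τ` tend to zero; the summand `1 / (n + 1)` keeps `τ`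
  -- positive when `T n = 0`.
  set τ : ℕ → ℝ := fun n => Real.sqrt (T n + 1 / ((n : ℝ) + 1)) with hτdef
  have hpos : ∀ n, 0 < T n + 1 / ((n : ℝ) + 1) := fun n => by
    have := hT0 n
    positivity
  have hτ : Tendsto τ atTop (𝓝 0) := by
    have := (hT.add (tendsto_one_div_add_atTop_nhds_zero_nat (𝕜 := ℝ))).sqrt
    rw [add_zero, Real.sqrt_zero] at this
    exact this
  have hτpos : ∀ n, 0 < τ n := fun n => Real.sqrt_pos.2 (hpos n)
  have hTτ : ∀ n, T n / τ n ≤ τ n := by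
    intro n
    rw [div_le_iff₀ (hτpos n), Real.mul_self_sqrt (hpos n).le]
    have : (0 : ℝ) ≤ 1 / ((n : ℝ) + 1) := by positivity
    linarith
  have hτ1 : ∀ᶠ n in atTop, τ n ≤ 1 :=
    (hτ.eventually (gt_mem_nhds (zero_lt_one))).mono fun n h => le_of_lt h
  have hmain : Tendsto (fun n => charFun ((P n).map fun ω => ∑ i, Y n i ω) t
      - Complex.exp (-(t ^ 2 * v n / 2 : ℝ))) atTop (𝓝 0) := by
    refine squeeze_zero_norm' (a := fun n => 4 * (t ^ 2 + |t| ^ 3) * T n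
      + t ^ 4 * v n * (τ n ^ 2 + τ n)) ?_ ?_
    · filter_upwards [hτ1] with n hn
      refine (norm_charFun_sum_sub_le (hind n) (hY n) (h0 n) t (hτpos n) hn).trans ?_
      have := hv0 n
      gcongr
      exact hTτ n
    · have := (hT.const_mul (4 * (t ^ 2 + |t| ^ 3))).add
        (((hv.const_mul (t ^ 4))).mul ((hτ.pow 2).add hτ))
      simpa using this
  have hlim : Tendsto (fun n => Complex.exp (-(t ^ 2 * v n / 2 : ℝ))) atTop
      (𝓝 (charFun (gaussianReal 0 1) t)) := by
    have e : charFun (gaussianReal 0 1) t = Complex.exp (-(t ^ 2 * 1 / 2 : ℝ)) := by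
      rw [charFun_gaussianReal]
      push_cast
      congr 1
      ring
    rw [e]
    have hc : Continuous fun x : ℝ => Complex.exp (-(t ^ 2 * x / 2 : ℝ)) := by fun_prop
    exact (hc.tendsto 1).comp hv
  simpa using hmain.add hlim

/-- If `S n` converges in law to the standard normal distribution and `W n - S n` converges to zero
in probability, then `W n` converges in law to the standard normal distribution. -/
theorem tendstoInDistribution_of_charFun (S W : ∀ n, Ω n → ℝ) (hS : ∀ n, Measurable (S n))
    (hW : ∀ n, Measurable (W n))
    (hc : ∀ t, Tendsto (fun n => charFun ((P n).map (S n)) t) atTop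
      (𝓝 (charFun (gaussianReal 0 1) t)))
    (hd : TendstoInProb P (fun n ω => W n ω - S n ω) 0) :
    TendstoInDistribution W atTop (id : ℝ → ℝ) P (gaussianReal 0 1) where
  forall_aemeasurable n := (hW n).aemeasurable
  aemeasurable_limit := aemeasurable_id
  tendsto := by
    refine ProbabilityMeasure.tendsto_iff_tendsto_charFun.2 fun t => ?_
    simp only [ProbabilityMeasure.coe_mk, Measure.map_id]
    have hdiff : Tendsto (fun n => charFun ((P n).map (W n)) t - charFun ((P n).map (S n)) t)
        atTop (𝓝 0) := by
      rw [Metric.tendsto_atTop]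
      intro ε hε
      -- Off the event `|W - S| ≥ δ` the exponentials differ by at most `|t| δ ≤ ε / 2`. On it they
      -- differ by at most `2`, and its probability is below `ε / 4`.
      set δ : ℝ := ε / (2 * (|t| + 1)) with hδ
      have hδ0 : 0 < δ := by positivity
      have h4 : 0 < ε / 4 := by positivity
      have := (hd δ hδ0).eventually (gt_mem_nhds h4)
      obtain ⟨N, hN⟩ := eventually_atTop.1 this
      refine ⟨N, fun n hn => ?_⟩
      have hn' := hN n hn
      rw [dist_zero_right, charFun_apply_real, charFun_apply_real,
        integral_map (hW n).aemeasurable (by fun_prop),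
        integral_map (hS n).aemeasurable (by fun_prop)]
      have int : ∀ f : Ω n → ℝ, Measurable f →
          Integrable (fun ω => Complex.exp (t * f ω * Complex.I)) (P n) := by
        intro f hf
        refine Integrable.of_bound (C := 1) ?_ (ae_of_all _ fun ω => ?_)
        · exact (by fun_prop : Measurable
            (fun ω => Complex.exp (t * f ω * Complex.I))).aestronglyMeasurable
        · rw [← Complex.ofReal_mul, Complex.norm_exp_ofReal_mul_I]
      rw [← integral_sub (int _ (hW n)) (int _ (hS n))]
      set B : Set (Ω n) := {ω | δ ≤ |W n ω - S n ω - 0|} with hB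
      have hBm : MeasurableSet B := by
        have : Measurable fun ω => |W n ω - S n ω - 0| :=
          (((hW n).sub (hS n)).sub_const 0).norm
        exact measurableSet_le measurable_const this
      have hbound : ∀ ω, ‖Complex.exp (t * W n ω * Complex.I) - Complex.exp (t * S n ω * Complex.I)‖
          ≤ |t| * δ + B.indicator (fun _ => (2 : ℝ)) ω := by
        intro ω
        by_cases hω : ω ∈ B
        · rw [Set.indicator_of_mem hω]
          refine (norm_sub_le _ _).trans ?_
          rw [← Complex.ofReal_mul, ← Complex.ofReal_mul, Complex.norm_exp_ofReal_mul_I,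
            Complex.norm_exp_ofReal_mul_I]
          have : 0 ≤ |t| * δ := by positivity
          linarith
        · rw [Set.indicator_of_notMem hω, add_zero]
          have hlt : |W n ω - S n ω| < δ := by
            simpa [hB] using hω
          have e : Complex.exp (t * W n ω * Complex.I) - Complex.exp (t * S n ω * Complex.I)
              = Complex.exp ((t * S n ω : ℝ) * Complex.I)
                * (Complex.exp (Complex.I * (t * (W n ω - S n ω) : ℝ)) - 1) := by
            rw [mul_sub, ← Complex.exp_add, mul_one]
            push_cast
            congr 2
            ring
          rw [e, norm_mul, Complex.norm_exp_ofReal_mul_I, one_mul]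
          refine Real.norm_exp_I_mul_ofReal_sub_one_le.trans ?_
          rw [Real.norm_eq_abs, abs_mul]
          gcongr
      have i1 : Integrable (fun _ : Ω n => |t| * δ) (P n) := integrable_const _
      have i2 : Integrable (B.indicator fun _ : Ω n => (2 : ℝ)) (P n) :=
        (integrable_const _).indicator hBm
      have i3 : ∫ ω, (|t| * δ + B.indicator (fun _ : Ω n => (2 : ℝ)) ω) ∂(P n)
          = |t| * δ + (P n).real B * 2 := by
        rw [integral_add i1 i2, integral_indicator_const _ hBm]
        simp
      refine lt_of_le_of_lt (norm_integral_le_of_norm_le (i1.add i2) (ae_of_all _ hbound)) ?_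
      refine lt_of_eq_of_lt i3 ?_
      have h5 : |t| * δ ≤ ε / 2 := by
        rw [hδ, mul_div_assoc', div_le_div_iff₀ (by positivity) (by positivity)]
        nlinarith [abs_nonneg t]
      have h6 : (P n).real B < ε / 4 := hn'
      linarith
    simpa using hdiff.add (hc t)

end Limits

/-! ### Gaussian tails and the limit of the rejection probability -/

section Gaussian

theorem gaussianReal_Iic_neg (z : ℝ) :
    (gaussianReal 0 1).real (Set.Iic (-z)) = (gaussianReal 0 1).real (Set.Ici z) := by
  have h := gaussianReal_map_neg (μ := 0) (v := 1)
  rw [neg_zero] at h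
  have h2 : (gaussianReal 0 1).real (Set.Ici z)
      = ((gaussianReal 0 1).map (fun x => -x)).real (Set.Ici z) := by rw [h]
  rw [h2, map_measureReal_apply measurable_neg measurableSet_Ici]
  congr 1
  ext x
  simp only [Set.mem_Iic, Set.mem_preimage, Set.mem_Ici]
  exact ⟨fun h => by linarith, fun h => by linarith⟩

/-- For `z ≤ 0` symmetry would give `[z, ∞)` mass at least `1/2 > α/2`. Positivity is what makes the
two tails disjoint. -/
theorem quantile_pos {α z : ℝ} (hα : α < 1)
    (hz : (gaussianReal 0 1).real (Set.Ici z) = α / 2) : 0 < z := by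
  by_contra hneg
  push Not at hneg
  have h1 : (gaussianReal 0 1).real (Set.Ici 0) ≤ (gaussianReal 0 1).real (Set.Ici z) :=
    measureReal_mono (Set.Ici_subset_Ici.2 hneg)
  have h2 := gaussianReal_Iic_neg 0
  rw [neg_zero] at h2
  have h3 : (1 : ℝ) ≤ (gaussianReal 0 1).real (Set.Iic 0) + (gaussianReal 0 1).real (Set.Ici 0) := by
    refine le_trans (le_of_eq ?_) (measureReal_union_le (μ := gaussianReal 0 1) _ _)
    rw [Set.Iic_union_Ici, probReal_univ]
  linarith

theorem gaussianReal_abs_ge {α z : ℝ} (hα : α < 1)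
    (hz : (gaussianReal 0 1).real (Set.Ici z) = α / 2) :
    (gaussianReal 0 1).real {x | z ≤ |x|} = α := by
  have hz0 := quantile_pos hα hz
  have e : {x : ℝ | z ≤ |x|} = Set.Ici z ∪ Set.Iic (-z) := by
    ext x
    simp only [Set.mem_ofPred_eq, Set.mem_union, Set.mem_Ici, Set.mem_Iic, le_abs]
    constructor <;> rintro (h | h)
    · exact Or.inl h
    · exact Or.inr (by linarith)
    · exact Or.inl h
    · exact Or.inr (by linarith)
  rw [e, measureReal_union _ measurableSet_Iic, gaussianReal_Iic_neg, hz]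
  · ring
  · rw [Set.disjoint_left]
    intro x hx hx'
    simp only [Set.mem_Ici, Set.mem_Iic] at hx hx'
    linarith

/-- Portmanteau theorem: the boundary of the rejection region lies in `{z, -z}`, a null set of the
Gaussian law. -/
theorem tendsto_prob_abs_ge {Ω : ℕ → Type*} [∀ n, MeasurableSpace (Ω n)] {P : ∀ n, Measure (Ω n)}
    [∀ n, IsProbabilityMeasure (P n)] {W : ∀ n, Ω n → ℝ} (hW : ∀ n, Measurable (W n))
    (h : TendstoInDistribution W atTop (id : ℝ → ℝ) P (gaussianReal 0 1)) {α z : ℝ} (hα : α < 1)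
    (hz : (gaussianReal 0 1).real (Set.Ici z) = α / 2) :
    Tendsto (fun n => (P n).real {ω | z ≤ |W n ω|}) atTop (𝓝 α) := by
  have hcl : IsClosed {x : ℝ | z ≤ |x|} := isClosed_le continuous_const continuous_abs
  have hfr : frontier {x : ℝ | z ≤ |x|} ⊆ {z, -z} := by
    intro x hx
    have hz' : z = |x| := frontier_le_subset_eq continuous_const continuous_abs hx
    rcases abs_choice x with h' | h'
    · left; rw [hz', h']
    · right
      simp only [Set.mem_singleton_iff]
      rw [hz', h', neg_neg]
  have hnull : (gaussianReal 0 1) (frontier {x : ℝ | z ≤ |x|}) = 0 := by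
    have : NullSingletonClass (gaussianReal 0 1) := nullSingletonClass_gaussianReal one_ne_zero
    exact measure_mono_null hfr ((Set.toFinite _).measure_zero _)
  have ht := h.tendsto
  have := ProbabilityMeasure.tendsto_measure_of_null_frontier_of_tendsto' ht
    (E := {x : ℝ | z ≤ |x|}) (by simpa using hnull)
  simp only [ProbabilityMeasure.coe_mk, Measure.map_id] at this
  have h2 := (ENNReal.tendsto_toReal (measure_ne_top (gaussianReal 0 1) {x : ℝ | z ≤ |x|})).comp this
  have e : ((gaussianReal 0 1) {x : ℝ | z ≤ |x|}).toReal = α := gaussianReal_abs_ge hα hz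
  rw [e] at h2
  refine h2.congr fun n => ?_
  simp only [Function.comp]
  rw [Measure.map_apply (hW n) hcl.measurableSet]
  rfl

end Gaussian

end P1

namespace P1

/-! ### Power sums of the parameters and the product form of dyad probabilities -/

namespace Param

variable {n : ℕ} (θ : Param n)

/-- `e^ρ`. -/
noncomputable def R : ℝ := Real.exp θ.ρ

noncomputable def sM : ℝ := ∑ i, θ.μ i
noncomputable def sN : ℝ := ∑ i, θ.ν i
noncomputable def sH : ℝ := ∑ i, θ.η i
noncomputable def sa : ℝ := ∑ i, θ.μ i ^ 2 * θ.ν i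
noncomputable def sb : ℝ := ∑ i, θ.μ i * θ.ν i ^ 2
noncomputable def sM2 : ℝ := ∑ i, θ.μ i ^ 2
noncomputable def sN2 : ℝ := ∑ i, θ.ν i ^ 2
noncomputable def sH2 : ℝ := ∑ i, θ.η i ^ 2

/-- The order of magnitude of the variance. -/
noncomputable def V0 : ℝ := θ.R * θ.sM ^ 2 * θ.sN ^ 2 * (θ.sH ^ 2 + θ.R * θ.sa * θ.sb)

/-- Quantitative form of the sparsity and degree conditions. -/
structure Sparse (ε c : ℝ) : Prop where
  pos : 0 < ε
  small : ε ≤ 1 / 1000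
  c_pos : 0 < c
  c_le : c ≤ 1
  μ_le : ∀ i, θ.μ i ≤ ε
  ν_le : ∀ i, θ.ν i ≤ ε
  ρη_le : ∀ i j, θ.R * (θ.η i * θ.η j) ≤ ε
  sH_ge : 1 ≤ ε * θ.sH
  RH_ge : 1 ≤ ε * (θ.R * θ.sH ^ 2)
  -- In this regime the non-reciprocated dyads matter for the variance, and no single node may
  -- dominate the sums `sa` and `sb`.
  large : c * θ.sH ^ 2 ≤ θ.R * θ.sa * θ.sb → ∀ i, θ.μ i ≤ ε * θ.sa ∧ θ.ν i ≤ ε * θ.sb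

variable {θ}

theorem R_pos : 0 < θ.R := Real.exp_pos _
theorem μ_pos (i : Fin n) : 0 < θ.μ i := Real.exp_pos _
theorem ν_pos (i : Fin n) : 0 < θ.ν i := Real.exp_pos _
theorem η_pos (i : Fin n) : 0 < θ.η i := mul_pos (μ_pos i) (ν_pos i)

theorem sM_nonneg : 0 ≤ θ.sM := Finset.sum_nonneg fun i _ => (μ_pos i).le
theorem sN_nonneg : 0 ≤ θ.sN := Finset.sum_nonneg fun i _ => (ν_pos i).le
theorem sH_nonneg : 0 ≤ θ.sH := Finset.sum_nonneg fun i _ => (η_pos i).le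
theorem sa_nonneg : 0 ≤ θ.sa := Finset.sum_nonneg fun i _ => by
  have := ν_pos (θ := θ) i
  positivity
theorem sb_nonneg : 0 ≤ θ.sb := Finset.sum_nonneg fun i _ => by
  have := μ_pos (θ := θ) i
  positivity
theorem sM2_nonneg : 0 ≤ θ.sM2 := Finset.sum_nonneg fun i _ => by positivity
theorem sN2_nonneg : 0 ≤ θ.sN2 := Finset.sum_nonneg fun i _ => by positivity
theorem sH2_nonneg : 0 ≤ θ.sH2 := Finset.sum_nonneg fun i _ => by positivity

/-- Cauchy–Schwarz for `μν = √(μ²ν) √ν`. With its mirror image below it turns norms of `η` into the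
inner products occurring in `V0`. -/
theorem sH_sq_le_sa_mul_sN : θ.sH ^ 2 ≤ θ.sa * θ.sN := by
  refine Finset.sum_sq_le_sum_mul_sum_of_sq_le_mul _ (fun i _ => ?_) (fun i _ => (ν_pos i).le)
    fun i _ => ?_
  · have := ν_pos (θ := θ) i
    positivity
  · rw [η]
    exact le_of_eq (by ring)

theorem sH_sq_le_sb_mul_sM : θ.sH ^ 2 ≤ θ.sb * θ.sM := by
  refine Finset.sum_sq_le_sum_mul_sum_of_sq_le_mul _ (fun i _ => ?_) (fun i _ => (μ_pos i).le)
    fun i _ => ?_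
  · have := μ_pos (θ := θ) i
    positivity
  · rw [η]
    exact le_of_eq (by ring)

theorem V0_nonneg : 0 ≤ θ.V0 := by
  have := R_pos (θ := θ)
  have := sa_nonneg (θ := θ)
  have := sb_nonneg (θ := θ)
  unfold V0
  positivity

/-- The factor of the dyad probability that depends on the first node. -/
noncomputable def wout (θ : Param n) (a b : Bool) (i : Fin n) : ℝ :=
  if a then (if b then θ.R * θ.η i else θ.μ i) else (if b then θ.ν i else 1)

/-- The factor of the dyad probability that depends on the second node. -/
noncomputable def win (θ : Param n) (a b : Bool) (i : Fin n) : ℝ :=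
  if a then (if b then θ.η i else θ.ν i) else (if b then θ.μ i else 1)

theorem wout_pos (a b : Bool) (i : Fin n) : 0 < θ.wout a b i := by
  have := μ_pos (θ := θ) i
  have := ν_pos (θ := θ) i
  have := mul_pos (R_pos (θ := θ)) (η_pos (θ := θ) i)
  cases a <;> cases b <;> simp [wout] <;> assumption

theorem win_pos (a b : Bool) (i : Fin n) : 0 < θ.win a b i := by
  have := μ_pos (θ := θ) i
  have := ν_pos (θ := θ) i
  have := η_pos (θ := θ) i
  cases a <;> cases b <;> simp [win] <;> assumption

theorem K_eq (i j : Fin n) :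
    θ.K i j = (1 + θ.μ i * θ.ν j + θ.μ j * θ.ν i + θ.R * (θ.η i * θ.η j))⁻¹ := by
  unfold K R η μ ν
  simp only [← Real.exp_add]
  ring_nf

theorem K_symm (i j : Fin n) : θ.K i j = θ.K j i := by
  rw [K_eq, K_eq]
  ring_nf

/-- Up to the symmetric factor `K` the probability is a product of node weights. This lets sums over
several nodes split into products of one-node sums. -/
theorem dyadProb_eq (a b : Bool) (i j : Fin n) :
    θ.dyadProb a b i j = θ.K i j * (θ.wout a b i * θ.win a b j) := by
  unfold dyadProb
  congr 1
  cases a <;> cases b <;> simp only [wout, win, R, η, μ, ν, ← Real.exp_add, if_true, if_false,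
    Bool.and_true, Bool.and_false, Bool.false_eq_true] <;> ring_nf
  simp

theorem K_pos (i j : Fin n) : 0 < θ.K i j := by
  rw [K_eq]
  have := mul_pos (μ_pos (θ := θ) i) (ν_pos (θ := θ) j)
  have := mul_pos (μ_pos (θ := θ) j) (ν_pos (θ := θ) i)
  have := mul_pos (R_pos (θ := θ)) (mul_pos (η_pos (θ := θ) i) (η_pos (θ := θ) j))
  positivity

theorem K_le_one (i j : Fin n) : θ.K i j ≤ 1 := by
  rw [K_eq]
  have := mul_pos (μ_pos (θ := θ) i) (ν_pos (θ := θ) j)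
  have := mul_pos (μ_pos (θ := θ) j) (ν_pos (θ := θ) i)
  have := mul_pos (R_pos (θ := θ)) (mul_pos (η_pos (θ := θ) i) (η_pos (θ := θ) j))
  exact inv_le_one_of_one_le₀ (by linarith)

theorem dyadProb_nonneg (a b : Bool) (i j : Fin n) : 0 ≤ θ.dyadProb a b i j :=
  mul_nonneg (K_pos i j).le (Real.exp_nonneg _)

theorem dyadProb_le (a b : Bool) (i j : Fin n) :
    θ.dyadProb a b i j ≤ θ.wout a b i * θ.win a b j := by
  rw [dyadProb_eq]
  exact mul_le_of_le_one_left (mul_pos (wout_pos a b i) (win_pos a b j)).le (K_le_one i j)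

theorem dyadProb_swap (a b : Bool) (i j : Fin n) : θ.dyadProb a b i j = θ.dyadProb b a j i := by
  rw [dyadProb_eq, dyadProb_eq, K_symm]
  congr 1
  cases a <;> cases b <;> simp only [wout, win, if_true, if_false, Bool.false_eq_true] <;> ring

namespace Sparse

variable {ε c : ℝ} (h : θ.Sparse ε c)
include h

/-- Each of the three nonconstant terms of the denominator is at most `ε`, and `1 / (1 + 3ε) ≥ 1 -
3ε`. -/
theorem le_K (i j : Fin n) : 1 - 3 * ε ≤ θ.K i j := by
  have h1 := μ_pos (θ := θ) i
  have h2 := μ_pos (θ := θ) j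
  have h3 := ν_pos (θ := θ) i
  have h4 := ν_pos (θ := θ) j
  have h5 := mul_pos (R_pos (θ := θ)) (mul_pos (η_pos (θ := θ) i) (η_pos (θ := θ) j))
  have h6 := h.ρη_le i j
  have hε := h.pos
  have hs := h.small
  have m1 : θ.μ i * θ.ν j ≤ ε := by nlinarith [h.μ_le i, h.ν_le j]
  have m2 : θ.μ j * θ.ν i ≤ ε := by nlinarith [h.μ_le j, h.ν_le i]
  have p1 := mul_pos h1 h4
  have p2 := mul_pos h2 h3
  rw [K_eq, le_inv_comm₀ (by linarith) (by positivity)]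
  have : (1 - 3 * ε) * (1 + 3 * ε) ≤ 1 := by nlinarith
  refine le_trans (by linarith : _ ≤ 1 + 3 * ε) ?_
  rw [le_inv_comm₀ (by linarith) (by linarith)]
  rw [le_inv_comm₀ (by linarith) (by linarith), ← one_div, le_div_iff₀ (by linarith)]
  linarith

theorem le_dyadProb (a b : Bool) (i j : Fin n) :
    (1 - 3 * ε) * (θ.wout a b i * θ.win a b j) ≤ θ.dyadProb a b i j := by
  rw [dyadProb_eq]
  exact mul_le_mul_of_nonneg_right (h.le_K i j) (mul_pos (wout_pos a b i) (win_pos a b j)).le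

theorem sH_le_ε_sN : θ.sH ≤ ε * θ.sN := by
  rw [sH, sN, Finset.mul_sum]
  exact Finset.sum_le_sum fun i _ => mul_le_mul_of_nonneg_right (h.μ_le i) (ν_pos i).le

theorem sH_le_ε_sM : θ.sH ≤ ε * θ.sM := by
  rw [sH, sM, Finset.mul_sum]
  refine Finset.sum_le_sum fun i _ => ?_
  rw [η, mul_comm]
  exact mul_le_mul_of_nonneg_right (h.ν_le i) (μ_pos i).le

theorem sa_le : θ.sa ≤ ε * θ.sH := by
  rw [sa, sH, Finset.mul_sum]
  refine Finset.sum_le_sum fun i _ => ?_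
  rw [η, sq, mul_assoc]
  exact mul_le_mul_of_nonneg_right (h.μ_le i) (η_pos (θ := θ) i).le

theorem sb_le : θ.sb ≤ ε * θ.sH := by
  rw [sb, sH, Finset.mul_sum]
  refine Finset.sum_le_sum fun i _ => ?_
  rw [η, sq, ← mul_assoc, mul_comm]
  exact mul_le_mul_of_nonneg_right (h.ν_le i) (η_pos (θ := θ) i).le

theorem sM2_le : θ.sM2 ≤ ε * θ.sM := by
  rw [sM2, sM, Finset.mul_sum]
  refine Finset.sum_le_sum fun i _ => ?_
  rw [sq]
  exact mul_le_mul_of_nonneg_right (h.μ_le i) (μ_pos i).le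

theorem sN2_le : θ.sN2 ≤ ε * θ.sN := by
  rw [sN2, sN, Finset.mul_sum]
  refine Finset.sum_le_sum fun i _ => ?_
  rw [sq]
  exact mul_le_mul_of_nonneg_right (h.ν_le i) (ν_pos i).le

theorem sH2_le_sa : θ.sH2 ≤ ε * θ.sa := by
  rw [sH2, sa, Finset.mul_sum]
  refine Finset.sum_le_sum fun i _ => ?_
  have := ν_pos (θ := θ) i
  have e : θ.η i ^ 2 = θ.ν i * (θ.μ i ^ 2 * θ.ν i) := by rw [η]; ring
  rw [e]
  exact mul_le_mul_of_nonneg_right (h.ν_le i) (by positivity)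

theorem sH2_le_sb : θ.sH2 ≤ ε * θ.sb := by
  rw [sH2, sb, Finset.mul_sum]
  refine Finset.sum_le_sum fun i _ => ?_
  have := μ_pos (θ := θ) i
  have e : θ.η i ^ 2 = θ.μ i * (θ.μ i * θ.ν i ^ 2) := by rw [η]; ring
  rw [e]
  exact mul_le_mul_of_nonneg_right (h.μ_le i) (by positivity)

theorem one_le_sH : 1 ≤ θ.sH := by
  nlinarith [h.sH_ge, h.small, h.pos, sH_nonneg (θ := θ)]

theorem one_le_ε_sM : 1 ≤ ε * θ.sM := h.one_le_sH.trans h.sH_le_ε_sM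

theorem one_le_ε_sN : 1 ≤ ε * θ.sN := h.one_le_sH.trans h.sH_le_ε_sN

theorem one_le_sM : 1 ≤ θ.sM := by
  nlinarith [h.one_le_ε_sM, h.small, h.pos, sM_nonneg (θ := θ)]

theorem one_le_sN : 1 ≤ θ.sN := by
  nlinarith [h.one_le_ε_sN, h.small, h.pos, sN_nonneg (θ := θ)]

theorem sa_pos : 0 < θ.sa := by
  have h1 := sH_sq_le_sa_mul_sN (θ := θ)
  have h2 := h.one_le_sH
  have h3 := h.one_le_sN
  by_contra hn
  have : θ.sa = 0 := le_antisymm (not_lt.1 hn) sa_nonneg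
  rw [this] at h1
  nlinarith

theorem sb_pos : 0 < θ.sb := by
  have h1 := sH_sq_le_sb_mul_sM (θ := θ)
  have h2 := h.one_le_sH
  by_contra hn
  have : θ.sb = 0 := le_antisymm (not_lt.1 hn) sb_nonneg
  rw [this] at h1
  nlinarith

theorem V0_pos : 0 < θ.V0 := by
  have := R_pos (θ := θ)
  have := h.sa_pos
  have := h.sb_pos
  have := h.one_le_sM
  have := h.one_le_sN
  unfold V0
  positivity

end Sparse

end Param

/-! ### Sums over paths and four-cycles with distinct nodes -/

section Distinct

variable {n : ℕ}

/-- The indicator that four nodes are distinct. -/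
def dst (i j k l : Fin n) : ℝ :=
  if i ≠ j ∧ i ≠ k ∧ i ≠ l ∧ j ≠ k ∧ j ≠ l ∧ k ≠ l then 1 else 0

theorem dst_nonneg (i j k l : Fin n) : 0 ≤ dst i j k l := by
  unfold dst; split_ifs <;> norm_num

theorem dst_le_one (i j k l : Fin n) : dst i j k l ≤ 1 := by
  unfold dst; split_ifs <;> norm_num

theorem dst_ne_zero {i j k l : Fin n} (h : dst i j k l ≠ 0) :
    i ≠ j ∧ i ≠ k ∧ i ≠ l ∧ j ≠ k ∧ j ≠ l ∧ k ≠ l := by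
  by_contra hn
  exact h (by rw [dst, if_neg hn])

theorem dst_rotate (i j k l : Fin n) : dst i j k l = dst j k l i := by
  unfold dst
  congr 1
  simp only [eq_iff_iff, ne_comm (a := i)]
  tauto

theorem dst_reverse (i j k l : Fin n) : dst i j k l = dst j i l k := by
  unfold dst
  congr 1
  simp only [eq_iff_iff, ne_comm (a := i) (b := j), ne_comm (a := k) (b := l)]
  tauto

/-- The weighted number of paths `j → k → l → i` that avoid each other's nodes. -/
def pth (i j : Fin n) (f g h : Fin n → Fin n → ℝ) : ℝ :=
  ∑ k, ∑ l, dst i j k l * (f j k * g k l * h l i)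

/-- The weighted number of four-cycles `i → j → k → l → i`. -/
def cyc (e f g h : Fin n → Fin n → ℝ) : ℝ :=
  ∑ i, ∑ j, ∑ k, ∑ l, dst i j k l * (e i j * f j k * g k l * h l i)

theorem sum_others {i j : Fin n} (hij : i ≠ j) (F : Fin n → Fin n → ℝ) :
    ∑ p ∈ others i j, F p.1 p.2 = ∑ k, ∑ l, dst i j k l * F k l := by
  rw [others, Finset.sum_filter, Fintype.sum_prod_type]
  refine Finset.sum_congr rfl fun k _ => Finset.sum_congr rfl fun l _ => ?_
  unfold dst
  simp only [ite_mul, one_mul, zero_mul]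
  congr 1
  simp only [ne_eq, eq_iff_iff, hij, not_false_eq_true, true_and]
  rw [eq_comm (a := k) (b := i), eq_comm (a := k) (b := j), eq_comm (a := l) (b := i),
    eq_comm (a := l) (b := j)]
  tauto

theorem pth_eq_sum_others {i j : Fin n} (hij : i ≠ j) (f g h : Fin n → Fin n → ℝ) :
    pth i j f g h = ∑ p ∈ others i j, f j p.1 * g p.1 p.2 * h p.2 i :=
  (sum_others hij fun k l => f j k * g k l * h l i).symm

/-- The factor `dst` makes diagonal pairs vanish, so sums over all pairs may replace sums over
distinct ones. -/
theorem pth_self (i : Fin n) (f g h : Fin n → Fin n → ℝ) : pth i i f g h = 0 := by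
  unfold pth
  refine Finset.sum_eq_zero fun k _ => Finset.sum_eq_zero fun l _ => ?_
  simp [dst]

theorem cyc_eq_sum_pth (e f g h : Fin n → Fin n → ℝ) :
    cyc e f g h = ∑ i, ∑ j, e i j * pth i j f g h := by
  unfold cyc pth
  refine Finset.sum_congr rfl fun i _ => Finset.sum_congr rfl fun j _ => ?_
  rw [Finset.mul_sum]
  refine Finset.sum_congr rfl fun k _ => ?_
  rw [Finset.mul_sum]
  refine Finset.sum_congr rfl fun l _ => ?_
  ring

theorem sum_erase_eq (F : Fin n → Fin n → ℝ) (hF : ∀ i, F i i = 0) :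
    ∑ i, ∑ j ∈ Finset.univ.erase i, F i j = ∑ i, ∑ j, F i j :=
  Finset.sum_congr rfl fun i _ => Finset.sum_erase _ (hF i)

/-- Relabelling of the nodes. Rotations reduce the terms of the expansions to a few positions of the
centred factors. -/
theorem cyc_rotate (e f g h : Fin n → Fin n → ℝ) : cyc e f g h = cyc h e f g := by
  unfold cyc
  have : ∀ F : Fin n → Fin n → Fin n → Fin n → ℝ,
      ∑ i, ∑ j, ∑ k, ∑ l, F i j k l = ∑ l, ∑ i, ∑ j, ∑ k, F i j k l := by
    intro F
    calc ∑ i, ∑ j, ∑ k, ∑ l, F i j k l = ∑ i, ∑ j, ∑ l, ∑ k, F i j k l :=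
          Finset.sum_congr rfl fun i _ => Finset.sum_congr rfl fun j _ => Finset.sum_comm
      _ = ∑ i, ∑ l, ∑ j, ∑ k, F i j k l :=
          Finset.sum_congr rfl fun i _ => Finset.sum_comm
      _ = _ := Finset.sum_comm
  rw [this]
  refine Finset.sum_congr rfl fun l _ => Finset.sum_congr rfl fun i _ =>
    Finset.sum_congr rfl fun j _ => Finset.sum_congr rfl fun k _ => ?_
  rw [dst_rotate l i j k]
  ring

theorem pth_reverse (i j : Fin n) (f g h : Fin n → Fin n → ℝ) :
    pth i j f g h = pth j i (fun x y => h y x) (fun x y => g y x) (fun x y => f y x) := by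
  unfold pth
  rw [Finset.sum_comm]
  refine Finset.sum_congr rfl fun l _ => Finset.sum_congr rfl fun k _ => ?_
  rw [dst_reverse i j k l]
  ring

section Linear

variable (i j : Fin n) (e f g h e' f' g' h' : Fin n → Fin n → ℝ)

theorem pth_add₁ : pth i j (fun x y => f x y + f' x y) g h = pth i j f g h + pth i j f' g h := by
  simp only [pth, add_mul, mul_add, Finset.sum_add_distrib]

theorem pth_add₂ : pth i j f (fun x y => g x y + g' x y) h = pth i j f g h + pth i j f g' h := by
  simp only [pth, add_mul, mul_add, Finset.sum_add_distrib]

theorem pth_add₃ : pth i j f g (fun x y => h x y + h' x y) = pth i j f g h + pth i j f g h' := by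
  simp only [pth, mul_add, Finset.sum_add_distrib]

theorem cyc_add₁ : cyc (fun x y => e x y + e' x y) f g h = cyc e f g h + cyc e' f g h := by
  simp only [cyc, add_mul, mul_add, Finset.sum_add_distrib]

theorem cyc_add₂ : cyc e (fun x y => f x y + f' x y) g h = cyc e f g h + cyc e f' g h := by
  simp only [cyc, add_mul, mul_add, Finset.sum_add_distrib]

theorem cyc_add₃ : cyc e f (fun x y => g x y + g' x y) h = cyc e f g h + cyc e f g' h := by
  simp only [cyc, add_mul, mul_add, Finset.sum_add_distrib]

theorem cyc_add₄ : cyc e f g (fun x y => h x y + h' x y) = cyc e f g h + cyc e f g h' := by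
  simp only [cyc, mul_add, Finset.sum_add_distrib]

end Linear

theorem Qa_eq (G : Graph n) : Graph.Qa G = cyc (Graph.dyad G true true) (Graph.dyad G false false)
    (Graph.dyad G false true) (Graph.dyad G false false) := by
  rw [cyc_eq_sum_pth, Graph.Qa, ← sum_erase_eq _ (fun i => by simp [Graph.dyad])]
  refine Finset.sum_congr rfl fun i _ => Finset.sum_congr rfl fun j hj => ?_
  rw [pth_eq_sum_others (Finset.ne_of_mem_erase hj).symm, Finset.mul_sum]
  refine Finset.sum_congr rfl fun p _ => ?_
  ring

theorem Qb_eq (G : Graph n) : Graph.Qb G = cyc (Graph.dyad G true false) (Graph.dyad G true false)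
    (Graph.dyad G false false) (Graph.dyad G true false) := by
  rw [cyc_eq_sum_pth, Graph.Qb, ← sum_erase_eq _ (fun i => by simp [Graph.dyad])]
  refine Finset.sum_congr rfl fun i _ => Finset.sum_congr rfl fun j hj => ?_
  rw [pth_eq_sum_others (Finset.ne_of_mem_erase hj).symm, Finset.mul_sum]
  refine Finset.sum_congr rfl fun p _ => ?_
  ring

end Distinct

end P1

namespace P1

/-! ### Second moments of four-cycle sums with centred factors -/

section Shapes

variable {n : ℕ}

/-- The centred dyad indicator. -/
noncomputable def cen (θ : Param n) (a b : Bool) (G : Graph n) (i j : Fin n) : ℝ :=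
  Graph.dyad G a b i j - θ.dyadProb a b i j

/-- The centred dyad indicator as an item. -/
noncomputable def cenItem (θ : Param n) (a b : Bool) (i j : Fin n) : Item n :=
  ⟨i, j, fun x y => (if x = a ∧ y = b then 1 else 0) - θ.dyadProb a b i j⟩

/-- The dyad indicator as an item. -/
noncomputable def dyadItem (a b : Bool) (i j : Fin n) : Item n :=
  ⟨i, j, fun x y => if x = a ∧ y = b then 1 else 0⟩

@[simp] theorem cenItem_fst (θ : Param n) (a b : Bool) (i j : Fin n) : (cenItem θ a b i j).fst = i := rfl
@[simp] theorem cenItem_snd (θ : Param n) (a b : Bool) (i j : Fin n) : (cenItem θ a b i j).snd = j := rfl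
@[simp] theorem cenItem_edge (θ : Param n) (a b : Bool) (i j : Fin n) :
    (cenItem θ a b i j).edge = s(i, j) := rfl
@[simp] theorem dyadItem_edge (a b : Bool) (i j : Fin n) : (dyadItem a b i j).edge = s(i, j) := rfl

theorem cenItem_val {θ : Param n} (a b : Bool) {i j : Fin n} (h : i ≠ j) (G : Graph n) :
    (cenItem θ a b i j).val G = cen θ a b G i j := by
  simp [cenItem, cen, Item.val, Graph.dyad, h]

theorem dyadItem_val (a b : Bool) {i j : Fin n} (h : i ≠ j) (G : Graph n) :
    (dyadItem a b i j).val G = Graph.dyad G a b i j := by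
  simp [dyadItem, Item.val, Graph.dyad, h]

theorem dyad_nonneg (G : Graph n) (a b : Bool) (i j : Fin n) : 0 ≤ Graph.dyad G a b i j := by
  unfold Graph.dyad; split_ifs <;> norm_num

theorem dyad_sq (G : Graph n) (a b : Bool) (i j : Fin n) :
    Graph.dyad G a b i j ^ 2 = Graph.dyad G a b i j := by
  unfold Graph.dyad; split_ifs <;> norm_num

theorem dyad_self (G : Graph n) (a b : Bool) (i : Fin n) : Graph.dyad G a b i i = 0 := by
  simp [Graph.dyad]

section Nodup

variable {α : Type*} {i j k l : α}

theorem nodup_adjacent (h2 : i ≠ k) (h1 : i ≠ j) : [s(i, j), s(j, k)].Nodup := by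
  simp [h2, h1]

theorem nodup_opposite (h2 : i ≠ k) (h3 : i ≠ l) : [s(i, j), s(k, l)].Nodup := by
  simp [h2, h3]

theorem nodup_three (h1 : i ≠ j) (h2 : i ≠ k) (h3 : i ≠ l) (h4 : j ≠ k) (h5 : j ≠ l) :
    [s(i, j), s(j, k), s(k, l)].Nodup := by
  simp [h1, h2, h3, h4, h5]

theorem nodup_four (h1 : i ≠ j) (h2 : i ≠ k) (h3 : i ≠ l) (h4 : j ≠ k) (h5 : j ≠ l)
    (h6 : k ≠ l) : [s(i, j), s(j, k), s(k, l), s(l, i)].Nodup := by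
  simp [h1, h2, h3, h4, h5, h6, h1.symm, h2.symm]

end Nodup

variable {θ : Param n} {Ω : Type*} [MeasurableSpace Ω] {P : Measure Ω} [IsProbabilityMeasure P]
  {A : Ω → Graph n} (hA : IsP1Model θ P A)
include hA

omit [IsProbabilityMeasure P] in
theorem ex_dyad (a b : Bool) {i j : Fin n} (h : i ≠ j) :
    ex P A (fun G => Graph.dyad G a b i j) = θ.dyadProb a b i j := by
  rw [← hA.law i j h a b]
  have hm : MeasurableSet {ω | A ω i j = a ∧ A ω j i = b} :=
    (measurable_graph_comp hA.measurable (fun G : Graph n => (G i j = a ∧ G j i = b : Prop))).setOf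
  rw [← integral_indicator_one hm, ex]
  refine integral_congr_ae (ae_of_all _ fun ω => ?_)
  simp [Graph.dyad, h, Set.indicator_apply]

theorem ex_cen (a b : Bool) {i j : Fin n} (h : i ≠ j) :
    ex P A (fun G => cen θ a b G i j) = 0 := by
  unfold cen
  rw [ex_sub hA.measurable, ex_dyad hA a b h, ex_const, sub_self]

theorem ex_cen_sq_le (a b : Bool) {i j : Fin n} (h : i ≠ j) :
    ex P A (fun G => cen θ a b G i j ^ 2) ≤ θ.dyadProb a b i j := by
  have e : (fun G => cen θ a b G i j ^ 2)
      = fun G => Graph.dyad G a b i j - (2 * θ.dyadProb a b i j) * cen θ a b G i j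
        - θ.dyadProb a b i j ^ 2 := by
    funext G
    have := dyad_sq G a b i j
    unfold cen
    nlinarith
  rw [e, ex_sub hA.measurable, ex_sub hA.measurable, ex_const_mul, ex_cen hA a b h, ex_const,
    ex_dyad hA a b h]
  nlinarith [sq_nonneg (θ.dyadProb a b i j)]

theorem ex_cenItem (a b : Bool) {i j : Fin n} (h : i ≠ j) :
    ex P A (cenItem θ a b i j).val = 0 := by
  rw [← ex_cen hA a b h]
  congr 1
  funext G
  exact cenItem_val a b h G

theorem ex_cenItem_sq_le (a b : Bool) {i j : Fin n} (h : i ≠ j) :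
    ex P A (fun G => (cenItem θ a b i j).val G ^ 2) ≤ θ.wout a b i * θ.win a b j := by
  simp_rw [cenItem_val a b h]
  exact (ex_cen_sq_le hA a b h).trans (Param.dyadProb_le a b i j)

omit hA [IsProbabilityMeasure P] in
theorem ex_cenItem_sq_nonneg (a b : Bool) (i j : Fin n) :
    0 ≤ ex P A (fun G => (cenItem θ a b i j).val G ^ 2) :=
  ex_nonneg fun _ => sq_nonneg _

/-- Second moment bound, with the weights of the terms bounded by `B`. -/
theorem ex_sq_sum_cen_le {ι : Type*} [Fintype ι] [DecidableEq ι] {m : ℕ} (tup : ι → Fin m → Fin n)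
    (hm : m ≤ 4) (hinj : Function.Injective tup) (L : ι → List (Item n)) (W : List (Item n))
    (c B : ι → ℝ) (Y : ι → Graph n → ℝ)
    (hlen : ∀ x, (L x).length ≤ 4)
    (hcov : ∀ x, ∀ a, ∃ t ∈ L x, tup x a ∈ t.edge)
    (hL : ∀ x, c x ≠ 0 → CenteredProd P A (L x))
    (hY : ∀ x, c x ≠ 0 → ∀ G, Y x G = listVal (L x) G)
    (hW0 : ∀ G, 0 ≤ listVal W G)
    (hW : ∀ t ∈ W, t.fst ≠ t.snd) (hWn : (W.map Item.edge).Nodup)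
    (hWL : ∀ x, c x ≠ 0 → ∀ u ∈ W, ∀ v ∈ L x, v.edge ≠ u.edge)
    (hB0 : ∀ x, 0 ≤ B x)
    (hB : ∀ x, c x ≠ 0 → c x ^ 2 *
        (ex P A (listVal W) * ((L x).map fun t => ex P A fun G => t.val G ^ 2).prod) ≤ B x) :
    ex P A (fun G => listVal W G * (∑ x, c x * Y x G) ^ 2) ≤ 4096 * ∑ x, B x := by
  have e : (fun G => listVal W G * (∑ x, c x * Y x G) ^ 2)
      = fun G => listVal W G * (∑ x, c x * listVal (L x) G) ^ 2 := by
    funext G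
    congr 2
    refine Finset.sum_congr rfl fun x _ => ?_
    by_cases hc : c x = 0
    · simp [hc]
    · rw [hY x hc G]
  rw [e]
  refine (ex_sq_sum_le hA tup hm hinj L W c hlen hcov hL hW0 hW hWn hWL).trans ?_
  gcongr with x
  by_cases hc : c x = 0
  · simp [hc, hB0 x]
  · exact hB x hc

/-- The weights of a deterministic function of pairs of nodes. -/
structure Bd (f : Fin n → Fin n → ℝ) (p q : Fin n → ℝ) : Prop where
  left_nonneg : ∀ i, 0 ≤ p i
  right_nonneg : ∀ i, 0 ≤ q i
  nonneg : ∀ i j, 0 ≤ f i j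
  le : ∀ i j, f i j ≤ p i * q j

omit hA in
theorem Bd.dyadProb (θ : Param n) (a b : Bool) :
    Bd (θ.dyadProb a b) (θ.wout a b) (θ.win a b) :=
  ⟨fun i => (Param.wout_pos a b i).le, fun i => (Param.win_pos a b i).le,
    Param.dyadProb_nonneg a b, Param.dyadProb_le a b⟩

omit hA in
theorem Bd.one : Bd (n := n) (fun _ _ => 1) (fun _ => 1) (fun _ => 1) :=
  ⟨by simp, by simp, by simp, by simp⟩

omit hA in
theorem sum_mul_sum₄ (a b c d : Fin n → ℝ) :
    ∑ i, ∑ j, ∑ k, ∑ l, a i * b j * c k * d l = (∑ i, a i) * (∑ j, b j) * (∑ k, c k) * ∑ l, d l := by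
  simp only [← Finset.mul_sum, ← Finset.sum_mul]

omit hA in
theorem sum_mul_sum₃ (a b c : Fin n → ℝ) :
    ∑ i, ∑ j, ∑ k, a i * b j * c k = (∑ i, a i) * (∑ j, b j) * ∑ k, c k := by
  simp only [← Finset.mul_sum, ← Finset.sum_mul]

omit hA in
theorem pth_nonneg {f g h : Fin n → Fin n → ℝ} (hf : ∀ i j, 0 ≤ f i j) (hg : ∀ i j, 0 ≤ g i j)
    (hh : ∀ i j, 0 ≤ h i j) (i j : Fin n) : 0 ≤ pth i j f g h := by
  unfold pth
  refine Finset.sum_nonneg fun k _ => Finset.sum_nonneg fun l _ => ?_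
  have := dst_nonneg i j k l
  have := hf j k
  have := hg k l
  have := hh l i
  positivity

omit hA in
theorem dst_mul_le {i j k l : Fin n} {x y : ℝ} (hx : 0 ≤ x) (h : x ≤ y) : dst i j k l * x ≤ y :=
  (mul_le_of_le_one_left hx (dst_le_one i j k l)).trans h

omit hA in
-- Once the distinctness condition is dropped, the product bounds let the double sum split into one
-- sum for each interior node.
theorem pth_le {f g h : Fin n → Fin n → ℝ} {p q p' q' p'' q'' : Fin n → ℝ} (hf : Bd f p q)
    (hg : Bd g p' q') (hh : Bd h p'' q'') (i j : Fin n) :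
    pth i j f g h ≤ p j * (∑ k, q k * p' k) * (∑ l, q' l * p'' l) * q'' i := by
  have e : p j * (∑ k, q k * p' k) * (∑ l, q' l * p'' l) * q'' i
      = ∑ k, ∑ l, (p j * q k) * (p' k * q' l) * (p'' l * q'' i) := by
    rw [mul_assoc (p j), Finset.sum_mul_sum, Finset.mul_sum, Finset.sum_mul]
    refine Finset.sum_congr rfl fun k _ => ?_
    rw [Finset.mul_sum, Finset.sum_mul]
    refine Finset.sum_congr rfl fun l _ => ?_
    ring
  rw [e]
  unfold pth
  refine Finset.sum_le_sum fun k _ => Finset.sum_le_sum fun l _ => ?_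
  have h1 := hf.nonneg j k
  have h2 := hg.nonneg k l
  have h3 := hh.nonneg l i
  have h4 := hf.left_nonneg j
  have h5 := hf.right_nonneg k
  have h6 := hg.left_nonneg k
  have h7 := hg.right_nonneg l
  refine dst_mul_le (by positivity) ?_
  have := hf.le j k
  have := hg.le k l
  have := hh.le l i
  gcongr

omit hA in
theorem sum_ne_zero_exists {ι : Type*} [Fintype ι] {f : ι → ℝ} (h : ∑ i, f i ≠ 0) :
    ∃ i, f i ≠ 0 := by
  obtain ⟨i, _, hi⟩ := Finset.exists_ne_zero_of_sum_ne_zero h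
  exact ⟨i, hi⟩

variable (t₁ t₂ t₃ t₄ : Bool × Bool)

/-- Each centred dyad has a deterministic path sum as coefficient, and `pth_le` splits its square
over the nodes. The same reading rule governs all later bounds of this kind: a node between two
deterministic edges contributes the square of the sum of its weights, a node between a deterministic
and a centred edge a sum in which only the deterministic weight is squared, and a node between two
centred edges a sum with no squares. -/
theorem ex_cyc_one_sq_le {f g h : Fin n → Fin n → ℝ} {p₂ q₂ p₃ q₃ p₄ q₄ : Fin n → ℝ}
    (hf : Bd f p₂ q₂) (hg : Bd g p₃ q₃) (hh : Bd h p₄ q₄) :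
    ex P A (fun G => cyc (cen θ t₁.1 t₁.2 G) f g h ^ 2) ≤
      4096 * ((∑ i, q₄ i ^ 2 * θ.wout t₁.1 t₁.2 i) * (∑ j, θ.win t₁.1 t₁.2 j * p₂ j ^ 2)
        * (∑ k, q₂ k * p₃ k) ^ 2 * (∑ l, q₃ l * p₄ l) ^ 2) := by
  have key := ex_sq_sum_cen_le hA (ι := Fin n × Fin n) (m := 2) (fun x => ![x.1, x.2])
    (by norm_num) (fun x y hxy => Prod.ext (congrFun hxy 0) (congrFun hxy 1))
    (fun x => [cenItem θ t₁.1 t₁.2 x.1 x.2]) [] (fun x => pth x.1 x.2 f g h)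
    (fun x => (q₄ x.1 ^ 2 * θ.wout t₁.1 t₁.2 x.1) * (θ.win t₁.1 t₁.2 x.2 * p₂ x.2 ^ 2)
        * ((∑ k, q₂ k * p₃ k) ^ 2 * (∑ l, q₃ l * p₄ l) ^ 2))
    (fun x G => cen θ t₁.1 t₁.2 G x.1 x.2)
    (by simp) (by
      intro x a
      fin_cases a <;> simp)
    (by
      intro x hx
      have hne : x.1 ≠ x.2 := by
        intro h'
        rw [h', pth_self] at hx
        exact hx rfl
      exact ⟨by simpa using hne, by simp, by simpa using ex_cenItem hA _ _ hne⟩)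
    (by
      intro x hx G
      have hne : x.1 ≠ x.2 := by
        intro h'
        rw [h', pth_self] at hx
        exact hx rfl
      simp [cenItem_val _ _ hne])
    (by simp) (by simp) (by simp) (by simp)
    (by
      intro x
      have := Param.wout_pos (θ := θ) t₁.1 t₁.2 x.1
      have := Param.win_pos (θ := θ) t₁.1 t₁.2 x.2
      positivity)
    (by
      intro x hx
      have hne : x.1 ≠ x.2 := by
        intro h'
        rw [h', pth_self] at hx
        exact hx rfl
      have h1 := ex_cenItem_sq_le hA t₁.1 t₁.2 hne
      have h2 := ex_cenItem_sq_nonneg (θ := θ) (P := P) (A := A) t₁.1 t₁.2 x.1 x.2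
      have h3 := pth_le hf hg hh x.1 x.2
      have h4 := pth_nonneg hf.nonneg hg.nonneg hh.nonneg x.1 x.2
      simp only [listVal_nil_eq, ex_const, List.map_cons, List.map_nil, List.prod_cons,
        List.prod_nil, mul_one, one_mul]
      calc _ ≤ _ := mul_le_mul (pow_le_pow_left₀ h4 h3 2) h1 h2 (by positivity)
        _ = _ := by ring)
  have e : (fun G => cyc (cen θ t₁.1 t₁.2 G) f g h ^ 2) = fun G => listVal [] G *
      (∑ x : Fin n × Fin n, pth x.1 x.2 f g h * cen θ t₁.1 t₁.2 G x.1 x.2) ^ 2 := by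
    funext G
    rw [listVal_nil, one_mul, cyc_eq_sum_pth, Fintype.sum_prod_type]
    simp only [mul_comm]
  rw [e]
  refine key.trans (le_of_eq ?_)
  rw [Fintype.sum_prod_type]
  simp only [← Finset.sum_mul, ← Finset.mul_sum]
  ring

theorem ex_cyc_two_sq_le {g h : Fin n → Fin n → ℝ} {p₃ q₃ p₄ q₄ : Fin n → ℝ}
    (hg : Bd g p₃ q₃) (hh : Bd h p₄ q₄) :
    ex P A (fun G => cyc (cen θ t₁.1 t₁.2 G) (cen θ t₂.1 t₂.2 G) g h ^ 2) ≤
      4096 * ((∑ i, q₄ i ^ 2 * θ.wout t₁.1 t₁.2 i)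
        * (∑ j, θ.win t₁.1 t₁.2 j * θ.wout t₂.1 t₂.2 j)
        * (∑ k, θ.win t₂.1 t₂.2 k * p₃ k ^ 2) * (∑ l, q₃ l * p₄ l) ^ 2) := by
  -- The node `l` touches no centred factor and is summed out; the coefficient depends on the other
  -- three nodes.
  set c : Fin n × Fin n × Fin n → ℝ := fun x =>
    ∑ l, dst x.1 x.2.1 x.2.2 l * (g x.2.2 l * h l x.1) with hc
  have hne : ∀ x, c x ≠ 0 → x.1 ≠ x.2.1 ∧ x.1 ≠ x.2.2 ∧ x.2.1 ≠ x.2.2 := by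
    intro x hx
    obtain ⟨l, hl⟩ := sum_ne_zero_exists hx
    have := dst_ne_zero (left_ne_zero_of_mul hl)
    tauto
  have hc0 : ∀ x, 0 ≤ c x := fun x => Finset.sum_nonneg fun l _ =>
    mul_nonneg (dst_nonneg _ _ _ _) (mul_nonneg (hg.nonneg _ _) (hh.nonneg _ _))
  have hcle : ∀ x, c x ≤ q₄ x.1 * p₃ x.2.2 * ∑ l, q₃ l * p₄ l := by
    intro x
    rw [hc, Finset.mul_sum]
    refine Finset.sum_le_sum fun l _ => ?_
    refine dst_mul_le (mul_nonneg (hg.nonneg _ _) (hh.nonneg _ _)) ?_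
    calc _ ≤ _ := mul_le_mul (hg.le x.2.2 l) (hh.le l x.1) (hh.nonneg _ _)
          (mul_nonneg (hg.left_nonneg _) (hg.right_nonneg _))
      _ = _ := by ring
  have key := ex_sq_sum_cen_le hA (ι := Fin n × Fin n × Fin n) (m := 3)
    (fun x => ![x.1, x.2.1, x.2.2])
    (by norm_num)
    (fun x y hxy => Prod.ext (congrFun hxy 0) (Prod.ext (congrFun hxy 1) (congrFun hxy 2)))
    (fun x => [cenItem θ t₁.1 t₁.2 x.1 x.2.1, cenItem θ t₂.1 t₂.2 x.2.1 x.2.2]) [] c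
    (fun x => (q₄ x.1 ^ 2 * θ.wout t₁.1 t₁.2 x.1)
        * (θ.win t₁.1 t₁.2 x.2.1 * θ.wout t₂.1 t₂.2 x.2.1)
        * (θ.win t₂.1 t₂.2 x.2.2 * p₃ x.2.2 ^ 2) * (∑ l, q₃ l * p₄ l) ^ 2)
    (fun x G => cen θ t₁.1 t₁.2 G x.1 x.2.1 * cen θ t₂.1 t₂.2 G x.2.1 x.2.2)
    (by simp) (by
      intro x a
      fin_cases a <;> simp)
    (by
      intro x hx
      obtain ⟨h1, h2, h3⟩ := hne x hx
      exact ⟨by simp [h1, h3], nodup_adjacent h2 h1,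
        by simp [ex_cenItem hA _ _ h1, ex_cenItem hA _ _ h3]⟩)
    (by
      intro x hx G
      obtain ⟨h1, h2, h3⟩ := hne x hx
      simp [cenItem_val _ _ h1, cenItem_val _ _ h3])
    (by simp) (by simp) (by simp) (by simp)
    (by
      intro x
      have := Param.wout_pos (θ := θ) t₁.1 t₁.2 x.1
      have := Param.win_pos (θ := θ) t₁.1 t₁.2 x.2.1
      have := Param.wout_pos (θ := θ) t₂.1 t₂.2 x.2.1
      have := Param.win_pos (θ := θ) t₂.1 t₂.2 x.2.2
      positivity)
    (by
      intro x hx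
      obtain ⟨h1, h2, h3⟩ := hne x hx
      have e1 := ex_cenItem_sq_le hA t₁.1 t₁.2 h1
      have e2 := ex_cenItem_sq_le hA t₂.1 t₂.2 h3
      have e1' := ex_cenItem_sq_nonneg (θ := θ) (P := P) (A := A) t₁.1 t₁.2 x.1 x.2.1
      have e2' := ex_cenItem_sq_nonneg (θ := θ) (P := P) (A := A) t₂.1 t₂.2 x.2.1 x.2.2
      simp only [listVal_nil_eq, ex_const, List.map_cons, List.map_nil, List.prod_cons,
        List.prod_nil, mul_one, one_mul]
      calc _ ≤ _ := mul_le_mul (pow_le_pow_left₀ (hc0 x) (hcle x) 2)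
            (mul_le_mul e1 e2 e2' (e1'.trans e1)) (mul_nonneg e1' e2') (by positivity)
        _ = _ := by ring)
  have e : (fun G => cyc (cen θ t₁.1 t₁.2 G) (cen θ t₂.1 t₂.2 G) g h ^ 2) = fun G => listVal [] G *
      (∑ x : Fin n × Fin n × Fin n,
        c x * (cen θ t₁.1 t₁.2 G x.1 x.2.1 * cen θ t₂.1 t₂.2 G x.2.1 x.2.2)) ^ 2 := by
    funext G
    rw [listVal_nil, one_mul, Fintype.sum_prod_type]
    simp only [Fintype.sum_prod_type, cyc, hc, Finset.sum_mul]
    congr 1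
    refine Finset.sum_congr rfl fun i _ => Finset.sum_congr rfl fun j _ =>
      Finset.sum_congr rfl fun k _ => Finset.sum_congr rfl fun l _ => ?_
    ring
  rw [e]
  refine key.trans (le_of_eq ?_)
  simp only [Fintype.sum_prod_type, ← Finset.sum_mul]
  rw [sum_mul_sum₃]

/-- Second moment bound for sums over distinct quadruples of products of centred functions. -/
theorem ex_quad_sq_le (L : Fin n × Fin n × Fin n × Fin n → List (Item n))
    (c : Fin n × Fin n × Fin n × Fin n → ℝ) (Y : Fin n × Fin n × Fin n × Fin n → Graph n → ℝ)
    (a₁ a₂ a₃ a₄ : Fin n → ℝ)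
    (ha₁ : ∀ i, 0 ≤ a₁ i) (ha₂ : ∀ i, 0 ≤ a₂ i) (ha₃ : ∀ i, 0 ≤ a₃ i) (ha₄ : ∀ i, 0 ≤ a₄ i)
    (hlen : ∀ x, (L x).length ≤ 4)
    (hcov : ∀ x, ∀ a, ∃ t ∈ L x, ![x.1, x.2.1, x.2.2.1, x.2.2.2] a ∈ t.edge)
    (hL : ∀ x, dst x.1 x.2.1 x.2.2.1 x.2.2.2 ≠ 0 → CenteredProd P A (L x))
    (hY : ∀ x, dst x.1 x.2.1 x.2.2.1 x.2.2.2 ≠ 0 → ∀ G, Y x G = listVal (L x) G)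
    (hB : ∀ x, dst x.1 x.2.1 x.2.2.1 x.2.2.2 ≠ 0 → c x ^ 2 *
        ((L x).map fun t => ex P A fun G => t.val G ^ 2).prod
          ≤ a₁ x.1 * a₂ x.2.1 * a₃ x.2.2.1 * a₄ x.2.2.2) :
    ex P A (fun G => (∑ i, ∑ j, ∑ k, ∑ l, dst i j k l * (c (i, j, k, l) * Y (i, j, k, l) G)) ^ 2)
      ≤ 4096 * ((∑ i, a₁ i) * (∑ j, a₂ j) * (∑ k, a₃ k) * ∑ l, a₄ l) := by
  have hne : ∀ x : Fin n × Fin n × Fin n × Fin n, dst x.1 x.2.1 x.2.2.1 x.2.2.2 * c x ≠ 0 →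
      dst x.1 x.2.1 x.2.2.1 x.2.2.2 ≠ 0 := fun x hx => left_ne_zero_of_mul hx
  have key := ex_sq_sum_cen_le hA (ι := Fin n × Fin n × Fin n × Fin n) (m := 4)
    (fun x => ![x.1, x.2.1, x.2.2.1, x.2.2.2]) le_rfl
    (fun x y hxy => Prod.ext (congrFun hxy 0) (Prod.ext (congrFun hxy 1)
      (Prod.ext (congrFun hxy 2) (congrFun hxy 3))))
    L [] (fun x => dst x.1 x.2.1 x.2.2.1 x.2.2.2 * c x)
    (fun x => a₁ x.1 * a₂ x.2.1 * a₃ x.2.2.1 * a₄ x.2.2.2) Y hlen hcov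
    (fun x hx => hL x (hne x hx)) (fun x hx => hY x (hne x hx))
    (by simp) (by simp) (by simp) (by simp)
    (fun x => by
      have := ha₁ x.1
      have := ha₂ x.2.1
      have := ha₃ x.2.2.1
      have := ha₄ x.2.2.2
      positivity)
    (fun x hx => by
      have h1 := hB x (hne x hx)
      have h2 : dst x.1 x.2.1 x.2.2.1 x.2.2.2 ^ 2 = 1 := by
        have := hne x hx
        unfold dst at this ⊢
        split_ifs at this ⊢ <;> simp at this ⊢
      rw [listVal_nil_eq, ex_const, one_mul, mul_pow, h2, one_mul]
      exact h1)
  refine le_trans (le_of_eq ?_) (key.trans (le_of_eq ?_))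
  · congr 1
    funext G
    rw [listVal_nil, one_mul]
    simp only [Fintype.sum_prod_type, mul_assoc]
  · simp only [Fintype.sum_prod_type]
    rw [sum_mul_sum₄]

theorem ex_cyc_opposite_sq_le {f h : Fin n → Fin n → ℝ} {p₂ q₂ p₄ q₄ : Fin n → ℝ}
    (hf : Bd f p₂ q₂) (hh : Bd h p₄ q₄) :
    ex P A (fun G => cyc (cen θ t₁.1 t₁.2 G) f (cen θ t₃.1 t₃.2 G) h ^ 2) ≤
      4096 * ((∑ i, q₄ i ^ 2 * θ.wout t₁.1 t₁.2 i) * (∑ j, θ.win t₁.1 t₁.2 j * p₂ j ^ 2)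
        * (∑ k, q₂ k ^ 2 * θ.wout t₃.1 t₃.2 k) * (∑ l, θ.win t₃.1 t₃.2 l * p₄ l ^ 2)) := by
  refine le_trans (le_of_eq ?_) (ex_quad_sq_le hA
    (fun x => [cenItem θ t₁.1 t₁.2 x.1 x.2.1, cenItem θ t₃.1 t₃.2 x.2.2.1 x.2.2.2])
    (fun x => f x.2.1 x.2.2.1 * h x.2.2.2 x.1)
    (fun x G => cen θ t₁.1 t₁.2 G x.1 x.2.1 * cen θ t₃.1 t₃.2 G x.2.2.1 x.2.2.2)
    _ _ _ _
    (fun i => mul_nonneg (sq_nonneg _) (Param.wout_pos _ _ _).le)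
    (fun i => mul_nonneg (Param.win_pos _ _ _).le (sq_nonneg _))
    (fun i => mul_nonneg (sq_nonneg _) (Param.wout_pos _ _ _).le)
    (fun i => mul_nonneg (Param.win_pos _ _ _).le (sq_nonneg _))
    (by simp) (by
      intro x a
      fin_cases a <;> simp) ?_ ?_ ?_)
  · congr 1
    funext G
    unfold cyc
    congr 1
    refine Finset.sum_congr rfl fun i _ => Finset.sum_congr rfl fun j _ =>
      Finset.sum_congr rfl fun k _ => Finset.sum_congr rfl fun l _ => ?_
    ring
  · intro x hx
    obtain ⟨h1, h2, h3, h4, h5, h6⟩ := dst_ne_zero hx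
    exact ⟨by simp [h1, h6], nodup_opposite h2 h3,
      by simp [ex_cenItem hA _ _ h1, ex_cenItem hA _ _ h6]⟩
  · intro x hx G
    obtain ⟨h1, h2, h3, h4, h5, h6⟩ := dst_ne_zero hx
    simp [cenItem_val _ _ h1, cenItem_val _ _ h6]
  · intro x hx
    obtain ⟨h1, h2, h3, h4, h5, h6⟩ := dst_ne_zero hx
    have e1 := ex_cenItem_sq_le hA t₁.1 t₁.2 h1
    have e2 := ex_cenItem_sq_le hA t₃.1 t₃.2 h6
    have e1' := ex_cenItem_sq_nonneg (θ := θ) (P := P) (A := A) t₁.1 t₁.2 x.1 x.2.1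
    have e2' := ex_cenItem_sq_nonneg (θ := θ) (P := P) (A := A) t₃.1 t₃.2 x.2.2.1 x.2.2.2
    simp only [List.map_cons, List.map_nil, List.prod_cons, List.prod_nil, mul_one]
    have hc := mul_le_mul (hf.le x.2.1 x.2.2.1) (hh.le x.2.2.2 x.1) (hh.nonneg _ _)
      (mul_nonneg (hf.left_nonneg _) (hf.right_nonneg _))
    calc _ ≤ _ := mul_le_mul (pow_le_pow_left₀ (mul_nonneg (hf.nonneg _ _) (hh.nonneg _ _)) hc 2)
          (mul_le_mul e1 e2 e2' (e1'.trans e1)) (mul_nonneg e1' e2') (by positivity)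
      _ = _ := by ring

theorem ex_cyc_three_sq_le {h : Fin n → Fin n → ℝ} {p₄ q₄ : Fin n → ℝ} (hh : Bd h p₄ q₄) :
    ex P A (fun G => cyc (cen θ t₁.1 t₁.2 G) (cen θ t₂.1 t₂.2 G) (cen θ t₃.1 t₃.2 G) h ^ 2) ≤
      4096 * ((∑ i, q₄ i ^ 2 * θ.wout t₁.1 t₁.2 i)
        * (∑ j, θ.win t₁.1 t₁.2 j * θ.wout t₂.1 t₂.2 j)
        * (∑ k, θ.win t₂.1 t₂.2 k * θ.wout t₃.1 t₃.2 k)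
        * (∑ l, θ.win t₃.1 t₃.2 l * p₄ l ^ 2)) := by
  refine le_trans (le_of_eq ?_) (ex_quad_sq_le hA
    (fun x => [cenItem θ t₁.1 t₁.2 x.1 x.2.1, cenItem θ t₂.1 t₂.2 x.2.1 x.2.2.1,
      cenItem θ t₃.1 t₃.2 x.2.2.1 x.2.2.2])
    (fun x => h x.2.2.2 x.1)
    (fun x G => cen θ t₁.1 t₁.2 G x.1 x.2.1 * cen θ t₂.1 t₂.2 G x.2.1 x.2.2.1
      * cen θ t₃.1 t₃.2 G x.2.2.1 x.2.2.2)
    _ _ _ _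
    (fun i => mul_nonneg (sq_nonneg _) (Param.wout_pos _ _ _).le)
    (fun i => mul_nonneg (Param.win_pos _ _ _).le (Param.wout_pos _ _ _).le)
    (fun i => mul_nonneg (Param.win_pos _ _ _).le (Param.wout_pos _ _ _).le)
    (fun i => mul_nonneg (Param.win_pos _ _ _).le (sq_nonneg _))
    (by simp) (by
      intro x a
      fin_cases a <;> simp) ?_ ?_ ?_)
  · congr 1
    funext G
    unfold cyc
    congr 1
    refine Finset.sum_congr rfl fun i _ => Finset.sum_congr rfl fun j _ =>
      Finset.sum_congr rfl fun k _ => Finset.sum_congr rfl fun l _ => ?_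
    ring
  · intro x hx
    obtain ⟨h1, h2, h3, h4, h5, h6⟩ := dst_ne_zero hx
    exact ⟨by simp [h1, h4, h6], nodup_three h1 h2 h3 h4 h5,
      by simp [ex_cenItem hA _ _ h1, ex_cenItem hA _ _ h4, ex_cenItem hA _ _ h6]⟩
  · intro x hx G
    obtain ⟨h1, h2, h3, h4, h5, h6⟩ := dst_ne_zero hx
    simp [cenItem_val _ _ h1, cenItem_val _ _ h4, cenItem_val _ _ h6, mul_assoc]
  · intro x hx
    obtain ⟨h1, h2, h3, h4, h5, h6⟩ := dst_ne_zero hx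
    have e1 := ex_cenItem_sq_le hA t₁.1 t₁.2 h1
    have e2 := ex_cenItem_sq_le hA t₂.1 t₂.2 h4
    have e3 := ex_cenItem_sq_le hA t₃.1 t₃.2 h6
    have e1' := ex_cenItem_sq_nonneg (θ := θ) (P := P) (A := A) t₁.1 t₁.2 x.1 x.2.1
    have e2' := ex_cenItem_sq_nonneg (θ := θ) (P := P) (A := A) t₂.1 t₂.2 x.2.1 x.2.2.1
    have e3' := ex_cenItem_sq_nonneg (θ := θ) (P := P) (A := A) t₃.1 t₃.2 x.2.2.1 x.2.2.2
    simp only [List.map_cons, List.map_nil, List.prod_cons, List.prod_nil, mul_one]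
    calc _ ≤ _ := mul_le_mul (pow_le_pow_left₀ (hh.nonneg _ _) (hh.le _ _) 2)
          (mul_le_mul e1 (mul_le_mul e2 e3 e3' (e2'.trans e2)) (mul_nonneg e2' e3') (e1'.trans e1))
          (mul_nonneg e1' (mul_nonneg e2' e3')) (by positivity)
      _ = _ := by ring

theorem ex_cyc_four_sq_le :
    ex P A (fun G => cyc (cen θ t₁.1 t₁.2 G) (cen θ t₂.1 t₂.2 G) (cen θ t₃.1 t₃.2 G)
        (cen θ t₄.1 t₄.2 G) ^ 2) ≤
      4096 * ((∑ i, θ.win t₄.1 t₄.2 i * θ.wout t₁.1 t₁.2 i)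
        * (∑ j, θ.win t₁.1 t₁.2 j * θ.wout t₂.1 t₂.2 j)
        * (∑ k, θ.win t₂.1 t₂.2 k * θ.wout t₃.1 t₃.2 k)
        * (∑ l, θ.win t₃.1 t₃.2 l * θ.wout t₄.1 t₄.2 l)) := by
  refine le_trans (le_of_eq ?_) (ex_quad_sq_le hA
    (fun x => [cenItem θ t₁.1 t₁.2 x.1 x.2.1, cenItem θ t₂.1 t₂.2 x.2.1 x.2.2.1,
      cenItem θ t₃.1 t₃.2 x.2.2.1 x.2.2.2, cenItem θ t₄.1 t₄.2 x.2.2.2 x.1])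
    (fun x => 1)
    (fun x G => cen θ t₁.1 t₁.2 G x.1 x.2.1 * cen θ t₂.1 t₂.2 G x.2.1 x.2.2.1
      * cen θ t₃.1 t₃.2 G x.2.2.1 x.2.2.2 * cen θ t₄.1 t₄.2 G x.2.2.2 x.1)
    _ _ _ _
    (fun i => mul_nonneg (Param.win_pos _ _ _).le (Param.wout_pos _ _ _).le)
    (fun i => mul_nonneg (Param.win_pos _ _ _).le (Param.wout_pos _ _ _).le)
    (fun i => mul_nonneg (Param.win_pos _ _ _).le (Param.wout_pos _ _ _).le)
    (fun i => mul_nonneg (Param.win_pos _ _ _).le (Param.wout_pos _ _ _).le)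
    (by simp) (by
      intro x a
      fin_cases a <;> simp) ?_ ?_ ?_)
  · congr 1
    funext G
    unfold cyc
    congr 1
    refine Finset.sum_congr rfl fun i _ => Finset.sum_congr rfl fun j _ =>
      Finset.sum_congr rfl fun k _ => Finset.sum_congr rfl fun l _ => ?_
    ring
  · intro x hx
    obtain ⟨h1, h2, h3, h4, h5, h6⟩ := dst_ne_zero hx
    exact ⟨by simp [h1, h4, h6, h3.symm], nodup_four h1 h2 h3 h4 h5 h6,
      by simp [ex_cenItem hA _ _ h1, ex_cenItem hA _ _ h4, ex_cenItem hA _ _ h6,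
        ex_cenItem hA _ _ h3.symm]⟩
  · intro x hx G
    obtain ⟨h1, h2, h3, h4, h5, h6⟩ := dst_ne_zero hx
    simp [cenItem_val _ _ h1, cenItem_val _ _ h4, cenItem_val _ _ h6, cenItem_val _ _ h3.symm,
      mul_assoc]
  · intro x hx
    obtain ⟨h1, h2, h3, h4, h5, h6⟩ := dst_ne_zero hx
    have e1 := ex_cenItem_sq_le hA t₁.1 t₁.2 h1
    have e2 := ex_cenItem_sq_le hA t₂.1 t₂.2 h4
    have e3 := ex_cenItem_sq_le hA t₃.1 t₃.2 h6
    have e4 := ex_cenItem_sq_le hA t₄.1 t₄.2 h3.symm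
    have e1' := ex_cenItem_sq_nonneg (θ := θ) (P := P) (A := A) t₁.1 t₁.2 x.1 x.2.1
    have e2' := ex_cenItem_sq_nonneg (θ := θ) (P := P) (A := A) t₂.1 t₂.2 x.2.1 x.2.2.1
    have e3' := ex_cenItem_sq_nonneg (θ := θ) (P := P) (A := A) t₃.1 t₃.2 x.2.2.1 x.2.2.2
    have e4' := ex_cenItem_sq_nonneg (θ := θ) (P := P) (A := A) t₄.1 t₄.2 x.2.2.2 x.1
    simp only [List.map_cons, List.map_nil, List.prod_cons, List.prod_nil, mul_one, one_pow,
      one_mul]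
    calc _ ≤ _ := mul_le_mul e1 (mul_le_mul e2 (mul_le_mul e3 e4 e4' (e3'.trans e3))
            (mul_nonneg e3' e4') (e2'.trans e2))
          (mul_nonneg e2' (mul_nonneg e3' e4')) (e1'.trans e1)
      _ = _ := by ring

end Shapes

end P1

namespace P1

/-! ### Second moments of path sums weighted by the indicator of the closing dyad -/

section PathShapes

variable {n : ℕ}

theorem sum_ex_le_of_le {E : Fin n → Fin n → ℝ} {u v : Fin n → ℝ} {C : ℝ}
    (h : ∀ i j, E i j ≤ 4096 * (u i * v j * C)) :
    ∑ i, ∑ j, E i j ≤ 4096 * ((∑ i, u i) * (∑ j, v j) * C) := by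
  refine (Finset.sum_le_sum fun i _ => Finset.sum_le_sum fun j _ => h i j).trans (le_of_eq ?_)
  simp only [← Finset.mul_sum, ← Finset.sum_mul]

variable {θ : Param n} {Ω : Type*} [MeasurableSpace Ω] {P : Measure Ω}
  [IsProbabilityMeasure P] {A : Ω → Graph n} (hA : IsP1Model θ P A)

theorem listVal_dyadItem_nonneg (a b : Bool) (i j : Fin n) (G : Graph n) :
    0 ≤ listVal [dyadItem a b i j] G := by
  simp only [listVal_cons, listVal_nil, mul_one, dyadItem, Item.val]
  split_ifs <;> norm_num

include hA

omit [IsProbabilityMeasure P] in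
theorem ex_listVal_dyadItem (a b : Bool) {i j : Fin n} (h : i ≠ j) :
    ex P A (listVal [dyadItem a b i j]) = θ.dyadProb a b i j := by
  rw [← ex_dyad hA a b h]
  congr 1
  funext G
  simp [dyadItem_val a b h]

variable (t₁ t₂ t₃ t₄ : Bool × Bool)

/-- The path avoids the dyad `{i, j}`, whose indicator therefore acts as a nonnegative independent
weight and enters only through its mean. The other nodes follow the reading rule for cycles. -/
theorem ex_dyad_mul_pth_left {g h : Fin n → Fin n → ℝ} {p₃ q₃ p₄ q₄ : Fin n → ℝ}
    (hg : Bd g p₃ q₃) (hh : Bd h p₄ q₄) (i j : Fin n) :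
    ex P A (fun G => Graph.dyad G t₁.1 t₁.2 i j * pth i j (cen θ t₂.1 t₂.2 G) g h ^ 2) ≤
      4096 * ((q₄ i ^ 2 * θ.wout t₁.1 t₁.2 i) * (θ.win t₁.1 t₁.2 j * θ.wout t₂.1 t₂.2 j)
        * ((∑ k, θ.win t₂.1 t₂.2 k * p₃ k ^ 2) * (∑ l, q₃ l * p₄ l) ^ 2)) := by
  have w1 := Param.wout_pos (θ := θ) t₁.1 t₁.2 i
  have w2 := Param.win_pos (θ := θ) t₁.1 t₁.2 j
  have w3 := Param.wout_pos (θ := θ) t₂.1 t₂.2 j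
  have w4 := fun k => Param.win_pos (θ := θ) t₂.1 t₂.2 k
  have hs : 0 ≤ ∑ k, θ.win t₂.1 t₂.2 k * p₃ k ^ 2 := Finset.sum_nonneg fun k _ => by
    have := w4 k
    positivity
  by_cases hij : i = j
  · subst hij
    simp only [dyad_self, zero_mul, ex_const]
    positivity
  set c : Fin n → ℝ := fun k => ∑ l, dst i j k l * (g k l * h l i) with hc
  have hne : ∀ k, c k ≠ 0 → i ≠ k ∧ j ≠ k := by
    intro k hk
    obtain ⟨l, hl⟩ := sum_ne_zero_exists hk
    have := dst_ne_zero (left_ne_zero_of_mul hl)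
    tauto
  have hc0 : ∀ x, 0 ≤ c x := fun x => Finset.sum_nonneg fun l _ =>
    mul_nonneg (dst_nonneg _ _ _ _) (mul_nonneg (hg.nonneg _ _) (hh.nonneg _ _))
  have hcle : ∀ k, c k ≤ q₄ i * p₃ k * ∑ l, q₃ l * p₄ l := by
    intro k
    rw [hc, Finset.mul_sum]
    refine Finset.sum_le_sum fun l _ => ?_
    refine dst_mul_le (mul_nonneg (hg.nonneg _ _) (hh.nonneg _ _)) ?_
    calc _ ≤ _ := mul_le_mul (hg.le k l) (hh.le l i) (hh.nonneg _ _)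
          (mul_nonneg (hg.left_nonneg _) (hg.right_nonneg _))
      _ = _ := by ring
  have key := ex_sq_sum_cen_le hA (ι := Fin n) (m := 1) (fun x => ![x]) (by norm_num)
    (fun x y hxy => congrFun hxy 0)
    (fun k => [cenItem θ t₂.1 t₂.2 j k]) [dyadItem t₁.1 t₁.2 i j] c
    (fun k => (q₄ i ^ 2 * θ.wout t₁.1 t₁.2 i) * (θ.win t₁.1 t₁.2 j * θ.wout t₂.1 t₂.2 j)
        * ((θ.win t₂.1 t₂.2 k * p₃ k ^ 2) * (∑ l, q₃ l * p₄ l) ^ 2))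
    (fun k G => cen θ t₂.1 t₂.2 G j k)
    (by simp) (by simp)
    (fun k hk => ⟨by simp [(hne k hk).2], by simp, by simp [ex_cenItem hA _ _ (hne k hk).2]⟩)
    (fun k hk G => by simp [cenItem_val _ _ (hne k hk).2])
    (listVal_dyadItem_nonneg _ _ i j) (by simpa [dyadItem] using hij) (by simp)
    (by
      intro k hk
      obtain ⟨h1, h2⟩ := hne k hk
      simp [h1.symm, h2.symm])
    (fun k => by
      have := w4 k
      positivity)
    (by
      intro k hk
      obtain ⟨h1, h2⟩ := hne k hk
      have e1 := ex_cenItem_sq_le hA t₂.1 t₂.2 h2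
      have e1' := ex_cenItem_sq_nonneg (θ := θ) (P := P) (A := A) t₂.1 t₂.2 j k
      rw [ex_listVal_dyadItem hA _ _ hij]
      simp only [List.map_cons, List.map_nil, List.prod_cons, List.prod_nil, mul_one]
      calc _ ≤ _ := mul_le_mul (pow_le_pow_left₀ (hc0 k) (hcle k) 2)
            (mul_le_mul (Param.dyadProb_le _ _ i j) e1 e1' (by positivity))
            (mul_nonneg (Param.dyadProb_nonneg _ _ _ _) e1') (by positivity)
        _ = _ := by ring)
  refine le_trans (le_of_eq ?_) (key.trans (le_of_eq ?_))
  · congr 1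
    funext G
    simp only [listVal_cons, listVal_nil, mul_one, dyadItem_val _ _ hij, pth, hc, Finset.sum_mul]
    congr 2
    refine Finset.sum_congr rfl fun k _ => Finset.sum_congr rfl fun l _ => ?_
    ring
  · simp only [← Finset.mul_sum, ← Finset.sum_mul]

theorem ex_dyad_mul_pth_right {f g : Fin n → Fin n → ℝ} {p₂ q₂ p₃ q₃ : Fin n → ℝ}
    (hf : Bd f p₂ q₂) (hg : Bd g p₃ q₃) (i j : Fin n) :
    ex P A (fun G => Graph.dyad G t₁.1 t₁.2 i j * pth i j f g (cen θ t₄.1 t₄.2 G) ^ 2) ≤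
      4096 * ((θ.win t₄.1 t₄.2 i * θ.wout t₁.1 t₁.2 i) * (θ.win t₁.1 t₁.2 j * p₂ j ^ 2)
        * ((∑ k, q₂ k * p₃ k) ^ 2 * (∑ l, q₃ l ^ 2 * θ.wout t₄.1 t₄.2 l))) := by
  have w1 := Param.wout_pos (θ := θ) t₁.1 t₁.2 i
  have w2 := Param.win_pos (θ := θ) t₁.1 t₁.2 j
  have w3 := Param.win_pos (θ := θ) t₄.1 t₄.2 i
  have w4 := fun k => Param.wout_pos (θ := θ) t₄.1 t₄.2 k
  have hs : 0 ≤ ∑ l, q₃ l ^ 2 * θ.wout t₄.1 t₄.2 l := Finset.sum_nonneg fun k _ => by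
    have := w4 k
    positivity
  by_cases hij : i = j
  · subst hij
    simp only [dyad_self, zero_mul, ex_const]
    positivity
  set c : Fin n → ℝ := fun l => ∑ k, dst i j k l * (f j k * g k l) with hc
  have hne : ∀ l, c l ≠ 0 → i ≠ l ∧ j ≠ l := by
    intro l hl
    obtain ⟨k, hk⟩ := sum_ne_zero_exists hl
    have := dst_ne_zero (left_ne_zero_of_mul hk)
    tauto
  have hc0 : ∀ x, 0 ≤ c x := fun x => Finset.sum_nonneg fun l _ =>
    mul_nonneg (dst_nonneg _ _ _ _) (mul_nonneg (hf.nonneg _ _) (hg.nonneg _ _))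
  have hcle : ∀ l, c l ≤ p₂ j * q₃ l * ∑ k, q₂ k * p₃ k := by
    intro l
    rw [hc, Finset.mul_sum]
    refine Finset.sum_le_sum fun k _ => ?_
    refine dst_mul_le (mul_nonneg (hf.nonneg _ _) (hg.nonneg _ _)) ?_
    calc _ ≤ _ := mul_le_mul (hf.le j k) (hg.le k l) (hg.nonneg _ _)
          (mul_nonneg (hf.left_nonneg _) (hf.right_nonneg _))
      _ = _ := by ring
  have key := ex_sq_sum_cen_le hA (ι := Fin n) (m := 1) (fun x => ![x]) (by norm_num)
    (fun x y hxy => congrFun hxy 0)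
    (fun l => [cenItem θ t₄.1 t₄.2 l i]) [dyadItem t₁.1 t₁.2 i j] c
    (fun l => (θ.win t₄.1 t₄.2 i * θ.wout t₁.1 t₁.2 i) * (θ.win t₁.1 t₁.2 j * p₂ j ^ 2)
        * ((∑ k, q₂ k * p₃ k) ^ 2 * (q₃ l ^ 2 * θ.wout t₄.1 t₄.2 l)))
    (fun l G => cen θ t₄.1 t₄.2 G l i)
    (by simp) (by simp)
    (fun l hl => ⟨by simp [(hne l hl).1.symm], by simp,
      by simp [ex_cenItem hA _ _ (hne l hl).1.symm]⟩)
    (fun l hl G => by simp [cenItem_val _ _ (hne l hl).1.symm])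
    (listVal_dyadItem_nonneg _ _ i j) (by simpa [dyadItem] using hij) (by simp)
    (by
      intro l hl
      obtain ⟨h1, h2⟩ := hne l hl
      simp [h1.symm, h2.symm])
    (fun k => by
      have := w4 k
      positivity)
    (by
      intro l hl
      obtain ⟨h1, h2⟩ := hne l hl
      have e1 := ex_cenItem_sq_le hA t₄.1 t₄.2 h1.symm
      have e1' := ex_cenItem_sq_nonneg (θ := θ) (P := P) (A := A) t₄.1 t₄.2 l i
      rw [ex_listVal_dyadItem hA _ _ hij]
      simp only [List.map_cons, List.map_nil, List.prod_cons, List.prod_nil, mul_one]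
      calc _ ≤ _ := mul_le_mul (pow_le_pow_left₀ (hc0 l) (hcle l) 2)
            (mul_le_mul (Param.dyadProb_le _ _ i j) e1 e1' (by positivity))
            (mul_nonneg (Param.dyadProb_nonneg _ _ _ _) e1') (by positivity)
        _ = _ := by ring)
  refine le_trans (le_of_eq ?_) (key.trans (le_of_eq ?_))
  · congr 1
    funext G
    simp only [listVal_cons, listVal_nil, mul_one, dyadItem_val _ _ hij, pth, hc, Finset.sum_mul]
    congr 2
    rw [Finset.sum_comm]
    refine Finset.sum_congr rfl fun k _ => Finset.sum_congr rfl fun l _ => ?_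
    ring
  · simp only [← Finset.mul_sum]

/-- Weighted second moment bound for sums over the pairs completing `(i, j)` to a quadruple. -/
theorem ex_pair_sq_le {i j : Fin n} (hij : i ≠ j) (L : Fin n × Fin n → List (Item n))
    (c : Fin n × Fin n → ℝ) (Y : Fin n × Fin n → Graph n → ℝ) (u v : ℝ) (a₃ a₄ : Fin n → ℝ)
    (hu : 0 ≤ u) (hv : 0 ≤ v) (ha₃ : ∀ i, 0 ≤ a₃ i) (ha₄ : ∀ i, 0 ≤ a₄ i)
    (hlen : ∀ x, (L x).length ≤ 4)
    (hcov : ∀ x, ∀ a, ∃ t ∈ L x, ![x.1, x.2] a ∈ t.edge)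
    (hL : ∀ x, dst i j x.1 x.2 ≠ 0 → CenteredProd P A (L x))
    (hY : ∀ x, dst i j x.1 x.2 ≠ 0 → ∀ G, Y x G = listVal (L x) G)
    (hd : ∀ x, dst i j x.1 x.2 ≠ 0 → ∀ t ∈ L x, t.edge ≠ s(i, j))
    (hB : ∀ x, dst i j x.1 x.2 ≠ 0 → c x ^ 2 * (θ.wout t₁.1 t₁.2 i * θ.win t₁.1 t₁.2 j *
        ((L x).map fun t => ex P A fun G => t.val G ^ 2).prod) ≤ u * v * (a₃ x.1 * a₄ x.2)) :
    ex P A (fun G => Graph.dyad G t₁.1 t₁.2 i j *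
        (∑ k, ∑ l, dst i j k l * (c (k, l) * Y (k, l) G)) ^ 2)
      ≤ 4096 * (u * v * ((∑ k, a₃ k) * ∑ l, a₄ l)) := by
  have hne : ∀ x : Fin n × Fin n, dst i j x.1 x.2 * c x ≠ 0 → dst i j x.1 x.2 ≠ 0 :=
    fun x hx => left_ne_zero_of_mul hx
  have key := ex_sq_sum_cen_le hA (ι := Fin n × Fin n) (m := 2) (fun x => ![x.1, x.2])
    (by norm_num) (fun x y hxy => Prod.ext (congrFun hxy 0) (congrFun hxy 1))
    L [dyadItem t₁.1 t₁.2 i j] (fun x => dst i j x.1 x.2 * c x)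
    (fun x => u * v * (a₃ x.1 * a₄ x.2)) Y hlen hcov
    (fun x hx => hL x (hne x hx)) (fun x hx => hY x (hne x hx))
    (listVal_dyadItem_nonneg _ _ i j) (by simpa [dyadItem] using hij) (by simp)
    (fun x hx w hw t ht => by
      rw [List.mem_singleton.1 hw]
      exact hd x (hne x hx) t ht)
    (fun x => by
      have := ha₃ x.1
      have := ha₄ x.2
      positivity)
    (fun x hx => by
      have h2 : dst i j x.1 x.2 ^ 2 = 1 := by
        have := hne x hx
        unfold dst at this ⊢
        split_ifs at this ⊢ <;> simp at this ⊢
      have h3 : 0 ≤ ((L x).map fun t => ex P A fun G => t.val G ^ 2).prod := by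
        refine List.prod_nonneg fun y hy => ?_
        obtain ⟨t, _, rfl⟩ := List.mem_map.1 hy
        exact ex_nonneg fun _ => sq_nonneg _
      rw [ex_listVal_dyadItem hA _ _ hij, mul_pow, h2, one_mul]
      refine le_trans ?_ (hB x (hne x hx))
      gcongr
      exact Param.dyadProb_le _ _ i j)
  refine le_trans (le_of_eq ?_) (key.trans (le_of_eq ?_))
  · congr 1
    funext G
    simp only [listVal_cons, listVal_nil, mul_one, dyadItem_val _ _ hij, Fintype.sum_prod_type,
      mul_assoc]
  · simp only [Fintype.sum_prod_type, ← Finset.mul_sum, ← Finset.sum_mul]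

theorem ex_dyad_mul_pth_mid {f h : Fin n → Fin n → ℝ} {p₂ q₂ p₄ q₄ : Fin n → ℝ}
    (hf : Bd f p₂ q₂) (hh : Bd h p₄ q₄) (i j : Fin n) :
    ex P A (fun G => Graph.dyad G t₁.1 t₁.2 i j * pth i j f (cen θ t₃.1 t₃.2 G) h ^ 2) ≤
      4096 * ((q₄ i ^ 2 * θ.wout t₁.1 t₁.2 i) * (θ.win t₁.1 t₁.2 j * p₂ j ^ 2)
        * ((∑ k, q₂ k ^ 2 * θ.wout t₃.1 t₃.2 k) * (∑ l, θ.win t₃.1 t₃.2 l * p₄ l ^ 2))) := by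
  have w1 := Param.wout_pos (θ := θ) t₁.1 t₁.2 i
  have w2 := Param.win_pos (θ := θ) t₁.1 t₁.2 j
  have w3 := fun k => Param.wout_pos (θ := θ) t₃.1 t₃.2 k
  have w4 := fun k => Param.win_pos (θ := θ) t₃.1 t₃.2 k
  have a3 : ∀ k, 0 ≤ q₂ k ^ 2 * θ.wout t₃.1 t₃.2 k := fun k => by
    have := w3 k
    positivity
  have a4 : ∀ l, 0 ≤ θ.win t₃.1 t₃.2 l * p₄ l ^ 2 := fun k => by
    have := w4 k
    positivity
  by_cases hij : i = j
  · subst hij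
    simp only [dyad_self, zero_mul, ex_const]
    have := Finset.sum_nonneg fun k (_ : k ∈ Finset.univ) => a3 k
    have := Finset.sum_nonneg fun k (_ : k ∈ Finset.univ) => a4 k
    positivity
  refine le_trans (le_of_eq ?_) (ex_pair_sq_le hA t₁ hij
    (fun x => [cenItem θ t₃.1 t₃.2 x.1 x.2]) (fun x => f j x.1 * h x.2 i)
    (fun x G => cen θ t₃.1 t₃.2 G x.1 x.2) _ _ _ _ (by positivity) (by positivity) a3 a4
    (by simp) (by
      intro x a
      fin_cases a <;> simp) ?_ ?_ ?_ ?_)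
  · congr 1
    funext G
    unfold pth
    congr 2
    refine Finset.sum_congr rfl fun k _ => Finset.sum_congr rfl fun l _ => ?_
    ring
  · intro x hx
    obtain ⟨h1, h2, h3, h4, h5, h6⟩ := dst_ne_zero hx
    exact ⟨by simp [h6], by simp, by simp [ex_cenItem hA _ _ h6]⟩
  · intro x hx G
    obtain ⟨h1, h2, h3, h4, h5, h6⟩ := dst_ne_zero hx
    simp [cenItem_val _ _ h6]
  · rintro ⟨k, l⟩ hx
    obtain ⟨h1, h2, h3, h4, h5, h6⟩ := dst_ne_zero hx
    simp [h2.symm, h4.symm]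
  · intro x hx
    obtain ⟨h1, h2, h3, h4, h5, h6⟩ := dst_ne_zero hx
    have e1 := ex_cenItem_sq_le hA t₃.1 t₃.2 h6
    have e1' := ex_cenItem_sq_nonneg (θ := θ) (P := P) (A := A) t₃.1 t₃.2 x.1 x.2
    simp only [List.map_cons, List.map_nil, List.prod_cons, List.prod_nil, mul_one]
    have hc := mul_le_mul (hf.le j x.1) (hh.le x.2 i) (hh.nonneg _ _)
      (mul_nonneg (hf.left_nonneg _) (hf.right_nonneg _))
    calc _ ≤ _ := mul_le_mul (pow_le_pow_left₀ (mul_nonneg (hf.nonneg _ _) (hh.nonneg _ _)) hc 2)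
          (mul_le_mul le_rfl e1 e1' (by positivity)) (by positivity) (by positivity)
      _ = _ := by ring

theorem ex_dyad_mul_pth_left_mid {h : Fin n → Fin n → ℝ} {p₄ q₄ : Fin n → ℝ}
    (hh : Bd h p₄ q₄) (i j : Fin n) :
    ex P A (fun G => Graph.dyad G t₁.1 t₁.2 i j *
        pth i j (cen θ t₂.1 t₂.2 G) (cen θ t₃.1 t₃.2 G) h ^ 2) ≤
      4096 * ((q₄ i ^ 2 * θ.wout t₁.1 t₁.2 i) * (θ.win t₁.1 t₁.2 j * θ.wout t₂.1 t₂.2 j)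
        * ((∑ k, θ.win t₂.1 t₂.2 k * θ.wout t₃.1 t₃.2 k)
          * (∑ l, θ.win t₃.1 t₃.2 l * p₄ l ^ 2))) := by
  have w0 := Param.wout_pos (θ := θ) t₁.1 t₁.2 i
  have w1 := Param.win_pos (θ := θ) t₁.1 t₁.2 j
  have w2 := Param.wout_pos (θ := θ) t₂.1 t₂.2 j
  have a3 : ∀ k, 0 ≤ θ.win t₂.1 t₂.2 k * θ.wout t₃.1 t₃.2 k := fun k =>
    (mul_pos (Param.win_pos _ _ _) (Param.wout_pos _ _ _)).le
  have a4 : ∀ l, 0 ≤ θ.win t₃.1 t₃.2 l * p₄ l ^ 2 := fun k =>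
    mul_nonneg (Param.win_pos _ _ _).le (sq_nonneg _)
  by_cases hij : i = j
  · subst hij
    simp only [dyad_self, zero_mul, ex_const]
    have := Finset.sum_nonneg fun k (_ : k ∈ Finset.univ) => a3 k
    have := Finset.sum_nonneg fun k (_ : k ∈ Finset.univ) => a4 k
    positivity
  refine le_trans (le_of_eq ?_) (ex_pair_sq_le hA t₁ hij
    (fun x => [cenItem θ t₂.1 t₂.2 j x.1, cenItem θ t₃.1 t₃.2 x.1 x.2]) (fun x => h x.2 i)
    (fun x G => cen θ t₂.1 t₂.2 G j x.1 * cen θ t₃.1 t₃.2 G x.1 x.2) _ _ _ _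
    (by positivity) (by positivity) a3 a4
    (by simp) (by
      intro x a
      fin_cases a <;> simp) ?_ ?_ ?_ ?_)
  · congr 1
    funext G
    unfold pth
    congr 2
    refine Finset.sum_congr rfl fun k _ => Finset.sum_congr rfl fun l _ => ?_
    ring
  · intro x hx
    obtain ⟨h1, h2, h3, h4, h5, h6⟩ := dst_ne_zero hx
    exact ⟨by simp [h4, h6], nodup_adjacent h5 h4,
      by simp [ex_cenItem hA _ _ h4, ex_cenItem hA _ _ h6]⟩
  · intro x hx G
    obtain ⟨h1, h2, h3, h4, h5, h6⟩ := dst_ne_zero hx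
    simp [cenItem_val _ _ h4, cenItem_val _ _ h6]
  · rintro ⟨k, l⟩ hx
    obtain ⟨h1, h2, h3, h4, h5, h6⟩ := dst_ne_zero hx
    simp [h2.symm, h4.symm, h1.symm]
  · intro x hx
    obtain ⟨h1, h2, h3, h4, h5, h6⟩ := dst_ne_zero hx
    have e1 := ex_cenItem_sq_le hA t₂.1 t₂.2 h4
    have e2 := ex_cenItem_sq_le hA t₃.1 t₃.2 h6
    have e1' := ex_cenItem_sq_nonneg (θ := θ) (P := P) (A := A) t₂.1 t₂.2 j x.1
    have e2' := ex_cenItem_sq_nonneg (θ := θ) (P := P) (A := A) t₃.1 t₃.2 x.1 x.2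
    simp only [List.map_cons, List.map_nil, List.prod_cons, List.prod_nil, mul_one]
    calc _ ≤ _ := mul_le_mul (pow_le_pow_left₀ (hh.nonneg _ _) (hh.le _ _) 2)
          (mul_le_mul le_rfl (mul_le_mul e1 e2 e2' (e1'.trans e1)) (mul_nonneg e1' e2')
            (by positivity)) (by positivity) (by positivity)
      _ = _ := by ring

theorem ex_dyad_mul_pth_mid_right {f : Fin n → Fin n → ℝ} {p₂ q₂ : Fin n → ℝ}
    (hf : Bd f p₂ q₂) (i j : Fin n) :
    ex P A (fun G => Graph.dyad G t₁.1 t₁.2 i j *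
        pth i j f (cen θ t₃.1 t₃.2 G) (cen θ t₄.1 t₄.2 G) ^ 2) ≤
      4096 * ((θ.win t₄.1 t₄.2 i * θ.wout t₁.1 t₁.2 i) * (θ.win t₁.1 t₁.2 j * p₂ j ^ 2)
        * ((∑ k, q₂ k ^ 2 * θ.wout t₃.1 t₃.2 k)
          * (∑ l, θ.win t₃.1 t₃.2 l * θ.wout t₄.1 t₄.2 l))) := by
  have w0 := Param.wout_pos (θ := θ) t₁.1 t₁.2 i
  have w1 := Param.win_pos (θ := θ) t₁.1 t₁.2 j
  have w2 := Param.win_pos (θ := θ) t₄.1 t₄.2 i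
  have a3 : ∀ k, 0 ≤ q₂ k ^ 2 * θ.wout t₃.1 t₃.2 k := fun k =>
    mul_nonneg (sq_nonneg _) (Param.wout_pos _ _ _).le
  have a4 : ∀ l, 0 ≤ θ.win t₃.1 t₃.2 l * θ.wout t₄.1 t₄.2 l := fun k =>
    (mul_pos (Param.win_pos _ _ _) (Param.wout_pos _ _ _)).le
  by_cases hij : i = j
  · subst hij
    simp only [dyad_self, zero_mul, ex_const]
    have := Finset.sum_nonneg fun k (_ : k ∈ Finset.univ) => a3 k
    have := Finset.sum_nonneg fun k (_ : k ∈ Finset.univ) => a4 k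
    positivity
  refine le_trans (le_of_eq ?_) (ex_pair_sq_le hA t₁ hij
    (fun x => [cenItem θ t₃.1 t₃.2 x.1 x.2, cenItem θ t₄.1 t₄.2 x.2 i]) (fun x => f j x.1)
    (fun x G => cen θ t₃.1 t₃.2 G x.1 x.2 * cen θ t₄.1 t₄.2 G x.2 i) _ _ _ _
    (by positivity) (by positivity) a3 a4
    (by simp) (by
      intro x a
      fin_cases a <;> simp) ?_ ?_ ?_ ?_)
  · congr 1
    funext G
    unfold pth
    congr 2
    refine Finset.sum_congr rfl fun k _ => Finset.sum_congr rfl fun l _ => ?_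
    ring
  · intro x hx
    obtain ⟨h1, h2, h3, h4, h5, h6⟩ := dst_ne_zero hx
    exact ⟨by simp [h3.symm, h6], nodup_adjacent h2.symm h6,
      by simp [ex_cenItem hA _ _ h3.symm, ex_cenItem hA _ _ h6]⟩
  · intro x hx G
    obtain ⟨h1, h2, h3, h4, h5, h6⟩ := dst_ne_zero hx
    simp [cenItem_val _ _ h3.symm, cenItem_val _ _ h6]
  · rintro ⟨k, l⟩ hx
    obtain ⟨h1, h2, h3, h4, h5, h6⟩ := dst_ne_zero hx
    simp [h2.symm, h4.symm, h3.symm, h5.symm]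
  · intro x hx
    obtain ⟨h1, h2, h3, h4, h5, h6⟩ := dst_ne_zero hx
    have e1 := ex_cenItem_sq_le hA t₃.1 t₃.2 h6
    have e2 := ex_cenItem_sq_le hA t₄.1 t₄.2 h3.symm
    have e1' := ex_cenItem_sq_nonneg (θ := θ) (P := P) (A := A) t₃.1 t₃.2 x.1 x.2
    have e2' := ex_cenItem_sq_nonneg (θ := θ) (P := P) (A := A) t₄.1 t₄.2 x.2 i
    simp only [List.map_cons, List.map_nil, List.prod_cons, List.prod_nil, mul_one]
    calc _ ≤ _ := mul_le_mul (pow_le_pow_left₀ (hf.nonneg _ _) (hf.le _ _) 2)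
          (mul_le_mul le_rfl (mul_le_mul e1 e2 e2' (e1'.trans e1)) (mul_nonneg e1' e2')
            (by positivity)) (by positivity) (by positivity)
      _ = _ := by ring

theorem ex_dyad_mul_pth_left_right {g : Fin n → Fin n → ℝ} {p₃ q₃ : Fin n → ℝ}
    (hg : Bd g p₃ q₃) (i j : Fin n) :
    ex P A (fun G => Graph.dyad G t₁.1 t₁.2 i j *
        pth i j (cen θ t₂.1 t₂.2 G) g (cen θ t₄.1 t₄.2 G) ^ 2) ≤
      4096 * ((θ.win t₄.1 t₄.2 i * θ.wout t₁.1 t₁.2 i)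
        * (θ.win t₁.1 t₁.2 j * θ.wout t₂.1 t₂.2 j)
        * ((∑ k, θ.win t₂.1 t₂.2 k * p₃ k ^ 2) * (∑ l, q₃ l ^ 2 * θ.wout t₄.1 t₄.2 l))) := by
  have w0 := Param.wout_pos (θ := θ) t₁.1 t₁.2 i
  have w1 := Param.win_pos (θ := θ) t₁.1 t₁.2 j
  have w2 := Param.win_pos (θ := θ) t₄.1 t₄.2 i
  have w3 := Param.wout_pos (θ := θ) t₂.1 t₂.2 j
  have a3 : ∀ k, 0 ≤ θ.win t₂.1 t₂.2 k * p₃ k ^ 2 := fun k =>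
    mul_nonneg (Param.win_pos _ _ _).le (sq_nonneg _)
  have a4 : ∀ l, 0 ≤ q₃ l ^ 2 * θ.wout t₄.1 t₄.2 l := fun k =>
    mul_nonneg (sq_nonneg _) (Param.wout_pos _ _ _).le
  by_cases hij : i = j
  · subst hij
    simp only [dyad_self, zero_mul, ex_const]
    have := Finset.sum_nonneg fun k (_ : k ∈ Finset.univ) => a3 k
    have := Finset.sum_nonneg fun k (_ : k ∈ Finset.univ) => a4 k
    positivity
  refine le_trans (le_of_eq ?_) (ex_pair_sq_le hA t₁ hij
    (fun x => [cenItem θ t₂.1 t₂.2 j x.1, cenItem θ t₄.1 t₄.2 x.2 i]) (fun x => g x.1 x.2)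
    (fun x G => cen θ t₂.1 t₂.2 G j x.1 * cen θ t₄.1 t₄.2 G x.2 i) _ _ _ _
    (by positivity) (by positivity) a3 a4
    (by simp) (by
      intro x a
      fin_cases a <;> simp) ?_ ?_ ?_ ?_)
  · congr 1
    funext G
    unfold pth
    congr 2
    refine Finset.sum_congr rfl fun k _ => Finset.sum_congr rfl fun l _ => ?_
    ring
  · intro x hx
    obtain ⟨h1, h2, h3, h4, h5, h6⟩ := dst_ne_zero hx
    exact ⟨by simp [h3.symm, h4], nodup_opposite h5 h1.symm,
      by simp [ex_cenItem hA _ _ h3.symm, ex_cenItem hA _ _ h4]⟩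
  · intro x hx G
    obtain ⟨h1, h2, h3, h4, h5, h6⟩ := dst_ne_zero hx
    simp [cenItem_val _ _ h3.symm, cenItem_val _ _ h4]
  · rintro ⟨k, l⟩ hx
    obtain ⟨h1, h2, h3, h4, h5, h6⟩ := dst_ne_zero hx
    simp [h1.symm, h2.symm, h3.symm, h5.symm]
  · intro x hx
    obtain ⟨h1, h2, h3, h4, h5, h6⟩ := dst_ne_zero hx
    have e1 := ex_cenItem_sq_le hA t₂.1 t₂.2 h4
    have e2 := ex_cenItem_sq_le hA t₄.1 t₄.2 h3.symm
    have e1' := ex_cenItem_sq_nonneg (θ := θ) (P := P) (A := A) t₂.1 t₂.2 j x.1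
    have e2' := ex_cenItem_sq_nonneg (θ := θ) (P := P) (A := A) t₄.1 t₄.2 x.2 i
    simp only [List.map_cons, List.map_nil, List.prod_cons, List.prod_nil, mul_one]
    calc _ ≤ _ := mul_le_mul (pow_le_pow_left₀ (hg.nonneg _ _) (hg.le _ _) 2)
          (mul_le_mul le_rfl (mul_le_mul e1 e2 e2' (e1'.trans e1)) (mul_nonneg e1' e2')
            (by positivity)) (by positivity) (by positivity)
      _ = _ := by ring

end PathShapes

end P1

namespace P1

/-! ### Comparison of the moment bounds with the order of the variance -/

namespace Param

variable {n : ℕ} {θ : Param n}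

@[simp] theorem wout_tt (i : Fin n) : θ.wout true true i = θ.R * θ.η i := rfl
@[simp] theorem wout_tf (i : Fin n) : θ.wout true false i = θ.μ i := rfl
@[simp] theorem wout_ft (i : Fin n) : θ.wout false true i = θ.ν i := rfl
@[simp] theorem wout_ff (i : Fin n) : θ.wout false false i = 1 := rfl
@[simp] theorem win_tt (i : Fin n) : θ.win true true i = θ.η i := rfl
@[simp] theorem win_tf (i : Fin n) : θ.win true false i = θ.ν i := rfl
@[simp] theorem win_ft (i : Fin n) : θ.win false true i = θ.μ i := rfl
@[simp] theorem win_ff (i : Fin n) : θ.win false false i = 1 := rfl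

@[simp] theorem sum_μ : ∑ i, θ.μ i = θ.sM := rfl
@[simp] theorem sum_ν : ∑ i, θ.ν i = θ.sN := rfl
@[simp] theorem sum_η : ∑ i, θ.η i = θ.sH := rfl
@[simp] theorem sum_μ_sq : ∑ i, θ.μ i ^ 2 = θ.sM2 := rfl
@[simp] theorem sum_ν_sq : ∑ i, θ.ν i ^ 2 = θ.sN2 := rfl
@[simp] theorem sum_η_sq : ∑ i, θ.η i ^ 2 = θ.sH2 := rfl
@[simp] theorem sum_R_η : ∑ i, θ.R * θ.η i = θ.R * θ.sH := by rw [← Finset.mul_sum, sum_η]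
@[simp] theorem sum_R_η_sq : ∑ i, (θ.R * θ.η i) ^ 2 = θ.R ^ 2 * θ.sH2 := by
  simp only [mul_pow]
  rw [← Finset.mul_sum, sum_η_sq]
@[simp] theorem sum_μ_ν : ∑ i, θ.μ i * θ.ν i = θ.sH := rfl
@[simp] theorem sum_ν_μ : ∑ i, θ.ν i * θ.μ i = θ.sH := by simp only [mul_comm, sH, η]
@[simp] theorem sum_ν_sq_μ : ∑ i, θ.ν i ^ 2 * θ.μ i = θ.sb := by simp only [mul_comm, sb]
@[simp] theorem sum_ν_μ_sq : ∑ i, θ.ν i * θ.μ i ^ 2 = θ.sa := by simp only [mul_comm, sa]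

namespace Sparse

variable {ε c : ℝ} (h : θ.Sparse ε c)
include h

theorem le_V0_left {x : ℝ} (hx : x ≤ θ.R * θ.sH ^ 2 * (θ.sM ^ 2 * θ.sN ^ 2)) : x ≤ θ.V0 := by
  have := R_pos (θ := θ)
  have := h.sa_pos
  have := h.sb_pos
  have : 0 ≤ θ.R ^ 2 * θ.sa * θ.sb * (θ.sM ^ 2 * θ.sN ^ 2) := by positivity
  unfold V0
  linarith

omit h in
theorem le_V0_right {x : ℝ} (hx : x ≤ θ.R ^ 2 * θ.sa * θ.sb * (θ.sM ^ 2 * θ.sN ^ 2)) :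
    x ≤ θ.V0 := by
  have := R_pos (θ := θ)
  have : 0 ≤ θ.R * θ.sH ^ 2 * (θ.sM ^ 2 * θ.sN ^ 2) := by positivity
  unfold V0
  linarith

theorem le_ε_V0_left {x : ℝ} (hx : x ≤ ε * (θ.R * θ.sH ^ 2 * (θ.sM ^ 2 * θ.sN ^ 2))) :
    x ≤ ε * θ.V0 :=
  hx.trans (mul_le_mul_of_nonneg_left (h.le_V0_left le_rfl) h.pos.le)

theorem le_ε_V0_right {x : ℝ} (hx : x ≤ ε * (θ.R ^ 2 * θ.sa * θ.sb * (θ.sM ^ 2 * θ.sN ^ 2))) :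
    x ≤ ε * θ.V0 :=
  hx.trans (mul_le_mul_of_nonneg_left (le_V0_right le_rfl) h.pos.le)

theorem ε_le_one : ε ≤ 1 := by linarith [h.small]

theorem sM_le_sq : θ.sM ≤ θ.sM ^ 2 := by nlinarith [h.one_le_sM]
theorem sN_le_sq : θ.sN ≤ θ.sN ^ 2 := by nlinarith [h.one_le_sN]
theorem sM_le_ε_sq : θ.sM ≤ ε * θ.sM ^ 2 := by nlinarith [h.one_le_sM, h.one_le_ε_sM]
theorem sM2_le_sq : θ.sM2 ≤ ε * θ.sM ^ 2 :=
  h.sM2_le.trans (mul_le_mul_of_nonneg_left h.sM_le_sq h.pos.le)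
theorem sN2_le_sq : θ.sN2 ≤ ε * θ.sN ^ 2 :=
  h.sN2_le.trans (mul_le_mul_of_nonneg_left h.sN_le_sq h.pos.le)
theorem sM2_le_sq' : θ.sM2 ≤ θ.sM ^ 2 :=
  h.sM2_le_sq.trans (mul_le_of_le_one_left (sq_nonneg _) h.ε_le_one)
theorem sN2_le_sq' : θ.sN2 ≤ θ.sN ^ 2 :=
  h.sN2_le_sq.trans (mul_le_of_le_one_left (sq_nonneg _) h.ε_le_one)
theorem sH2_le_sa' : θ.sH2 ≤ θ.sa :=
  h.sH2_le_sa.trans (mul_le_of_le_one_left sa_nonneg h.ε_le_one)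
theorem sH2_le_sb' : θ.sH2 ≤ θ.sb :=
  h.sH2_le_sb.trans (mul_le_of_le_one_left sb_nonneg h.ε_le_one)
-- One multiplies by `1 ≤ ε * sH` before applying Cauchy–Schwarz; this is how divergence of `‖η‖₁`
-- yields a factor `ε`.
theorem sH_le_sa_sN : θ.sH ≤ ε * (θ.sa * θ.sN) := by
  have := sH_sq_le_sa_mul_sN (θ := θ)
  nlinarith [h.sH_ge, h.pos, h.one_le_sH]
theorem sH_le_sb_sM : θ.sH ≤ ε * (θ.sb * θ.sM) := by
  have := sH_sq_le_sb_mul_sM (θ := θ)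
  nlinarith [h.sH_ge, h.pos, h.one_le_sH]

omit h in
theorem sH_pow_four_le : θ.sH ^ 4 ≤ θ.sa * θ.sb * (θ.sM * θ.sN) := by
  have h1 := sH_sq_le_sa_mul_sN (θ := θ)
  have h2 := sH_sq_le_sb_mul_sM (θ := θ)
  have := mul_le_mul h1 h2 (sq_nonneg _) (mul_nonneg sa_nonneg sN_nonneg)
  calc θ.sH ^ 4 = θ.sH ^ 2 * θ.sH ^ 2 := by ring
    _ ≤ _ := this
    _ = _ := by ring

theorem sH_sq_le_four : θ.sH ^ 2 ≤ ε * (θ.sa * θ.sb * (θ.sM * θ.sN)) := by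
  refine le_trans ?_ (mul_le_mul_of_nonneg_left sH_pow_four_le h.pos.le)
  have h1 := h.sH_ge
  have h2 := h.one_le_sH
  have : θ.sH ^ 2 * 1 ≤ θ.sH ^ 2 * (ε * θ.sH * θ.sH) := by
    gcongr
    nlinarith
  linarith

/-- The bounds on second moments that do not contribute to the leading order. -/
theorem negligible :
    θ.R ^ 2 * (θ.sH2 * θ.sN2 * θ.sM ^ 2 * θ.sH ^ 2) ≤ ε * θ.V0 ∧
    θ.R ^ 2 * (θ.sH2 * θ.sM2 * θ.sN ^ 2 * θ.sH ^ 2) ≤ ε * θ.V0 ∧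
    θ.R * (θ.sH ^ 2 * θ.sN2 * θ.sM ^ 2) ≤ ε * θ.V0 ∧
    θ.R * (θ.sH ^ 2 * θ.sM2 * θ.sN ^ 2) ≤ ε * θ.V0 ∧
    θ.R ^ 2 * (θ.sH2 * θ.sH ^ 2 * θ.sM * θ.sN) ≤ ε * θ.V0 ∧
    θ.R * (θ.sH ^ 2 * θ.sM * θ.sN) ≤ ε * θ.V0 ∧
    θ.R ^ 2 * (θ.sH2 ^ 2 * θ.sM2 * θ.sN2) ≤ ε * θ.V0 ∧
    θ.R ^ 2 * (θ.sH2 ^ 2 * θ.sM * θ.sN) ≤ ε * θ.V0 ∧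
    θ.R * (θ.sH ^ 2 * θ.sM2 * θ.sN2) ≤ ε * θ.V0 := by
  have hR := R_pos (θ := θ)
  have ha := h.sa_pos
  have hb := h.sb_pos
  have hM := h.one_le_sM
  have hN := h.one_le_sN
  have hM2 := sM2_nonneg (θ := θ)
  have hN2 := sN2_nonneg (θ := θ)
  have hH2 := sH2_nonneg (θ := θ)
  have hε := h.pos
  have hM' : 0 ≤ θ.sM := sM_nonneg
  have hN' : 0 ≤ θ.sN := sN_nonneg
  have e1 := sH_sq_le_sa_mul_sN (θ := θ)
  have e2 := sH_sq_le_sb_mul_sM (θ := θ)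
  have f1 := h.sH2_le_sa
  have f2 := h.sH2_le_sb
  have f1' := h.sH2_le_sa'
  have f2' := h.sH2_le_sb'
  have m1 := h.sM2_le_sq'
  have n1 := h.sN2_le_sq'
  -- Terms with `R ^ 2` are matched with the summand `R² sa sb sM² sN²` of `V0`, terms with `R` with
  -- the summand `R sH² sM² sN²`.
  refine ⟨h.le_ε_V0_right ?_, h.le_ε_V0_right ?_, h.le_ε_V0_left ?_, h.le_ε_V0_left ?_,
    h.le_ε_V0_right ?_, h.le_ε_V0_left ?_, h.le_ε_V0_right ?_, h.le_ε_V0_right ?_,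
    h.le_ε_V0_left ?_⟩
  · have n2 : θ.sN2 ≤ θ.sN := h.sN2_le.trans (mul_le_of_le_one_left hN' h.ε_le_one)
    calc _ ≤ θ.R ^ 2 * ((ε * θ.sb) * θ.sN * θ.sM ^ 2 * (θ.sa * θ.sN)) := by gcongr
      _ = _ := by ring
  · have m2 : θ.sM2 ≤ θ.sM := h.sM2_le.trans (mul_le_of_le_one_left hM' h.ε_le_one)
    calc _ ≤ θ.R ^ 2 * ((ε * θ.sa) * θ.sM * θ.sN ^ 2 * (θ.sb * θ.sM)) := by gcongr
      _ = _ := by ring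
  · calc _ ≤ θ.R * (θ.sH ^ 2 * (ε * θ.sN ^ 2) * θ.sM ^ 2) := by gcongr; exact h.sN2_le_sq
      _ = _ := by ring
  · calc _ ≤ θ.R * (θ.sH ^ 2 * (ε * θ.sM ^ 2) * θ.sN ^ 2) := by gcongr; exact h.sM2_le_sq
      _ = _ := by ring
  · have m2 := h.sM_le_sq
    calc _ ≤ θ.R ^ 2 * ((ε * θ.sb) * (θ.sa * θ.sN) * θ.sM ^ 2 * θ.sN) := by gcongr
      _ = _ := by ring
  · have m2 := h.sM_le_ε_sq
    have n2 := h.sN_le_sq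
    calc _ ≤ θ.R * (θ.sH ^ 2 * (ε * θ.sM ^ 2) * θ.sN ^ 2) := by gcongr
      _ = _ := by ring
  · calc _ = θ.R ^ 2 * (θ.sH2 * θ.sH2 * θ.sM2 * θ.sN2) := by ring
      _ ≤ θ.R ^ 2 * ((ε * θ.sa) * θ.sb * θ.sM ^ 2 * θ.sN ^ 2) := by gcongr
      _ = _ := by ring
  · have m2 := h.sM_le_sq
    have n2 := h.sN_le_sq
    calc _ = θ.R ^ 2 * (θ.sH2 * θ.sH2 * θ.sM * θ.sN) := by ring
      _ ≤ θ.R ^ 2 * ((ε * θ.sa) * θ.sb * θ.sM ^ 2 * θ.sN ^ 2) := by gcongr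
      _ = _ := by ring
  · calc _ ≤ θ.R * (θ.sH ^ 2 * (ε * θ.sM ^ 2) * θ.sN ^ 2) := by gcongr; exact h.sM2_le_sq
      _ = _ := by ring

/-- The list for `R * Qb` and for the estimated coefficients `t`. The gain `ε` comes from a second
power sum, as in `sM2 ≤ ε sM²`, from `1 ≤ ε sM`, or from `1 ≤ ε sH`. -/
theorem negligible' :
    θ.R ^ 2 * (θ.sN2 * θ.sM2 * θ.sH ^ 4) ≤ ε * θ.V0 ∧
    θ.R ^ 2 * (θ.sb * θ.sH * θ.sN * θ.sM ^ 2) ≤ ε * θ.V0 ∧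
    θ.R ^ 2 * (θ.sa * θ.sH * θ.sM * θ.sN ^ 2) ≤ ε * θ.V0 ∧
    θ.R ^ 2 * (θ.sb * θ.sN * θ.sM2 * θ.sH ^ 2) ≤ ε * θ.V0 ∧
    θ.R ^ 2 * (θ.sa * θ.sM * θ.sN2 * θ.sH ^ 2) ≤ ε * θ.V0 ∧
    θ.R ^ 2 * (θ.sa * θ.sb * θ.sM2 * θ.sN2) ≤ ε * θ.V0 ∧
    θ.R ^ 2 * (θ.sa * θ.sb * θ.sM * θ.sN) ≤ ε * θ.V0 ∧
    θ.R ^ 2 * (θ.sb * θ.sH * θ.sN * θ.sM2) ≤ ε * θ.V0 ∧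
    θ.R ^ 2 * (θ.sa * θ.sH * θ.sM * θ.sN2) ≤ ε * θ.V0 ∧
    θ.R ^ 2 * (θ.sH ^ 2 * θ.sM * θ.sN) ≤ ε * θ.V0 := by
  have hR := R_pos (θ := θ)
  have ha := h.sa_pos
  have hb := h.sb_pos
  have hM := h.one_le_sM
  have hN := h.one_le_sN
  have hM2 := sM2_nonneg (θ := θ)
  have hN2 := sN2_nonneg (θ := θ)
  have hε := h.pos
  have hM' : 0 ≤ θ.sM := sM_nonneg
  have hN' : 0 ≤ θ.sN := sN_nonneg
  have e1 := sH_sq_le_sa_mul_sN (θ := θ)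
  have e2 := sH_sq_le_sb_mul_sM (θ := θ)
  have hH := h.one_le_sH
  have e3 := h.sH_le_sa_sN
  have e4 := h.sH_le_sb_sM
  have m1 := h.sM2_le_sq'
  have n1 := h.sN2_le_sq'
  refine ⟨h.le_ε_V0_right ?_, h.le_ε_V0_right ?_, h.le_ε_V0_right ?_, h.le_ε_V0_right ?_,
    h.le_ε_V0_right ?_, h.le_ε_V0_right ?_, h.le_ε_V0_right ?_, h.le_ε_V0_right ?_,
    h.le_ε_V0_right ?_, h.le_ε_V0_right ?_⟩
  · have n2 : θ.sN2 ≤ θ.sN := h.sN2_le.trans (mul_le_of_le_one_left hN' h.ε_le_one)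
    have := sH_pow_four_le (θ := θ)
    calc _ ≤ θ.R ^ 2 * (θ.sN * (ε * θ.sM) * (θ.sa * θ.sb * (θ.sM * θ.sN))) := by
          gcongr
          exact h.sM2_le
      _ = _ := by ring
  · calc _ ≤ θ.R ^ 2 * (θ.sb * (ε * (θ.sa * θ.sN)) * θ.sN * θ.sM ^ 2) := by gcongr
      _ = _ := by ring
  · calc _ ≤ θ.R ^ 2 * (θ.sa * (ε * (θ.sb * θ.sM)) * θ.sM * θ.sN ^ 2) := by gcongr
      _ = _ := by ring
  · calc _ ≤ θ.R ^ 2 * (θ.sb * θ.sN * (ε * θ.sM ^ 2) * (θ.sa * θ.sN)) := by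
          gcongr
          exact h.sM2_le_sq
      _ = _ := by ring
  · calc _ ≤ θ.R ^ 2 * (θ.sa * θ.sM * (ε * θ.sN ^ 2) * (θ.sb * θ.sM)) := by
          gcongr
          exact h.sN2_le_sq
      _ = _ := by ring
  · calc _ ≤ θ.R ^ 2 * (θ.sa * θ.sb * (ε * θ.sM ^ 2) * θ.sN ^ 2) := by
          gcongr
          exact h.sM2_le_sq
      _ = _ := by ring
  · have m2 := h.sM_le_ε_sq
    have n2 := h.sN_le_sq
    calc _ ≤ θ.R ^ 2 * (θ.sa * θ.sb * (ε * θ.sM ^ 2) * θ.sN ^ 2) := by gcongr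
      _ = _ := by ring
  · calc _ ≤ θ.R ^ 2 * (θ.sb * (ε * (θ.sa * θ.sN)) * θ.sN * θ.sM ^ 2) := by gcongr
      _ = _ := by ring
  · calc _ ≤ θ.R ^ 2 * (θ.sa * (ε * (θ.sb * θ.sM)) * θ.sM * θ.sN ^ 2) := by gcongr
      _ = _ := by ring
  · have := h.sH_sq_le_four
    calc _ ≤ θ.R ^ 2 * (ε * (θ.sa * θ.sb * (θ.sM * θ.sN)) * θ.sM * θ.sN) := by gcongr
      _ = _ := by ring

/-- The bounds on second moments of leading order. -/
theorem leading :
    θ.R * (θ.sH ^ 2 * θ.sM ^ 2 * θ.sN ^ 2) ≤ θ.V0 ∧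
    θ.R ^ 2 * (θ.sH ^ 4 * θ.sM * θ.sN) ≤ θ.V0 ∧
    θ.R ^ 2 * (θ.sa * θ.sb * θ.sM ^ 2 * θ.sN ^ 2) ≤ θ.V0 ∧
    θ.R ^ 2 * (θ.sb * θ.sN * θ.sM ^ 2 * θ.sH ^ 2) ≤ θ.V0 ∧
    θ.R ^ 2 * (θ.sa * θ.sM * θ.sN ^ 2 * θ.sH ^ 2) ≤ θ.V0 := by
  have hR := R_pos (θ := θ)
  have ha := h.sa_pos
  have hb := h.sb_pos
  have hM' : 0 ≤ θ.sM := sM_nonneg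
  have hN' : 0 ≤ θ.sN := sN_nonneg
  have e1 := sH_sq_le_sa_mul_sN (θ := θ)
  have e2 := sH_sq_le_sb_mul_sM (θ := θ)
  refine ⟨h.le_V0_left (le_of_eq (by ring)), le_V0_right ?_, le_V0_right (le_of_eq (by ring)),
    le_V0_right ?_, le_V0_right ?_⟩
  · have := sH_pow_four_le (θ := θ)
    calc _ ≤ θ.R ^ 2 * ((θ.sa * θ.sb * (θ.sM * θ.sN)) * θ.sM * θ.sN) := by gcongr
      _ = _ := by ring
  · calc _ ≤ θ.R ^ 2 * (θ.sb * θ.sN * θ.sM ^ 2 * (θ.sa * θ.sN)) := by gcongr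
      _ = _ := by ring
  · calc _ ≤ θ.R ^ 2 * (θ.sa * θ.sM * θ.sN ^ 2 * (θ.sb * θ.sM)) := by gcongr
      _ = _ := by ring

end Sparse

end Param

/-! ### Expansion of the two quadruple counts -/

section Expansion

variable {n : ℕ} {θ : Param n}

theorem dyad_eq_add (θ : Param n) (G : Graph n) (a b : Bool) :
    Graph.dyad G a b = fun i j => θ.dyadProb a b i j + cen θ a b G i j := by
  funext i j
  simp [cen]

theorem cyc_rotate' (e f g h : Fin n → Fin n → ℝ) : cyc e f g h = cyc f g h e :=
  (cyc_rotate f g h e).symm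

theorem cyc_rotate₂ (e f g h : Fin n → Fin n → ℝ) : cyc e f g h = cyc g h e f := by
  rw [cyc_rotate', cyc_rotate']

/-- The expected value of `Q_n(a)`. -/
noncomputable def meanQ (θ : Param n) : ℝ :=
  cyc (θ.dyadProb true true) (θ.dyadProb false false) (θ.dyadProb false true)
    (θ.dyadProb false false)

/-- The first order part of `Q_n(a)`. -/
noncomputable def linA (θ : Param n) (G : Graph n) : ℝ :=
  cyc (cen θ true true G) (θ.dyadProb false false) (θ.dyadProb false true) (θ.dyadProb false false)
  + cyc (θ.dyadProb true true) (θ.dyadProb false false) (cen θ false true G)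
    (θ.dyadProb false false)

/-- The first order part of `Q_n(b)`. -/
noncomputable def linB (θ : Param n) (G : Graph n) : ℝ :=
  cyc (cen θ true false G) (θ.dyadProb true false) (θ.dyadProb false false) (θ.dyadProb true false)
  + cyc (θ.dyadProb true false) (cen θ true false G) (θ.dyadProb false false)
    (θ.dyadProb true false)
  + cyc (θ.dyadProb true false) (θ.dyadProb true false) (θ.dyadProb false false)
    (cen θ true false G)

/-- Both patterns place the weight `η_i η_j ν_k μ_l` on the nodes, the reciprocated dyad of the
first adding the factor `R`, and the factors `K` belong to the same four dyads. This identity is the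
reason why the log-ratio estimates `ρ`. -/
theorem R_mul_cyc_eq_meanQ : θ.R * cyc (θ.dyadProb true false) (θ.dyadProb true false)
    (θ.dyadProb false false) (θ.dyadProb true false) = meanQ θ := by
  unfold meanQ cyc
  simp only [Finset.mul_sum]
  refine Finset.sum_congr rfl fun i _ => Finset.sum_congr rfl fun j _ =>
    Finset.sum_congr rfl fun k _ => Finset.sum_congr rfl fun l _ => ?_
  simp only [Param.dyadProb_eq, Param.wout_tt, Param.wout_tf, Param.wout_ft, Param.wout_ff,
    Param.win_tt, Param.win_tf, Param.win_ft, Param.win_ff, Param.η]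
  ring

variable {Ω : Type*} [MeasurableSpace Ω] {P : Measure Ω}
  [IsProbabilityMeasure P] {A : Ω → Graph n}

theorem ex_list_sum_sq_le (hm : Measurable A) {B : ℝ} (L : List (Graph n → ℝ))
    (hL : ∀ f ∈ L, ex P A (fun G => f G ^ 2) ≤ B) :
    ex P A (fun G => ((L.map fun f => f G).sum) ^ 2) ≤ (L.length : ℝ) ^ 2 * B := by
  have h1 : ∀ G : Graph n, ((L.map fun f => f G).sum) ^ 2
      ≤ (L.length : ℝ) * ∑ k : Fin L.length, (L.get k) G ^ 2 := by
    intro G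
    have e : (L.map fun f => f G).sum = ∑ k : Fin L.length, (L.get k) G := by
      rw [← List.sum_ofFn, ← List.ofFn_get (L.map fun f => f G)]
      congr 1
      simp [List.ofFn_eq_map]
    rw [e]
    simpa using sq_sum_le_card_mul_sum_sq (s := (Finset.univ : Finset (Fin L.length)))
      (f := fun k => (L.get k) G)
  refine (ex_mono hm h1).trans ?_
  rw [ex_const_mul, ex_sum hm, sq, mul_assoc]
  gcongr
  refine (Finset.sum_le_sum fun k _ => hL _ (L.get_mem k)).trans (le_of_eq ?_)
  simp

variable (hA : IsP1Model θ P A) {ε c : ℝ} (h : θ.Sparse ε c)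
include hA h

/-- Of the sixteen terms of the fourfold product, the mean and the two terms of `linA` are removed.
The other thirteen, including the two linear in `A^{00}`, each have second moment at most `4096 ε
V0`, and `13² * 4096 ≤ 700000`. -/
theorem ex_remA_sq_le :
    ex P A (fun G => (Graph.Qa G - meanQ θ - linA θ G) ^ 2) ≤ 700000 * (ε * θ.V0) := by
  obtain ⟨n1, n2, n3, n4, n5, n6, n7, n8, n9⟩ := h.negligible
  have B11 := Bd.dyadProb θ true true
  have B00 := Bd.dyadProb θ false false
  have B01 := Bd.dyadProb θ false true
  set X11 := cen θ true true with hX11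
  set X00 := cen θ false false with hX00
  set X01 := cen θ false true with hX01
  set p11 := θ.dyadProb true true with hp11
  set p00 := θ.dyadProb false false with hp00
  set p01 := θ.dyadProb false true with hp01
  have key := ex_list_sum_sq_le hA.measurable (P := P) (B := 4096 * (ε * θ.V0))
    [fun G => cyc p11 (X00 G) p01 p00, fun G => cyc p11 p00 p01 (X00 G),
     fun G => cyc (X11 G) (X00 G) p01 p00, fun G => cyc (X11 G) p00 p01 (X00 G),
     fun G => cyc p11 (X00 G) (X01 G) p00, fun G => cyc p11 p00 (X01 G) (X00 G),
     fun G => cyc (X11 G) p00 (X01 G) p00, fun G => cyc p11 (X00 G) p01 (X00 G),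
     fun G => cyc (X11 G) (X00 G) (X01 G) p00, fun G => cyc p11 (X00 G) (X01 G) (X00 G),
     fun G => cyc (X11 G) p00 (X01 G) (X00 G), fun G => cyc (X11 G) (X00 G) p01 (X00 G),
     fun G => cyc (X11 G) (X00 G) (X01 G) (X00 G)] ?_
  · refine le_trans (le_of_eq ?_) (key.trans ?_)
    · congr 1
      funext G
      rw [Qa_eq]
      simp only [dyad_eq_add θ G, cyc_add₁, cyc_add₂, cyc_add₃, cyc_add₄, List.map_cons,
        List.map_nil, List.sum_cons, List.sum_nil, meanQ, linA]
      ring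
    · simp only [List.length_cons, List.length_nil]
      have := mul_nonneg h.pos.le (Param.V0_nonneg (θ := θ))
      push_cast
      linarith
  · simp only [List.forall_mem_cons]
    have fin : ∀ {x y z : ℝ}, x ≤ 4096 * y → y = z → z ≤ ε * θ.V0 → x ≤ 4096 * (ε * θ.V0) := by
      intro x y z h1 h2 h3
      linarith
    refine ⟨?_, ?_, ?_, ?_, ?_, ?_, ?_, ?_, ?_, ?_, ?_, ?_, ?_, by simp⟩
    · simp only [cyc_rotate' p11]
      refine fin (ex_cyc_one_sq_le hA (false, false) B01 B00 B11) ?_ n1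
      simp [-mul_eq_mul_left_iff] <;> ring
    · simp only [cyc_rotate p11]
      refine fin (ex_cyc_one_sq_le hA (false, false) B11 B00 B01) ?_ n2
      simp [-mul_eq_mul_left_iff] <;> ring
    · refine fin (ex_cyc_two_sq_le hA (true, true) (false, false) B01 B00) ?_ n3
      simp [-mul_eq_mul_left_iff] <;> ring
    · simp only [cyc_rotate (X11 _)]
      refine fin (ex_cyc_two_sq_le hA (false, false) (true, true) B00 B01) ?_ n4
      simp [-mul_eq_mul_left_iff] <;> ring
    · simp only [cyc_rotate' p11]
      refine fin (ex_cyc_two_sq_le hA (false, false) (false, true) B00 B11) ?_ n5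
      simp [-mul_eq_mul_left_iff] <;> ring
    · simp only [cyc_rotate₂ p11]
      refine fin (ex_cyc_two_sq_le hA (false, true) (false, false) B11 B00) ?_ n5
      simp [-mul_eq_mul_left_iff] <;> ring
    · refine fin (ex_cyc_opposite_sq_le hA (true, true) (false, true) B00 B00) ?_ n6
      simp [-mul_eq_mul_left_iff] <;> ring
    · simp only [cyc_rotate' p11]
      refine fin (ex_cyc_opposite_sq_le hA (false, false) (false, false) B01 B11) ?_ n7
      simp [-mul_eq_mul_left_iff] <;> ring
    · refine fin (ex_cyc_three_sq_le hA (true, true) (false, false) (false, true) B00) ?_ n6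
      simp [-mul_eq_mul_left_iff] <;> ring
    · simp only [cyc_rotate' p11]
      refine fin (ex_cyc_three_sq_le hA (false, false) (false, true) (false, false) B11) ?_ n8
      simp [-mul_eq_mul_left_iff] <;> ring
    · simp only [cyc_rotate₂ (X11 _)]
      refine fin (ex_cyc_three_sq_le hA (false, true) (false, false) (true, true) B00) ?_ n6
      simp [-mul_eq_mul_left_iff] <;> ring
    · simp only [cyc_rotate (X11 _)]
      refine fin (ex_cyc_three_sq_le hA (false, false) (true, true) (false, false) B01) ?_ n9
      simp [-mul_eq_mul_left_iff] <;> ring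
    · refine fin (ex_cyc_four_sq_le hA (true, true) (false, false) (false, true) (false, false))
        ?_ n6
      simp [-mul_eq_mul_left_iff] <;> ring

/-- Here `linB` keeps three linear terms, so twelve terms remain, among them again the one linear in
`A^{00}`, and `12² * 4096 ≤ 700000`. -/
theorem ex_remB_sq_le :
    ex P A (fun G => (θ.R * Graph.Qb G - meanQ θ - θ.R * linB θ G) ^ 2)
      ≤ 700000 * (ε * θ.V0) := by
  obtain ⟨n1, n2, n3, n4, n5, n6, n7, n8, n9, n10⟩ := h.negligible'
  have B10 := Bd.dyadProb θ true false
  have B00 := Bd.dyadProb θ false false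
  set X10 := cen θ true false with hX10
  set X00 := cen θ false false with hX00
  set p10 := θ.dyadProb true false with hp10
  set p00 := θ.dyadProb false false with hp00
  have key := ex_list_sum_sq_le hA.measurable (P := P) (B := 4096 * (ε * θ.V0))
    [fun G => θ.R * cyc p10 p10 (X00 G) p10,
     fun G => θ.R * cyc (X10 G) (X10 G) p00 p10, fun G => θ.R * cyc (X10 G) p10 p00 (X10 G),
     fun G => θ.R * cyc p10 (X10 G) (X00 G) p10, fun G => θ.R * cyc p10 p10 (X00 G) (X10 G),
     fun G => θ.R * cyc (X10 G) p10 (X00 G) p10, fun G => θ.R * cyc p10 (X10 G) p00 (X10 G),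
     fun G => θ.R * cyc (X10 G) (X10 G) (X00 G) p10, fun G => θ.R * cyc p10 (X10 G) (X00 G) (X10 G),
     fun G => θ.R * cyc (X10 G) p10 (X00 G) (X10 G), fun G => θ.R * cyc (X10 G) (X10 G) p00 (X10 G),
     fun G => θ.R * cyc (X10 G) (X10 G) (X00 G) (X10 G)] ?_
  · refine le_trans (le_of_eq ?_) (key.trans ?_)
    · congr 1
      funext G
      rw [Qb_eq, ← R_mul_cyc_eq_meanQ]
      simp only [dyad_eq_add θ G, cyc_add₁, cyc_add₂, cyc_add₃, cyc_add₄, List.map_cons,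
        List.map_nil, List.sum_cons, List.sum_nil, linB]
      ring
    · simp only [List.length_cons, List.length_nil]
      have := mul_nonneg h.pos.le (Param.V0_nonneg (θ := θ))
      push_cast
      linarith
  · simp only [List.forall_mem_cons]
    have fin : ∀ {f : Graph n → ℝ} {y z : ℝ}, ex P A (fun G => f G ^ 2) ≤ 4096 * y →
        θ.R ^ 2 * y = z → z ≤ ε * θ.V0 →
        ex P A (fun G => (θ.R * f G) ^ 2) ≤ 4096 * (ε * θ.V0) := by
      intro f y z h1 h2 h3
      simp only [mul_pow]
      rw [ex_const_mul]
      have : 0 ≤ θ.R ^ 2 := sq_nonneg _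
      nlinarith [mul_le_mul_of_nonneg_left h1 this]
    refine ⟨?_, ?_, ?_, ?_, ?_, ?_, ?_, ?_, ?_, ?_, ?_, ?_, by simp⟩
    · simp only [cyc_rotate₂ p10 p10 (X00 _) p10]
      refine fin (ex_cyc_one_sq_le hA (false, false) B10 B10 B10) ?_ n1
      simp [-mul_eq_mul_left_iff] <;> ring
    · refine fin (ex_cyc_two_sq_le hA (true, false) (true, false) B00 B10) ?_ n2
      simp [-mul_eq_mul_left_iff]
    · simp only [cyc_rotate (X10 _) p10 p00 (X10 _)]
      refine fin (ex_cyc_two_sq_le hA (true, false) (true, false) B10 B00) ?_ n3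
      simp [-mul_eq_mul_left_iff] <;> ring
    · simp only [cyc_rotate' p10]
      refine fin (ex_cyc_two_sq_le hA (true, false) (false, false) B10 B10) ?_ n4
      simp [-mul_eq_mul_left_iff]
    · simp only [cyc_rotate₂ p10 p10]
      refine fin (ex_cyc_two_sq_le hA (false, false) (true, false) B10 B10) ?_ n5
      simp [-mul_eq_mul_left_iff] <;> ring
    · refine fin (ex_cyc_opposite_sq_le hA (true, false) (false, false) B10 B10) ?_ n6
      simp [-mul_eq_mul_left_iff] <;> ring
    · simp only [cyc_rotate' p10]
      refine fin (ex_cyc_opposite_sq_le hA (true, false) (true, false) B00 B10) ?_ n7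
      simp [-mul_eq_mul_left_iff] <;> ring
    · refine fin (ex_cyc_three_sq_le hA (true, false) (true, false) (false, false) B10) ?_ n8
      simp [-mul_eq_mul_left_iff]
    · simp only [cyc_rotate' p10]
      refine fin (ex_cyc_three_sq_le hA (true, false) (false, false) (true, false) B10) ?_ n7
      simp [-mul_eq_mul_left_iff] <;> ring
    · simp only [cyc_rotate₂ (X10 _)]
      refine fin (ex_cyc_three_sq_le hA (false, false) (true, false) (true, false) B10) ?_ n9
      simp [-mul_eq_mul_left_iff] <;> ring
    · simp only [cyc_rotate (X10 _) (X10 _) p00 (X10 _)]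
      refine fin (ex_cyc_three_sq_le hA (true, false) (true, false) (true, false) B00) ?_ n10
      simp [-mul_eq_mul_left_iff] <;> ring
    · refine fin (ex_cyc_four_sq_le hA (true, false) (true, false) (false, false) (true, false))
        ?_ n10
      simp [-mul_eq_mul_left_iff] <;> ring

theorem ex_linA_sq_le : ex P A (fun G => linA θ G ^ 2) ≤ 20000 * θ.V0 := by
  obtain ⟨n1, n2, n3, n4, n5⟩ := h.leading
  have B11 := Bd.dyadProb θ true true
  have B00 := Bd.dyadProb θ false false
  have B01 := Bd.dyadProb θ false true
  have V := Param.V0_nonneg (θ := θ)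
  have h1 := ex_cyc_one_sq_le hA (true, true) B00 B01 B00
  have h2 := ex_cyc_one_sq_le hA (false, true) B00 B11 B00
  simp only [cyc_rotate₂ (cen θ (false, true).1 (false, true).2 _)] at h2
  simp [mul_pow] at h1 h2
  refine (ex_add_sq_le hA.measurable _ _).trans ?_
  nlinarith

theorem ex_linB_sq_le : ex P A (fun G => (θ.R * linB θ G) ^ 2) ≤ 50000 * θ.V0 := by
  obtain ⟨n1, n2, n3, n4, n5⟩ := h.leading
  have B10 := Bd.dyadProb θ true false
  have B00 := Bd.dyadProb θ false false
  have V := Param.V0_nonneg (θ := θ)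
  have h1 := ex_cyc_one_sq_le hA (true, false) B10 B00 B10
  have h2 := ex_cyc_one_sq_le hA (true, false) B00 B10 B10
  have h3 := ex_cyc_one_sq_le hA (true, false) B10 B10 B00
  simp only [cyc_rotate (cen θ (true, false).1 (true, false).2 _)] at h2
  simp only [cyc_rotate' (cen θ (true, false).1 (true, false).2 _)] at h3
  simp at h1 h2 h3
  have hR : 0 ≤ θ.R ^ 2 := sq_nonneg _
  simp only [mul_pow]
  rw [ex_const_mul]
  have e : ex P A (fun G => linB θ G ^ 2) ≤ _ :=
    (ex_add_sq_le hA.measurable _ _).trans (add_le_add_left (mul_le_mul_of_nonneg_left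
      (ex_add_sq_le hA.measurable _ _) zero_le_two) _)
  have e' := mul_le_mul_of_nonneg_left e hR
  have h1' := mul_le_mul_of_nonneg_left h1 hR
  have h2' := mul_le_mul_of_nonneg_left h2 hR
  have h3' := mul_le_mul_of_nonneg_left h3 hR
  refine e'.trans ?_
  linarith

end Expansion

end P1

namespace P1

/-! ### Lower bounds for path sums -/

section PathLowerBound

variable {n : ℕ}

/-- A union bound over the five coincidences that remain possible once `i ≠ j`. -/
theorem le_dst {i j : Fin n} (hij : i ≠ j) (k l : Fin n) :
    1 - (if k = i then (1 : ℝ) else 0) - (if k = j then (1 : ℝ) else 0)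
      - (if l = i then (1 : ℝ) else 0) - (if l = j then (1 : ℝ) else 0)
      - (if k = l then (1 : ℝ) else 0) ≤ dst i j k l := by
  have h0 := dst_nonneg i j k l
  by_cases h1 : k = i
  · rw [if_pos h1]; split_ifs <;> linarith
  by_cases h2 : k = j
  · rw [if_pos h2]; split_ifs <;> linarith
  by_cases h3 : l = i
  · rw [if_pos h3]; split_ifs <;> linarith
  by_cases h4 : l = j
  · rw [if_pos h4]; split_ifs <;> linarith
  by_cases h5 : k = l
  · rw [if_pos h5]; split_ifs <;> linarith
  have : dst i j k l = 1 := if_pos ⟨hij, Ne.symm h1, Ne.symm h3, Ne.symm h2, Ne.symm h4, h5⟩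
  rw [this]
  simp [h1, h2, h3, h4, h5]

/-- Each of the five coincidences fixes or identifies an index, and thereby removes at most a
fraction `δ` of the full product. -/
theorem le_sum_dst_mul {i j : Fin n} (hij : i ≠ j) {p q : Fin n → ℝ} (hp : ∀ k, 0 ≤ p k)
    (hq : ∀ k, 0 ≤ q k) {δ : ℝ} (hpδ : ∀ k, p k ≤ δ * ∑ x, p x) (hqδ : ∀ k, q k ≤ δ * ∑ x, q x) :
    (1 - 5 * δ) * ((∑ x, p x) * ∑ x, q x) ≤ ∑ k, ∑ l, dst i j k l * (p k * q l) := by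
  have hP : 0 ≤ ∑ x, p x := Finset.sum_nonneg fun k _ => hp k
  have hQ : 0 ≤ ∑ x, q x := Finset.sum_nonneg fun k _ => hq k
  set Sp := ∑ x, p x
  set Sq := ∑ x, q x
  have e : ∑ k, ∑ l, (1 - (if k = i then (1 : ℝ) else 0) - (if k = j then (1 : ℝ) else 0)
      - (if l = i then (1 : ℝ) else 0) - (if l = j then (1 : ℝ) else 0)
      - (if k = l then (1 : ℝ) else 0)) * (p k * q l)
      = Sp * Sq - p i * Sq - p j * Sq - Sp * q i - Sp * q j - ∑ k, p k * q k := by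
    simp only [sub_mul, one_mul, Finset.sum_sub_distrib, ite_mul, zero_mul, Finset.sum_ite_eq,
      Finset.sum_ite_eq', Finset.mem_univ, if_true]
    have h1 : ∑ k, ∑ l, p k * q l = Sp * Sq := by rw [Finset.sum_mul_sum]
    have h2 : ∀ a, ∑ k, ∑ l, (if k = a then p k * q l else 0) = p a * Sq := by
      intro a
      rw [Finset.sum_eq_single a (by intro b _ hb; simp [hb]) (by simp)]
      simp [Finset.mul_sum, Sq]
    rw [h1, h2, h2, ← Finset.sum_mul, ← Finset.sum_mul]
  have hd : ∑ k, p k * q k ≤ δ * Sp * Sq := by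
    calc ∑ k, p k * q k ≤ ∑ k, δ * Sp * q k :=
          Finset.sum_le_sum fun k _ => mul_le_mul_of_nonneg_right (hpδ k) (hq k)
      _ = _ := (Finset.mul_sum _ _ _).symm
  have k1 := mul_le_mul_of_nonneg_right (hpδ i) hQ
  have k2 := mul_le_mul_of_nonneg_right (hpδ j) hQ
  have k3 := mul_le_mul_of_nonneg_left (hqδ i) hP
  have k4 := mul_le_mul_of_nonneg_left (hqδ j) hP
  refine le_trans ?_ (Finset.sum_le_sum fun k _ => Finset.sum_le_sum fun l _ =>
    mul_le_mul_of_nonneg_right (le_dst hij k l) (mul_nonneg (hp k) (hq l)))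
  rw [e]
  nlinarith

/-- Three factors `1 - 3ε` from the edge bounds and `1 - 5ε` from distinctness have product at least
`1 - 14ε`. -/
theorem le_pth {f g h : Fin n → Fin n → ℝ} {p q p' q' p'' q'' : Fin n → ℝ} (hf : Bd f p q)
    (hg : Bd g p' q') (hh : Bd h p'' q'') {ε : ℝ} (hε : 0 ≤ ε) (hε' : ε ≤ 1 / 1000)
    (lf : ∀ i j, (1 - 3 * ε) * (p i * q j) ≤ f i j)
    (lg : ∀ i j, (1 - 3 * ε) * (p' i * q' j) ≤ g i j)
    (lh : ∀ i j, (1 - 3 * ε) * (p'' i * q'' j) ≤ h i j)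
    (hk : ∀ k, q k * p' k ≤ ε * ∑ x, q x * p' x)
    (hl : ∀ k, q' k * p'' k ≤ ε * ∑ x, q' x * p'' x) {i j : Fin n} (hij : i ≠ j) :
    (1 - 14 * ε) * (p j * (∑ k, q k * p' k) * (∑ l, q' l * p'' l) * q'' i) ≤ pth i j f g h := by
  have hδ : 0 ≤ 1 - 3 * ε := by linarith
  have h0 : ∀ k, 0 ≤ q k * p' k := fun k => mul_nonneg (hf.right_nonneg k) (hg.left_nonneg k)
  have h1 : ∀ k, 0 ≤ q' k * p'' k := fun k => mul_nonneg (hg.right_nonneg k) (hh.left_nonneg k)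
  have key := le_sum_dst_mul hij h0 h1 hk hl
  have hpj := hf.left_nonneg j
  have hqi := hh.right_nonneg i
  have hS0 : 0 ≤ ∑ k, q k * p' k := Finset.sum_nonneg fun k _ => h0 k
  have hS1 : 0 ≤ ∑ k, q' k * p'' k := Finset.sum_nonneg fun k _ => h1 k
  have hS : 0 ≤ p j * (∑ k, q k * p' k) * (∑ l, q' l * p'' l) * q'' i := by positivity
  calc _ ≤ (1 - 3 * ε) ^ 3 * (1 - 5 * ε)
          * (p j * (∑ k, q k * p' k) * (∑ l, q' l * p'' l) * q'' i) := by
        refine mul_le_mul_of_nonneg_right ?_ hS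
        nlinarith [mul_nonneg hε hε, pow_nonneg hε 3, pow_nonneg hε 4]
    _ = (1 - 3 * ε) ^ 3 * (p j * q'' i)
          * ((1 - 5 * ε) * ((∑ k, q k * p' k) * ∑ l, q' l * p'' l)) := by ring
    _ ≤ (1 - 3 * ε) ^ 3 * (p j * q'' i)
          * ∑ k, ∑ l, dst i j k l * ((q k * p' k) * (q' l * p'' l)) := by gcongr
    _ = ∑ k, ∑ l, dst i j k l * (((1 - 3 * ε) * (p j * q k)) * ((1 - 3 * ε) * (p' k * q' l))
          * ((1 - 3 * ε) * (p'' l * q'' i))) := by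
        rw [Finset.mul_sum]
        refine Finset.sum_congr rfl fun k _ => ?_
        rw [Finset.mul_sum]
        refine Finset.sum_congr rfl fun l _ => ?_
        ring
    _ ≤ _ := by
        refine Finset.sum_le_sum fun k _ => Finset.sum_le_sum fun l _ =>
          mul_le_mul_of_nonneg_left ?_ (dst_nonneg _ _ _ _)
        have a1 := mul_nonneg hδ (mul_nonneg (hf.left_nonneg j) (hf.right_nonneg k))
        have a2 := mul_nonneg hδ (mul_nonneg (hg.left_nonneg k) (hg.right_nonneg l))
        have a3 := mul_nonneg hδ (mul_nonneg (hh.left_nonneg l) (hh.right_nonneg i))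
        exact mul_le_mul (mul_le_mul (lf _ _) (lg _ _) a2 (hf.nonneg _ _)) (lh _ _) a3
          (mul_nonneg (hf.nonneg _ _) (hg.nonneg _ _))

end PathLowerBound

/-! ### Leading order of the coefficients, of the mean and of the variance proxy -/

namespace Param

variable {n : ℕ} (θ : Param n)

/-- The coefficients `r`, `s`, `t` with the convention that they vanish on the diagonal. -/
noncomputable def rr (i j : Fin n) : ℝ :=
  pth i j (θ.dyadProb false false) (θ.dyadProb false true) (θ.dyadProb false false)

noncomputable def ss (i j : Fin n) : ℝ :=
  pth i j (θ.dyadProb false false) (θ.dyadProb true true) (θ.dyadProb false false)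

noncomputable def tt (i j : Fin n) : ℝ :=
  pth i j (θ.dyadProb true false) (θ.dyadProb true false) (θ.dyadProb false false)
  + pth i j (θ.dyadProb false false) (θ.dyadProb true false) (θ.dyadProb true false)
  + pth i j (θ.dyadProb true false) (θ.dyadProb false false) (θ.dyadProb true false)

noncomputable def uu (i j : Fin n) : ℝ := θ.ss i j - θ.R * θ.tt i j

/-- The leading order of `t`. -/
noncomputable def τ (i j : Fin n) : ℝ :=
  θ.μ j * θ.sH * θ.sN + θ.ν i * θ.sM * θ.sH + θ.μ j * θ.ν i * (θ.sM * θ.sN)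

variable {θ}

@[simp] theorem rr_self (i : Fin n) : θ.rr i i = 0 := pth_self _ _ _ _
@[simp] theorem ss_self (i : Fin n) : θ.ss i i = 0 := pth_self _ _ _ _
@[simp] theorem tt_self (i : Fin n) : θ.tt i i = 0 := by simp [tt, pth_self]
@[simp] theorem uu_self (i : Fin n) : θ.uu i i = 0 := by simp [uu]

theorem rr_eq {i j : Fin n} (h : i ≠ j) : θ.rr i j = θ.r i j := pth_eq_sum_others h _ _ _
theorem ss_eq {i j : Fin n} (h : i ≠ j) : θ.ss i j = θ.s i j := pth_eq_sum_others h _ _ _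
theorem tt_eq {i j : Fin n} (h : i ≠ j) : θ.tt i j = θ.t i j := by
  rw [tt, pth_eq_sum_others h, pth_eq_sum_others h, pth_eq_sum_others h, t,
    Finset.sum_add_distrib, Finset.sum_add_distrib]

theorem V_eq : θ.V = ∑ i, ∑ j, (2 * θ.rr i j ^ 2 * θ.dyadProb true true i j
    + θ.uu i j ^ 2 * θ.dyadProb true false i j) := by
  rw [← sum_erase_eq _ (by simp), V]
  refine Finset.sum_congr rfl fun i _ => Finset.sum_congr rfl fun j hj => ?_
  have h : i ≠ j := (Finset.ne_of_mem_erase hj).symm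
  rw [uu, rr_eq h, ss_eq h, tt_eq h]
  rfl

theorem rr_nonneg (i j : Fin n) : 0 ≤ θ.rr i j :=
  pth_nonneg (dyadProb_nonneg _ _) (dyadProb_nonneg _ _) (dyadProb_nonneg _ _) i j

theorem ss_nonneg (i j : Fin n) : 0 ≤ θ.ss i j :=
  pth_nonneg (dyadProb_nonneg _ _) (dyadProb_nonneg _ _) (dyadProb_nonneg _ _) i j

theorem tt_nonneg (i j : Fin n) : 0 ≤ θ.tt i j :=
  add_nonneg (add_nonneg
    (pth_nonneg (dyadProb_nonneg _ _) (dyadProb_nonneg _ _) (dyadProb_nonneg _ _) i j)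
    (pth_nonneg (dyadProb_nonneg _ _) (dyadProb_nonneg _ _) (dyadProb_nonneg _ _) i j))
    (pth_nonneg (dyadProb_nonneg _ _) (dyadProb_nonneg _ _) (dyadProb_nonneg _ _) i j)

theorem rr_le (i j : Fin n) : θ.rr i j ≤ θ.sM * θ.sN := by
  refine (pth_le (Bd.dyadProb θ _ _) (Bd.dyadProb θ _ _) (Bd.dyadProb θ _ _) i j).trans
    (le_of_eq ?_)
  simp
  ring

theorem ss_le (i j : Fin n) : θ.ss i j ≤ θ.R * θ.sH ^ 2 := by
  refine (pth_le (Bd.dyadProb θ _ _) (Bd.dyadProb θ _ _) (Bd.dyadProb θ _ _) i j).trans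
    (le_of_eq ?_)
  simp
  ring

theorem tt_le (i j : Fin n) : θ.tt i j ≤ θ.τ i j := by
  refine (add_le_add (add_le_add
    (pth_le (Bd.dyadProb θ _ _) (Bd.dyadProb θ _ _) (Bd.dyadProb θ _ _) i j)
    (pth_le (Bd.dyadProb θ _ _) (Bd.dyadProb θ _ _) (Bd.dyadProb θ _ _) i j))
    (pth_le (Bd.dyadProb θ _ _) (Bd.dyadProb θ _ _) (Bd.dyadProb θ _ _) i j)).trans
    (le_of_eq ?_)
  simp [τ]
  ring

theorem τ_nonneg (i j : Fin n) : 0 ≤ θ.τ i j := (tt_nonneg i j).trans (tt_le i j)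

/-- The cross term has a favourable sign, since `ss` and `R * tt` are both nonnegative. -/
theorem uu_sq_le (i j : Fin n) : θ.uu i j ^ 2 ≤ θ.R ^ 2 * (θ.sH ^ 4 + θ.τ i j ^ 2) := by
  have h1 := ss_le (θ := θ) i j
  have h2 := tt_le (θ := θ) i j
  have h3 := ss_nonneg (θ := θ) i j
  have h4 := tt_nonneg (θ := θ) i j
  have hR := R_pos (θ := θ)
  have e1 := pow_le_pow_left₀ h3 h1 2
  have e2 := pow_le_pow_left₀ h4 h2 2
  have e3 := mul_le_mul_of_nonneg_left e2 (sq_nonneg θ.R)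
  have e4 : 0 ≤ θ.R * (θ.ss i j * θ.tt i j) := by positivity
  unfold uu
  nlinarith

theorem τ_sq_le (i j : Fin n) : θ.τ i j ^ 2 ≤ 3 * (θ.μ j ^ 2 * (θ.sH ^ 2 * θ.sN ^ 2)
    + θ.ν i ^ 2 * (θ.sM ^ 2 * θ.sH ^ 2) + θ.μ j ^ 2 * θ.ν i ^ 2 * (θ.sM ^ 2 * θ.sN ^ 2)) := by
  unfold τ
  nlinarith [sq_nonneg (θ.μ j * θ.sH * θ.sN - θ.ν i * θ.sM * θ.sH),
    sq_nonneg (θ.μ j * θ.sH * θ.sN - θ.μ j * θ.ν i * (θ.sM * θ.sN)),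
    sq_nonneg (θ.ν i * θ.sM * θ.sH - θ.μ j * θ.ν i * (θ.sM * θ.sN))]

/-- Product sums, in the form in which they occur in the computation of `V`. -/
theorem sum_sum_mul (f g : Fin n → ℝ) (C : ℝ) :
    ∑ i, ∑ j, C * (f i * g j) = C * ((∑ i, f i) * ∑ j, g j) := by
  rw [Finset.sum_mul_sum, Finset.mul_sum]
  simp only [Finset.mul_sum]

theorem sum_τ : ∑ i, ∑ j, θ.μ i * θ.ν j * θ.τ i j = 3 * (θ.sM * θ.sN * θ.sH ^ 2) := by
  have e : ∀ i j, θ.μ i * θ.ν j * θ.τ i j = (θ.sH * θ.sN) * (θ.μ i * (θ.μ j * θ.ν j))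
      + (θ.sM * θ.sH) * ((θ.μ i * θ.ν i) * θ.ν j)
      + (θ.sM * θ.sN) * ((θ.μ i * θ.ν i) * (θ.μ j * θ.ν j)) := by
    intro i j
    unfold τ
    ring
  simp only [e, Finset.sum_add_distrib]
  rw [sum_sum_mul θ.μ, sum_sum_mul _ θ.ν, sum_sum_mul]
  simp
  ring

theorem sum_τ_sq : ∑ i, ∑ j, θ.μ i * θ.ν j * θ.τ i j ^ 2
    = 3 * (θ.sH ^ 2 * θ.sN ^ 2 * θ.sM * θ.sa) + 3 * (θ.sH ^ 2 * θ.sM ^ 2 * θ.sN * θ.sb)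
      + θ.sM ^ 2 * θ.sN ^ 2 * θ.sa * θ.sb + 2 * (θ.sH ^ 4 * θ.sM * θ.sN) := by
  have e : ∀ i j, θ.μ i * θ.ν j * θ.τ i j ^ 2
      = (θ.sH ^ 2 * θ.sN ^ 2) * (θ.μ i * (θ.μ j ^ 2 * θ.ν j))
      + (θ.sH ^ 2 * θ.sM ^ 2) * ((θ.μ i * θ.ν i ^ 2) * θ.ν j)
      + (θ.sM ^ 2 * θ.sN ^ 2) * ((θ.μ i * θ.ν i ^ 2) * (θ.μ j ^ 2 * θ.ν j))
      + (2 * (θ.sH ^ 2 * θ.sM * θ.sN)) * ((θ.μ i * θ.ν i) * (θ.μ j * θ.ν j))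
      + (2 * (θ.sH * θ.sM * θ.sN ^ 2)) * ((θ.μ i * θ.ν i) * (θ.μ j ^ 2 * θ.ν j))
      + (2 * (θ.sH * θ.sM ^ 2 * θ.sN)) * ((θ.μ i * θ.ν i ^ 2) * (θ.μ j * θ.ν j)) := by
    intro i j
    unfold τ
    ring
  have ha : ∑ i, θ.μ i ^ 2 * θ.ν i = θ.sa := rfl
  have hb : ∑ i, θ.μ i * θ.ν i ^ 2 = θ.sb := rfl
  simp only [e, Finset.sum_add_distrib]
  rw [sum_sum_mul θ.μ, sum_sum_mul _ θ.ν, sum_sum_mul (fun i => θ.μ i * θ.ν i ^ 2),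
    sum_sum_mul (fun i => θ.μ i * θ.ν i) (fun i => θ.μ i * θ.ν i),
    sum_sum_mul (fun i => θ.μ i * θ.ν i), sum_sum_mul (fun i => θ.μ i * θ.ν i ^ 2)]
  simp only [ha, hb, sum_μ_ν, sum_μ, sum_ν]
  ring

theorem sum_μν : ∑ i, ∑ j, θ.μ i * θ.ν j = θ.sM * θ.sN := (Finset.sum_mul_sum _ _ _ _).symm

theorem sum_ηη : ∑ i, ∑ j, θ.η i * θ.η j = θ.sH ^ 2 := by
  rw [sq]; exact (Finset.sum_mul_sum _ _ _ _).symm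

/-- The second moments of the coefficients of the non-reciprocated dyads. -/
theorem sum_sq_main : θ.sM ^ 2 * θ.sN ^ 2 * (θ.sa * θ.sb)
    ≤ ∑ i, ∑ j, θ.μ i * θ.ν j * (θ.sH ^ 2 - θ.τ i j) ^ 2 := by
  have e : ∑ i, ∑ j, θ.μ i * θ.ν j * (θ.sH ^ 2 - θ.τ i j) ^ 2
      = θ.sH ^ 4 * ∑ i, ∑ j, θ.μ i * θ.ν j - 2 * θ.sH ^ 2 * ∑ i, ∑ j, θ.μ i * θ.ν j * θ.τ i j
        + ∑ i, ∑ j, θ.μ i * θ.ν j * θ.τ i j ^ 2 := by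
    simp only [Finset.mul_sum, ← Finset.sum_sub_distrib, ← Finset.sum_add_distrib]
    refine Finset.sum_congr rfl fun i _ => Finset.sum_congr rfl fun j _ => ?_
    ring
  rw [e, sum_μν, sum_τ, sum_τ_sq]
  -- Beyond the claimed term the expansion leaves `3 sH² sM sN (sa sN + sb sM) - 3 sH⁴ sM sN`, which
  -- the two Cauchy–Schwarz inequalities make nonnegative. So the difference `sH² - τ` does not
  -- cancel on average.
  have h1 := mul_le_mul_of_nonneg_left (sH_sq_le_sa_mul_sN (θ := θ))
    (mul_nonneg (sq_nonneg θ.sH) (mul_nonneg (sM_nonneg (θ := θ)) (sN_nonneg (θ := θ))))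
  have h2 := mul_le_mul_of_nonneg_left (sH_sq_le_sb_mul_sM (θ := θ))
    (mul_nonneg (sq_nonneg θ.sH) (mul_nonneg (sM_nonneg (θ := θ)) (sN_nonneg (θ := θ))))
  have h3 : 0 ≤ θ.sH ^ 4 * (θ.sM * θ.sN) :=
    mul_nonneg (by positivity) (mul_nonneg sM_nonneg sN_nonneg)
  nlinarith

/-- Cauchy–Schwarz bounds every monomial by `sM² sN² sa sb`; the coefficients add up to `1 + 3 + 3 +
1 + 2 = 10`. -/
theorem sum_weighted_le : ∑ i, ∑ j, θ.μ i * θ.ν j * (θ.sH ^ 4 + θ.τ i j ^ 2)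
    ≤ 10 * (θ.sM ^ 2 * θ.sN ^ 2 * (θ.sa * θ.sb)) := by
  have e : ∑ i, ∑ j, θ.μ i * θ.ν j * (θ.sH ^ 4 + θ.τ i j ^ 2)
      = θ.sH ^ 4 * ∑ i, ∑ j, θ.μ i * θ.ν j + ∑ i, ∑ j, θ.μ i * θ.ν j * θ.τ i j ^ 2 := by
    simp only [Finset.mul_sum, ← Finset.sum_add_distrib]
    refine Finset.sum_congr rfl fun i _ => Finset.sum_congr rfl fun j _ => ?_
    ring
  rw [e, sum_μν, sum_τ_sq]
  have M := sM_nonneg (θ := θ)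
  have N := sN_nonneg (θ := θ)
  have a := sa_nonneg (θ := θ)
  have b := sb_nonneg (θ := θ)
  have h1 := mul_le_mul_of_nonneg_left (sH_sq_le_sb_mul_sM (θ := θ))
    (show 0 ≤ θ.sN ^ 2 * θ.sM * θ.sa by positivity)
  have h2 := mul_le_mul_of_nonneg_left (sH_sq_le_sa_mul_sN (θ := θ))
    (show 0 ≤ θ.sM ^ 2 * θ.sN * θ.sb by positivity)
  have h3 := mul_le_mul_of_nonneg_left (Sparse.sH_pow_four_le (θ := θ)) (mul_nonneg M N)
  nlinarith

theorem sum_uu_sq_le : ∑ i, ∑ j, θ.uu i j ^ 2 * θ.dyadProb true false i j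
    ≤ 10 * (θ.R ^ 2 * θ.sa * θ.sb * (θ.sM ^ 2 * θ.sN ^ 2)) := by
  have hR := R_pos (θ := θ)
  calc _ ≤ ∑ i, ∑ j, θ.R ^ 2 * (θ.μ i * θ.ν j * (θ.sH ^ 4 + θ.τ i j ^ 2)) := by
        refine Finset.sum_le_sum fun i _ => Finset.sum_le_sum fun j _ => ?_
        refine (mul_le_mul (uu_sq_le i j) (dyadProb_le true false i j) (dyadProb_nonneg _ _ _ _)
          (by positivity)).trans (le_of_eq ?_)
        simp
        ring
    _ = θ.R ^ 2 * ∑ i, ∑ j, θ.μ i * θ.ν j * (θ.sH ^ 4 + θ.τ i j ^ 2) := by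
        simp only [Finset.mul_sum]
    _ ≤ θ.R ^ 2 * (10 * (θ.sM ^ 2 * θ.sN ^ 2 * (θ.sa * θ.sb))) :=
        mul_le_mul_of_nonneg_left sum_weighted_le (sq_nonneg _)
    _ = _ := by ring

theorem sum_rr_sq_le : ∑ i, ∑ j, θ.rr i j ^ 2 * θ.dyadProb true true i j
    ≤ θ.R * θ.sH ^ 2 * (θ.sM ^ 2 * θ.sN ^ 2) := by
  calc _ ≤ ∑ i, ∑ j, θ.R * (θ.sM ^ 2 * θ.sN ^ 2) * (θ.η i * θ.η j) := by
        refine Finset.sum_le_sum fun i _ => Finset.sum_le_sum fun j _ => ?_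
        refine (mul_le_mul (pow_le_pow_left₀ (rr_nonneg i j) (rr_le i j) 2)
          (dyadProb_le true true i j) (dyadProb_nonneg _ _ _ _)
          (by positivity)).trans (le_of_eq ?_)
        simp
        ring
    _ = _ := by
        rw [sum_sum_mul, sum_η]
        ring

namespace Sparse

variable {ε c : ℝ} (h : θ.Sparse ε c)
include h

theorem μ_le_ε_sum (i : Fin n) : θ.μ i ≤ ε * θ.sM :=
  (h.μ_le i).trans (le_mul_of_one_le_right h.pos.le h.one_le_sM)

theorem ν_le_ε_sum (i : Fin n) : θ.ν i ≤ ε * θ.sN :=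
  (h.ν_le i).trans (le_mul_of_one_le_right h.pos.le h.one_le_sN)

theorem η_le_ε (i : Fin n) : θ.η i ≤ ε := by
  have := h.μ_le i
  have := h.ν_le i
  have := μ_pos (θ := θ) i
  have := ν_pos (θ := θ) i
  have := h.small
  unfold η
  nlinarith [h.pos]

theorem η_le_ε_sum (i : Fin n) : θ.η i ≤ ε * θ.sH :=
  (h.η_le_ε i).trans (le_mul_of_one_le_right h.pos.le h.one_le_sH)

theorem le_rr {i j : Fin n} (hij : i ≠ j) : (1 - 14 * ε) * (θ.sM * θ.sN) ≤ θ.rr i j := by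
  have key := le_pth (Bd.dyadProb θ false false) (Bd.dyadProb θ false true)
    (Bd.dyadProb θ false false) h.pos.le h.small (h.le_dyadProb _ _) (h.le_dyadProb _ _)
    (h.le_dyadProb _ _) (by simpa using h.ν_le_ε_sum) (by simpa using h.μ_le_ε_sum) hij
  refine le_trans (le_of_eq ?_) key
  simp [-mul_eq_mul_left_iff]
  ring

theorem le_ss {i j : Fin n} (hij : i ≠ j) : (1 - 14 * ε) * (θ.R * θ.sH ^ 2) ≤ θ.ss i j := by
  have hR := R_pos (θ := θ)
  have key := le_pth (Bd.dyadProb θ false false) (Bd.dyadProb θ true true)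
    (Bd.dyadProb θ false false) h.pos.le h.small (h.le_dyadProb _ _) (h.le_dyadProb _ _)
    (h.le_dyadProb _ _)
    (fun k => by
      have := mul_le_mul_of_nonneg_left (h.η_le_ε_sum k) hR.le
      simp
      linarith)
    (by simpa using h.η_le_ε_sum) hij
  refine le_trans (le_of_eq ?_) key
  simp [-mul_eq_mul_left_iff]
  ring

theorem le_tt {i j : Fin n} (hij : i ≠ j) : (1 - 14 * ε) * θ.τ i j ≤ θ.tt i j := by
  have k1 := le_pth (Bd.dyadProb θ true false) (Bd.dyadProb θ true false)
    (Bd.dyadProb θ false false) h.pos.le h.small (h.le_dyadProb _ _) (h.le_dyadProb _ _)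
    (h.le_dyadProb _ _) (by simpa [η, mul_comm (θ.ν _)] using h.η_le_ε_sum)
    (by simpa using h.ν_le_ε_sum) hij
  have k2 := le_pth (Bd.dyadProb θ false false) (Bd.dyadProb θ true false)
    (Bd.dyadProb θ true false) h.pos.le h.small (h.le_dyadProb _ _) (h.le_dyadProb _ _)
    (h.le_dyadProb _ _) (by simpa using h.μ_le_ε_sum)
    (by simpa [η, mul_comm (θ.ν _)] using h.η_le_ε_sum) hij
  have k3 := le_pth (Bd.dyadProb θ true false) (Bd.dyadProb θ false false)
    (Bd.dyadProb θ true false) h.pos.le h.small (h.le_dyadProb _ _) (h.le_dyadProb _ _)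
    (h.le_dyadProb _ _) (by simpa using h.ν_le_ε_sum) (by simpa using h.μ_le_ε_sum) hij
  refine le_trans (le_of_eq ?_) (add_le_add (add_le_add k1 k2) k3)
  simp [τ]
  ring

/-- A loss of `3ε` comes from `K`, and one more `ε` from the missing diagonal. -/
theorem le_sum_dyadProb_tt : (1 - 4 * ε) * (θ.R * θ.sH ^ 2)
    ≤ ∑ i, ∑ j ∈ Finset.univ.erase i, θ.dyadProb true true i j := by
  have hR := R_pos (θ := θ)
  have hH := h.one_le_sH
  have hd : ∑ i, θ.η i * θ.η i ≤ ε * θ.sH ^ 2 := by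
    calc ∑ i, θ.η i * θ.η i ≤ ∑ i, ε * θ.η i :=
          Finset.sum_le_sum fun i _ => mul_le_mul_of_nonneg_right (h.η_le_ε i) (η_pos i).le
      _ = ε * θ.sH := by rw [← Finset.mul_sum, sum_η]
      _ ≤ _ := mul_le_mul_of_nonneg_left (by nlinarith) h.pos.le
  have e : ∑ i, ∑ j ∈ Finset.univ.erase i, (1 - 3 * ε) * (θ.R * (θ.η i * θ.η j))
      = (1 - 3 * ε) * (θ.R * (θ.sH ^ 2 - ∑ i, θ.η i * θ.η i)) := by
    rw [← sum_ηη, ← Finset.sum_sub_distrib, Finset.mul_sum, Finset.mul_sum]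
    refine Finset.sum_congr rfl fun i _ => ?_
    rw [← Finset.mul_sum, ← Finset.mul_sum, ← Finset.sum_erase_eq_sub (Finset.mem_univ i)]
  refine le_trans ?_ (Finset.sum_le_sum fun i _ => Finset.sum_le_sum fun j _ =>
    h.le_dyadProb true true i j)
  simp only [wout_tt, win_tt, mul_assoc]
  rw [e]
  have hε := h.pos
  have hs := h.small
  have : θ.R * (θ.sH ^ 2 - ε * θ.sH ^ 2) ≤ θ.R * (θ.sH ^ 2 - ∑ i, θ.η i * θ.η i) := by gcongr
  have h2 := mul_le_mul_of_nonneg_left this (show 0 ≤ 1 - 3 * ε by linarith)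
  refine le_trans ?_ h2
  have h3 : 0 ≤ ε ^ 2 * (θ.R * θ.sH ^ 2) := by positivity
  nlinarith

theorem le_sum_rr_sq : (9 / 10) * (θ.R * θ.sH ^ 2 * (θ.sM ^ 2 * θ.sN ^ 2))
    ≤ ∑ i, ∑ j, θ.rr i j ^ 2 * θ.dyadProb true true i j := by
  have hε := h.pos
  have hs := h.small
  have M := sM_nonneg (θ := θ)
  have N := sN_nonneg (θ := θ)
  have hR := R_pos (θ := θ)
  rw [← sum_erase_eq _ (by simp)]
  calc _ ≤ ((1 - 14 * ε) * (θ.sM * θ.sN)) ^ 2 * ((1 - 4 * ε) * (θ.R * θ.sH ^ 2)) := by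
        have e1 : (9 / 10 : ℝ) ≤ (1 - 14 * ε) ^ 2 * (1 - 4 * ε) := by
          have : (986 / 1000 : ℝ) ≤ 1 - 14 * ε := by linarith
          have : (986 / 1000 : ℝ) ^ 2 ≤ (1 - 14 * ε) ^ 2 := by gcongr
          nlinarith
        have e2 : 0 ≤ θ.R * θ.sH ^ 2 * (θ.sM ^ 2 * θ.sN ^ 2) := by positivity
        have := mul_le_mul_of_nonneg_right e1 e2
        linarith
    _ ≤ ((1 - 14 * ε) * (θ.sM * θ.sN)) ^ 2
          * ∑ i, ∑ j ∈ Finset.univ.erase i, θ.dyadProb true true i j := by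
        gcongr
        exact h.le_sum_dyadProb_tt
    _ = ∑ i, ∑ j ∈ Finset.univ.erase i,
          ((1 - 14 * ε) * (θ.sM * θ.sN)) ^ 2 * θ.dyadProb true true i j := by
        simp only [Finset.mul_sum]
    _ ≤ _ := by
        refine Finset.sum_le_sum fun i _ => Finset.sum_le_sum fun j hj => ?_
        have hij : i ≠ j := (Finset.ne_of_mem_erase hj).symm
        have h0 : 0 ≤ (1 - 14 * ε) * (θ.sM * θ.sN) :=
          mul_nonneg (by linarith) (mul_nonneg M N)
        exact mul_le_mul_of_nonneg_right (pow_le_pow_left₀ h0 (h.le_rr hij) 2)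
          (dyadProb_nonneg _ _ _ _)

theorem le_meanQ : (9 / 10) * (θ.R * θ.sH ^ 2 * (θ.sM * θ.sN)) ≤ meanQ θ := by
  have hε := h.pos
  have hs := h.small
  have M := sM_nonneg (θ := θ)
  have N := sN_nonneg (θ := θ)
  have hR := R_pos (θ := θ)
  rw [meanQ, cyc_eq_sum_pth]
  change _ ≤ ∑ i, ∑ j, θ.dyadProb true true i j * θ.rr i j
  rw [← sum_erase_eq _ (by simp)]
  calc _ ≤ ((1 - 14 * ε) * (θ.sM * θ.sN)) * ((1 - 4 * ε) * (θ.R * θ.sH ^ 2)) := by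
        have e1 : (9 / 10 : ℝ) ≤ (1 - 14 * ε) * (1 - 4 * ε) := by nlinarith
        have e2 : 0 ≤ θ.R * θ.sH ^ 2 * (θ.sM * θ.sN) := by positivity
        have := mul_le_mul_of_nonneg_right e1 e2
        linarith
    _ ≤ ((1 - 14 * ε) * (θ.sM * θ.sN))
          * ∑ i, ∑ j ∈ Finset.univ.erase i, θ.dyadProb true true i j :=
        mul_le_mul_of_nonneg_left h.le_sum_dyadProb_tt
          (mul_nonneg (by linarith) (mul_nonneg M N))
    _ = ∑ i, ∑ j ∈ Finset.univ.erase i,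
          ((1 - 14 * ε) * (θ.sM * θ.sN)) * θ.dyadProb true true i j := by
        simp only [Finset.mul_sum]
    _ ≤ _ := by
        refine Finset.sum_le_sum fun i _ => Finset.sum_le_sum fun j hj => ?_
        have hij : i ≠ j := (Finset.ne_of_mem_erase hj).symm
        rw [mul_comm (θ.dyadProb _ _ _ _)]
        exact mul_le_mul_of_nonneg_right (h.le_rr hij) (dyadProb_nonneg _ _ _ _)

theorem meanQ_pos : 0 < meanQ θ := by
  refine lt_of_lt_of_le ?_ h.le_meanQ
  have := R_pos (θ := θ)
  have := h.one_le_sH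
  have := h.one_le_sM
  have := h.one_le_sN
  positivity

/-- The standard deviation is of smaller order than the mean, so the signal-to-noise ratio diverges.
The reciprocated part uses `1 ≤ ε R sH²`, the other part `sa ≤ ε sH` and `sb ≤ ε sH`. -/
theorem V0_le_meanQ_sq : θ.V0 ≤ 8 * ε * meanQ θ ^ 2 := by
  have hε := h.pos
  have hs := h.small
  have M := sM_nonneg (θ := θ)
  have N := sN_nonneg (θ := θ)
  have hR := R_pos (θ := θ)
  have hH := h.one_le_sH
  have e1 := pow_le_pow_left₀ (by positivity) h.le_meanQ 2
  have e2 : θ.R * θ.sH ^ 2 * (θ.sM ^ 2 * θ.sN ^ 2)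
      ≤ ε * (θ.R * θ.sH ^ 2 * (θ.sM * θ.sN)) ^ 2 := by
    have := mul_le_mul_of_nonneg_left h.RH_ge
      (show 0 ≤ θ.R * θ.sH ^ 2 * (θ.sM ^ 2 * θ.sN ^ 2) by positivity)
    linarith
  have e3 : θ.R ^ 2 * θ.sa * θ.sb * (θ.sM ^ 2 * θ.sN ^ 2)
      ≤ ε * (θ.R * θ.sH ^ 2 * (θ.sM * θ.sN)) ^ 2 := by
    have h1 : θ.sa * θ.sb ≤ ε * θ.sH ^ 4 := by
      calc θ.sa * θ.sb ≤ (ε * θ.sH) * (ε * θ.sH) :=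
            mul_le_mul h.sa_le h.sb_le sb_nonneg (by positivity)
        _ = ε * (ε * θ.sH ^ 2) := by ring
        _ ≤ ε * (1 * θ.sH ^ 4) := by
            gcongr ε * ?_
            exact mul_le_mul h.ε_le_one (pow_le_pow_right₀ hH (by norm_num)) (by positivity)
              zero_le_one
        _ = _ := by ring
    calc _ = θ.R ^ 2 * (θ.sM ^ 2 * θ.sN ^ 2) * (θ.sa * θ.sb) := by ring
      _ ≤ θ.R ^ 2 * (θ.sM ^ 2 * θ.sN ^ 2) * (ε * θ.sH ^ 4) := by gcongr
      _ = _ := by ring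
  have e4 := mul_le_mul_of_nonneg_left e1 hε.le
  have e5 : 0 ≤ ε * (θ.R * θ.sH ^ 2 * (θ.sM * θ.sN)) ^ 2 := by positivity
  unfold V0
  nlinarith

/-- The bound `sum_sq_main` runs over all pairs, so its diagonal has to be shown negligible. The
regime assumption enters through `∑ μ³ν³`, which is controlled by `μ_i ≤ ε sa`. -/
theorem sum_diag_le (hl : c * θ.sH ^ 2 ≤ θ.R * θ.sa * θ.sb) :
    ∑ i, θ.μ i * θ.ν i * (θ.sH ^ 4 + θ.τ i i ^ 2)
      ≤ 10 * ε * (θ.sM ^ 2 * θ.sN ^ 2 * (θ.sa * θ.sb)) := by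
  have hL := h.large hl
  have hε := h.pos
  have a := h.sa_pos
  have b := h.sb_pos
  have M := h.one_le_sM
  have N := h.one_le_sN
  have H := h.one_le_sH
  have hs := h.small
  have h1 : ∑ i, θ.μ i ^ 3 * θ.ν i ≤ ε * θ.sa := by
    rw [sa, Finset.mul_sum]
    refine Finset.sum_le_sum fun i _ => ?_
    have := μ_pos (θ := θ) i
    have := ν_pos (θ := θ) i
    calc θ.μ i ^ 3 * θ.ν i = θ.μ i * (θ.μ i ^ 2 * θ.ν i) := by ring
      _ ≤ _ := by gcongr; exact h.μ_le i
  have h2 : ∑ i, θ.μ i * θ.ν i ^ 3 ≤ ε * θ.sb := by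
    rw [sb, Finset.mul_sum]
    refine Finset.sum_le_sum fun i _ => ?_
    have := μ_pos (θ := θ) i
    have := ν_pos (θ := θ) i
    calc θ.μ i * θ.ν i ^ 3 = θ.ν i * (θ.μ i * θ.ν i ^ 2) := by ring
      _ ≤ _ := by gcongr; exact h.ν_le i
  have h3 : ∑ i, θ.μ i ^ 3 * θ.ν i ^ 3 ≤ ε * θ.sa * θ.sb := by
    rw [sb, Finset.mul_sum]
    refine Finset.sum_le_sum fun i _ => ?_
    have := μ_pos (θ := θ) i
    have := ν_pos (θ := θ) i
    have h4 := h.η_le_ε i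
    have h5 := (hL i).1
    calc θ.μ i ^ 3 * θ.ν i ^ 3 = θ.μ i * (θ.μ i * θ.ν i) * (θ.μ i * θ.ν i ^ 2) := by ring
      _ ≤ (ε * θ.sa) * 1 * (θ.μ i * θ.ν i ^ 2) := by
          gcongr
          unfold η at h4
          linarith
      _ = _ := by ring
  have e : ∑ i, θ.μ i * θ.ν i * (θ.sH ^ 4 + θ.τ i i ^ 2)
      ≤ θ.sH ^ 4 * θ.sH + 3 * ((θ.sH ^ 2 * θ.sN ^ 2) * (ε * θ.sa)
        + (θ.sM ^ 2 * θ.sH ^ 2) * (ε * θ.sb) + (θ.sM ^ 2 * θ.sN ^ 2) * (ε * θ.sa * θ.sb)) := by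
    calc _ ≤ ∑ i, (θ.sH ^ 4 * (θ.μ i * θ.ν i) + 3 * ((θ.sH ^ 2 * θ.sN ^ 2) * (θ.μ i ^ 3 * θ.ν i)
          + (θ.sM ^ 2 * θ.sH ^ 2) * (θ.μ i * θ.ν i ^ 3)
          + (θ.sM ^ 2 * θ.sN ^ 2) * (θ.μ i ^ 3 * θ.ν i ^ 3))) := by
          refine Finset.sum_le_sum fun i _ => ?_
          have := mul_le_mul_of_nonneg_left (τ_sq_le (θ := θ) i i) (η_pos (θ := θ) i).le
          unfold η at this
          linarith
      _ = θ.sH ^ 4 * θ.sH + 3 * ((θ.sH ^ 2 * θ.sN ^ 2) * (∑ i, θ.μ i ^ 3 * θ.ν i)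
          + (θ.sM ^ 2 * θ.sH ^ 2) * (∑ i, θ.μ i * θ.ν i ^ 3)
          + (θ.sM ^ 2 * θ.sN ^ 2) * (∑ i, θ.μ i ^ 3 * θ.ν i ^ 3)) := by
          simp only [Finset.sum_add_distrib, ← Finset.mul_sum, sum_μ_ν]
      _ ≤ _ := by gcongr
  refine e.trans ?_
  have M2 : θ.sM ≤ θ.sM ^ 2 := h.sM_le_sq
  have N2 : θ.sN ≤ θ.sN ^ 2 := h.sN_le_sq
  have M0 : 0 ≤ θ.sM := sM_nonneg
  have N0 : 0 ≤ θ.sN := sN_nonneg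
  have f1 : θ.sH ^ 4 * θ.sH ≤ ε * (θ.sM ^ 2 * θ.sN ^ 2 * (θ.sa * θ.sb)) := by
    calc _ ≤ (θ.sa * θ.sb * (θ.sM * θ.sN)) * (ε * θ.sM) := by
          gcongr
          · exact sH_pow_four_le
          · exact h.sH_le_ε_sM
      _ = ε * (θ.sM ^ 2 * θ.sN * (θ.sa * θ.sb)) := by ring
      _ ≤ _ := by gcongr
  have f2 : (θ.sH ^ 2 * θ.sN ^ 2) * (ε * θ.sa) ≤ ε * (θ.sM ^ 2 * θ.sN ^ 2 * (θ.sa * θ.sb)) := by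
    calc _ ≤ ((θ.sb * θ.sM) * θ.sN ^ 2) * (ε * θ.sa) := by
          gcongr
          exact sH_sq_le_sb_mul_sM
      _ = ε * (θ.sM * θ.sN ^ 2 * (θ.sa * θ.sb)) := by ring
      _ ≤ _ := by gcongr
  have f3 : (θ.sM ^ 2 * θ.sH ^ 2) * (ε * θ.sb) ≤ ε * (θ.sM ^ 2 * θ.sN ^ 2 * (θ.sa * θ.sb)) := by
    calc _ ≤ (θ.sM ^ 2 * (θ.sa * θ.sN)) * (ε * θ.sb) := by
          gcongr
          exact sH_sq_le_sa_mul_sN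
      _ = ε * (θ.sM ^ 2 * θ.sN * (θ.sa * θ.sb)) := by ring
      _ ≤ _ := by gcongr
  nlinarith

/-- From `(x + e)² ≥ x²/2 - e²` with `x = R (sH² - τ)` and `|e| ≤ 14 ε R (sH² + τ)`; the constant is
`392 = 2 * 14²`. -/
theorem le_uu_sq {i j : Fin n} (hij : i ≠ j) :
    θ.R ^ 2 * ((1 / 2) * (θ.sH ^ 2 - θ.τ i j) ^ 2 - 392 * ε ^ 2 * (θ.sH ^ 4 + θ.τ i j ^ 2))
      ≤ θ.uu i j ^ 2 := by
  have hR := R_pos (θ := θ)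
  have s1 := ss_le (θ := θ) i j
  have s2 := h.le_ss hij
  have t1 := mul_le_mul_of_nonneg_left (tt_le (θ := θ) i j) hR.le
  have t2 := mul_le_mul_of_nonneg_left (h.le_tt hij) hR.le
  have hτ := τ_nonneg (θ := θ) i j
  have hε := h.pos
  set e := θ.uu i j - θ.R * (θ.sH ^ 2 - θ.τ i j) with he
  have p1 : 0 ≤ ε * (θ.R * θ.sH ^ 2) := by positivity
  have p2 : 0 ≤ ε * (θ.R * θ.τ i j) := by positivity
  have he1 : |e| ≤ 14 * ε * θ.R * (θ.sH ^ 2 + θ.τ i j) := by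
    rw [abs_le]
    unfold uu at he
    constructor <;> nlinarith
  have he2 : e ^ 2 ≤ 392 * ε ^ 2 * θ.R ^ 2 * (θ.sH ^ 4 + θ.τ i j ^ 2) := by
    have := pow_le_pow_left₀ (abs_nonneg e) he1 2
    rw [sq_abs] at this
    refine this.trans ?_
    have : 0 ≤ ε ^ 2 * θ.R ^ 2 * (θ.sH ^ 2 - θ.τ i j) ^ 2 := by positivity
    nlinarith
  have hu : θ.uu i j = θ.R * (θ.sH ^ 2 - θ.τ i j) + e := by rw [he]; ring
  rw [hu]
  nlinarith [sq_nonneg (θ.R * (θ.sH ^ 2 - θ.τ i j) + 2 * e)]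

/-- Starting from `sum_sq_main`, one percent is given up for the diagonal, then a factor `(1 - 3ε) /
2`, then the error of `le_uu_sq`, at most another percent. For `ε ≤ 1/1000` more than `2/5`
survives. -/
theorem le_sum_uu_sq (hl : c * θ.sH ^ 2 ≤ θ.R * θ.sa * θ.sb) :
    (2 / 5) * (θ.R ^ 2 * θ.sa * θ.sb * (θ.sM ^ 2 * θ.sN ^ 2))
      ≤ ∑ i, ∑ j, θ.uu i j ^ 2 * θ.dyadProb true false i j := by
  have hε := h.pos
  have hs := h.small
  have hR := R_pos (θ := θ)
  have a := h.sa_pos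
  have b := h.sb_pos
  set D := θ.sM ^ 2 * θ.sN ^ 2 * (θ.sa * θ.sb) with hD
  have hD0 : 0 ≤ D := by positivity
  have k1 := sum_sq_main (θ := θ)
  have k2 := sum_weighted_le (θ := θ)
  have k3 := h.sum_diag_le hl
  rw [← hD] at k1 k2 k3
  have hdiag : ∑ i, θ.μ i * θ.ν i * (θ.sH ^ 2 - θ.τ i i) ^ 2
      ≤ ∑ i, θ.μ i * θ.ν i * (θ.sH ^ 4 + θ.τ i i ^ 2) := by
    refine Finset.sum_le_sum fun i _ => mul_le_mul_of_nonneg_left ?_ (η_pos (θ := θ) i).le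
    have := mul_nonneg (sq_nonneg θ.sH) (τ_nonneg (θ := θ) i i)
    nlinarith
  have k4 : (99 / 100) * D
      ≤ ∑ i, ∑ j ∈ Finset.univ.erase i, θ.μ i * θ.ν j * (θ.sH ^ 2 - θ.τ i j) ^ 2 := by
    have e : ∑ i, ∑ j ∈ Finset.univ.erase i, θ.μ i * θ.ν j * (θ.sH ^ 2 - θ.τ i j) ^ 2
        = ∑ i, ∑ j, θ.μ i * θ.ν j * (θ.sH ^ 2 - θ.τ i j) ^ 2
          - ∑ i, θ.μ i * θ.ν i * (θ.sH ^ 2 - θ.τ i i) ^ 2 := by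
      rw [← Finset.sum_sub_distrib]
      exact Finset.sum_congr rfl fun i _ => Finset.sum_erase_eq_sub (Finset.mem_univ i)
    rw [e]
    nlinarith
  have k5 : ∑ i, ∑ j ∈ Finset.univ.erase i, θ.μ i * θ.ν j * (θ.sH ^ 4 + θ.τ i j ^ 2) ≤ 10 * D := by
    refine le_trans (Finset.sum_le_sum fun i _ => ?_) k2
    refine Finset.sum_le_sum_of_subset_of_nonneg (Finset.erase_subset _ _) fun j _ _ => ?_
    have := μ_pos (θ := θ) i
    have := ν_pos (θ := θ) j
    positivity
  have k6 : θ.R ^ 2 * ((1 / 2) * ((1 - 3 * ε) *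
        ∑ i, ∑ j ∈ Finset.univ.erase i, θ.μ i * θ.ν j * (θ.sH ^ 2 - θ.τ i j) ^ 2)
      - 392 * ε ^ 2 * ∑ i, ∑ j ∈ Finset.univ.erase i, θ.μ i * θ.ν j * (θ.sH ^ 4 + θ.τ i j ^ 2))
      ≤ ∑ i, ∑ j, θ.uu i j ^ 2 * θ.dyadProb true false i j := by
    rw [← sum_erase_eq (fun i j => θ.uu i j ^ 2 * θ.dyadProb true false i j) (by simp)]
    simp only [Finset.mul_sum, ← Finset.sum_sub_distrib]
    refine Finset.sum_le_sum fun i _ => Finset.sum_le_sum fun j hj => ?_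
    have hij : i ≠ j := (Finset.ne_of_mem_erase hj).symm
    have q1 := mul_le_mul_of_nonneg_right (h.le_uu_sq hij) (dyadProb_nonneg (θ := θ) true false i j)
    refine le_trans ?_ q1
    have q2 := h.le_dyadProb true false i j
    have q3 := dyadProb_le (θ := θ) true false i j
    simp only [wout_tf, win_tf] at q2 q3
    have q4 : 0 ≤ (1 / 2) * (θ.sH ^ 2 - θ.τ i j) ^ 2 := by positivity
    have q5 : 0 ≤ 392 * ε ^ 2 * (θ.sH ^ 4 + θ.τ i j ^ 2) := by positivity
    have q6 := mul_le_mul_of_nonneg_left q2 q4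
    have q7 := mul_le_mul_of_nonneg_left q3 q5
    have q8 := mul_le_mul_of_nonneg_left (sub_le_sub q6 q7) (sq_nonneg θ.R)
    refine le_trans (le_of_eq ?_) (q8.trans (le_of_eq ?_)) <;> ring
  refine le_trans ?_ k6
  have q9 : (2 / 5) * D ≤ (1 / 2) * ((1 - 3 * ε) *
        ∑ i, ∑ j ∈ Finset.univ.erase i, θ.μ i * θ.ν j * (θ.sH ^ 2 - θ.τ i j) ^ 2)
      - 392 * ε ^ 2 * ∑ i, ∑ j ∈ Finset.univ.erase i, θ.μ i * θ.ν j * (θ.sH ^ 4 + θ.τ i j ^ 2) := by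
    have r1 := mul_le_mul_of_nonneg_left k4 (show 0 ≤ 1 - 3 * ε by linarith)
    have r2 := mul_le_mul_of_nonneg_left k5 (show 0 ≤ 392 * ε ^ 2 by positivity)
    have r3 : 392 * ε ^ 2 * (10 * D) ≤ (1 / 100) * D := by
      have : ε ^ 2 ≤ (1 / 1000) ^ 2 := by gcongr
      nlinarith
    have r4 : ε * D ≤ (1 / 1000) * D := by gcongr
    nlinarith
  have := mul_le_mul_of_nonneg_left q9 (sq_nonneg θ.R)
  refine le_trans (le_of_eq ?_) this
  rw [hD]
  ring

/-- In the large regime both parts of `V0` are matched separately. Otherwise `R sa sb ≤ sH²`, and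
the reciprocated dyads alone dominate `V0`. -/
theorem le_V : (2 / 5) * θ.V0 ≤ θ.V := by
  have hR := R_pos (θ := θ)
  have a := h.sa_pos
  have b := h.sb_pos
  have e : θ.V = 2 * ∑ i, ∑ j, θ.rr i j ^ 2 * θ.dyadProb true true i j
      + ∑ i, ∑ j, θ.uu i j ^ 2 * θ.dyadProb true false i j := by
    rw [V_eq]
    simp only [Finset.mul_sum, ← Finset.sum_add_distrib]
    refine Finset.sum_congr rfl fun i _ => Finset.sum_congr rfl fun j _ => ?_
    ring
  have h1 := h.le_sum_rr_sq
  have h0 : 0 ≤ ∑ i, ∑ j, θ.uu i j ^ 2 * θ.dyadProb true false i j :=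
    Finset.sum_nonneg fun i _ => Finset.sum_nonneg fun j _ =>
      mul_nonneg (sq_nonneg _) (dyadProb_nonneg _ _ _ _)
  have p : 0 ≤ θ.R * θ.sH ^ 2 * (θ.sM ^ 2 * θ.sN ^ 2) := by positivity
  rw [e]
  unfold V0
  by_cases hl : c * θ.sH ^ 2 ≤ θ.R * θ.sa * θ.sb
  · have := h.le_sum_uu_sq hl
    nlinarith
  · have h2 : θ.R * θ.sa * θ.sb ≤ θ.sH ^ 2 :=
      (not_le.1 hl).le.trans (mul_le_of_le_one_left (sq_nonneg _) h.c_le)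
    have h3 := mul_le_mul_of_nonneg_left h2
      (show 0 ≤ θ.R * (θ.sM ^ 2 * θ.sN ^ 2) by positivity)
    nlinarith

theorem V_pos : 0 < θ.V := lt_of_lt_of_le (mul_pos (by norm_num) h.V0_pos) h.le_V

/-- No single coefficient is comparable with the standard deviation; this is the step at which
degree heterogeneity must be limited. -/
theorem uu_sq_le_of_large (hl : c * θ.sH ^ 2 ≤ θ.R * θ.sa * θ.sb) (i j : Fin n) :
    θ.uu i j ^ 2 ≤ 10 * (ε * θ.V0) := by
  have hL := h.large hl
  have hε := h.pos
  have a := h.sa_pos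
  have b := h.sb_pos
  have M := h.one_le_sM
  have N := h.one_le_sN
  have hR := R_pos (θ := θ)
  have hs := h.ε_le_one
  have M2 : θ.sM ≤ θ.sM ^ 2 := h.sM_le_sq
  have N2 : θ.sN ≤ θ.sN ^ 2 := h.sN_le_sq
  have M0 : 0 ≤ θ.sM := sM_nonneg
  have N0 : 0 ≤ θ.sN := sN_nonneg
  have mj := μ_pos (θ := θ) j
  have ni := ν_pos (θ := θ) i
  have m1 : θ.μ j ^ 2 ≤ ε * θ.sa := by
    rw [sq]
    calc _ ≤ (ε * θ.sa) * 1 := mul_le_mul (hL j).1 ((h.μ_le j).trans hs) mj.le (by positivity)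
      _ = _ := mul_one _
  have n1 : θ.ν i ^ 2 ≤ ε * θ.sb := by
    rw [sq]
    calc _ ≤ (ε * θ.sb) * 1 := mul_le_mul (hL i).2 ((h.ν_le i).trans hs) ni.le (by positivity)
      _ = _ := mul_one _
  set D := θ.sM ^ 2 * θ.sN ^ 2 * (θ.sa * θ.sb) with hD
  have f0 : θ.sH ^ 4 ≤ ε * D := by
    calc _ ≤ θ.sa * θ.sb * (θ.sM * θ.sN) := sH_pow_four_le
      _ ≤ θ.sa * θ.sb * ((ε * θ.sM ^ 2) * θ.sN ^ 2) := by gcongr; exact h.sM_le_ε_sq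
      _ = _ := by ring
  have f1 : θ.μ j ^ 2 * (θ.sH ^ 2 * θ.sN ^ 2) ≤ ε * D := by
    calc _ ≤ (ε * θ.sa) * ((θ.sb * θ.sM) * θ.sN ^ 2) := by
          gcongr
          exact sH_sq_le_sb_mul_sM
      _ ≤ (ε * θ.sa) * ((θ.sb * θ.sM ^ 2) * θ.sN ^ 2) := by gcongr
      _ = _ := by ring
  have f2 : θ.ν i ^ 2 * (θ.sM ^ 2 * θ.sH ^ 2) ≤ ε * D := by
    calc _ ≤ (ε * θ.sb) * (θ.sM ^ 2 * (θ.sa * θ.sN)) := by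
          gcongr
          exact sH_sq_le_sa_mul_sN
      _ ≤ (ε * θ.sb) * (θ.sM ^ 2 * (θ.sa * θ.sN ^ 2)) := by gcongr
      _ = _ := by ring
  have f3 : θ.μ j ^ 2 * θ.ν i ^ 2 * (θ.sM ^ 2 * θ.sN ^ 2) ≤ ε * D := by
    calc _ ≤ (ε * θ.sa) * (1 * θ.sb) * (θ.sM ^ 2 * θ.sN ^ 2) := by
          have : θ.ν i ^ 2 ≤ 1 * θ.sb := n1.trans (by gcongr)
          gcongr
      _ = _ := by ring
  have f4 : θ.R ^ 2 * D ≤ θ.V0 := by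
    refine le_V0_right (le_of_eq ?_)
    rw [hD]
    ring
  have f5 : θ.sH ^ 4 + θ.τ i j ^ 2 ≤ 10 * (ε * D) := by
    have := τ_sq_le (θ := θ) i j
    linarith
  calc θ.uu i j ^ 2 ≤ θ.R ^ 2 * (θ.sH ^ 4 + θ.τ i j ^ 2) := uu_sq_le i j
    _ ≤ θ.R ^ 2 * (10 * (ε * D)) := by gcongr
    _ = 10 * (ε * (θ.R ^ 2 * D)) := by ring
    _ ≤ _ := by gcongr

end Sparse

end Param

end P1

namespace P1

/-! ### Sums over unordered dyads and moments of a single dyad -/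

section Dyads

variable {n : ℕ}

theorem sum_dyads_eq (F : Fin n → Fin n → ℝ) :
    ∑ e : {e : Fin n × Fin n // e.1 < e.2}, F e.1.1 e.1.2
      = ∑ i, ∑ j, if i < j then F i j else 0 := by
  rw [← Fintype.sum_prod_type' (f := fun i j => if i < j then F i j else 0), ← Finset.sum_filter]
  exact (Finset.sum_subtype _ (by simp) fun e : Fin n × Fin n => F e.1 e.2).symm

theorem sum_dyads_le {F : Fin n → Fin n → ℝ} (hF : ∀ i j, 0 ≤ F i j) :
    ∑ e : {e : Fin n × Fin n // e.1 < e.2}, F e.1.1 e.1.2 ≤ ∑ i, ∑ j, F i j := by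
  rw [sum_dyads_eq]
  refine Finset.sum_le_sum fun i _ => Finset.sum_le_sum fun j _ => ?_
  split_ifs
  · exact le_rfl
  · exact hF i j

theorem sum_sum_eq_sum_dyads (F : Fin n → Fin n → ℝ) (hF : ∀ i, F i i = 0) :
    ∑ i, ∑ j, F i j = ∑ e : {e : Fin n × Fin n // e.1 < e.2},
      (F e.1.1 e.1.2 + F e.1.2 e.1.1) := by
  rw [Finset.sum_add_distrib, sum_dyads_eq F, sum_dyads_eq fun i j => F j i,
    Finset.sum_comm (f := fun i j => if i < j then F j i else 0), ← Finset.sum_add_distrib]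
  refine Finset.sum_congr rfl fun i _ => ?_
  rw [← Finset.sum_add_distrib]
  refine Finset.sum_congr rfl fun j _ => ?_
  rcases lt_trichotomy i j with h | h | h
  · simp [h, h.le]
  · subst h; simp [hF]
  · simp [h, h.le]

theorem dyad_swap (G : Graph n) (a b : Bool) (i j : Fin n) :
    Graph.dyad G a b i j = Graph.dyad G b a j i := by
  unfold Graph.dyad
  congr 1
  simp only [eq_iff_iff, ne_comm (a := i) (b := j)]
  tauto

theorem cen_swap (θ : Param n) (G : Graph n) (a b : Bool) (i j : Fin n) :
    cen θ a b G i j = cen θ b a G j i := by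
  unfold cen
  rw [dyad_swap, Param.dyadProb_swap]

theorem abs_cen_le {θ : Param n} (G : Graph n) (a b : Bool) {i j : Fin n}
    (hp : θ.dyadProb a b i j ≤ 1) : |cen θ a b G i j| ≤ 1 := by
  have h0 := Param.dyadProb_nonneg (θ := θ) a b i j
  unfold cen Graph.dyad
  rw [abs_le]
  split_ifs <;> constructor <;> linarith

/-- A linear combination of the centred indicators of one dyad. -/
noncomputable def dyadTerm (θ : Param n) (g₁ g₂ g₃ : ℝ) (i j : Fin n) (G : Graph n) : ℝ :=
  g₁ * cen θ true true G i j + g₂ * cen θ true false G i j + g₃ * cen θ false true G i j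

/-- An upper bound for the second moment of `dyadTerm`. -/
noncomputable def dyadMoment (θ : Param n) (g₁ g₂ g₃ : ℝ) (i j : Fin n) : ℝ :=
  g₁ ^ 2 * θ.dyadProb true true i j + g₂ ^ 2 * θ.dyadProb true false i j
    + g₃ ^ 2 * θ.dyadProb false true i j

theorem dyadMoment_nonneg (θ : Param n) (g₁ g₂ g₃ : ℝ) (i j : Fin n) :
    0 ≤ dyadMoment θ g₁ g₂ g₃ i j := by
  have h1 := Param.dyadProb_nonneg (θ := θ) true true i j
  have h2 := Param.dyadProb_nonneg (θ := θ) true false i j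
  have h3 := Param.dyadProb_nonneg (θ := θ) false true i j
  unfold dyadMoment
  positivity

theorem iIndepFun_dyadTerm {θ : Param n} {Ω : Type*} [MeasurableSpace Ω] {P : Measure Ω}
    {A : Ω → Graph n} (hA : IsP1Model θ P A) (g₁ g₂ g₃ : Fin n → Fin n → ℝ) (s : ℝ) :
    iIndepFun (fun (e : {e : Fin n × Fin n // e.1 < e.2}) (ω : Ω) =>
      dyadTerm θ (g₁ e.1.1 e.1.2) (g₂ e.1.1 e.1.2) (g₃ e.1.1 e.1.2) e.1.1 e.1.2 (A ω) / s) P := by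
  have key := hA.indep.comp (fun e (z : Bool × Bool) =>
    (g₁ e.1.1 e.1.2 * ((if z.1 = true ∧ z.2 = true then 1 else 0) - θ.dyadProb true true e.1.1 e.1.2)
    + g₂ e.1.1 e.1.2 * ((if z.1 = true ∧ z.2 = false then 1 else 0)
      - θ.dyadProb true false e.1.1 e.1.2)
    + g₃ e.1.1 e.1.2 * ((if z.1 = false ∧ z.2 = true then 1 else 0)
      - θ.dyadProb false true e.1.1 e.1.2)) / s) (fun e => measurable_of_finite _)
  refine (iIndepFun_congr fun e => ?_).1 key
  refine ae_of_all _ fun ω => ?_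
  have hne : e.1.1 ≠ e.1.2 := e.2.ne
  simp only [Function.comp, dyadTerm, cen, Graph.dyad, hne, ne_eq, not_false_eq_true, true_and]

section Moments

variable {θ : Param n} {Ω : Type*} [MeasurableSpace Ω] {P : Measure Ω} [IsProbabilityMeasure P]
  {A : Ω → Graph n} (hA : IsP1Model θ P A)
include hA

theorem ex_dyadTerm (g₁ g₂ g₃ : ℝ) {i j : Fin n} (hij : i ≠ j) :
    ex P A (dyadTerm θ g₁ g₂ g₃ i j) = 0 := by
  unfold dyadTerm
  rw [ex_add hA.measurable, ex_add hA.measurable, ex_const_mul, ex_const_mul, ex_const_mul,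
    ex_cen hA _ _ hij, ex_cen hA _ _ hij, ex_cen hA _ _ hij]
  simp

/-- The three indicators exclude each other, so the square of the uncentred combination has no cross
terms; what is subtracted is the square of its mean. -/
theorem ex_dyadTerm_sq (g₁ g₂ g₃ : ℝ) {i j : Fin n} (hij : i ≠ j) :
    ex P A (fun G => dyadTerm θ g₁ g₂ g₃ i j G ^ 2) = dyadMoment θ g₁ g₂ g₃ i j
      - (g₁ * θ.dyadProb true true i j + g₂ * θ.dyadProb true false i j
        + g₃ * θ.dyadProb false true i j) ^ 2 := by
  set m := g₁ * θ.dyadProb true true i j + g₂ * θ.dyadProb true false i j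
        + g₃ * θ.dyadProb false true i j with hm
  have e : (fun G => dyadTerm θ g₁ g₂ g₃ i j G ^ 2)
      = fun G => (g₁ ^ 2 * Graph.dyad G true true i j + g₂ ^ 2 * Graph.dyad G true false i j
        + g₃ ^ 2 * Graph.dyad G false true i j) - (2 * m) * dyadTerm θ g₁ g₂ g₃ i j G
        - m ^ 2 := by
    funext G
    have : dyadTerm θ g₁ g₂ g₃ i j G = g₁ * Graph.dyad G true true i j
        + g₂ * Graph.dyad G true false i j + g₃ * Graph.dyad G false true i j - m := by
      unfold dyadTerm cen
      rw [hm]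
      ring
    rw [this]
    unfold Graph.dyad
    rcases G i j <;> rcases G j i <;> simp [hij] <;> ring
  rw [e, ex_sub hA.measurable, ex_sub hA.measurable, ex_const_mul, ex_dyadTerm hA _ _ _ hij,
    ex_const, ex_add hA.measurable, ex_add hA.measurable, ex_const_mul, ex_const_mul,
    ex_const_mul, ex_dyad hA _ _ hij, ex_dyad hA _ _ hij, ex_dyad hA _ _ hij]
  unfold dyadMoment
  ring

theorem ex_dyadTerm_sq_le (g₁ g₂ g₃ : ℝ) {i j : Fin n} (hij : i ≠ j) :
    ex P A (fun G => dyadTerm θ g₁ g₂ g₃ i j G ^ 2) ≤ dyadMoment θ g₁ g₂ g₃ i j := by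
  rw [ex_dyadTerm_sq hA _ _ _ hij]
  exact sub_le_self _ (sq_nonneg _)

theorem ex_sum_dyadTerm_sq (g₁ g₂ g₃ : Fin n → Fin n → ℝ) :
    ex P A (fun G => (∑ e : {e : Fin n × Fin n // e.1 < e.2},
        dyadTerm θ (g₁ e.1.1 e.1.2) (g₂ e.1.1 e.1.2) (g₃ e.1.1 e.1.2) e.1.1 e.1.2 G) ^ 2)
      = ∑ e : {e : Fin n × Fin n // e.1 < e.2}, ex P A (fun G =>
        dyadTerm θ (g₁ e.1.1 e.1.2) (g₂ e.1.1 e.1.2) (g₃ e.1.1 e.1.2) e.1.1 e.1.2 G ^ 2) := by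
  have hind := iIndepFun_dyadTerm hA g₁ g₂ g₃ 1
  simp only [div_one] at hind
  have hL : ∀ f : Graph n → ℝ, MemLp (fun ω => f (A ω)) 2 P := fun f => by
    rw [memLp_two_iff_integrable_sq (measurable_graph_comp hA.measurable f).aestronglyMeasurable]
    exact integrable_graph_comp hA.measurable (fun G => f G ^ 2)
  have key := IndepFun.variance_sum (μ := P) (s := Finset.univ)
    (fun e _ => hL (dyadTerm θ (g₁ e.1.1 e.1.2) (g₂ e.1.1 e.1.2) (g₃ e.1.1 e.1.2) e.1.1 e.1.2))
    (fun e _ e' _ h => hind.indepFun h)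
  have h0 : ∀ e : {e : Fin n × Fin n // e.1 < e.2}, ∫ ω,
      dyadTerm θ (g₁ e.1.1 e.1.2) (g₂ e.1.1 e.1.2) (g₃ e.1.1 e.1.2) e.1.1 e.1.2 (A ω) ∂P = 0 :=
    fun e => ex_dyadTerm hA _ _ _ e.2.ne
  rw [variance_of_integral_eq_zero] at key
  · refine Eq.trans ?_ (key.trans (Finset.sum_congr rfl fun e _ => ?_))
    · refine integral_congr_ae (ae_of_all _ fun ω => ?_)
      simp [Finset.sum_apply]
    · rw [variance_of_integral_eq_zero _ (h0 e)]
      · rfl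
      · exact (measurable_graph_comp hA.measurable _).aemeasurable
  · convert (measurable_graph_comp hA.measurable (fun G => ∑ e : {e : Fin n × Fin n // e.1 < e.2},
      dyadTerm θ (g₁ e.1.1 e.1.2) (g₂ e.1.1 e.1.2) (g₃ e.1.1 e.1.2) e.1.1 e.1.2 G)).aemeasurable
      using 1
    ext ω
    simp [Finset.sum_apply]
  · simp only [Finset.sum_apply]
    rw [integral_finsetSum _ fun e _ => integrable_graph_comp hA.measurable _]
    exact Finset.sum_eq_zero fun e _ => h0 e

end Moments

end Dyads

/-! ### The linear part of `U`: its variance and the Lyapunov condition -/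

section Linear

variable {n : ℕ}

/-- The first order part of `U = Q_n(a) - e^ρ Q_n(b)`. -/
noncomputable def linU (θ : Param n) (G : Graph n) : ℝ := linA θ G - θ.R * linB θ G

/-- Rotations group the linear terms by their centred dyad. The factor `A^{11}` receives `rr`, the
factor `A^{01}` read backwards receives `ss`, and the three positions of `A^{10}` in `Qb` give the
three paths of `tt`. -/
theorem linU_eq_sum (θ : Param n) (G : Graph n) : linU θ G = ∑ i, ∑ j,
    (θ.rr i j * cen θ true true G i j + θ.uu i j * cen θ true false G i j) := by
  have s00 : (fun x y => θ.dyadProb false false y x) = θ.dyadProb false false := by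
    funext x y; rw [Param.dyadProb_swap]
  have s11 : (fun x y => θ.dyadProb true true y x) = θ.dyadProb true true := by
    funext x y; rw [Param.dyadProb_swap]
  have h1 : cyc (θ.dyadProb true true) (θ.dyadProb false false) (cen θ false true G)
      (θ.dyadProb false false) = ∑ i, ∑ j, cen θ true false G i j * θ.ss i j := by
    rw [cyc_rotate₂, cyc_eq_sum_pth, Finset.sum_comm]
    refine Finset.sum_congr rfl fun i _ => Finset.sum_congr rfl fun j _ => ?_
    rw [cen_swap, pth_reverse, s00, s11]
    rfl
  rw [linU, linA, linB, h1, cyc_rotate' (θ.dyadProb true false) (cen θ true false G),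
    cyc_rotate (θ.dyadProb true false) (θ.dyadProb true false) (θ.dyadProb false false)]
  simp only [cyc_eq_sum_pth, Finset.mul_sum, ← Finset.sum_add_distrib, ← Finset.sum_sub_distrib]
  refine Finset.sum_congr rfl fun i _ => Finset.sum_congr rfl fun j _ => ?_
  unfold Param.uu Param.tt Param.rr
  ring

/-- The contribution of one dyad to the linear part. -/
noncomputable def linTerm (θ : Param n) (i j : Fin n) (G : Graph n) : ℝ :=
  dyadTerm θ (θ.rr i j + θ.rr j i) (θ.uu i j) (θ.uu j i) i j G

noncomputable def linMoment (θ : Param n) (i j : Fin n) : ℝ :=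
  dyadMoment θ (θ.rr i j + θ.rr j i) (θ.uu i j) (θ.uu j i) i j

theorem linU_eq (θ : Param n) (G : Graph n) :
    linU θ G = ∑ e : {e : Fin n × Fin n // e.1 < e.2}, linTerm θ e.1.1 e.1.2 G := by
  rw [linU_eq_sum, sum_sum_eq_sum_dyads _ (by simp)]
  refine Finset.sum_congr rfl fun e _ => ?_
  rw [cen_swap θ G true true e.1.2 e.1.1, cen_swap θ G true false e.1.2 e.1.1, linTerm, dyadTerm]
  ring

namespace Param.Sparse

variable {θ : Param n} {ε c : ℝ} (h : θ.Sparse ε c)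
include h

theorem sum_dyadProb_le (i j : Fin n) : θ.dyadProb true true i j + θ.dyadProb true false i j
    + θ.dyadProb false true i j ≤ 3 * ε := by
  have h1 := Param.dyadProb_le (θ := θ) true true i j
  have h2 := Param.dyadProb_le (θ := θ) true false i j
  have h3 := Param.dyadProb_le (θ := θ) false true i j
  simp at h1 h2 h3
  have h4 := h.ρη_le i j
  have hs := h.ε_le_one
  have h5 : θ.μ i * θ.ν j ≤ ε * 1 :=
    mul_le_mul (h.μ_le i) ((h.ν_le j).trans hs) (Param.ν_pos j).le h.pos.le
  have h6 : θ.ν i * θ.μ j ≤ ε * 1 :=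
    mul_le_mul (h.ν_le i) ((h.μ_le j).trans hs) (Param.μ_pos j).le h.pos.le
  linarith

theorem abs_cen_le_one (G : Graph n) (i j : Fin n) : |cen θ true true G i j| ≤ 1
    ∧ |cen θ true false G i j| ≤ 1 ∧ |cen θ false true G i j| ≤ 1 := by
  have h0 := h.sum_dyadProb_le i j
  have hs := h.small
  have h1 := Param.dyadProb_nonneg (θ := θ) true true i j
  have h2 := Param.dyadProb_nonneg (θ := θ) true false i j
  have h3 := Param.dyadProb_nonneg (θ := θ) false true i j
  exact ⟨abs_cen_le G _ _ (by linarith), abs_cen_le G _ _ (by linarith),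
    abs_cen_le G _ _ (by linarith)⟩

omit h in
/-- The variance of the linear part is close to `V`. -/
theorem sum_linMoment_le : ∑ e : {e : Fin n × Fin n // e.1 < e.2}, linMoment θ e.1.1 e.1.2
    ≤ θ.V := by
  rw [Param.V_eq, sum_sum_eq_sum_dyads _ (by simp)]
  refine Finset.sum_le_sum fun e _ => ?_
  rw [Param.dyadProb_swap true true e.1.2 e.1.1, Param.dyadProb_swap true false e.1.2 e.1.1,
    linMoment, dyadMoment]
  have := Param.dyadProb_nonneg (θ := θ) true true e.1.1 e.1.2
  nlinarith [mul_nonneg (sq_nonneg (θ.rr e.1.1 e.1.2 - θ.rr e.1.2 e.1.1)) this]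

/-- The defect is the sum of `(rr i j - rr j i)² Ω^{11}`, and both coefficients lie between `(1 -
14ε) sM sN` and `sM sN`. -/
theorem le_sum_linMoment : (1 - ε) * θ.V
    ≤ ∑ e : {e : Fin n × Fin n // e.1 < e.2}, linMoment θ e.1.1 e.1.2 := by
  have hε := h.pos
  have hs := h.small
  have hR := Param.R_pos (θ := θ)
  have M := Param.sM_nonneg (θ := θ)
  have N := Param.sN_nonneg (θ := θ)
  have key : θ.V - ∑ e : {e : Fin n × Fin n // e.1 < e.2}, linMoment θ e.1.1 e.1.2
      ≤ ∑ i, ∑ j, (14 * ε * (θ.sM * θ.sN)) ^ 2 * (θ.R * (θ.η i * θ.η j)) := by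
    calc _ ≤ ∑ e : {e : Fin n × Fin n // e.1 < e.2},
          (14 * ε * (θ.sM * θ.sN)) ^ 2 * (θ.R * (θ.η e.1.1 * θ.η e.1.2)) := by
          rw [Param.V_eq, sum_sum_eq_sum_dyads _ (by simp), ← Finset.sum_sub_distrib]
          refine Finset.sum_le_sum fun e _ => ?_
          rw [Param.dyadProb_swap true true e.1.2 e.1.1,
            Param.dyadProb_swap true false e.1.2 e.1.1, linMoment, dyadMoment]
          have h1 := Param.dyadProb_le (θ := θ) true true e.1.1 e.1.2
          have h2 := Param.dyadProb_nonneg (θ := θ) true true e.1.1 e.1.2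
          simp only [Param.wout_tt, Param.win_tt, mul_assoc] at h1
          have h3 : (θ.rr e.1.1 e.1.2 - θ.rr e.1.2 e.1.1) ^ 2
              ≤ (14 * ε * (θ.sM * θ.sN)) ^ 2 := by
            have a1 := h.le_rr e.2.ne
            have a2 := h.le_rr e.2.ne'
            have a3 := Param.rr_le (θ := θ) e.1.1 e.1.2
            have a4 := Param.rr_le (θ := θ) e.1.2 e.1.1
            apply sq_le_sq'
            · linarith
            · linarith
          have h4 := mul_le_mul h3 h1 h2 (sq_nonneg _)
          refine le_trans (le_of_eq ?_) h4
          ring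
      _ ≤ _ := sum_dyads_le (F := fun i j => (14 * ε * (θ.sM * θ.sN)) ^ 2
          * (θ.R * (θ.η i * θ.η j))) fun i j => by
            have := Param.η_pos (θ := θ) i
            have := Param.η_pos (θ := θ) j
            positivity
  have e2 : ∑ i, ∑ j, (14 * ε * (θ.sM * θ.sN)) ^ 2 * (θ.R * (θ.η i * θ.η j))
      = (14 * ε) ^ 2 * (θ.R * (θ.sH ^ 2 * θ.sM ^ 2 * θ.sN ^ 2)) := by
    simp only [← mul_assoc (_ ^ 2) θ.R]
    rw [Param.sum_sum_mul, Param.sum_η]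
    ring
  have h5 := h.leading.1
  have h6 := h.le_V
  have h7 := h.V0_pos
  rw [e2] at key
  have h8 := mul_le_mul_of_nonneg_left h5 (sq_nonneg (14 * ε))
  have h9 : (14 * ε) ^ 2 * θ.V0 ≤ ε * (2 / 5 * θ.V0) := by
    have : (14 * ε) ^ 2 ≤ ε * (2 / 5) := by nlinarith
    nlinarith
  nlinarith

theorem sM_sq_mul_sN_sq_le : θ.sM ^ 2 * θ.sN ^ 2 ≤ ε * θ.V0 := by
  refine h.le_ε_V0_left ?_
  have := mul_le_mul_of_nonneg_right h.RH_ge (show 0 ≤ θ.sM ^ 2 * θ.sN ^ 2 by positivity)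
  linarith

theorem rr_add_sq_le (i j : Fin n) : (θ.rr i j + θ.rr j i) ^ 2 ≤ 4 * (ε * θ.V0) := by
  have h1 := Param.rr_nonneg (θ := θ) i j
  have h2 := Param.rr_nonneg (θ := θ) j i
  have h3 := Param.rr_le (θ := θ) i j
  have h4 := Param.rr_le (θ := θ) j i
  have h5 := pow_le_pow_left₀ (add_nonneg h1 h2) (add_le_add h3 h4) 2
  have := h.sM_sq_mul_sN_sq_le
  linarith

end Param.Sparse

section Asymptotics

variable {θ : Param n} {ε c : ℝ} {Ω : Type*} [MeasurableSpace Ω] {P : Measure Ω}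
  [IsProbabilityMeasure P] {A : Ω → Graph n} (hA : IsP1Model θ P A)
include hA

theorem ex_linTerm_sq_le {i j : Fin n} (hij : i ≠ j) :
    ex P A (fun G => linTerm θ i j G ^ 2) ≤ linMoment θ i j := ex_dyadTerm_sq_le hA _ _ _ hij

theorem ex_linU_sq_eq : ex P A (fun G => linU θ G ^ 2)
    = ∑ e : {e : Fin n × Fin n // e.1 < e.2}, ex P A (fun G => linTerm θ e.1.1 e.1.2 G ^ 2) := by
  simp only [linU_eq]
  exact ex_sum_dyadTerm_sq hA (fun i j => θ.rr i j + θ.rr j i) θ.uu fun i j => θ.uu j i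

theorem ex_linU_sq_le : ex P A (fun G => linU θ G ^ 2) ≤ θ.V := by
  rw [ex_linU_sq_eq hA]
  exact (Finset.sum_le_sum fun e _ => ex_linTerm_sq_le hA e.2.ne).trans
    Param.Sparse.sum_linMoment_le

/-- The squared mean subtracted in each dyad is, by Cauchy–Schwarz, at most the moment times the
total probability of the three nonempty states, which is at most `3ε`. -/
theorem le_ex_linU_sq (h : θ.Sparse ε c) :
    (1 - 4 * ε) * θ.V ≤ ex P A (fun G => linU θ G ^ 2) := by
  have key : (1 - 3 * ε) * ∑ e : {e : Fin n × Fin n // e.1 < e.2}, linMoment θ e.1.1 e.1.2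
      ≤ ex P A (fun G => linU θ G ^ 2) := by
    rw [ex_linU_sq_eq hA, Finset.mul_sum]
    refine Finset.sum_le_sum fun e _ => ?_
    unfold linTerm linMoment
    rw [ex_dyadTerm_sq hA _ _ _ e.2.ne]
    have h1 := Param.dyadProb_nonneg (θ := θ) true true e.1.1 e.1.2
    have h2 := Param.dyadProb_nonneg (θ := θ) true false e.1.1 e.1.2
    have h3 := Param.dyadProb_nonneg (θ := θ) false true e.1.1 e.1.2
    have hp := h.sum_dyadProb_le e.1.1 e.1.2
    have h0 := mul_le_mul_of_nonneg_left hp (dyadMoment_nonneg θ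
      (θ.rr e.1.1 e.1.2 + θ.rr e.1.2 e.1.1) (θ.uu e.1.1 e.1.2) (θ.uu e.1.2 e.1.1) e.1.1 e.1.2)
    unfold dyadMoment at h0 ⊢
    generalize θ.dyadProb true true e.1.1 e.1.2 = p₁ at *
    generalize θ.dyadProb true false e.1.1 e.1.2 = p₂ at *
    generalize θ.dyadProb false true e.1.1 e.1.2 = p₃ at *
    generalize θ.rr e.1.1 e.1.2 + θ.rr e.1.2 e.1.1 = g₁ at *
    generalize θ.uu e.1.1 e.1.2 = g₂ at *
    generalize θ.uu e.1.2 e.1.1 = g₃ at *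
    nlinarith [mul_nonneg (mul_nonneg h1 h2) (sq_nonneg (g₁ - g₂)),
      mul_nonneg (mul_nonneg h1 h3) (sq_nonneg (g₁ - g₃)),
      mul_nonneg (mul_nonneg h2 h3) (sq_nonneg (g₂ - g₃))]
  have hε := h.pos
  have hs := h.small
  have h1 := mul_le_mul_of_nonneg_left h.le_sum_linMoment (show 0 ≤ 1 - 3 * ε by linarith)
  have h2 := h.V_pos
  have h3 : 0 ≤ ε ^ 2 * θ.V := by positivity
  nlinarith

theorem ex_linU : ex P A (linU θ) = 0 := by
  have e : linU θ = fun G => ∑ e : {e : Fin n × Fin n // e.1 < e.2}, linTerm θ e.1.1 e.1.2 G :=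
    funext fun G => linU_eq θ G
  rw [e, ex_sum hA.measurable]
  exact Finset.sum_eq_zero fun e _ => ex_dyadTerm hA _ _ _ e.2.ne

omit hA [IsProbabilityMeasure P] in
-- The larger of `|a|` and `|w|` controls the sum: the cube is used if it is `|a|`, the square if it
-- is `|w|`. So a uniformly small part can be combined with a part known only to have small
-- variance.
theorem min_sq_cube_add_le (a w : ℝ) :
    min ((a + w) ^ 2) (|a + w| ^ 3) ≤ 8 * |a| ^ 3 + 4 * w ^ 2 := by
  have ha := abs_nonneg a
  have hab := abs_add_le a w
  rcases le_total |w| |a| with hw | hw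
  · refine (min_le_right _ _).trans ?_
    have : |a + w| ^ 3 ≤ (2 * |a|) ^ 3 := pow_le_pow_left₀ (abs_nonneg _) (by linarith) 3
    nlinarith [sq_nonneg w]
  · refine (min_le_left _ _).trans ?_
    have : |a + w| ^ 2 ≤ (2 * |w|) ^ 2 := pow_le_pow_left₀ (abs_nonneg _) (by linarith) 2
    rw [sq_abs, mul_pow, sq_abs] at this
    have : 0 ≤ 8 * |a| ^ 3 := by positivity
    linarith

omit hA in
theorem truncMoment_le_ex (hm : Measurable A) {f g : Graph n → ℝ}
    (h : ∀ G, min (f G ^ 2) (|f G| ^ 3) ≤ g G) : truncMoment P (fun ω => f (A ω)) ≤ ex P A g :=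
  ex_mono (f := fun G => min (f G ^ 2) (|f G| ^ 3)) hm h

/-- In the large regime each term is at most `14√ε` standard deviations, and a cube costs this
factor times a square. Otherwise the `uu` parts have total variance at most `25 c V` and are treated
by squares, while the `rr` part is still uniformly small. -/
theorem sum_truncMoment_le (h : θ.Sparse ε c) :
    ∑ e : {e : Fin n × Fin n // e.1 < e.2},
      truncMoment P (fun ω => linTerm θ e.1.1 e.1.2 (A ω) / √θ.V) ≤ 100 * (√ε + c) := by
  have hε := h.pos
  have hc := h.c_pos
  have hV := h.V_pos
  have hV0 := h.le_V
  have hsε : 0 ≤ √ε := Real.sqrt_nonneg _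
  have hsV : √θ.V ^ 2 = θ.V := Real.sq_sqrt hV.le
  have hsum := Param.Sparse.sum_linMoment_le (θ := θ)
  by_cases hl : c * θ.sH ^ 2 ≤ θ.R * θ.sa * θ.sb
  · have hb : ∀ e : {e : Fin n × Fin n // e.1 < e.2},
        truncMoment P (fun ω => linTerm θ e.1.1 e.1.2 (A ω) / √θ.V)
          ≤ 14 * √ε / θ.V * linMoment θ e.1.1 e.1.2 := by
      intro e
      refine (truncMoment_le_ex hA.measurable (f := fun G => linTerm θ e.1.1 e.1.2 G / √θ.V)
        (g := fun G => 14 * √ε / θ.V * linTerm θ e.1.1 e.1.2 G ^ 2) fun G => ?_).trans ?_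
      · refine (min_le_right _ _).trans ?_
        -- The bounds `4`, `10`, `10` on the three squares give `3 * 24 * ε V0 ≤ 180 ε V`, rounded
        -- up to `14²`.
        have hT : linTerm θ e.1.1 e.1.2 G ^ 2 ≤ 196 * ε * θ.V := by
          obtain ⟨x1, x2, x3⟩ := h.abs_cen_le_one G e.1.1 e.1.2
          rw [← sq_le_one_iff_abs_le_one] at x1 x2 x3
          have g1 := h.rr_add_sq_le e.1.1 e.1.2
          have g2 := h.uu_sq_le_of_large hl e.1.1 e.1.2
          have g3 := h.uu_sq_le_of_large hl e.1.2 e.1.1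
          have y1 := mul_le_mul g1 x1 (sq_nonneg _) (by linarith [sq_nonneg (θ.uu e.1.1 e.1.2)])
          have y2 := mul_le_mul g2 x2 (sq_nonneg _) (by linarith [sq_nonneg (θ.uu e.1.1 e.1.2)])
          have y3 := mul_le_mul g3 x3 (sq_nonneg _) (by linarith [sq_nonneg (θ.uu e.1.1 e.1.2)])
          have y4 := mul_le_mul_of_nonneg_left hV0 hε.le
          unfold linTerm dyadTerm
          rw [← mul_pow] at y1 y2 y3
          generalize (θ.rr e.1.1 e.1.2 + θ.rr e.1.2 e.1.1) * cen θ true true G e.1.1 e.1.2 = a at *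
          generalize θ.uu e.1.1 e.1.2 * cen θ true false G e.1.1 e.1.2 = b at *
          generalize θ.uu e.1.2 e.1.1 * cen θ false true G e.1.1 e.1.2 = d at *
          nlinarith [sq_nonneg (a - b), sq_nonneg (a - d), sq_nonneg (b - d)]
        have hA' : |linTerm θ e.1.1 e.1.2 G / √θ.V| ≤ 14 * √ε := by
          refine abs_le_of_sq_le_sq ?_ (by positivity)
          rw [div_pow, hsV, div_le_iff₀ hV, mul_pow, Real.sq_sqrt hε.le]
          linarith
        calc |linTerm θ e.1.1 e.1.2 G / √θ.V| ^ 3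
            = |linTerm θ e.1.1 e.1.2 G / √θ.V| * (linTerm θ e.1.1 e.1.2 G / √θ.V) ^ 2 := by
              rw [← sq_abs (linTerm θ e.1.1 e.1.2 G / √θ.V)]; ring
          _ ≤ (14 * √ε) * (linTerm θ e.1.1 e.1.2 G / √θ.V) ^ 2 := by gcongr
          _ = _ := by rw [div_pow, hsV]; ring
      · rw [ex_const_mul]
        gcongr
        exact ex_linTerm_sq_le hA e.2.ne
    calc _ ≤ ∑ e : {e : Fin n × Fin n // e.1 < e.2}, 14 * √ε / θ.V * linMoment θ e.1.1 e.1.2 :=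
          Finset.sum_le_sum fun e _ => hb e
      _ = 14 * √ε / θ.V * ∑ e : {e : Fin n × Fin n // e.1 < e.2}, linMoment θ e.1.1 e.1.2 := by
          rw [Finset.mul_sum]
      _ ≤ 14 * √ε / θ.V * θ.V := by gcongr
      _ = 14 * √ε := by field_simp
      _ ≤ _ := by linarith
  · have hb : ∀ e : {e : Fin n × Fin n // e.1 < e.2},
        truncMoment P (fun ω => linTerm θ e.1.1 e.1.2 (A ω) / √θ.V)
          ≤ 32 * √ε / θ.V * linMoment θ e.1.1 e.1.2
            + 4 / θ.V * dyadMoment θ 0 (θ.uu e.1.1 e.1.2) (θ.uu e.1.2 e.1.1) e.1.1 e.1.2 := by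
      intro e
      refine (truncMoment_le_ex hA.measurable (f := fun G => linTerm θ e.1.1 e.1.2 G / √θ.V)
        (g := fun G => 32 * √ε / θ.V
            * dyadTerm θ (θ.rr e.1.1 e.1.2 + θ.rr e.1.2 e.1.1) 0 0 e.1.1 e.1.2 G ^ 2
          + 4 / θ.V * dyadTerm θ 0 (θ.uu e.1.1 e.1.2) (θ.uu e.1.2 e.1.1) e.1.1 e.1.2 G ^ 2)
          fun G => ?_).trans ?_
      · have e1 : linTerm θ e.1.1 e.1.2 G / √θ.V
            = dyadTerm θ (θ.rr e.1.1 e.1.2 + θ.rr e.1.2 e.1.1) 0 0 e.1.1 e.1.2 G / √θ.V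
              + dyadTerm θ 0 (θ.uu e.1.1 e.1.2) (θ.uu e.1.2 e.1.1) e.1.1 e.1.2 G / √θ.V := by
          unfold linTerm dyadTerm
          ring
        have hT : dyadTerm θ (θ.rr e.1.1 e.1.2 + θ.rr e.1.2 e.1.1) 0 0 e.1.1 e.1.2 G ^ 2
            ≤ 16 * ε * θ.V := by
          obtain ⟨x1, x2, x3⟩ := h.abs_cen_le_one G e.1.1 e.1.2
          rw [← sq_le_one_iff_abs_le_one] at x1
          have g1 := h.rr_add_sq_le e.1.1 e.1.2
          have y1 := mul_le_mul g1 x1 (sq_nonneg _)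
            (by linarith [sq_nonneg (θ.rr e.1.1 e.1.2 + θ.rr e.1.2 e.1.1)])
          have y4 := mul_le_mul_of_nonneg_left hV0 hε.le
          unfold dyadTerm
          nlinarith
        rw [e1]
        refine (min_sq_cube_add_le _ _).trans ?_
        set a := dyadTerm θ (θ.rr e.1.1 e.1.2 + θ.rr e.1.2 e.1.1) 0 0 e.1.1 e.1.2 G
        have hA' : |a / √θ.V| ≤ 4 * √ε := by
          refine abs_le_of_sq_le_sq ?_ (by positivity)
          rw [div_pow, hsV, div_le_iff₀ hV, mul_pow, Real.sq_sqrt hε.le]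
          linarith
        have e2 : 8 * |a / √θ.V| ^ 3 ≤ 32 * √ε / θ.V * a ^ 2 := by
          calc 8 * |a / √θ.V| ^ 3 = 8 * (|a / √θ.V| * (a / √θ.V) ^ 2) := by
                rw [← sq_abs (a / √θ.V)]; ring
            _ ≤ 8 * ((4 * √ε) * (a / √θ.V) ^ 2) := by gcongr
            _ = _ := by rw [div_pow, hsV]; ring
        refine add_le_add e2 (le_of_eq ?_)
        rw [div_pow, hsV]
        ring
      · rw [ex_add hA.measurable, ex_const_mul, ex_const_mul]
        refine add_le_add (mul_le_mul_of_nonneg_left ?_ (by positivity))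
          (mul_le_mul_of_nonneg_left (ex_dyadTerm_sq_le hA _ _ _ e.2.ne) (by positivity))
        refine (ex_dyadTerm_sq_le hA _ _ _ e.2.ne).trans ?_
        have h2 := Param.dyadProb_nonneg (θ := θ) true false e.1.1 e.1.2
        have h3 := Param.dyadProb_nonneg (θ := θ) false true e.1.1 e.1.2
        unfold linMoment dyadMoment
        have h4 := mul_nonneg (sq_nonneg (θ.uu e.1.1 e.1.2)) h2
        have h5 := mul_nonneg (sq_nonneg (θ.uu e.1.2 e.1.1)) h3
        linarith
    have hw : ∑ e : {e : Fin n × Fin n // e.1 < e.2},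
        dyadMoment θ 0 (θ.uu e.1.1 e.1.2) (θ.uu e.1.2 e.1.1) e.1.1 e.1.2 ≤ 25 * c * θ.V := by
      have e1 : ∑ e : {e : Fin n × Fin n // e.1 < e.2},
          dyadMoment θ 0 (θ.uu e.1.1 e.1.2) (θ.uu e.1.2 e.1.1) e.1.1 e.1.2
          = ∑ i, ∑ j, θ.uu i j ^ 2 * θ.dyadProb true false i j := by
        rw [sum_sum_eq_sum_dyads _ (by simp)]
        refine Finset.sum_congr rfl fun e _ => ?_
        rw [Param.dyadProb_swap true false e.1.2 e.1.1, dyadMoment]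
        ring
      have hR := Param.R_pos (θ := θ)
      rw [e1]
      have k1 := Param.sum_uu_sq_le (θ := θ)
      have k2 : θ.R ^ 2 * θ.sa * θ.sb * (θ.sM ^ 2 * θ.sN ^ 2) ≤ c * θ.V0 := by
        calc _ = θ.R * (θ.sM ^ 2 * θ.sN ^ 2) * (θ.R * θ.sa * θ.sb) := by ring
          _ ≤ θ.R * (θ.sM ^ 2 * θ.sN ^ 2) * (c * θ.sH ^ 2) := by
              exact mul_le_mul_of_nonneg_left (not_le.1 hl).le (by positivity)
          _ = c * (θ.R * θ.sH ^ 2 * (θ.sM ^ 2 * θ.sN ^ 2)) := by ring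
          _ ≤ _ := by
              gcongr
              exact h.le_V0_left le_rfl
      have k3 := mul_le_mul_of_nonneg_left hV0 hc.le
      linarith
    calc _ ≤ ∑ e : {e : Fin n × Fin n // e.1 < e.2}, (32 * √ε / θ.V * linMoment θ e.1.1 e.1.2
            + 4 / θ.V * dyadMoment θ 0 (θ.uu e.1.1 e.1.2) (θ.uu e.1.2 e.1.1) e.1.1 e.1.2) :=
          Finset.sum_le_sum fun e _ => hb e
      _ = 32 * √ε / θ.V * (∑ e : {e : Fin n × Fin n // e.1 < e.2}, linMoment θ e.1.1 e.1.2)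
            + 4 / θ.V * ∑ e : {e : Fin n × Fin n // e.1 < e.2},
              dyadMoment θ 0 (θ.uu e.1.1 e.1.2) (θ.uu e.1.2 e.1.1) e.1.1 e.1.2 := by
          rw [Finset.sum_add_distrib, Finset.mul_sum, Finset.mul_sum]
      _ ≤ 32 * √ε / θ.V * θ.V + 4 / θ.V * (25 * c * θ.V) := by gcongr
      _ = 32 * √ε + 100 * c := by field_simp; ring
      _ ≤ _ := by linarith

end Asymptotics

end Linear

end P1

namespace P1

/-! ### The variance estimator -/

section VarianceEstimator

variable {n : ℕ}

theorem sq_list_sum_le (L : List ℝ) :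
    L.sum ^ 2 ≤ (L.length : ℝ) * (L.map fun x => x ^ 2).sum := by
  have h := sq_sum_le_card_mul_sum_sq (s := (Finset.univ : Finset (Fin L.length)))
    (f := fun k => L.get k)
  have e1 : ∑ k : Fin L.length, L.get k = L.sum := by
    rw [← List.sum_ofFn, List.ofFn_get]
  have e2 : ∑ k : Fin L.length, L.get k ^ 2 = (L.map fun x => x ^ 2).sum := by
    rw [← List.sum_ofFn]
    congr 1
    conv_rhs => rw [← List.ofFn_get L, List.map_ofFn]
    rfl
  rw [e1, e2] at h
  simpa using h

/-- The estimated coefficients, vanishing on the diagonal. -/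
noncomputable def rrHat (G : Graph n) (i j : Fin n) : ℝ :=
  pth i j (fun _ _ => 1) (Graph.dyad G false true) (fun _ _ => 1)

noncomputable def ssHat (G : Graph n) (i j : Fin n) : ℝ :=
  pth i j (fun _ _ => 1) (Graph.dyad G true true) (fun _ _ => 1)

noncomputable def ttHat (G : Graph n) (i j : Fin n) : ℝ :=
  pth i j (Graph.dyad G true false) (Graph.dyad G true false) (fun _ _ => 1)
  + pth i j (fun _ _ => 1) (Graph.dyad G true false) (Graph.dyad G true false)
  + pth i j (Graph.dyad G true false) (fun _ _ => 1) (Graph.dyad G true false)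

theorem Vhat_eq (G : Graph n) : Graph.Vhat G = ∑ i, ∑ j,
    (2 * rrHat G i j ^ 2 * Graph.dyad G true true i j
      + (ssHat G i j - Real.exp (Graph.ρhat G) * ttHat G i j) ^ 2
        * Graph.dyad G true false i j) := by
  rw [← sum_erase_eq _ (by simp [dyad_self]), Graph.Vhat]
  refine Finset.sum_congr rfl fun i _ => Finset.sum_congr rfl fun j hj => ?_
  have h : i ≠ j := (Finset.ne_of_mem_erase hj).symm
  have e1 : rrHat G i j = Graph.rhat G i j := by
    rw [rrHat, pth_eq_sum_others h, Graph.rhat]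
    simp
  have e2 : ssHat G i j = Graph.shat G i j := by
    rw [ssHat, pth_eq_sum_others h, Graph.shat]
    simp
  have e3 : ttHat G i j = Graph.that G i j := by
    rw [ttHat, pth_eq_sum_others h, pth_eq_sum_others h, pth_eq_sum_others h, Graph.that,
      ← Finset.sum_add_distrib, ← Finset.sum_add_distrib]
    simp
  rw [e1, e2, e3]

/-- The variance proxy with the true coefficients and the observed dyads. -/
noncomputable def semiV (θ : Param n) (G : Graph n) : ℝ := ∑ i, ∑ j,
  (2 * θ.rr i j ^ 2 * Graph.dyad G true true i j + θ.uu i j ^ 2 * Graph.dyad G true false i j)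

noncomputable def errR (θ : Param n) (G : Graph n) : ℝ :=
  ∑ i, ∑ j, Graph.dyad G true true i j * (rrHat G i j - θ.rr i j) ^ 2

noncomputable def errS (θ : Param n) (G : Graph n) : ℝ :=
  ∑ i, ∑ j, Graph.dyad G true false i j * (ssHat G i j - θ.ss i j) ^ 2

noncomputable def errT (θ : Param n) (G : Graph n) : ℝ :=
  ∑ i, ∑ j, Graph.dyad G true false i j * (θ.R * (ttHat G i j - θ.tt i j)) ^ 2

noncomputable def sizeT (θ : Param n) (G : Graph n) : ℝ :=
  ∑ i, ∑ j, Graph.dyad G true false i j * (θ.R * θ.tt i j) ^ 2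

/-- Young's inequality `2|ad| ≤ δ a² + d²/δ`. -/
theorem abs_sq_add_sub_le {δ : ℝ} (hδ : 0 < δ) (a d : ℝ) :
    |(a + d) ^ 2 - a ^ 2| ≤ δ * a ^ 2 + (1 + 1 / δ) * d ^ 2 := by
  have e : δ * a ^ 2 + (1 + 1 / δ) * d ^ 2 - 2 * |a * d| - d ^ 2 = (δ * |a| - |d|) ^ 2 / δ := by
    rw [abs_mul, ← sq_abs a, ← sq_abs d]
    field_simp
    ring
  have h0 : 0 ≤ (δ * |a| - |d|) ^ 2 / δ := by positivity
  have h1 := abs_add_le (2 * (a * d)) (d ^ 2)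
  have h2 : |2 * (a * d)| = 2 * |a * d| := by rw [abs_mul, abs_two]
  have h3 : |d ^ 2| = d ^ 2 := abs_of_nonneg (sq_nonneg d)
  have h4 : (a + d) ^ 2 - a ^ 2 = 2 * (a * d) + d ^ 2 := by ring
  rw [h4]
  linarith

/-- Here `x` stands for `e^(ρ̂-ρ)`. The error of the coefficient `ŝ - e^ρ̂ t̂` splits into the error
of `ŝ`, `x` times that of `R t̂`, and `(1 - x) R tt`; Young's inequality turns errors of
coefficients into errors of their squares. -/
theorem abs_Vhat_sub_le (θ : Param n) (G : Graph n) {δ : ℝ} (hδ : 0 < δ) {x : ℝ}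
    (hx : Real.exp (Graph.ρhat G) = x * θ.R) :
    |Graph.Vhat G - semiV θ G| ≤ δ * semiV θ G + (1 + 1 / δ) *
      (2 * errR θ G + 3 * errS θ G + 3 * x ^ 2 * errT θ G + 3 * (1 - x) ^ 2 * sizeT θ G) := by
  have hδ' : 0 ≤ 1 + 1 / δ := by positivity
  rw [Vhat_eq, semiV, ← Finset.sum_sub_distrib]
  simp only [← Finset.sum_sub_distrib]
  refine (Finset.abs_sum_le_sum_abs _ _).trans ((Finset.sum_le_sum fun i _ =>
    Finset.abs_sum_le_sum_abs _ _).trans ?_)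
  unfold errR errS errT sizeT
  simp only [Finset.mul_sum, ← Finset.sum_add_distrib]
  refine Finset.sum_le_sum fun i _ => Finset.sum_le_sum fun j _ => ?_
  have h1 := dyad_nonneg G true true i j
  have h2 := dyad_nonneg G true false i j
  have k1 := abs_sq_add_sub_le hδ (θ.rr i j) (rrHat G i j - θ.rr i j)
  have k2 := abs_sq_add_sub_le hδ (θ.uu i j) ((ssHat G i j - θ.ss i j)
    - x * (θ.R * (ttHat G i j - θ.tt i j)) + (1 - x) * (θ.R * θ.tt i j))
  have e1 : θ.rr i j + (rrHat G i j - θ.rr i j) = rrHat G i j := by ring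
  have e2 : θ.uu i j + ((ssHat G i j - θ.ss i j)
      - x * (θ.R * (ttHat G i j - θ.tt i j)) + (1 - x) * (θ.R * θ.tt i j))
      = ssHat G i j - Real.exp (Graph.ρhat G) * ttHat G i j := by
    rw [hx]
    unfold Param.uu
    ring
  rw [e1] at k1
  rw [e2] at k2
  have k3 : ((ssHat G i j - θ.ss i j)
      - x * (θ.R * (ttHat G i j - θ.tt i j)) + (1 - x) * (θ.R * θ.tt i j)) ^ 2
      ≤ 3 * (ssHat G i j - θ.ss i j) ^ 2 + 3 * x ^ 2 * (θ.R * (ttHat G i j - θ.tt i j)) ^ 2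
        + 3 * (1 - x) ^ 2 * (θ.R * θ.tt i j) ^ 2 := by
    have := sq_list_sum_le [ssHat G i j - θ.ss i j, -(x * (θ.R * (ttHat G i j - θ.tt i j))),
      (1 - x) * (θ.R * θ.tt i j)]
    simp only [List.sum_cons, List.sum_nil, List.length_cons, List.length_nil, List.map_cons,
      List.map_nil] at this
    push_cast at this
    nlinarith
  have k4 := mul_le_mul_of_nonneg_right k1 (mul_nonneg zero_le_two h1)
  have k5 := mul_le_mul_of_nonneg_right (k2.trans (add_le_add_right
    (mul_le_mul_of_nonneg_left k3 hδ') _)) h2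
  have e3 : 2 * rrHat G i j ^ 2 * Graph.dyad G true true i j
      + (ssHat G i j - Real.exp (Graph.ρhat G) * ttHat G i j) ^ 2 * Graph.dyad G true false i j
      - (2 * θ.rr i j ^ 2 * Graph.dyad G true true i j
        + θ.uu i j ^ 2 * Graph.dyad G true false i j)
      = (rrHat G i j ^ 2 - θ.rr i j ^ 2) * (2 * Graph.dyad G true true i j)
        + ((ssHat G i j - Real.exp (Graph.ρhat G) * ttHat G i j) ^ 2 - θ.uu i j ^ 2)
          * Graph.dyad G true false i j := by ring
  rw [e3]
  refine (abs_add_le _ _).trans ?_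
  rw [abs_mul, abs_mul _ (Graph.dyad G true false i j), abs_of_nonneg h2,
    abs_of_nonneg (mul_nonneg zero_le_two h1)]
  refine (add_le_add k4 k5).trans (le_of_eq ?_)
  ring

variable {θ : Param n} {Ω : Type*} [MeasurableSpace Ω] {P : Measure Ω}
  [IsProbabilityMeasure P] {A : Ω → Graph n}

theorem ex_sum_sum (hm : Measurable A) (f : Fin n → Fin n → Graph n → ℝ) :
    ex P A (fun G => ∑ i, ∑ j, f i j G) = ∑ i, ∑ j, ex P A (f i j) := by
  rw [ex_sum hm]
  exact Finset.sum_congr rfl fun i _ => ex_sum hm _ _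

/-- Passage from second to first moments by `|f| ≤ s/2 + f²/(2s)`. -/
theorem ex_abs_le (hm : Measurable A) {f : Graph n → ℝ} {s : ℝ} (hs : 0 < s)
    (h : ex P A (fun G => f G ^ 2) ≤ s ^ 2) : ex P A (fun G => |f G|) ≤ s := by
  have h1 : ∀ G, |f G| ≤ s / 2 + 1 / (2 * s) * f G ^ 2 := by
    intro G
    have : s / 2 + 1 / (2 * s) * f G ^ 2 - |f G| = (s - |f G|) ^ 2 / (2 * s) := by
      rw [← sq_abs (f G)]
      field_simp
      ring
    have : 0 ≤ (s - |f G|) ^ 2 / (2 * s) := by positivity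
    linarith
  refine (ex_mono hm h1).trans ?_
  rw [ex_add hm, ex_const, ex_const_mul]
  have : 1 / (2 * s) * ex P A (fun G => f G ^ 2) ≤ 1 / (2 * s) * s ^ 2 := by gcongr
  have e : 1 / (2 * s) * s ^ 2 = s / 2 := by field_simp
  linarith

variable (hA : IsP1Model θ P A)
include hA

theorem ex_dyad_le (a b : Bool) (i j : Fin n) :
    ex P A (fun G => Graph.dyad G a b i j) ≤ θ.dyadProb a b i j := by
  by_cases h : i = j
  · subst h
    simp only [dyad_self, ex_const]
    exact Param.dyadProb_nonneg _ _ _ _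
  · exact (ex_dyad hA a b h).le

theorem ex_dyad_mul_add_sq_le (a b : Bool) (i j : Fin n) (f : Graph n → ℝ) {d B : ℝ}
    (h : ex P A (fun G => Graph.dyad G a b i j * f G ^ 2) ≤ B) :
    ex P A (fun G => Graph.dyad G a b i j * (f G + d) ^ 2)
      ≤ 2 * B + 2 * d ^ 2 * θ.dyadProb a b i j := by
  have h1 : ∀ G, Graph.dyad G a b i j * (f G + d) ^ 2
      ≤ 2 * (Graph.dyad G a b i j * f G ^ 2) + 2 * d ^ 2 * Graph.dyad G a b i j := by
    intro G
    nlinarith [mul_nonneg (dyad_nonneg G a b i j) (sq_nonneg (f G - d))]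
  refine (ex_mono hA.measurable h1).trans ?_
  rw [ex_add hA.measurable, ex_const_mul, ex_const_mul]
  have := mul_le_mul_of_nonneg_left (ex_dyad_le hA a b i j)
    (show 0 ≤ 2 * d ^ 2 by positivity)
  linarith

theorem ex_sum_sum_sq_le {f g : Fin n → Fin n → ℝ} (hf : ∀ i, f i i = 0) (hg : ∀ i, g i i = 0) :
    ex P A (fun G => (∑ i, ∑ j, (f i j * cen θ true true G i j
        + g i j * cen θ true false G i j)) ^ 2)
      ≤ ∑ i, ∑ j, (2 * f i j ^ 2 * θ.dyadProb true true i j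
        + g i j ^ 2 * θ.dyadProb true false i j) := by
  have e : ∀ G : Graph n, ∑ i, ∑ j, (f i j * cen θ true true G i j
      + g i j * cen θ true false G i j) = ∑ e : {e : Fin n × Fin n // e.1 < e.2},
        dyadTerm θ (f e.1.1 e.1.2 + f e.1.2 e.1.1) (g e.1.1 e.1.2) (g e.1.2 e.1.1)
          e.1.1 e.1.2 G := by
    intro G
    rw [sum_sum_eq_sum_dyads _ (by simp [hf, hg])]
    refine Finset.sum_congr rfl fun e _ => ?_
    rw [cen_swap θ G true true e.1.2 e.1.1, cen_swap θ G true false e.1.2 e.1.1, dyadTerm]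
    ring
  simp only [e]
  rw [ex_sum_dyadTerm_sq hA (fun i j => f i j + f j i) g fun i j => g j i,
    sum_sum_eq_sum_dyads _ (by simp [hf, hg])]
  refine Finset.sum_le_sum fun e _ => (ex_dyadTerm_sq_le hA _ _ _ e.2.ne).trans ?_
  rw [Param.dyadProb_swap true true e.1.2 e.1.1, Param.dyadProb_swap true false e.1.2 e.1.1,
    dyadMoment]
  have := Param.dyadProb_nonneg (θ := θ) true true e.1.1 e.1.2
  nlinarith [mul_nonneg (sq_nonneg (f e.1.1 e.1.2 - f e.1.2 e.1.1)) this]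

variable {ε c : ℝ} (h : θ.Sparse ε c)
include h

/-- The dichotomy again. If all squared coefficients are `O(ε V0)`, the second moment of the
difference is `O(ε V0²)`. Otherwise the `uu` part, too irregular for second moments, is bounded in
mean by twice its expectation, which is of order `c V0`. -/
theorem ex_abs_semiV_sub_le :
    ex P A (fun G => |semiV θ G - θ.V|) ≤ 20 * (√ε + c) * θ.V0 := by
  have hε := h.pos
  have hc := h.c_pos
  have hV0 := h.V0_pos
  have hR := Param.R_pos (θ := θ)
  have hsε : 0 < √ε := Real.sqrt_pos.2 hε
  have hsq : √ε ^ 2 = ε := Real.sq_sqrt hε.le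
  have e : ∀ G, semiV θ G - θ.V = ∑ i, ∑ j, (2 * θ.rr i j ^ 2 * cen θ true true G i j
      + θ.uu i j ^ 2 * cen θ true false G i j) := by
    intro G
    rw [semiV, Param.V_eq, ← Finset.sum_sub_distrib]
    simp only [← Finset.sum_sub_distrib]
    refine Finset.sum_congr rfl fun i _ => Finset.sum_congr rfl fun j _ => ?_
    unfold cen
    ring
  have hrr : ∑ i, ∑ j, 2 * (2 * θ.rr i j ^ 2) ^ 2 * θ.dyadProb true true i j
      ≤ 8 * ε * θ.V0 ^ 2 := by
    calc _ ≤ ∑ i, ∑ j, 8 * (ε * θ.V0) * (θ.rr i j ^ 2 * θ.dyadProb true true i j) := by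
          refine Finset.sum_le_sum fun i _ => Finset.sum_le_sum fun j _ => ?_
          have h1 := Param.rr_nonneg (θ := θ) i j
          have h2 := pow_le_pow_left₀ h1 (Param.rr_le (θ := θ) i j) 2
          have h3 := h.sM_sq_mul_sN_sq_le
          have h4 : θ.rr i j ^ 2 ≤ ε * θ.V0 := h2.trans (by rw [mul_pow]; exact h3)
          have h5 := mul_le_mul_of_nonneg_right h4
            (mul_nonneg (sq_nonneg (θ.rr i j)) (Param.dyadProb_nonneg (θ := θ) true true i j))
          linarith
      _ = 8 * (ε * θ.V0) * ∑ i, ∑ j, θ.rr i j ^ 2 * θ.dyadProb true true i j := by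
          simp only [Finset.mul_sum]
      _ ≤ 8 * (ε * θ.V0) * θ.V0 := by
          gcongr
          exact Param.sum_rr_sq_le.trans (h.le_V0_left le_rfl)
      _ = _ := by ring
  by_cases hl : c * θ.sH ^ 2 ≤ θ.R * θ.sa * θ.sb
  · have huu : ∑ i, ∑ j, (θ.uu i j ^ 2) ^ 2 * θ.dyadProb true false i j ≤ 100 * ε * θ.V0 ^ 2 := by
      calc _ ≤ ∑ i, ∑ j, 10 * (ε * θ.V0) * (θ.uu i j ^ 2 * θ.dyadProb true false i j) := by
            refine Finset.sum_le_sum fun i _ => Finset.sum_le_sum fun j _ => ?_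
            have h5 := mul_le_mul_of_nonneg_right (h.uu_sq_le_of_large hl i j)
              (mul_nonneg (sq_nonneg (θ.uu i j)) (Param.dyadProb_nonneg (θ := θ) true false i j))
            linarith
        _ = 10 * (ε * θ.V0) * ∑ i, ∑ j, θ.uu i j ^ 2 * θ.dyadProb true false i j := by
            simp only [Finset.mul_sum]
        _ ≤ 10 * (ε * θ.V0) * (10 * θ.V0) := by
            gcongr
            exact Param.sum_uu_sq_le.trans (mul_le_mul_of_nonneg_left
              (Param.Sparse.le_V0_right le_rfl) (by norm_num))
        _ = _ := by ring
    simp only [e]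
    refine (ex_abs_le hA.measurable (s := 20 * √ε * θ.V0) (by positivity) ?_).trans ?_
    · refine (ex_sum_sum_sq_le hA (by simp) (by simp)).trans ?_
      simp only [Finset.sum_add_distrib]
      rw [mul_pow, mul_pow, hsq]
      have : 0 ≤ ε * θ.V0 ^ 2 := by positivity
      linarith
    · gcongr
      linarith
  · have h1 : ex P A (fun G => |∑ i, ∑ j, (2 * θ.rr i j ^ 2 * cen θ true true G i j
        + 0 * cen θ true false G i j)|) ≤ 3 * √ε * θ.V0 := by
      refine ex_abs_le hA.measurable (by positivity) ?_
      refine (ex_sum_sum_sq_le hA (g := fun _ _ => 0) (by simp) (by simp)).trans ?_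
      simp only [Finset.sum_add_distrib]
      rw [mul_pow, mul_pow, hsq]
      have : 0 ≤ ε * θ.V0 ^ 2 := by positivity
      simp
      linarith
    have h2 : ex P A (fun G => ∑ i, ∑ j, θ.uu i j ^ 2 * |cen θ true false G i j|)
        ≤ 20 * c * θ.V0 := by
      rw [ex_sum_sum hA.measurable]
      calc _ ≤ ∑ i, ∑ j, 2 * (θ.uu i j ^ 2 * θ.dyadProb true false i j) := by
            refine Finset.sum_le_sum fun i _ => Finset.sum_le_sum fun j _ => ?_
            have : ∀ G : Graph n, |cen θ true false G i j|
                ≤ Graph.dyad G true false i j + θ.dyadProb true false i j := fun G => by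
              have h1 := dyad_nonneg G true false i j
              have h2 := Param.dyadProb_nonneg (θ := θ) true false i j
              unfold cen
              rw [abs_le]
              constructor <;> linarith
            have h3 := ex_mono (P := P) hA.measurable this
            rw [ex_add hA.measurable, ex_const] at h3
            rw [ex_const_mul]
            have := ex_dyad_le hA true false i j
            nlinarith [sq_nonneg (θ.uu i j)]
        _ = 2 * ∑ i, ∑ j, θ.uu i j ^ 2 * θ.dyadProb true false i j := by
            simp only [Finset.mul_sum]
        _ ≤ 2 * (10 * (c * θ.V0)) := by
            gcongr
            refine Param.sum_uu_sq_le.trans (mul_le_mul_of_nonneg_left ?_ (by norm_num))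
            calc _ = θ.R * (θ.sM ^ 2 * θ.sN ^ 2) * (θ.R * θ.sa * θ.sb) := by ring
              _ ≤ θ.R * (θ.sM ^ 2 * θ.sN ^ 2) * (c * θ.sH ^ 2) :=
                  mul_le_mul_of_nonneg_left (not_le.1 hl).le (by positivity)
              _ = c * (θ.R * θ.sH ^ 2 * (θ.sM ^ 2 * θ.sN ^ 2)) := by ring
              _ ≤ _ := by
                  gcongr
                  exact h.le_V0_left le_rfl
        _ = _ := by ring
    have h3 : ∀ G, |semiV θ G - θ.V| ≤ |∑ i, ∑ j, (2 * θ.rr i j ^ 2 * cen θ true true G i j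
        + 0 * cen θ true false G i j)| + ∑ i, ∑ j, θ.uu i j ^ 2 * |cen θ true false G i j| := by
      intro G
      have e1 : semiV θ G - θ.V = (∑ i, ∑ j, (2 * θ.rr i j ^ 2 * cen θ true true G i j
          + 0 * cen θ true false G i j)) + ∑ i, ∑ j, θ.uu i j ^ 2 * cen θ true false G i j := by
        rw [e]
        simp only [← Finset.sum_add_distrib, zero_mul, add_zero]
      rw [e1]
      refine (abs_add_le _ _).trans (add_le_add_right ?_ _)
      refine (Finset.abs_sum_le_sum_abs _ _).trans (Finset.sum_le_sum fun i _ =>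
        (Finset.abs_sum_le_sum_abs _ _).trans (Finset.sum_le_sum fun j _ => ?_))
      rw [abs_mul, abs_of_nonneg (sq_nonneg _)]
    refine (ex_mono hA.measurable h3).trans ?_
    rw [ex_add hA.measurable]
    have : 0 ≤ √ε * θ.V0 := by positivity
    linarith

/-- Apart from the fluctuation of `A^{01}`, the estimate has the bias `d` from replacing `Ω^{00}` by
one. Both path sums lie between `(1 - 14ε) sM sN` and `sM sN`, so `d` is at most `14ε sM sN` in
absolute value. -/
theorem ex_errR_le : ex P A (errR θ) ≤ 20000 * (ε * θ.V0) := by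
  have hε := h.pos
  have hs := h.small
  have hR := Param.R_pos (θ := θ)
  have hV0 := h.V0_pos
  have M := Param.sM_nonneg (θ := θ)
  have N := Param.sN_nonneg (θ := θ)
  unfold errR
  rw [ex_sum_sum hA.measurable]
  have hb : ∀ i j, ex P A (fun G => Graph.dyad G true true i j * (rrHat G i j - θ.rr i j) ^ 2)
      ≤ 4096 * ((θ.R * θ.η i) * θ.η j
        * (2 * (θ.sN * θ.sM) + ε * (θ.sM ^ 2 * θ.sN ^ 2))) := by
    intro i j
    have hη := mul_pos (mul_pos hR (Param.η_pos (θ := θ) i)) (Param.η_pos (θ := θ) j)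
    by_cases hij : i = j
    · subst hij
      simp only [dyad_self, zero_mul, ex_const]
      positivity
    set d := pth i j (fun _ _ => 1) (θ.dyadProb false true) (fun _ _ => 1) - θ.rr i j with hd
    have e : ∀ G : Graph n, rrHat G i j - θ.rr i j
        = pth i j (fun _ _ => 1) (cen θ false true G) (fun _ _ => 1) + d := by
      intro G
      rw [rrHat, dyad_eq_add θ G, pth_add₂, hd]
      ring
    have d1 : pth i j (fun _ _ => 1) (θ.dyadProb false true) (fun _ _ => 1) ≤ θ.sM * θ.sN := by
      refine (pth_le Bd.one (Bd.dyadProb θ _ _) Bd.one i j).trans (le_of_eq ?_)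
      simp
      ring
    have d2 : (1 - 14 * ε) * (θ.sM * θ.sN)
        ≤ pth i j (fun _ _ => 1) (θ.dyadProb false true) (fun _ _ => 1) := by
      have := le_pth Bd.one (Bd.dyadProb θ false true) Bd.one hε.le hs
        (fun _ _ => by linarith) (h.le_dyadProb _ _) (fun _ _ => by linarith)
        (by simpa using h.ν_le_ε_sum) (by simpa using h.μ_le_ε_sum) hij
      refine le_trans (le_of_eq ?_) this
      simp [-mul_eq_mul_left_iff]
      ring
    have d3 : d ^ 2 ≤ (14 * ε * (θ.sM * θ.sN)) ^ 2 := by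
      have := Param.rr_le (θ := θ) i j
      have := h.le_rr hij
      apply sq_le_sq' <;> linarith
    have k := ex_dyad_mul_pth_mid hA (true, true) (false, true) Bd.one Bd.one i j
    have k2 := ex_dyad_mul_add_sq_le hA true true i j _ (d := d) k
    simp only [e]
    refine k2.trans ?_
    have p := Param.dyadProb_le (θ := θ) true true i j
    have p0 := Param.dyadProb_nonneg (θ := θ) true true i j
    simp at p
    simp
    have d4 := mul_le_mul d3 p p0 (sq_nonneg _)
    have d5 : (14 * ε * (θ.sM * θ.sN)) ^ 2 * (θ.R * θ.η i * θ.η j)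
        ≤ ε * (θ.sM ^ 2 * θ.sN ^ 2) * (θ.R * θ.η i * θ.η j) := by
      gcongr
      have : 196 * ε ^ 2 ≤ ε := by nlinarith
      have := mul_le_mul_of_nonneg_right this (show 0 ≤ (θ.sM * θ.sN) ^ 2 by positivity)
      linarith
    have d6 : 0 ≤ ε * (θ.sM ^ 2 * θ.sN ^ 2) * (θ.R * θ.η i * θ.η j) := by positivity
    linarith
  refine (sum_ex_le_of_le hb).trans ?_
  rw [Param.sum_R_η, Param.sum_η]
  have n6 := h.negligible.2.2.2.2.2.1
  have l1 := h.leading.1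
  have := mul_le_mul_of_nonneg_left l1 hε.le
  have t : 4096 * (θ.R * θ.sH * θ.sH * (2 * (θ.sN * θ.sM) + ε * (θ.sM ^ 2 * θ.sN ^ 2)))
    = 8192 * (θ.R * (θ.sH ^ 2 * θ.sM * θ.sN))
      + 4096 * (ε * (θ.R * (θ.sH ^ 2 * θ.sM ^ 2 * θ.sN ^ 2))) := by ring
  rw [t]
  have := mul_pos hε hV0
  linarith

theorem ex_errS_le : ex P A (errS θ) ≤ 20000 * (ε * θ.V0) := by
  have hε := h.pos
  have hs := h.small
  have hR := Param.R_pos (θ := θ)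
  have hV0 := h.V0_pos
  have H := h.one_le_sH
  unfold errS
  rw [ex_sum_sum hA.measurable]
  have hb : ∀ i j, ex P A (fun G => Graph.dyad G true false i j * (ssHat G i j - θ.ss i j) ^ 2)
      ≤ 4096 * (θ.μ i * θ.ν j
        * (2 * ((θ.R * θ.sH) * θ.sH) + ε * (θ.R * θ.sH ^ 2) ^ 2)) := by
    intro i j
    have hη := mul_pos (Param.μ_pos (θ := θ) i) (Param.ν_pos (θ := θ) j)
    by_cases hij : i = j
    · subst hij
      simp only [dyad_self, zero_mul, ex_const]
      positivity
    set d := pth i j (fun _ _ => 1) (θ.dyadProb true true) (fun _ _ => 1) - θ.ss i j with hd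
    have e : ∀ G : Graph n, ssHat G i j - θ.ss i j
        = pth i j (fun _ _ => 1) (cen θ true true G) (fun _ _ => 1) + d := by
      intro G
      rw [ssHat, dyad_eq_add θ G, pth_add₂, hd]
      ring
    have d1 : pth i j (fun _ _ => 1) (θ.dyadProb true true) (fun _ _ => 1) ≤ θ.R * θ.sH ^ 2 := by
      refine (pth_le Bd.one (Bd.dyadProb θ _ _) Bd.one i j).trans (le_of_eq ?_)
      simp
      ring
    have d2 : (1 - 14 * ε) * (θ.R * θ.sH ^ 2)
        ≤ pth i j (fun _ _ => 1) (θ.dyadProb true true) (fun _ _ => 1) := by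
      have := le_pth Bd.one (Bd.dyadProb θ true true) Bd.one hε.le hs
        (fun _ _ => by linarith) (h.le_dyadProb _ _) (fun _ _ => by linarith)
        (fun k => by
          have := mul_le_mul_of_nonneg_left (h.η_le_ε_sum k) hR.le
          simp
          linarith) (by simpa using h.η_le_ε_sum) hij
      refine le_trans (le_of_eq ?_) this
      simp [-mul_eq_mul_left_iff]
      ring
    have d3 : d ^ 2 ≤ (14 * ε * (θ.R * θ.sH ^ 2)) ^ 2 := by
      have := Param.ss_le (θ := θ) i j
      have := h.le_ss hij
      apply sq_le_sq' <;> linarith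
    have k := ex_dyad_mul_pth_mid hA (true, false) (true, true) Bd.one Bd.one i j
    have k2 := ex_dyad_mul_add_sq_le hA true false i j _ (d := d) k
    simp only [e]
    refine k2.trans ?_
    have p := Param.dyadProb_le (θ := θ) true false i j
    have p0 := Param.dyadProb_nonneg (θ := θ) true false i j
    simp at p
    simp
    have d4 := mul_le_mul d3 p p0 (sq_nonneg _)
    have d5 : (14 * ε * (θ.R * θ.sH ^ 2)) ^ 2 * (θ.μ i * θ.ν j)
        ≤ ε * (θ.R * θ.sH ^ 2) ^ 2 * (θ.μ i * θ.ν j) := by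
      gcongr
      have : 196 * ε ^ 2 ≤ ε := by nlinarith
      have := mul_le_mul_of_nonneg_right this (show 0 ≤ (θ.R * θ.sH ^ 2) ^ 2 by positivity)
      linarith
    have d6 : 0 ≤ ε * (θ.R * θ.sH ^ 2) ^ 2 * (θ.μ i * θ.ν j) := by positivity
    linarith
  refine (sum_ex_le_of_le hb).trans ?_
  rw [Param.sum_μ, Param.sum_ν]
  have n6 := h.negligible.2.2.2.2.2.1
  have l1 := h.leading.2.1
  have := mul_le_mul_of_nonneg_left l1 hε.le
  have t : 4096 * (θ.sM * θ.sN * (2 * ((θ.R * θ.sH) * θ.sH) + ε * (θ.R * θ.sH ^ 2) ^ 2))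
    = 8192 * (θ.R * (θ.sH ^ 2 * θ.sM * θ.sN))
      + 4096 * (ε * (θ.R ^ 2 * (θ.sH ^ 4 * θ.sM * θ.sN))) := by ring
  rw [t]
  have := mul_pos hε hV0
  linarith

omit h in
theorem ex_sum_dyad_mul_list_sq_le (a b : Bool) {B : ℝ} (L : List (Fin n → Fin n → Graph n → ℝ))
    (hL : ∀ f ∈ L, ∑ i, ∑ j, ex P A (fun G => Graph.dyad G a b i j * f i j G ^ 2) ≤ B) :
    ∑ i, ∑ j, ex P A (fun G => Graph.dyad G a b i j * ((L.map fun f => f i j G).sum) ^ 2)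
      ≤ (L.length : ℝ) ^ 2 * B := by
  have h1 : ∀ i j (G : Graph n), Graph.dyad G a b i j * ((L.map fun f => f i j G).sum) ^ 2
      ≤ (L.length : ℝ) * ∑ k : Fin L.length, Graph.dyad G a b i j * (L.get k) i j G ^ 2 := by
    intro i j G
    have e : (L.map fun f => f i j G).sum = ∑ k : Fin L.length, (L.get k) i j G := by
      rw [← List.sum_ofFn, ← List.ofFn_get (L.map fun f => f i j G)]
      congr 1
      simp [List.ofFn_eq_map]
    have := sq_sum_le_card_mul_sum_sq (s := (Finset.univ : Finset (Fin L.length)))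
      (f := fun k => (L.get k) i j G)
    rw [e, ← Finset.mul_sum]
    have := mul_le_mul_of_nonneg_left this (dyad_nonneg G a b i j)
    simp only [Finset.card_univ, Fintype.card_fin] at this
    linarith
  have h2 : ∀ i j, ex P A (fun G => Graph.dyad G a b i j * ((L.map fun f => f i j G).sum) ^ 2)
      ≤ (L.length : ℝ) * ∑ k : Fin L.length,
        ex P A (fun G => Graph.dyad G a b i j * (L.get k) i j G ^ 2) := by
    intro i j
    refine (ex_mono hA.measurable (h1 i j)).trans (le_of_eq ?_)
    rw [ex_const_mul, ex_sum hA.measurable]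
  have e2 : ∑ i, ∑ j, (L.length : ℝ) * ∑ k : Fin L.length, ex P A (fun G => Graph.dyad G a b i j
      * (L.get k) i j G ^ 2) = (L.length : ℝ) * ∑ k : Fin L.length, ∑ i, ∑ j,
        ex P A (fun G => Graph.dyad G a b i j * (L.get k) i j G ^ 2) := by
    rw [Finset.sum_comm, Finset.mul_sum]
    simp only [← Finset.mul_sum]
    congr 1
    rw [Finset.sum_comm]
    have : ∀ i, ∑ j, ∑ k : Fin L.length, ex P A (fun G => Graph.dyad G a b i j
        * (L.get k) i j G ^ 2) = ∑ k : Fin L.length, ∑ j, ex P A (fun G => Graph.dyad G a b i j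
        * (L.get k) i j G ^ 2) := fun i => Finset.sum_comm
    simp only [this]
    exact Finset.sum_comm
  refine (Finset.sum_le_sum fun i _ => Finset.sum_le_sum fun j _ => h2 i j).trans ?_
  rw [e2, sq, mul_assoc]
  gcongr
  refine (Finset.sum_le_sum fun k _ => hL _ (L.get_mem k)).trans (le_of_eq ?_)
  simp

omit h in
theorem ex_sum_dyad_mul_sq_le {d : Fin n → Fin n → ℝ} {D : ℝ} (hd : ∀ i j, d i j ^ 2
    ≤ D * (θ.R ^ 2 * θ.τ i j ^ 2)) (hD : 0 ≤ D) :
    ∑ i, ∑ j, ex P A (fun G => Graph.dyad G true false i j * d i j ^ 2) ≤ D * (10 * θ.V0) := by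
  have hR := Param.R_pos (θ := θ)
  calc _ ≤ ∑ i, ∑ j, D * θ.R ^ 2 * (θ.μ i * θ.ν j * (θ.sH ^ 4 + θ.τ i j ^ 2)) := by
        refine Finset.sum_le_sum fun i _ => Finset.sum_le_sum fun j _ => ?_
        rw [ex_mul_const]
        have h1 := (ex_dyad_le hA true false i j).trans (Param.dyadProb_le true false i j)
        simp only [Param.wout_tf, Param.win_tf] at h1
        have h2 := mul_pos (Param.μ_pos (θ := θ) i) (Param.ν_pos (θ := θ) j)
        have h3 := mul_le_mul h1 (hd i j) (sq_nonneg _) h2.le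
        have h4 : 0 ≤ D * θ.R ^ 2 * (θ.μ i * θ.ν j * θ.sH ^ 4) := by positivity
        linarith
    _ = D * θ.R ^ 2 * ∑ i, ∑ j, θ.μ i * θ.ν j * (θ.sH ^ 4 + θ.τ i j ^ 2) := by
        simp only [Finset.mul_sum]
    _ ≤ D * θ.R ^ 2 * (10 * (θ.sM ^ 2 * θ.sN ^ 2 * (θ.sa * θ.sb))) := by
        gcongr
        exact Param.sum_weighted_le
    _ = D * (10 * (θ.R ^ 2 * θ.sa * θ.sb * (θ.sM ^ 2 * θ.sN ^ 2))) := by ring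
    _ ≤ _ := by
        gcongr
        exact Param.Sparse.le_V0_right le_rfl

omit h in
theorem ex_sizeT_le : ex P A (sizeT θ) ≤ 10 * θ.V0 := by
  unfold sizeT
  rw [ex_sum_sum hA.measurable]
  refine (ex_sum_dyad_mul_sq_le hA (d := fun i j => θ.R * θ.tt i j) (D := 1) (fun i j => ?_)
    zero_le_one).trans (le_of_eq (one_mul _))
  rw [mul_pow, one_mul]
  gcongr
  · exact Param.tt_nonneg i j
  · exact Param.tt_le i j

/-- Each of the three paths has two random edges and so three terms that are not deterministic;
together with the bias there are ten terms, and `10² * 4096 ≤ 500000`. -/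
theorem ex_errT_le : ex P A (errT θ) ≤ 500000 * (ε * θ.V0) := by
  have hε := h.pos
  have hs := h.small
  have hR := Param.R_pos (θ := θ)
  have hV0 := h.V0_pos
  obtain ⟨n1, n2, n3, n4, n5, n6, n7, n8, n9, n10⟩ := h.negligible'
  have B10 := Bd.dyadProb θ true false
  set p := θ.dyadProb true false with hp
  set X := cen θ true false with hX
  set o : Fin n → Fin n → ℝ := fun _ _ => 1 with ho
  have O : Bd o (fun _ => 1) (fun _ => 1) := Bd.one
  unfold errT
  rw [ex_sum_sum hA.measurable]
  set d : Fin n → Fin n → ℝ := fun i j =>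
    θ.R * (pth i j p p o + pth i j o p p + pth i j p o p - θ.tt i j) with hd
  have key := ex_sum_dyad_mul_list_sq_le hA (P := P) true false (B := 4096 * (ε * θ.V0))
    [fun i j G => θ.R * pth i j (X G) p o, fun i j G => θ.R * pth i j p (X G) o,
     fun i j G => θ.R * pth i j (X G) (X G) o, fun i j G => θ.R * pth i j o (X G) p,
     fun i j G => θ.R * pth i j o p (X G), fun i j G => θ.R * pth i j o (X G) (X G),
     fun i j G => θ.R * pth i j (X G) o p, fun i j G => θ.R * pth i j p o (X G),
     fun i j G => θ.R * pth i j (X G) o (X G), fun i j G => d i j] ?_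
  · refine le_trans (le_of_eq ?_) (key.trans ?_)
    · refine Finset.sum_congr rfl fun i _ => Finset.sum_congr rfl fun j _ => ?_
      congr 1
      funext G
      congr 2
      unfold ttHat
      simp only [dyad_eq_add θ G, pth_add₁, pth_add₂, pth_add₃, List.map_cons,
        List.map_nil, List.sum_cons, List.sum_nil, hd]
      ring
    · simp only [List.length_cons, List.length_nil]
      have := mul_pos hε hV0
      push_cast
      linarith
  · simp only [List.forall_mem_cons]
    have fin : ∀ {f : Fin n → Fin n → Graph n → ℝ} {u v : Fin n → ℝ} {C z : ℝ},
        (∀ i j, ex P A (fun G => Graph.dyad G true false i j * f i j G ^ 2)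
          ≤ 4096 * (u i * v j * C)) →
        θ.R ^ 2 * ((∑ i, u i) * (∑ j, v j) * C) = z → z ≤ ε * θ.V0 →
        ∑ i, ∑ j, ex P A (fun G => Graph.dyad G true false i j * (θ.R * f i j G) ^ 2)
          ≤ 4096 * (ε * θ.V0) := by
      intro f u v C z h1 h2 h3
      have e : ∀ i j (G : Graph n), Graph.dyad G true false i j * (θ.R * f i j G) ^ 2
          = θ.R ^ 2 * (Graph.dyad G true false i j * f i j G ^ 2) := fun i j G => by ring
      simp only [e, ex_const_mul, ← Finset.mul_sum]
      have h4 := mul_le_mul_of_nonneg_left (sum_ex_le_of_le h1) (sq_nonneg θ.R)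
      linarith
    refine ⟨?_, ?_, ?_, ?_, ?_, ?_, ?_, ?_, ?_, ?_, by simp⟩
    · refine fin (ex_dyad_mul_pth_left hA (true, false) (true, false) B10 O) ?_ n3
      simp [-mul_eq_mul_left_iff] <;> ring
    · refine fin (ex_dyad_mul_pth_mid hA (true, false) (true, false) B10 O) ?_ n7
      simp [-mul_eq_mul_left_iff] <;> ring
    · refine fin (ex_dyad_mul_pth_left_mid hA (true, false) (true, false) (true, false) O) ?_ n10
      simp [-mul_eq_mul_left_iff] <;> ring
    · refine fin (ex_dyad_mul_pth_mid hA (true, false) (true, false) O B10) ?_ n7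
      simp [-mul_eq_mul_left_iff] <;> ring
    · refine fin (ex_dyad_mul_pth_right hA (true, false) (true, false) O B10) ?_ n2
      simp [-mul_eq_mul_left_iff] <;> ring
    · refine fin (ex_dyad_mul_pth_mid_right hA (true, false) (true, false) (true, false) O) ?_ n10
      simp [-mul_eq_mul_left_iff] <;> ring
    · refine fin (ex_dyad_mul_pth_left hA (true, false) (true, false) O B10) ?_ n2
      simp [-mul_eq_mul_left_iff] <;> ring
    · refine fin (ex_dyad_mul_pth_right hA (true, false) (true, false) B10 O) ?_ n3
      simp [-mul_eq_mul_left_iff] <;> ring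
    · refine fin (ex_dyad_mul_pth_left_right hA (true, false) (true, false) (true, false) O) ?_ n10
      simp [-mul_eq_mul_left_iff] <;> ring
    -- The bias term: both sums lie in `[(1 - 14ε) τ, τ]`, and `10 * (14ε)² = 1960 ε²` is below
    -- `4096 ε`.
    · refine (ex_sum_dyad_mul_sq_le hA (D := (14 * ε) ^ 2) (fun i j => ?_)
        (sq_nonneg _)).trans ?_
      · have hτ := Param.τ_nonneg (θ := θ) i j
        by_cases hij : i = j
        · subst hij
          simp [hd, pth_self]
          positivity
        have d1 : pth i j p p o + pth i j o p p + pth i j p o p ≤ θ.τ i j := by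
          refine (add_le_add (add_le_add (pth_le B10 B10 O i j) (pth_le O B10 B10 i j))
            (pth_le B10 O B10 i j)).trans (le_of_eq ?_)
          simp [Param.τ]
          ring
        have lp : ∀ i j, (1 - 3 * ε) * (θ.wout true false i * θ.win true false j) ≤ p i j :=
          h.le_dyadProb true false
        have lo : ∀ i j : Fin n, (1 - 3 * ε) * ((1 : ℝ) * 1) ≤ o i j := fun i j => by
          simp only [ho]
          linarith
        have d2 : (1 - 14 * ε) * θ.τ i j
            ≤ pth i j p p o + pth i j o p p + pth i j p o p := by
          have k1 := le_pth B10 B10 O hε.le hs lp lp lo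
            (by simpa [Param.η, mul_comm (θ.ν _)] using h.η_le_ε_sum)
            (by simpa using h.ν_le_ε_sum) hij
          have k2 := le_pth O B10 B10 hε.le hs lo lp lp (by simpa using h.μ_le_ε_sum)
            (by simpa [Param.η, mul_comm (θ.ν _)] using h.η_le_ε_sum) hij
          have k3 := le_pth B10 O B10 hε.le hs lp lo lp (by simpa using h.ν_le_ε_sum)
            (by simpa using h.μ_le_ε_sum) hij
          refine le_trans (le_of_eq ?_) (add_le_add (add_le_add k1 k2) k3)
          simp [Param.τ]
          ring
        have d3 := Param.tt_le (θ := θ) i j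
        have d4 := h.le_tt hij
        simp only [hd]
        have d5 : (pth i j p p o + pth i j o p p + pth i j p o p - θ.tt i j) ^ 2
            ≤ (14 * ε * θ.τ i j) ^ 2 := by
          apply sq_le_sq' <;> linarith
        have d6 := mul_le_mul_of_nonneg_left d5 (sq_nonneg θ.R)
        linarith
      · have : 1960 * ε ^ 2 ≤ 4096 * ε := by nlinarith
        nlinarith

end VarianceEstimator

end P1

namespace P1

/-! ### Convergence in probability as convergence along a filter -/

section ProbFilter

variable {Ω : ℕ → Type*} [∀ n, MeasurableSpace (Ω n)] (P : ∀ n, Measure (Ω n))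
  [∀ n, IsProbabilityMeasure (P n)]

/-- The filter of events whose probability tends to one: convergence in probability is convergence
along this filter. -/
def probFilter : Filter (Σ n, Ω n) where
  sets := {S | Tendsto (fun n => (P n).real {ω | (⟨n, ω⟩ : Σ n, Ω n) ∉ S}) atTop (𝓝 0)}
  univ_sets := by simp
  sets_of_superset {S T} hS hST :=
    squeeze_zero (fun n => measureReal_nonneg)
      (fun n => measureReal_mono (fun ω hω hT => hω (hST hT)) (measure_ne_top _ _)) hS
  inter_sets {S T} hS hT := by
    have h := Tendsto.add (Set.mem_ofPred_eq ▸ hS) (Set.mem_ofPred_eq ▸ hT)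
    rw [add_zero] at h
    refine squeeze_zero (fun n => measureReal_nonneg) (fun n => ?_) h
    refine le_trans (measureReal_mono ?_ (measure_ne_top _ _)) (measureReal_union_le _ _)
    intro ω hω
    by_contra hc
    simp only [Set.mem_union, Set.mem_ofPred_eq, not_or, not_not] at hc
    exact hω hc

variable {P}

theorem eventually_probFilter {p : (Σ n, Ω n) → Prop} : (∀ᶠ x in probFilter P, p x) ↔
    Tendsto (fun n => (P n).real {ω | ¬ p ⟨n, ω⟩}) atTop (𝓝 0) := Iff.rfl

theorem tendsto_fst_probFilter : Tendsto (fun x : Σ n, Ω n => x.1) (probFilter P) atTop := by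
  rw [tendsto_atTop]
  intro N
  rw [eventually_probFilter]
  refine tendsto_const_nhds.congr' ?_
  filter_upwards [eventually_ge_atTop N] with n hn
  simp [hn]

theorem tendstoInProb_iff {X : ∀ n, Ω n → ℝ} {c : ℝ} :
    TendstoInProb P X c ↔ Tendsto (fun x : Σ n, Ω n => X x.1 x.2) (probFilter P) (𝓝 c) := by
  rw [Metric.tendsto_nhds]
  simp only [eventually_probFilter, Real.dist_eq, not_lt]
  rfl

theorem eventually_probFilter_of_eventually {p : ℕ → Prop} (h : ∀ᶠ n in atTop, p n) :
    ∀ᶠ x : Σ n, Ω n in probFilter P, p x.1 := tendsto_fst_probFilter.eventually h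

theorem tendsto_prob_one {S : ∀ n, Set (Ω n)} (hS : ∀ n, MeasurableSet (S n))
    (h : ∀ᶠ x : Σ n, Ω n in probFilter P, x.2 ∈ S x.1) :
    Tendsto (fun n => (P n).real (S n)) atTop (𝓝 1) := by
  have h' := (eventually_probFilter.1 h).const_sub 1
  rw [sub_zero] at h'
  refine h'.congr fun n => ?_
  have := probReal_add_probReal_compl (μ := P n) (hS n)
  have e : {ω | ¬ ω ∈ S n} = (S n)ᶜ := rfl
  simp only [e]
  linarith

/-- The product of a tight sequence and of one that tends to zero in probability. -/
theorem tendsto_mul_of_tight {X : ∀ n, Ω n → ℝ} {Y : (Σ n, Ω n) → ℝ} {C : ℝ}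
    (hX : ∀ᶠ n in atTop, ∀ M > 0, (P n).real {ω | M ≤ |X n ω|} ≤ C / M)
    (hY : Tendsto Y (probFilter P) (𝓝 0)) :
    Tendsto (fun x : Σ n, Ω n => X x.1 x.2 * Y x) (probFilter P) (𝓝 0) := by
  rw [Metric.tendsto_nhds] at hY ⊢
  intro e he
  rw [eventually_probFilter, Metric.tendsto_atTop]
  intro η hη
  obtain ⟨M, hM0, hM⟩ : ∃ M : ℝ, 0 < M ∧ C / M < η / 2 := by
    refine ⟨2 * (|C| + 1) / η, by positivity, ?_⟩
    rw [div_lt_iff₀ (by positivity)]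
    have : η / 2 * (2 * (|C| + 1) / η) = |C| + 1 := by field_simp
    rw [this]
    linarith [le_abs_self C]
  have hY' := eventually_probFilter.1 (hY (e / M) (by positivity))
  obtain ⟨N, hN⟩ := eventually_atTop.1
    (hX.and (hY'.eventually (gt_mem_nhds (show (0 : ℝ) < η / 2 by positivity))))
  refine ⟨N, fun n hn => ?_⟩
  obtain ⟨h1, h2⟩ := hN n hn
  rw [Real.dist_eq, sub_zero, abs_of_nonneg measureReal_nonneg]
  refine lt_of_le_of_lt (le_trans (measureReal_mono ?_ (measure_ne_top _ _))
    (measureReal_union_le {ω | M ≤ |X n ω|} {ω | ¬ dist (Y ⟨n, ω⟩) 0 < e / M})) ?_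
  · intro ω hω
    by_contra hc
    simp only [Set.mem_union, Set.mem_ofPred_eq, not_or, not_not, not_le] at hc
    refine hω ?_
    rw [Real.dist_eq, sub_zero] at hc ⊢
    rw [abs_mul]
    calc |X n ω| * |Y ⟨n, ω⟩| ≤ M * |Y ⟨n, ω⟩| := by gcongr; exact hc.1.le
      _ < M * (e / M) := by gcongr; exact hc.2
      _ = e := by field_simp
  · have := h1 M hM0
    linarith

end ProbFilter

/-! ### From estimates for a single `n` to limits -/

section Sequences

variable {θ : ∀ n : ℕ, Param n}

/-- The asymptotic form of the sparsity and degree conditions. -/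
def SparseSeq (θ : ∀ n : ℕ, Param n) : Prop :=
  ∀ ε c : ℝ, 0 < ε → ε ≤ 1 / 1000 → 0 < c → c ≤ 1 → ∀ᶠ n in atTop, (θ n).Sparse ε c

theorem SparseSeq.eventually (hS : SparseSeq θ) :
    ∀ᶠ n in atTop, (θ n).Sparse (1 / 1000) 1 :=
  hS _ _ (by norm_num) le_rfl one_pos le_rfl

theorem SparseSeq.eventually_le (hS : SparseSeq θ) {f : ℕ → ℝ} {C : ℝ}
    (h : ∀ n ε c, (θ n).Sparse ε c → f n ≤ C * (√ε + c)) {e : ℝ} (he : 0 < e) :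
    ∀ᶠ n in atTop, f n < e := by
  -- With `ε = t ^ 2` and `c = t` both contributions to the bound equal `t`.
  set t : ℝ := min (1 / 1000) (e / (4 * (|C| + 1))) with ht
  have ht0 : 0 < t := lt_min (by norm_num) (by positivity)
  have ht1 : t ≤ 1 / 1000 := min_le_left _ _
  have ht2 : t ≤ e / (4 * (|C| + 1)) := min_le_right _ _
  filter_upwards [hS (t ^ 2) t (by positivity) (by nlinarith) ht0 (by linarith)] with n hn
  refine (h n _ _ hn).trans_lt ?_
  rw [Real.sqrt_sq ht0.le]
  have h1 : C * (t + t) ≤ (|C| + 1) * (2 * t) := by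
    have := le_abs_self C
    nlinarith
  rw [le_div_iff₀ (by positivity)] at ht2
  nlinarith

theorem SparseSeq.tendsto_zero (hS : SparseSeq θ) {f : ℕ → ℝ} {C : ℝ}
    (h : ∀ n ε c, (θ n).Sparse ε c → |f n| ≤ C * (√ε + c)) : Tendsto f atTop (𝓝 0) := by
  rw [Metric.tendsto_nhds]
  intro e he
  filter_upwards [hS.eventually_le h he] with n hn
  rwa [Real.dist_eq, sub_zero]

variable {Ω : ℕ → Type*} [∀ n, MeasurableSpace (Ω n)] {P : ∀ n, Measure (Ω n)}
  [∀ n, IsProbabilityMeasure (P n)] {A : ∀ n, Ω n → Graph n}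
  (hA : ∀ n, IsP1Model (θ n) (P n) (A n))

theorem prob_ge_le {n : ℕ} (hm : Measurable (A n)) (f : Graph n → ℝ) {M : ℝ} (hM : 0 < M) :
    (P n).real {ω | M ≤ |f (A n ω)|} ≤ ex (P n) (A n) (fun G => |f G|) / M := by
  rw [le_div_iff₀ hM, mul_comm]
  exact mul_meas_ge_le_integral_of_nonneg (ae_of_all _ fun _ => abs_nonneg _)
    (integrable_graph_comp hm fun G => |f G|) M

include hA

/-- Markov's inequality turns convergence in mean into convergence in probability. -/
theorem SparseSeq.tendsto_probFilter_zero (hS : SparseSeq θ) {f : ∀ n, Graph n → ℝ} {C : ℝ}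
    (h : ∀ n ε c, (θ n).Sparse ε c → ex (P n) (A n) (fun G => |f n G|) ≤ C * (√ε + c)) :
    Tendsto (fun x : Σ n, Ω n => f x.1 (A x.1 x.2)) (probFilter P) (𝓝 0) := by
  rw [← tendstoInProb_iff (X := fun n ω => f n (A n ω))]
  intro e he
  simp only [sub_zero]
  refine squeeze_zero (fun n => measureReal_nonneg)
    (fun n => prob_ge_le (hA n).measurable (f n) he) ?_
  have := (hS.tendsto_zero (f := fun n => ex (P n) (A n) fun G => |f n G|) (C := C)
    fun n ε c hn => by
      rw [abs_of_nonneg (ex_nonneg fun _ => abs_nonneg _)]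
      exact h n ε c hn).div_const e
  rwa [zero_div] at this

end Sequences

/-! ### Mean, variance and linearization of the statistics for a single `n` -/

section Limits

section Single

variable {n : ℕ} {θ : Param n} {ε c : ℝ} {Ω : Type*} [MeasurableSpace Ω] {P : Measure Ω}
  [IsProbabilityMeasure P] {A : Ω → Graph n} (hA : IsP1Model θ P A) (h : θ.Sparse ε c)

/-- The statistic `U = Q_n(a) - e^ρ Q_n(b)`. -/
noncomputable def statU (θ : Param n) (G : Graph n) : ℝ := Graph.Qa G - θ.R * Graph.Qb G

include h in
theorem ε_le_sqrt : ε ≤ √ε := by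
  have := Real.sqrt_nonneg ε
  have h1 := Real.sq_sqrt h.pos.le
  have : √ε ≤ 1 := Real.sqrt_le_one.2 h.ε_le_one
  nlinarith

include hA h

theorem ex_abs_Qa_sub_le :
    ex P A (fun G => |Graph.Qa G - meanQ θ|) ≤ 700 * √ε * meanQ θ := by
  have hε := h.pos
  have hs := h.small
  have hq := h.meanQ_pos
  have hV0 := h.V0_pos
  have hsε : 0 < √ε := Real.sqrt_pos.2 hε
  refine ex_abs_le hA.measurable (by positivity) ?_
  have h1 := ex_add_sq_le hA.measurable (P := P) (fun G => Graph.Qa G - meanQ θ - linA θ G) (linA θ)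
  simp only [sub_add_cancel] at h1
  have h2 := ex_remA_sq_le hA h
  have h3 := ex_linA_sq_le hA h
  have h4 := h.V0_le_meanQ_sq
  rw [mul_pow, mul_pow, Real.sq_sqrt hε.le]
  have h5 : ε * θ.V0 ≤ 1 / 1000 * θ.V0 := by gcongr
  linarith

theorem ex_abs_Qb_sub_le :
    ex P A (fun G => |θ.R * Graph.Qb G - meanQ θ|) ≤ 1000 * √ε * meanQ θ := by
  have hε := h.pos
  have hs := h.small
  have hq := h.meanQ_pos
  have hV0 := h.V0_pos
  have hsε : 0 < √ε := Real.sqrt_pos.2 hε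
  refine ex_abs_le hA.measurable (by positivity) ?_
  have h1 := ex_add_sq_le hA.measurable (P := P)
    (fun G => θ.R * Graph.Qb G - meanQ θ - θ.R * linB θ G) (fun G => θ.R * linB θ G)
  simp only [sub_add_cancel] at h1
  have h2 := ex_remB_sq_le hA h
  have h3 := ex_linB_sq_le hA h
  have h4 := h.V0_le_meanQ_sq
  rw [mul_pow, mul_pow, Real.sq_sqrt hε.le]
  have h5 : ε * θ.V0 ≤ 1 / 1000 * θ.V0 := by gcongr
  linarith

/-- The common mean `meanQ` cancels in `Qa - R * Qb`, so the error is the difference of the two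
remainders. -/
theorem ex_statU_sub_sq_le :
    ex P A (fun G => (statU θ G - linU θ G) ^ 2) ≤ 7000000 * (ε * θ.V) := by
  have h1 := ex_sub_sq_le hA.measurable (P := P) (fun G => Graph.Qa G - meanQ θ - linA θ G)
    (fun G => θ.R * Graph.Qb G - meanQ θ - θ.R * linB θ G)
  have e : ∀ G : Graph n, Graph.Qa G - meanQ θ - linA θ G
      - (θ.R * Graph.Qb G - meanQ θ - θ.R * linB θ G) = statU θ G - linU θ G := by
    intro G
    unfold statU linU
    ring
  simp only [e] at h1
  have h2 := ex_remA_sq_le hA h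
  have h3 := ex_remB_sq_le hA h
  have h4 := mul_le_mul_of_nonneg_left h.le_V h.pos.le
  linarith

/-- Young's inequality with parameter `√ε` balances the loss `√ε V` on the linear part against `ε V
/ √ε` from the remainder. The mean of `U` is that of the remainder, because `linU` is centred. -/
theorem abs_variance_statU_sub_le :
    |variance (fun ω => statU θ (A ω)) P - θ.V| ≤ 30000000 * √ε * θ.V := by
  have hε := h.pos
  have hs := h.small
  have hV := h.V_pos
  have hm := hA.measurable
  have hsε : 0 < √ε := Real.sqrt_pos.2 hε
  have hsq : √ε ^ 2 = ε := Real.sq_sqrt hε.le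
  have hle := ε_le_sqrt h
  set d := ex P A (fun G => (statU θ G - linU θ G) ^ 2) with hd
  set v := ex P A (fun G => linU θ G ^ 2) with hv
  have hd1 : d ≤ 7000000 * (ε * θ.V) := ex_statU_sub_sq_le hA h
  have hv1 : v ≤ θ.V := ex_linU_sq_le hA
  have hv2 := le_ex_linU_sq hA h
  have hd0 : 0 ≤ d := ex_nonneg fun _ => sq_nonneg _
  have hL : MemLp (fun ω => statU θ (A ω)) 2 P := by
    rw [memLp_two_iff_integrable_sq (measurable_graph_comp hm _).aestronglyMeasurable]
    exact integrable_graph_comp hm (fun G => statU θ G ^ 2)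
  have e1 : variance (fun ω => statU θ (A ω)) P
      = ex P A (fun G => statU θ G ^ 2) - ex P A (statU θ) ^ 2 := by
    rw [variance_eq_sub hL]
    rfl
  have e2 : ex P A (statU θ) = ex P A (fun G => statU θ G - linU θ G) := by
    rw [ex_sub hm, ex_linU hA, sub_zero]
  have e3 : ex P A (statU θ) ^ 2 ≤ d := by
    rw [e2]
    have hL' : MemLp (fun ω => statU θ (A ω) - linU θ (A ω)) 2 P := by
      rw [memLp_two_iff_integrable_sq (measurable_graph_comp hm
        fun G => statU θ G - linU θ G).aestronglyMeasurable]
      exact integrable_graph_comp hm (fun G => (statU θ G - linU θ G) ^ 2)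
    have := variance_nonneg (fun ω => statU θ (A ω) - linU θ (A ω)) P
    rw [variance_eq_sub hL'] at this
    exact sub_nonneg.1 this
  have e4 : ex P A (fun G => statU θ G ^ 2) ≤ v + √ε * v + (1 / √ε) * d + d := by
    have : ∀ G, statU θ G ^ 2 ≤ linU θ G ^ 2 + √ε * linU θ G ^ 2
        + (1 / √ε) * (statU θ G - linU θ G) ^ 2 + (statU θ G - linU θ G) ^ 2 := by
      intro G
      have k := le_of_abs_le (abs_sq_add_sub_le hsε (linU θ G) (statU θ G - linU θ G))
      rw [add_sub_cancel] at k
      linarith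
    refine (ex_mono hm this).trans (le_of_eq ?_)
    rw [ex_add hm, ex_add hm, ex_add hm, ex_const_mul, ex_const_mul]
  have e5 : v - √ε * v - (1 / √ε) * d - d ≤ ex P A (fun G => statU θ G ^ 2) := by
    have : ∀ G, linU θ G ^ 2 - √ε * linU θ G ^ 2
        - (1 / √ε) * (statU θ G - linU θ G) ^ 2 - (statU θ G - linU θ G) ^ 2
          ≤ statU θ G ^ 2 := by
      intro G
      have k := neg_le_of_abs_le (abs_sq_add_sub_le hsε (linU θ G) (statU θ G - linU θ G))
      rw [add_sub_cancel] at k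
      linarith
    refine le_trans (le_of_eq ?_) (ex_mono hm this)
    rw [ex_sub hm, ex_sub hm, ex_sub hm, ex_const_mul, ex_const_mul]
  have e6 : (1 / √ε) * d ≤ 7000000 * (√ε * θ.V) := by
    calc (1 / √ε) * d ≤ (1 / √ε) * (7000000 * (ε * θ.V)) := by gcongr
      _ = (1 / √ε) * (7000000 * (√ε ^ 2 * θ.V)) := by rw [hsq]
      _ = _ := by field_simp
  have e7 : √ε * v ≤ √ε * θ.V := by gcongr
  have e8 : ε * θ.V ≤ √ε * θ.V := by gcongr
  have e9 : 0 ≤ √ε * θ.V := by positivity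
  have e10 := sq_nonneg (ex P A (statU θ))
  rw [e1, abs_le]
  constructor <;> linarith

end Single

end Limits

end P1

namespace P1

/-! ### Limits of the ratio, the variance estimator and the studentized statistic -/

section ConvergenceInProbability

variable {θ : ∀ n : ℕ, Param n} {Ω : ℕ → Type*} [∀ n, MeasurableSpace (Ω n)]
  {P : ∀ n, Measure (Ω n)} [∀ n, IsProbabilityMeasure (P n)] {A : ∀ n, Ω n → Graph n}
  (hA : ∀ n, IsP1Model (θ n) (P n) (A n)) (hS : SparseSeq θ)
include hA hS

theorem tendsto_Qa_div : Tendsto (fun x : Σ n, Ω n => (A x.1 x.2).Qa / meanQ (θ x.1))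
    (probFilter P) (𝓝 1) := by
  have key := hS.tendsto_probFilter_zero hA (f := fun n G => (Graph.Qa G - meanQ (θ n)) / meanQ (θ n))
    (C := 700) fun n ε c h => by
      have hq := h.meanQ_pos
      simp only [abs_div, abs_of_pos hq]
      simp only [div_eq_mul_inv]
      rw [ex_mul_const, ← div_eq_mul_inv, div_le_iff₀ hq]
      refine (ex_abs_Qa_sub_le (hA n) h).trans ?_
      have := mul_pos h.c_pos hq
      linarith
  have := key.add_const 1
  rw [zero_add] at this
  refine this.congr' ?_
  filter_upwards [eventually_probFilter_of_eventually hS.eventually] with x hx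
  have := hx.meanQ_pos.ne'
  field_simp
  ring

theorem tendsto_Qb_div : Tendsto (fun x : Σ n, Ω n =>
    (θ x.1).R * (A x.1 x.2).Qb / meanQ (θ x.1)) (probFilter P) (𝓝 1) := by
  have key := hS.tendsto_probFilter_zero hA
    (f := fun n G => ((θ n).R * Graph.Qb G - meanQ (θ n)) / meanQ (θ n))
    (C := 1000) fun n ε c h => by
      have hq := h.meanQ_pos
      simp only [abs_div, abs_of_pos hq]
      simp only [div_eq_mul_inv]
      rw [ex_mul_const, ← div_eq_mul_inv, div_le_iff₀ hq]
      refine (ex_abs_Qb_sub_le (hA n) h).trans ?_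
      have := mul_pos h.c_pos hq
      linarith
  have := key.add_const 1
  rw [zero_add] at this
  refine this.congr' ?_
  filter_upwards [eventually_probFilter_of_eventually hS.eventually] with x hx
  have := hx.meanQ_pos.ne'
  field_simp
  ring

theorem eventually_pos : ∀ᶠ x : Σ n, Ω n in probFilter P,
    0 < (A x.1 x.2).Qa ∧ 0 < (A x.1 x.2).Qb := by
  filter_upwards [eventually_probFilter_of_eventually hS.eventually,
    (tendsto_Qa_div hA hS).eventually (lt_mem_nhds (zero_lt_one' ℝ)),
    (tendsto_Qb_div hA hS).eventually (lt_mem_nhds (zero_lt_one' ℝ))] with x hx h1 h2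
  have hq := hx.meanQ_pos
  have hR := Param.R_pos (θ := θ x.1)
  rw [lt_div_iff₀ hq, zero_mul] at h1 h2
  exact ⟨h1, pos_of_mul_pos_right h2 hR.le⟩

/-- The ratio `e^(ρ̂ - ρ)`. -/
theorem tendsto_ratio : Tendsto (fun x : Σ n, Ω n =>
    (A x.1 x.2).Qa / ((θ x.1).R * (A x.1 x.2).Qb)) (probFilter P) (𝓝 1) := by
  have := (tendsto_Qa_div hA hS).div (tendsto_Qb_div hA hS) one_ne_zero
  rw [div_one] at this
  refine this.congr' ?_
  filter_upwards [eventually_probFilter_of_eventually hS.eventually] with x hx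
  exact div_div_div_cancel_right₀ hx.meanQ_pos.ne' _ _

theorem eventually_exp_ρhat : ∀ᶠ x : Σ n, Ω n in probFilter P,
    Real.exp (A x.1 x.2).ρhat = (A x.1 x.2).Qa / ((θ x.1).R * (A x.1 x.2).Qb) * (θ x.1).R := by
  filter_upwards [eventually_pos hA hS] with x ⟨h1, h2⟩
  have hR := Param.R_pos (θ := θ x.1)
  rw [Graph.ρhat, Real.exp_log (div_pos h1 h2)]
  field_simp

theorem eventually_ρhat_sub : ∀ᶠ x : Σ n, Ω n in probFilter P,
    (A x.1 x.2).ρhat - (θ x.1).ρ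
      = Real.log ((A x.1 x.2).Qa / ((θ x.1).R * (A x.1 x.2).Qb)) := by
  filter_upwards [eventually_pos hA hS] with x ⟨h1, h2⟩
  have hR := Param.R_pos (θ := θ x.1)
  rw [Graph.ρhat, mul_comm, ← div_div, Real.log_div (div_pos h1 h2).ne' hR.ne', Param.R,
    Real.log_exp]

theorem tendsto_semiV_div : Tendsto (fun x : Σ n, Ω n => semiV (θ x.1) (A x.1 x.2) / (θ x.1).V)
    (probFilter P) (𝓝 1) := by
  have key := hS.tendsto_probFilter_zero hA
    (f := fun n G => (semiV (θ n) G - (θ n).V) / (θ n).V)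
    (C := 50) fun n ε c h => by
      have hV := h.V_pos
      simp only [abs_div, abs_of_pos hV]
      simp only [div_eq_mul_inv]
      rw [ex_mul_const, ← div_eq_mul_inv, div_le_iff₀ hV]
      refine (ex_abs_semiV_sub_le (hA n) h).trans ?_
      have := mul_le_mul_of_nonneg_left h.le_V (add_nonneg (Real.sqrt_nonneg ε) h.c_pos.le)
      linarith
  have := key.add_const 1
  rw [zero_add] at this
  refine this.congr' ?_
  filter_upwards [eventually_probFilter_of_eventually hS.eventually] with x hx
  have := hx.V_pos.ne'
  field_simp
  ring

theorem tendsto_err_div {f : ∀ n, Graph n → ℝ} {C : ℝ} (hC : 0 ≤ C) (h0 : ∀ n G, 0 ≤ f n G)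
    (h : ∀ n ε c, (θ n).Sparse ε c → ex (P n) (A n) (f n) ≤ C * (ε * (θ n).V0)) :
    Tendsto (fun x : Σ n, Ω n => f x.1 (A x.1 x.2) / (θ x.1).V) (probFilter P) (𝓝 0) := by
  refine hS.tendsto_probFilter_zero hA (f := fun n G => f n G / (θ n).V) (C := 3 * C)
    fun n ε c hs => ?_
  have hV := hs.V_pos
  simp only [abs_div, abs_of_pos hV, abs_of_nonneg (h0 _ _)]
  simp only [div_eq_mul_inv]
  rw [ex_mul_const, ← div_eq_mul_inv, div_le_iff₀ hV]
  refine (h n ε c hs).trans ?_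
  have h1 : ε * (θ n).V0 ≤ 3 * (√ε + c) * (θ n).V := by
    calc ε * (θ n).V0 ≤ (√ε + c) * (3 * (θ n).V) := by
          refine mul_le_mul ?_ ?_ hs.V0_pos.le (add_nonneg (Real.sqrt_nonneg ε) hs.c_pos.le)
          · linarith [ε_le_sqrt hs, hs.c_pos]
          · linarith [hs.le_V]
      _ = _ := by ring
  have := mul_le_mul_of_nonneg_left h1 hC
  linarith

/-- After division by `V` the errors of the three coefficients vanish in mean. The term `sizeT` is
only tight, but its factor `(1 - e^(ρ̂-ρ))²` tends to zero. -/
theorem tendsto_Vhat_div : Tendsto (fun x : Σ n, Ω n => (A x.1 x.2).Vhat / (θ x.1).V)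
    (probFilter P) (𝓝 1) := by
  have nn : ∀ {n : ℕ} (f : Fin n → Fin n → ℝ) (G : Graph n) (a b : Bool),
      0 ≤ ∑ i, ∑ j, Graph.dyad G a b i j * f i j ^ 2 := fun f G a b =>
    Finset.sum_nonneg fun i _ => Finset.sum_nonneg fun j _ =>
      mul_nonneg (dyad_nonneg G a b i j) (sq_nonneg _)
  have tR := tendsto_err_div hA hS (f := fun n => errR (θ n)) (C := 20000) (by norm_num)
    (fun n G => nn _ G true true) fun n ε c h => ex_errR_le (hA n) h
  have tS := tendsto_err_div hA hS (f := fun n => errS (θ n)) (C := 20000) (by norm_num)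
    (fun n G => nn _ G true false) fun n ε c h => ex_errS_le (hA n) h
  have tT := tendsto_err_div hA hS (f := fun n => errT (θ n)) (C := 500000) (by norm_num)
    (fun n G => nn _ G true false) fun n ε c h => ex_errT_le (hA n) h
  have tF := tendsto_semiV_div hA hS
  have tx := tendsto_ratio hA hS
  have tZ : Tendsto (fun x : Σ n, Ω n => sizeT (θ x.1) (A x.1 x.2) / (θ x.1).V
      * (1 - (A x.1 x.2).Qa / ((θ x.1).R * (A x.1 x.2).Qb)) ^ 2) (probFilter P) (𝓝 0) := by
    have h0 : Tendsto (fun x : Σ n, Ω n =>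
        (1 - (A x.1 x.2).Qa / ((θ x.1).R * (A x.1 x.2).Qb)) ^ 2) (probFilter P) (𝓝 0) := by
      have := (tx.const_sub 1).pow 2
      simpa using this
    refine tendsto_mul_of_tight (X := fun n ω => sizeT (θ n) (A n ω) / (θ n).V) (C := 25) ?_ h0
    filter_upwards [hS.eventually] with n hn M hM
    refine (prob_ge_le (hA n).measurable (fun G => sizeT (θ n) G / (θ n).V) hM).trans ?_
    have hV := hn.V_pos
    gcongr
    have e : ∀ G, |sizeT (θ n) G / (θ n).V| = sizeT (θ n) G * (θ n).V⁻¹ := fun G => by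
      have : 0 ≤ sizeT (θ n) G := nn _ G true false
      rw [abs_of_nonneg (div_nonneg this hV.le), div_eq_mul_inv]
    simp only [e]
    rw [ex_mul_const, ← div_eq_mul_inv, div_le_iff₀ hV]
    have := ex_sizeT_le (hA n)
    have := hn.le_V
    linarith
  have tD : Tendsto (fun x : Σ n, Ω n => 2 * (errR (θ x.1) (A x.1 x.2) / (θ x.1).V)
      + 3 * (errS (θ x.1) (A x.1 x.2) / (θ x.1).V)
      + 3 * (((A x.1 x.2).Qa / ((θ x.1).R * (A x.1 x.2).Qb)) ^ 2
        * (errT (θ x.1) (A x.1 x.2) / (θ x.1).V))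
      + 3 * (sizeT (θ x.1) (A x.1 x.2) / (θ x.1).V
        * (1 - (A x.1 x.2).Qa / ((θ x.1).R * (A x.1 x.2).Qb)) ^ 2)) (probFilter P) (𝓝 0) := by
    have := (((tR.const_mul 2).add (tS.const_mul 3)).add (((tx.pow 2).mul tT).const_mul 3)).add
      (tZ.const_mul 3)
    simpa using this
  rw [Metric.tendsto_nhds]
  intro e he
  -- Since `semiV / V < 2` eventually, the term with `δ` costs at most `e / 4`; the two other
  -- contributions are each below `e / 4`.
  set δ : ℝ := e / 8 with hδ
  have hδ0 : 0 < δ := by positivity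
  have hδ1 : 0 < 1 + 1 / δ := by positivity
  filter_upwards [eventually_probFilter_of_eventually hS.eventually, eventually_exp_ρhat hA hS,
    Metric.tendsto_nhds.1 tF (min 1 (e / 4)) (by positivity),
    Metric.tendsto_nhds.1 tD (e / (4 * (1 + 1 / δ))) (by positivity)] with x hx h1 h2 h3
  have hV := hx.V_pos
  have key := abs_Vhat_sub_le (θ x.1) (A x.1 x.2) hδ0 h1
  rw [Real.dist_eq] at h2 h3 ⊢
  rw [sub_zero] at h3
  have h4 := (le_abs_self _).trans_lt h3
  rw [lt_div_iff₀ (by positivity)] at h4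
  have h5 := lt_of_lt_of_le h2 (min_le_left _ _)
  have h6 := lt_of_lt_of_le h2 (min_le_right _ _)
  have h7 : semiV (θ x.1) (A x.1 x.2) / (θ x.1).V < 2 := by linarith [(abs_lt.1 h5).2]
  have h8 := div_le_div_of_nonneg_right key hV.le
  have e1 : (A x.1 x.2).Vhat / (θ x.1).V - 1
      = (Graph.Vhat (A x.1 x.2) - semiV (θ x.1) (A x.1 x.2)) / (θ x.1).V
        + (semiV (θ x.1) (A x.1 x.2) / (θ x.1).V - 1) := by ring
  rw [e1]
  refine lt_of_le_of_lt (abs_add_le _ _) ?_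
  rw [abs_div, abs_of_pos hV]
  have h9 : δ * (semiV (θ x.1) (A x.1 x.2) / (θ x.1).V) ≤ δ * 2 := by gcongr
  have e2 : (δ * semiV (θ x.1) (A x.1 x.2) + (1 + 1 / δ) * (2 * errR (θ x.1) (A x.1 x.2)
      + 3 * errS (θ x.1) (A x.1 x.2)
      + 3 * ((A x.1 x.2).Qa / ((θ x.1).R * (A x.1 x.2).Qb)) ^ 2 * errT (θ x.1) (A x.1 x.2)
      + 3 * (1 - (A x.1 x.2).Qa / ((θ x.1).R * (A x.1 x.2).Qb)) ^ 2
        * sizeT (θ x.1) (A x.1 x.2))) / (θ x.1).V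
      = δ * (semiV (θ x.1) (A x.1 x.2) / (θ x.1).V) + (2 * (errR (θ x.1) (A x.1 x.2) / (θ x.1).V)
      + 3 * (errS (θ x.1) (A x.1 x.2) / (θ x.1).V)
      + 3 * (((A x.1 x.2).Qa / ((θ x.1).R * (A x.1 x.2).Qb)) ^ 2
        * (errT (θ x.1) (A x.1 x.2) / (θ x.1).V))
      + 3 * (sizeT (θ x.1) (A x.1 x.2) / (θ x.1).V
        * (1 - (A x.1 x.2).Qa / ((θ x.1).R * (A x.1 x.2).Qb)) ^ 2)) * (1 + 1 / δ) := by
    ring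
  rw [e2] at h8
  linarith

theorem tendsto_mean_div : Tendsto (fun n => ex (P n) (A n) Graph.Qa / meanQ (θ n)) atTop (𝓝 1) := by
  have key := hS.tendsto_zero
    (f := fun n => (ex (P n) (A n) Graph.Qa - meanQ (θ n)) / meanQ (θ n)) (C := 700)
    fun n ε c h => by
      have hq := h.meanQ_pos
      rw [abs_div, abs_of_pos hq, div_le_iff₀ hq]
      have e : ex (P n) (A n) Graph.Qa - meanQ (θ n)
          = ex (P n) (A n) (fun G => Graph.Qa G - meanQ (θ n)) := by
        rw [ex_sub (hA n).measurable, ex_const]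
      rw [e]
      refine abs_integral_le_integral_abs.trans ((ex_abs_Qa_sub_le (hA n) h).trans ?_)
      have := mul_pos h.c_pos hq
      linarith
  have := key.add_const 1
  rw [zero_add] at this
  refine this.congr' ?_
  filter_upwards [hS.eventually] with n hx
  have := hx.meanQ_pos.ne'
  field_simp
  ring

theorem tendsto_variance_div : Tendsto
    (fun n => variance (fun ω => statU (θ n) (A n ω)) (P n) / (θ n).V) atTop (𝓝 1) := by
  have key := hS.tendsto_zero
    (f := fun n => (variance (fun ω => statU (θ n) (A n ω)) (P n) - (θ n).V) / (θ n).V)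
    (C := 30000000) fun n ε c h => by
      have hV := h.V_pos
      rw [abs_div, abs_of_pos hV, div_le_iff₀ hV]
      refine (abs_variance_statU_sub_le (hA n) h).trans ?_
      have := mul_pos h.c_pos hV
      linarith
  have := key.add_const 1
  rw [zero_add] at this
  refine this.congr' ?_
  filter_upwards [hS.eventually] with n hx
  have := hx.V_pos.ne'
  field_simp
  ring

theorem tendsto_SNR_div : Tendsto (fun n => SNR (θ n) (P n) (A n) / (meanQ (θ n) / √(θ n).V)) atTop
    (𝓝 1) := by
  have h1 := (Real.continuous_sqrt.tendsto 1).comp (tendsto_variance_div hA hS)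
  rw [Real.sqrt_one] at h1
  have h2 := (tendsto_mean_div hA hS).div h1 one_ne_zero
  rw [div_one] at h2
  refine h2.congr' ?_
  filter_upwards [hS.eventually] with n hn
  have hV := hn.V_pos
  simp only [Pi.div_apply, Function.comp_apply]
  rw [Real.sqrt_div' _ hV.le, SNR, ex]
  exact div_div_div_comm _ _ _ _

theorem tendsto_SNRhat_div' : Tendsto (fun x : Σ n, Ω n =>
    (A x.1 x.2).SNRhat / (meanQ (θ x.1) / √(θ x.1).V)) (probFilter P) (𝓝 1) := by
  have h1 := (Real.continuous_sqrt.tendsto 1).comp (tendsto_Vhat_div hA hS)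
  rw [Real.sqrt_one] at h1
  have h2 := (tendsto_Qa_div hA hS).div h1 one_ne_zero
  rw [div_one] at h2
  refine h2.congr' ?_
  filter_upwards [eventually_probFilter_of_eventually hS.eventually] with x hx
  have hV := hx.V_pos
  simp only [Pi.div_apply, Function.comp_apply]
  rw [Real.sqrt_div' _ hV.le, Graph.SNRhat]
  exact div_div_div_comm _ _ _ _

theorem tendsto_SNRhat_div : Tendsto (fun x : Σ n, Ω n =>
    (A x.1 x.2).SNRhat / SNR (θ x.1) (P x.1) (A x.1)) (probFilter P) (𝓝 1) := by
  have h := (tendsto_SNRhat_div' hA hS).div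
    ((tendsto_SNR_div hA hS).comp tendsto_fst_probFilter) one_ne_zero
  rw [div_one] at h
  refine h.congr' ?_
  filter_upwards [eventually_probFilter_of_eventually hS.eventually] with x hx
  have hV := Real.sqrt_pos.2 hx.V_pos
  simp only [Pi.div_apply, Function.comp_apply]
  exact div_div_div_cancel_right₀ (div_pos hx.meanQ_pos hV).ne' _ _

/-- Tightness of the standardized linear statistic. -/
theorem eventually_linU_tight : ∀ᶠ n in atTop, ∀ M > 0,
    (P n).real {ω | M ≤ |linU (θ n) (A n ω) / √(θ n).V|} ≤ 1 / M := by
  filter_upwards [hS.eventually] with n hn M hM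
  refine (prob_ge_le (hA n).measurable (fun G => linU (θ n) G / √(θ n).V) hM).trans ?_
  gcongr
  refine ex_abs_le (hA n).measurable one_pos ?_
  have hV := hn.V_pos
  simp only [div_pow, Real.sq_sqrt hV.le]
  simp only [div_eq_mul_inv]
  rw [ex_mul_const, ← div_eq_mul_inv, one_pow, div_le_one hV]
  exact ex_linU_sq_le (hA n)

theorem tendsto_statU_sub : Tendsto (fun x : Σ n, Ω n =>
    (statU (θ x.1) (A x.1 x.2) - linU (θ x.1) (A x.1 x.2)) / √(θ x.1).V) (probFilter P) (𝓝 0) := by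
  refine hS.tendsto_probFilter_zero hA (f := fun n G => (statU (θ n) G - linU (θ n) G) / √(θ n).V)
    (C := 3000) fun n ε c h => ?_
  have hV := h.V_pos
  have hε := Real.sqrt_pos.2 h.pos
  refine (ex_abs_le (hA n).measurable (s := 3000 * √ε) (by positivity) ?_).trans ?_
  · simp only [div_pow, Real.sq_sqrt hV.le]
    simp only [div_eq_mul_inv]
    rw [ex_mul_const, ← div_eq_mul_inv, div_le_iff₀ hV, mul_pow, Real.sq_sqrt h.pos.le]
    have := ex_statU_sub_sq_le (hA n) h
    have := mul_pos h.pos hV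
    linarith
  · have := h.c_pos
    linarith

/-- The identity `log y = (y - 1) * dslope log 1 y` also holds at `y = 1`, and the slope is
continuous there with value `log' 1 = 1`; no case distinction on `Qa = R * Qb` is needed. -/
theorem tendsto_dslope_log : Tendsto (fun x : Σ n, Ω n =>
    dslope Real.log 1 ((A x.1 x.2).Qa / ((θ x.1).R * (A x.1 x.2).Qb))) (probFilter P) (𝓝 1) := by
  have h : ContinuousAt (dslope Real.log 1) 1 :=
    continuousAt_dslope_same.2 (Real.differentiableAt_log one_ne_zero)
  have h1 := h.tendsto.comp (tendsto_ratio hA hS)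
  rw [dslope_same, Real.deriv_log, inv_one] at h1
  exact h1

/-- The studentized estimator differs negligibly from the standardized linear statistic. -/
theorem tendsto_studentized_sub : Tendsto (fun x : Σ n, Ω n =>
    (A x.1 x.2).SNRhat * ((A x.1 x.2).ρhat - (θ x.1).ρ) - linU (θ x.1) (A x.1 x.2) / √(θ x.1).V)
    (probFilter P) (𝓝 0) := by
  -- The studentized error equals `(U / √V) Z`. Its distance from `linU / √V` is `(linU / √V)(Z -
  -- 1)`, tight times vanishing, plus `((U - linU) / √V) Z`.
  set Z : (Σ n, Ω n) → ℝ := fun x => (A x.1 x.2).Qa / ((θ x.1).R * (A x.1 x.2).Qb)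
      / √((A x.1 x.2).Vhat / (θ x.1).V)
      * dslope Real.log 1 ((A x.1 x.2).Qa / ((θ x.1).R * (A x.1 x.2).Qb)) with hZ
  have tZ : Tendsto Z (probFilter P) (𝓝 1) := by
    have h1 := (Real.continuous_sqrt.tendsto 1).comp (tendsto_Vhat_div hA hS)
    rw [Real.sqrt_one] at h1
    have h2 := ((tendsto_ratio hA hS).div h1 one_ne_zero).mul (tendsto_dslope_log hA hS)
    simpa using h2
  have t0 := tendsto_statU_sub hA hS
  have tZ1 : Tendsto (fun x => Z x - 1) (probFilter P) (𝓝 0) := by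
    simpa using tZ.sub_const 1
  have t1 := tendsto_mul_of_tight (eventually_linU_tight hA hS) tZ1
  have t2 := t1.add (t0.mul tZ)
  rw [zero_mul, add_zero] at t2
  refine t2.congr' ?_
  filter_upwards [eventually_probFilter_of_eventually hS.eventually, eventually_ρhat_sub hA hS,
    eventually_pos hA hS,
    (tendsto_Vhat_div hA hS).eventually (lt_mem_nhds (zero_lt_one' ℝ))] with x hx h1 ⟨h2, h3⟩ h4
  have hV := hx.V_pos
  have hR := Param.R_pos (θ := θ x.1)
  rw [lt_div_iff₀ hV, zero_mul] at h4
  have hsV := Real.sqrt_pos.2 hV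
  have hsVh := Real.sqrt_pos.2 h4
  set y := (A x.1 x.2).Qa / ((θ x.1).R * (A x.1 x.2).Qb) with hy
  have h5 : Real.log y = (y - 1) * dslope Real.log 1 y := by
    have := sub_smul_dslope Real.log 1 y
    rw [Real.log_one, sub_zero, smul_eq_mul] at this
    exact this.symm
  have h6 : y - 1 = statU (θ x.1) (A x.1 x.2) / ((θ x.1).R * (A x.1 x.2).Qb) := by
    rw [hy, statU]
    field_simp
  have h7 : Z x = y / (√(A x.1 x.2).Vhat / √(θ x.1).V) * dslope Real.log 1 y := by
    rw [hZ]
    simp only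
    rw [Real.sqrt_div' _ hV.le]
  rw [h7, h1, h5, h6, Graph.SNRhat]
  generalize dslope Real.log 1 y = D
  rw [hy]
  field_simp
  ring

end ConvergenceInProbability

end P1

namespace P1

/-! ### From the asymptotic hypotheses to the quantitative conditions -/

section Conditions

theorem Param.normη_eq {n : ℕ} (θ : Param n) : θ.normη = θ.sH :=
  Finset.sum_congr rfl fun i _ => abs_of_pos (Param.η_pos i)

theorem Param.innerμη_eq {n : ℕ} (θ : Param n) : θ.innerμη = θ.sa :=
  Finset.sum_congr rfl fun i _ => by unfold Param.η; ring

theorem Param.innerνη_eq {n : ℕ} (θ : Param n) : θ.innerνη = θ.sb :=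
  Finset.sum_congr rfl fun i _ => by unfold Param.η; ring

theorem le_ciSup_fin {n : ℕ} (f : Fin n → ℝ) (i : Fin n) : f i ≤ ⨆ j, f j :=
  le_ciSup (Set.finite_range f).bddAbove i

theorem ciInf_fin_le {n : ℕ} (f : Fin n → ℝ) (i : Fin n) : ⨅ j, f j ≤ f i :=
  ciInf_le (Set.finite_range f).bddBelow i

theorem Param.largeWith_of_le {n : ℕ} {θ : Param n} {c : ℝ} (ha : 0 < θ.sa) (hb : 0 < θ.sb)
    (hH : 0 < θ.sH) (h : c * θ.sH ^ 2 ≤ θ.R * θ.sa * θ.sb) : θ.LargeWith c := by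
  unfold Param.LargeWith Param.ρtilde
  rw [Param.normη_eq, Param.innerμη_eq, Param.innerνη_eq,
    Real.exp_log (div_pos (pow_pos hH 2) (mul_pos ha hb)), ← mul_div_assoc,
    div_le_iff₀ (mul_pos ha hb), ← mul_assoc]
  exact h

variable (θ : ∀ n : ℕ, Param n)
  (hμ : Tendsto (fun n => (θ n).μmax) atTop (𝓝 0))
  (hν : Tendsto (fun n => (θ n).νmax) atTop (𝓝 0))
  (hη : Tendsto (fun n => Real.exp ((θ n).ρ / 2) * (θ n).ηmax) atTop (𝓝 0))
  (hη1 : Tendsto (fun n => (θ n).normη) atTop atTop)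
  (hρη : Tendsto (fun n => Real.exp ((θ n).ρ / 2) * (θ n).normη / Real.sqrt (Real.log n))
      atTop atTop)
include hμ hν hη hη1 hρη

omit hμ hν hη hη1 hρη in
theorem eventually_one_le_log : ∀ᶠ n : ℕ in atTop, 1 ≤ Real.log n :=
  (Real.tendsto_log_atTop.comp tendsto_natCast_atTop_atTop).eventually_ge_atTop 1

omit hμ hν hη hη1 hρη in
theorem exp_half_sq {n : ℕ} (θ : Param n) : Real.exp (θ.ρ / 2) ^ 2 = θ.R := by
  rw [← Real.exp_nat_mul, Param.R]
  congr 1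
  push_cast
  ring

omit hμ hν hη hη1 in
theorem eventually_exp_half_mul (K : ℝ) :
    ∀ᶠ n in atTop, K ≤ Real.exp ((θ n).ρ / 2) * (θ n).sH := by
  filter_upwards [hρη.eventually_ge_atTop (max K 0), eventually_one_le_log] with n hn hl
  rw [Param.normη_eq] at hn
  have h1 : 1 ≤ √(Real.log n) := Real.one_le_sqrt.2 hl
  rw [le_div_iff₀ (by linarith)] at hn
  refine le_trans ?_ hn
  calc K ≤ max K 0 * 1 := by rw [mul_one]; exact le_max_left _ _
    _ ≤ _ := mul_le_mul_of_nonneg_left h1 (le_max_right _ _)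

/-- The threshold `√ε` for `e^(ρ/2) ηmax` makes products of two such factors at most `ε`. In the
large regime the ratio condition gives `μmax ≤ ε μmin ‖η‖₁`, and `μmin ‖η‖₁ ≤ ∑ μ η = sa`; likewise
for `ν` and `sb`. -/
theorem sparseSeq_of_tendsto (hratio : ∀ c : ℝ, 0 < c →
      Tendsto (fun n => min ((θ n).μmin / (θ n).μmax) ((θ n).νmin / (θ n).νmax)
          * (θ n).normη / Real.log n)
        (atTop ⊓ 𝓟 {n | (θ n).LargeWith c}) atTop) : SparseSeq θ := by
  intro ε c hε hε' hc hc'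
  have hr := (hratio c hc).eventually_ge_atTop (1 / ε)
  rw [eventually_inf_principal] at hr
  filter_upwards [hμ.eventually (ge_mem_nhds hε), hν.eventually (ge_mem_nhds hε),
    hη.eventually (ge_mem_nhds (Real.sqrt_pos.2 hε)), hη1.eventually_ge_atTop (1 / ε),
    eventually_exp_half_mul θ hρη (1 / √ε), hr, eventually_one_le_log]
    with n h1 h2 h3 h4 h5 h6 h7
  rw [Param.normη_eq] at h4 h6
  have hsε := Real.sqrt_pos.2 hε
  have hsq := Real.sq_sqrt hε.le
  have hH : 0 < (θ n).sH := lt_of_lt_of_le (by positivity) h4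
  have hex := Real.exp_pos ((θ n).ρ / 2)
  refine ⟨hε, hε', hc, hc', fun i => (le_ciSup_fin _ i).trans h1,
    fun i => (le_ciSup_fin _ i).trans h2, fun i j => ?_, ?_, ?_, fun hl i => ?_⟩
  · have e1 : ∀ i, Real.exp ((θ n).ρ / 2) * (θ n).η i ≤ √ε := fun i =>
      (mul_le_mul_of_nonneg_left (le_ciSup_fin (θ n).η i) hex.le).trans h3
    have := mul_le_mul (e1 i) (e1 j) (mul_pos hex (Param.η_pos j)).le hsε.le
    rw [← exp_half_sq]
    nlinarith
  · rw [div_le_iff₀ hε] at h4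
    linarith
  · rw [div_le_iff₀ hsε] at h5
    have := pow_le_pow_left₀ zero_le_one h5 2
    rw [← exp_half_sq]
    nlinarith
  · have ha : 0 < (θ n).sa := by
      refine Finset.sum_pos (fun j _ => ?_) ⟨i, Finset.mem_univ i⟩
      have := Param.μ_pos (θ := θ n) j
      have := Param.ν_pos (θ := θ n) j
      positivity
    have hb : 0 < (θ n).sb := by
      refine Finset.sum_pos (fun j _ => ?_) ⟨i, Finset.mem_univ i⟩
      have := Param.μ_pos (θ := θ n) j
      have := Param.ν_pos (θ := θ n) j
      positivity
    have h8 := h6 (Param.largeWith_of_le ha hb hH hl)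
    rw [le_div_iff₀ (by linarith)] at h8
    have h9 : 1 / ε ≤ min ((θ n).μmin / (θ n).μmax) ((θ n).νmin / (θ n).νmax) * (θ n).sH := by
      refine le_trans ?_ h8
      have : 0 ≤ 1 / ε := by positivity
      nlinarith
    have hM : 0 < (θ n).μmax := lt_of_lt_of_le (Param.μ_pos i) (le_ciSup_fin _ i)
    have hN : 0 < (θ n).νmax := lt_of_lt_of_le (Param.ν_pos i) (le_ciSup_fin _ i)
    constructor
    · have k1 : 1 / ε ≤ (θ n).μmin / (θ n).μmax * (θ n).sH :=
        h9.trans (mul_le_mul_of_nonneg_right (min_le_left _ _) hH.le)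
      have k2 : (θ n).μmax ≤ ε * ((θ n).μmin * (θ n).sH) := by
        rw [div_mul_eq_mul_div, div_le_div_iff₀ hε hM] at k1
        linarith
      refine (le_ciSup_fin (θ n).μ i).trans (k2.trans (mul_le_mul_of_nonneg_left ?_ hε.le))
      rw [Param.sH, Param.sa, Finset.mul_sum]
      refine Finset.sum_le_sum fun j _ => ?_
      have := mul_le_mul_of_nonneg_right (ciInf_fin_le (θ n).μ j) (Param.η_pos (θ := θ n) j).le
      refine this.trans (le_of_eq ?_)
      unfold Param.η
      ring
    · have k1 : 1 / ε ≤ (θ n).νmin / (θ n).νmax * (θ n).sH :=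
        h9.trans (mul_le_mul_of_nonneg_right (min_le_right _ _) hH.le)
      have k2 : (θ n).νmax ≤ ε * ((θ n).νmin * (θ n).sH) := by
        rw [div_mul_eq_mul_div, div_le_div_iff₀ hε hN] at k1
        linarith
      refine (le_ciSup_fin (θ n).ν i).trans (k2.trans (mul_le_mul_of_nonneg_left ?_ hε.le))
      rw [Param.sH, Param.sb, Finset.mul_sum]
      refine Finset.sum_le_sum fun j _ => ?_
      have := mul_le_mul_of_nonneg_right (ciInf_fin_le (θ n).ν j) (Param.η_pos (θ := θ n) j).le
      refine this.trans (le_of_eq ?_)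
      unfold Param.η
      ring

/-- The truncation level exceeds the true parameter by a margin. -/
theorem eventually_abs_ρ_le : ∀ᶠ n : ℕ in atTop, |(θ n).ρ| ≤ 2 * Real.log n - 2 := by
  filter_upwards [hμ.eventually (ge_mem_nhds one_pos), hν.eventually (ge_mem_nhds one_pos),
    hη.eventually (ge_mem_nhds (Real.exp_pos (-1))), hη1.eventually_ge_atTop 1,
    eventually_exp_half_mul θ hρη (Real.exp 1), eventually_gt_atTop 0]
    with n h1 h2 h3 h4 h5 h6
  rw [Param.normη_eq] at h4
  have hn : (0 : ℝ) < n := by exact_mod_cast h6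
  have hex := Real.exp_pos ((θ n).ρ / 2)
  have hH1 : (θ n).sH ≤ n := by
    calc (θ n).sH ≤ ∑ _i : Fin n, (1 : ℝ) := by
          refine Finset.sum_le_sum fun i _ => ?_
          exact mul_le_one₀ ((le_ciSup_fin (θ n).μ i).trans h1) (Param.ν_pos i).le
            ((le_ciSup_fin (θ n).ν i).trans h2)
      _ = n := by simp
  have hH2 : (θ n).sH ≤ n * (θ n).ηmax := by
    calc (θ n).sH ≤ ∑ _i : Fin n, (θ n).ηmax :=
          Finset.sum_le_sum fun i _ => le_ciSup_fin (θ n).η i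
      _ = n * (θ n).ηmax := by simp
  -- Lower bound for `ρ`: the number `e^(ρ/2) ‖η‖₁` is at least `e`, while `‖η‖₁ ≤ n`.
  have k1 : Real.exp 1 ≤ Real.exp ((θ n).ρ / 2 + Real.log n) := by
    rw [Real.exp_add, Real.exp_log hn]
    exact h5.trans (mul_le_mul_of_nonneg_left hH1 hex.le)
  -- Upper bound for `ρ`: from `1 ≤ ‖η‖₁ ≤ n ηmax` and `e^(ρ/2) ηmax ≤ e⁻¹`.
  have k2 : Real.exp ((θ n).ρ / 2) ≤ Real.exp (-1 + Real.log n) := by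
    rw [Real.exp_add, Real.exp_log hn]
    calc Real.exp ((θ n).ρ / 2) ≤ Real.exp ((θ n).ρ / 2) * (n * (θ n).ηmax) :=
          le_mul_of_one_le_right hex.le (h4.trans hH2)
      _ = Real.exp ((θ n).ρ / 2) * (θ n).ηmax * n := by ring
      _ ≤ _ := by gcongr
  rw [Real.exp_le_exp] at k1 k2
  rw [abs_le]
  constructor <;> linarith

end Conditions

/-! ### Asymptotic normality after truncation, and power -/

section Main

variable {θ : ∀ n : ℕ, Param n} {Ω : ℕ → Type*} [∀ n, MeasurableSpace (Ω n)]
  {P : ∀ n, Measure (Ω n)} [∀ n, IsProbabilityMeasure (P n)] {A : ∀ n, Ω n → Graph n}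
  (hA : ∀ n, IsP1Model (θ n) (P n) (A n)) (hS : SparseSeq θ)
include hA hS

/-- The truncation of the estimator is inactive with probability tending to one. -/
theorem eventually_ρstar_eq (hρ : ∀ᶠ n : ℕ in atTop, |(θ n).ρ| ≤ 2 * Real.log n - 2) :
    ∀ᶠ x : Σ n, Ω n in probFilter P, (A x.1 x.2).ρstar = (A x.1 x.2).ρhat := by
  have h1 := (Real.continuousAt_log one_ne_zero).tendsto.comp (tendsto_ratio hA hS)
  rw [Real.log_one] at h1
  filter_upwards [eventually_probFilter_of_eventually hρ, eventually_ρhat_sub hA hS,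
    Metric.tendsto_nhds.1 h1 1 one_pos] with x h2 h3 h4
  rw [Real.dist_eq, sub_zero, Function.comp_apply, ← h3] at h4
  -- The deviation `|ρ̂ - ρ| < 1` stays within the margin `2` between `|ρ|` and the truncation
  -- level.
  rw [Graph.ρstar, truncate, if_pos]
  have := abs_add_le ((A x.1 x.2).ρhat - (θ x.1).ρ) (θ x.1).ρ
  rw [sub_add_cancel] at this
  linarith

theorem tendsto_charFun_linU (t : ℝ) : Tendsto
    (fun n => charFun ((P n).map fun ω => linU (θ n) (A n ω) / √(θ n).V) t) atTop
    (𝓝 (charFun (gaussianReal 0 1) t)) := by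
  have e : ∀ n, (fun ω => linU (θ n) (A n ω) / √(θ n).V) = fun ω =>
      ∑ e : {e : Fin n × Fin n // e.1 < e.2}, linTerm (θ n) e.1.1 e.1.2 (A n ω) / √(θ n).V := by
    intro n
    funext ω
    rw [linU_eq, Finset.sum_div]
  simp only [e]
  refine tendsto_charFun_of_truncMoment
    (fun n (e : {e : Fin n × Fin n // e.1 < e.2}) ω =>
      linTerm (θ n) e.1.1 e.1.2 (A n ω) / √(θ n).V)
    (fun n => iIndepFun_dyadTerm (hA n) (fun i j => (θ n).rr i j + (θ n).rr j i) (θ n).uu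
      (fun i j => (θ n).uu j i) _) (fun n e => ?_) (fun n e => ?_) ?_ ?_ t
  · rw [memLp_two_iff_integrable_sq (measurable_graph_comp (hA n).measurable
      fun G => linTerm (θ n) e.1.1 e.1.2 G / √(θ n).V).aestronglyMeasurable]
    exact integrable_graph_comp (hA n).measurable
      fun G => (linTerm (θ n) e.1.1 e.1.2 G / √(θ n).V) ^ 2
  · rw [integral_div]
    have : ∫ ω, linTerm (θ n) e.1.1 e.1.2 (A n ω) ∂(P n) = 0 := ex_dyadTerm (hA n) _ _ _ e.2.ne
    rw [this, zero_div]
  · have key := hS.tendsto_zero (f := fun n => (ex (P n) (A n) (fun G => linU (θ n) G ^ 2)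
      - (θ n).V) / (θ n).V) (C := 4) fun n ε c h => by
        have hV := h.V_pos
        rw [abs_div, abs_of_pos hV, div_le_iff₀ hV]
        have h1 := ex_linU_sq_le (hA n)
        have h2 := le_ex_linU_sq (hA n) h
        have h3 := mul_le_mul_of_nonneg_right ((ε_le_sqrt h).trans
          (le_add_of_nonneg_right h.c_pos.le)) hV.le
        have h4 := mul_pos h.pos hV
        rw [abs_le]
        constructor <;> linarith
    have := key.add_const 1
    rw [zero_add] at this
    refine this.congr' ?_
    filter_upwards [hS.eventually] with n hn
    have hV := hn.V_pos
    simp only [div_pow, integral_div, Real.sq_sqrt hV.le]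
    rw [← Finset.sum_div, ex_linU_sq_eq (hA n), sub_div, div_self hV.ne', sub_add_cancel]
    rfl
  · refine hS.tendsto_zero (C := 100) fun n ε c h => ?_
    rw [abs_of_nonneg (Finset.sum_nonneg fun e _ => truncMoment_nonneg _)]
    exact sum_truncMoment_le (hA n) h

theorem tendstoInDistribution_studentized
    (hρ : ∀ᶠ n : ℕ in atTop, |(θ n).ρ| ≤ 2 * Real.log n - 2) :
    TendstoInDistribution (fun n ω => (A n ω).SNRhat * ((A n ω).ρstar - (θ n).ρ)) atTop
        (id : ℝ → ℝ) P (gaussianReal 0 1) := by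
  refine tendstoInDistribution_of_charFun (fun n ω => linU (θ n) (A n ω) / √(θ n).V) _
    (fun n => measurable_graph_comp (hA n).measurable fun G => linU (θ n) G / √(θ n).V)
    (fun n => measurable_graph_comp (hA n).measurable
      fun G => Graph.SNRhat G * (Graph.ρstar G - (θ n).ρ))
    (tendsto_charFun_linU hA hS) ?_
  rw [tendstoInProb_iff (X := fun n ω => (A n ω).SNRhat * ((A n ω).ρstar - (θ n).ρ)
    - linU (θ n) (A n ω) / √(θ n).V)]
  refine (tendsto_studentized_sub hA hS).congr' ?_
  filter_upwards [eventually_ρstar_eq hA hS hρ] with x hx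
  rw [hx]

/-- Put `b = SNR * |ρ - ρ₀|`, which diverges. The drift `ŜNR (ρ - ρ₀)` is at least `b/2` in absolute
value because `ŜNR > SNR/2`, the tight noise is below `b/4`, and `b/4` exceeds `|z|`. -/
theorem eventually_le_abs_ψ (hρ : ∀ᶠ n : ℕ in atTop, |(θ n).ρ| ≤ 2 * Real.log n - 2)
    {ρ₀ : ℕ → ℝ}
    (h : Tendsto (fun n => SNR (θ n) (P n) (A n) * |(θ n).ρ - ρ₀ n|) atTop atTop) (z : ℝ) :
    ∀ᶠ x : Σ n, Ω n in probFilter P, z ≤ |(A x.1 x.2).ψ (ρ₀ x.1)| := by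
  have hb : Tendsto (fun x : Σ n, Ω n =>
      (SNR (θ x.1) (P x.1) (A x.1) * |(θ x.1).ρ - ρ₀ x.1|)⁻¹) (probFilter P) (𝓝 0) :=
    tendsto_inv_atTop_zero.comp (h.comp tendsto_fst_probFilter)
  have hW := (tendsto_mul_of_tight (eventually_linU_tight hA hS) hb).add
    ((tendsto_studentized_sub hA hS).mul hb)
  rw [mul_zero, add_zero] at hW
  filter_upwards [eventually_ρstar_eq hA hS hρ, Metric.tendsto_nhds.1 hW (1 / 4) (by norm_num),
    (tendsto_SNRhat_div hA hS).eventually (lt_mem_nhds (show (1 / 2 : ℝ) < 1 by norm_num)),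
    eventually_probFilter_of_eventually (h.eventually_gt_atTop (4 * |z|))] with x h1 h2 h3 h4
  set b := SNR (θ x.1) (P x.1) (A x.1) * |(θ x.1).ρ - ρ₀ x.1| with hb'
  have hz := abs_nonneg z
  have hbp : 0 < b := by linarith
  have hSp : 0 < SNR (θ x.1) (P x.1) (A x.1) := pos_of_mul_pos_left hbp (abs_nonneg _)
  rw [lt_div_iff₀ hSp] at h3
  set W := (A x.1 x.2).SNRhat * ((A x.1 x.2).ρhat - (θ x.1).ρ) with hWd
  rw [Real.dist_eq, sub_zero, ← add_mul, add_sub_cancel, abs_mul, abs_inv, abs_of_pos hbp,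
    ← div_eq_mul_inv, div_lt_iff₀ hbp] at h2
  have e : (A x.1 x.2).ψ (ρ₀ x.1) = (A x.1 x.2).SNRhat * ((θ x.1).ρ - ρ₀ x.1) + W := by
    rw [Graph.ψ, h1, hWd]
    ring
  have k1 : b / 2 ≤ |(A x.1 x.2).SNRhat * ((θ x.1).ρ - ρ₀ x.1)| := by
    rw [abs_mul]
    calc b / 2 = 1 / 2 * SNR (θ x.1) (P x.1) (A x.1) * |(θ x.1).ρ - ρ₀ x.1| := by
          rw [hb']; ring
      _ ≤ |(A x.1 x.2).SNRhat| * |(θ x.1).ρ - ρ₀ x.1| := by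
          gcongr
          exact h3.le.trans (le_abs_self _)
  have k2 := abs_sub_abs_le_abs_add ((A x.1 x.2).SNRhat * ((θ x.1).ρ - ρ₀ x.1)) W
  rw [e]
  linarith [le_abs_self z]

end Main

end P1

theorem theorem3p5 (θ : ∀ n : ℕ, P1.Param n) {Ω : ℕ → Type*} [∀ n, MeasurableSpace (Ω n)]
    (P : ∀ n, Measure (Ω n)) [∀ n, IsProbabilityMeasure (P n)]
    (A : ∀ n, Ω n → P1.Graph n) (hA : ∀ n, P1.IsP1Model (θ n) (P n) (A n))
    -- sparsity
    (hμ : Tendsto (fun n => (θ n).μmax) atTop (𝓝 0))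
    (hν : Tendsto (fun n => (θ n).νmax) atTop (𝓝 0))
    (hη : Tendsto (fun n => Real.exp ((θ n).ρ / 2) * (θ n).ηmax) atTop (𝓝 0))
    -- the total signal diverges
    (hη1 : Tendsto (fun n => (θ n).normη) atTop atTop)
    -- the expected number of reciprocated edges diverges faster than `log n`
    (hρη : Tendsto (fun n => Real.exp ((θ n).ρ / 2) * (θ n).normη / Real.sqrt (Real.log n))
      atTop atTop)
    -- the norms of `μ` and `ν` are of the same order along the `n` with large `ρ`
    (hSP2 : ∀ c : ℝ, 0 < c → ∃ c₀ c₁ : ℝ, 0 < c₀ ∧ c₀ < c₁ ∧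
      ∀ᶠ n in atTop, (θ n).LargeWith c →
        c₀ ≤ (θ n).normμ / (θ n).normν ∧ (θ n).normμ / (θ n).normν ≤ c₁)
    -- the degree heterogeneity condition along the `n` with large `ρ`
    (hratio : ∀ c : ℝ, 0 < c →
      Tendsto (fun n => min ((θ n).μmin / (θ n).μmax) ((θ n).νmin / (θ n).νmax)
          * (θ n).normη / Real.log n)
        (atTop ⊓ 𝓟 {n | (θ n).LargeWith c}) atTop) :
    -- the statistics are well defined with probability tending to one
    Tendsto (fun n => (P n).real {ω | 0 < (A n ω).Qa ∧ 0 < (A n ω).Qb}) atTop (𝓝 1)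
    ∧ P1.TendstoInProb P (fun n ω => (A n ω).Vhat / (θ n).V) 1
    ∧ P1.TendstoInProb P (fun n ω => (A n ω).SNRhat / P1.SNR (θ n) (P n) (A n)) 1
    ∧ TendstoInDistribution (fun n ω => (A n ω).SNRhat * ((A n ω).ρstar - (θ n).ρ)) atTop
        (id : ℝ → ℝ) P (gaussianReal 0 1)
    -- under the null hypothesis: limiting null distribution, and level of the two-sided test
    ∧ (∀ ρ₀ : ℕ → ℝ, (∀ n, (θ n).ρ = ρ₀ n) →
        TendstoInDistribution (fun n ω => (A n ω).ψ (ρ₀ n)) atTop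
          (id : ℝ → ℝ) P (gaussianReal 0 1)
        ∧ ∀ α z : ℝ, 0 < α → α < 1 → (gaussianReal 0 1).real (Set.Ici z) = α / 2 →
            Tendsto (fun n => (P n).real {ω | z ≤ |(A n ω).ψ (ρ₀ n)|}) atTop (𝓝 α))
    -- under the alternative: power
    ∧ (∀ ρ₀ : ℕ → ℝ,
        Tendsto (fun n => P1.SNR (θ n) (P n) (A n) * |(θ n).ρ - ρ₀ n|) atTop atTop →
        ∀ α z : ℝ, 0 < α → α < 1 → (gaussianReal 0 1).real (Set.Ici z) = α / 2 →
          Tendsto (fun n => (P n).real {ω | z ≤ |(A n ω).ψ (ρ₀ n)|}) atTop (𝓝 1)) := by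
  have hS := P1.sparseSeq_of_tendsto θ hμ hν hη hη1 hρη hratio
  have hρ := P1.eventually_abs_ρ_le θ hμ hν hη hη1 hρη
  have hW := P1.tendstoInDistribution_studentized hA hS hρ
  refine ⟨P1.tendsto_prob_one (fun n => ?_) (P1.eventually_pos hA hS),
    P1.tendstoInProb_iff.2 (P1.tendsto_Vhat_div hA hS),
    P1.tendstoInProb_iff.2 (P1.tendsto_SNRhat_div hA hS), hW, fun ρ₀ h0 => ?_,
    fun ρ₀ h α z _ _ _ => P1.tendsto_prob_one (fun n => ?_) (P1.eventually_le_abs_ψ hA hS hρ h z)⟩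
  · exact (P1.measurable_graph_comp (hA n).measurable
      fun G : P1.Graph n => (0 < G.Qa ∧ 0 < G.Qb : Prop)).setOf
  · have h1 : TendstoInDistribution (fun n ω => (A n ω).ψ (ρ₀ n)) atTop
        (id : ℝ → ℝ) P (gaussianReal 0 1) := by
      simp only [P1.Graph.ψ, ← h0]
      exact hW
    exact ⟨h1, fun α z _ hα hz => P1.tendsto_prob_abs_ge
      (fun n => P1.measurable_graph_comp (hA n).measurable fun G => P1.Graph.ψ G (ρ₀ n)) h1 hα hz⟩
  · exact (P1.measurable_graph_comp (hA n).measurable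
      fun G : P1.Graph n => (z ≤ |G.ψ (ρ₀ n)| : Prop)).setOf
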